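/- **Setting.** Let $D\subset\mathbb R^3$ be a bounded open set satisfying the cone condition (every point of $D$ is the vertex of a finite cone contained in $D$, all these cones being congruent), $T>0$, $\theta\in(\frac12,1]$, and let $m_0\in H^1(D)^3$ with $|m_0|=1$ a.e. Let $G$ be a Hilbert–Schmidt operator from $L^2(D)^3$ into $H^2(D)^3$, $(e_i)_{i\in\mathbb N}$ a complete orthonormal system of $L^2(D)^3$, $G_i=Ge_i$, so that $\sum_i\|G_i\|_{H^2}^2<\infty$. On a probability space $(\Omega,\mathcal F,\mathbb P)$ let $(\beta_i)$ be independent real Brownian motions and let $GW(t)=\sum_i\beta_i(t)G_i$, a process with continuous paths in $L^2(D)^3$. For $N\ge1$ put $\Delta t=T/N$. For $m\in H^1(D)^3$ with $|m|=1$ a.e. and $g\in L^2(D)^3$, let $v=\mathcal V_N(m,g)$ be the unique element of $\mathbb W_m=\{\psi\in H^1(D)^3:\psi\cdot m=0\text{ a.e.}\}$ such that for all $\varphi\in\mathbb W_m$ $$(v-m\times v,\varphi)_{L^2}+2\theta\Delta t(\nabla v,\nabla\varphi)_{L^2}=-2\Delta t(\nabla m,\nabla\varphi)_{L^2}+\big((\mathrm{Id}-m\times)(m\times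 g),\varphi\big)_{L^2}+\tfrac{\Delta t}2\sum_i\big((\mathrm{Id}-m\times)((m\times G_i)\times G_i),\varphi\big)_{L^2}.$$ The algorithm sets $m_N^0=m_0$, $v_N^n=\mathcal V_N\big(m_N^n,\,GW((n+1)\Delta t)-GW(n\Delta t)\big)$ and $m_N^{n+1}=(m_N^n+v_N^n)/|m_N^n+v_N^n|$, and $m_N(t)=m_N^n$ for $t\in[n\Delta t,(n+1)\Delta t)$, $0\le n\le N-1$. Let $(\bar\Omega,\bar{\mathcal F},\bar{\mathbb P})$ be a probability space carrying, for every $N\ge1$, random variables $(\bar m_N,G\bar W_N)$ with values in $L^2(0,T;L^2(D)^3)\times C([0,T];L^2(D)^3)$ and with the same law as $(m_N,GW)$, such that along a subsequence $\bar m_N\to\bar m$ a.s. in $L^2(0,T;L^2(D)^3)$. Let $\bar m_N^n$ be the (constant) value of $\bar m_N$ on $[n\Delta t,(n+1)\Delta t)$, $G\Delta\bar W_N^n=G\bar W_N((n+1)\Delta t)-G\bar W_N(n\Delta t)$, $\bar v_N^n=\mathcal V_N(\bar m_N^n,G\Delta\bar W_N^n)$, $\bar A_N^n=\bar m_N^n\times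 G\Delta\bar W_N^n$, $\bar w_N^n=(\bar v_N^n-\bar A_N^n)/\Delta t$, and $\bar w_N(t)=\bar w_N^n$ for $t\in[n\Delta t,(n+1)\Delta t)$, $0\le n\le N-1$. **Claim.** Along a further subsequence the following holds. 1. $\bar w_N\rightharpoonup\bar w$ weakly in $L^2(\bar\Omega\times[0,T]\times D)^3$. Moreover $\nabla\bar m\in L^2(\bar\Omega\times[0,T]\times D)^{3\times3}$, and for almost every $(\omega,t)$ the weak Laplacian $\Delta\bar m(\omega,t)$ (with homogeneous Neumann boundary condition, that is, $\int_D\Delta\bar m\cdot\varphi=-\int_D\nabla\bar m\cdot\nabla\varphi$ for all $\varphi\in C_c^\infty(\mathbb R^3)^3$) is a function in $L^1(D)^3$ and, a.e. in $D$, $$\bar w=\Delta\bar m+\bar m|\nabla\bar m|^2+\bar m\times\Delta\bar m+\tfrac12\,\Pi_{\bar m^\perp}\sum_{i\in\mathbb N}(\bar m\times G_i)\times G_i ,$$ where $\Pi_{a^\perp}$ is the orthogonal projection of $\mathbb R^3$ onto $a^\perp$. 2. For every $t\in[0,T]$, $\displaystyle\sum_{0\le (n+1)\Delta t\le t}\Delta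 t\,\bar w_N^n$ converges weakly in $L^2(\bar\Omega\times D)^3$ to $$\int_0^t\Big(\Delta\bar m+\bar m|\nabla\bar m|^2+\bar m\times\Delta\bar m+\tfrac12\,\Pi_{\bar m^\perp}\sum_{i\in\mathbb N}(\bar m\times G_i)\times G_i\Big)ds .$$ -/

import Mathlib

open MeasureTheory ProbabilityTheory Filter Set
open scoped Topology NNReal ENNReal

namespace LLG

noncomputable section

/-- `ℝ³` with its Euclidean norm. -/
abbrev E3 : Type := EuclideanSpace ℝ (Fin 3)

/-- The cross product of `ℝ³`. -/
def cross (a b : E3) : E3 := WithLp.toLp 2 (crossProduct a.ofLp b.ofLp)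

/-- The orthogonal projection of `ℝ³` onto the plane `aᗮ`, applied to `b`. -/
def projPerp (a b : E3) : E3 := (Submodule.span ℝ {a})ᗮ.starProjection b

/-- The cone condition: every point of `D` is the vertex of a finite cone contained in `D`, all
these cones being congruent (same height `h`, same aperture). -/
def ConeCondition (D : Set E3) : Prop :=
  ∃ h : ℝ, 0 < h ∧ ∃ κ : ℝ, κ < 1 ∧ ∀ x ∈ D, ∃ ξ : E3, ‖ξ‖ = 1 ∧
    ∀ y : E3, ‖y‖ ≤ h → κ * ‖y‖ ≤ inner ℝ y ξ → x + y ∈ D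

/-- `L²(D)³`. -/
abbrev L2V (D : Set E3) : Type := Lp E3 2 (volume.restrict D)

/-- `L²(0,T;L²(D)³)`, that is `L²([0,T]×D)³`. -/
abbrev L2TV (T : ℝ) (D : Set E3) : Type := Lp (L2V D) 2 (volume.restrict (Icc 0 T))

/-! ### Sobolev spaces on `D` -/

/-- `g` is the weak partial derivative `∂_k u` on the open set `D`. -/
def HasWeakPartial (D : Set E3) (k : Fin 3) (u g : L2V D) : Prop :=
  ∀ φ : E3 → ℝ, ContDiff ℝ (⊤ : ℕ∞) φ → HasCompactSupport φ → tsupport φ ⊆ D →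
    ∫ x in D, (fderiv ℝ φ x (EuclideanSpace.single k 1)) • u x = -∫ x in D, φ x • g x

/-- `u ∈ H¹(D)³`. -/
def MemH1 (D : Set E3) (u : L2V D) : Prop := ∀ k, ∃ g, HasWeakPartial D k u g

open Classical in
/-- The weak partial derivative `∂_k u ∈ L²(D)³` (with the value `0` if there is none). -/
def weakPartial (D : Set E3) (k : Fin 3) (u : L2V D) : L2V D :=
  if h : ∃ g, HasWeakPartial D k u g then h.choose else 0

/-- `u ∈ H²(D)³`. -/
def MemH2 (D : Set E3) (u : L2V D) : Prop := MemH1 D u ∧ ∀ k, MemH1 D (weakPartial D k u)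

/-- The squared norm of `H²(D)³`. -/
def normSqH2 (D : Set E3) (u : L2V D) : ℝ :=
  ‖u‖ ^ 2 + ∑ k, ‖weakPartial D k u‖ ^ 2 +
    ∑ k, ∑ l, ‖weakPartial D l (weakPartial D k u)‖ ^ 2

/-- `(∇u, ∇v)_{L²(D)}`. -/
def gradInner (D : Set E3) (u v : L2V D) : ℝ :=
  ∑ k, inner ℝ (weakPartial D k u) (weakPartial D k v)

/-- `G` is a Hilbert-Schmidt operator from `L²(D)³` (with the complete orthonormal system `e`)
into `H²(D)³`. -/
def IsHilbertSchmidtH2 (D : Set E3) (e : HilbertBasis ℕ ℝ (L2V D)) (G : L2V D →L[ℝ] L2V D) :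
    Prop :=
  (∀ i, MemH2 D (G (e i))) ∧ Summable fun i => normSqH2 D (G (e i))

/-! ### The algorithm -/

open Classical in
/-- The pointwise cross product `u × v`, as an element of `L²(D)³` (whenever it lies there, in
particular for bounded `u`). -/
def crossL2 (D : Set E3) (u v : L2V D) : L2V D :=
  if h : MemLp (fun x => cross (u x) (v x)) 2 (volume.restrict D) then h.toLp else 0

open Classical in
/-- `x ↦ u(x) / |u(x)|`, as an element of `L²(D)³` (for bounded `D` it always lies there). -/
def normalizeL2 (D : Set E3) (u : L2V D) : L2V D :=
  if h : MemLp (fun x => ‖u x‖⁻¹ • u x) 2 (volume.restrict D) then h.toLp else 0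

/-- The space of the fields of `H¹(D)³` that are orthogonal to `m` almost everywhere. -/
def MemTangent (D : Set E3) (m ψ : L2V D) : Prop :=
  MemH1 D ψ ∧ ∀ᵐ x ∂volume.restrict D, inner ℝ (ψ x) (m x) = 0

/-- `v` solves the variational problem of one step of the `θ`-scheme, with time step `τ`, noise
coefficients `Gf i = G e_i`, current state `m` and noise increment `g = G ΔW`. -/
def IsStepSolution (D : Set E3) (θ τ : ℝ) (Gf : ℕ → L2V D) (m g v : L2V D) : Prop :=
  MemTangent D m v ∧ ∀ φ : L2V D, MemTangent D m φ →
    (∫ x in D, inner ℝ (v x - cross (m x) (v x)) (φ x)) + 2 * θ * τ * gradInner D v φ =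
      -2 * τ * gradInner D m φ
      + (∫ x in D, inner ℝ
          (cross (m x) (g x) - cross (m x) (cross (m x) (g x))) (φ x))
      + τ / 2 * ∑' i, ∫ x in D, inner ℝ
          (cross (cross (m x) (Gf i x)) (Gf i x)
            - cross (m x) (cross (cross (m x) (Gf i x)) (Gf i x))) (φ x)

open Classical in
/-- The solution `v` of the variational problem of one step (it exists and is unique in `L²(D)³`
for `m ∈ H¹(D)³` with `|m| = 1`). -/
def stepSolution (D : Set E3) (θ τ : ℝ) (Gf : ℕ → L2V D) (m g : L2V D) : L2V D :=
  if h : ∃ v, IsStepSolution D θ τ Gf m g v then h.choose else 0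

/-- The sequence `m^n` produced by the algorithm from the initial datum `m₀` and the noise
increments `g^n`. -/
def schemeState (D : Set E3) (θ τ : ℝ) (Gf : ℕ → L2V D) (m₀ : L2V D) (g : ℕ → L2V D) :
    ℕ → L2V D
  | 0 => m₀
  | n + 1 => normalizeL2 D (schemeState D θ τ Gf m₀ g n
      + stepSolution D θ τ Gf (schemeState D θ τ Gf m₀ g n) (g n))

/-- The increment `b((n+1)Δt) - b(nΔt)` of a path `b : [0,T] → L²(D)³`, where `Δt = T/N`. -/
def pathIncrement {D : Set E3} {T : ℝ} (hT : 0 ≤ T) (N : ℕ) (b : C(Icc (0 : ℝ) T, L2V D))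
    (n : ℕ) : L2V D :=
  b (projIcc 0 T hT (((n : ℝ) + 1) * (T / N))) - b (projIcc 0 T hT ((n : ℝ) * (T / N)))

/-- The function of time with the constant value `a n` on `[nΔt,(n+1)Δt)`, `0 ≤ n ≤ N-1`,
`Δt = T/N`, as an element of `L²(0,T;L²(D)³)`. -/
def stepFunction {D : Set E3} (T : ℝ) (N : ℕ) (a : ℕ → L2V D) : L2TV T D :=
  ∑ n ∈ Finset.range N, indicatorConstLp 2
    (measurableSet_Ico (a := (n : ℝ) * (T / N)) (b := ((n : ℝ) + 1) * (T / N)))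
    (measure_ne_top _ _) (a n)

/-- The value of `f ∈ L²(0,T;L²(D)³)` on the interval `[nΔt,(n+1)Δt)`, `Δt = T/N`, where `f` is
constant on this interval. It is written as a mean value because `f` is only determined up to
null sets of times. -/
def stepValue {D : Set E3} {T : ℝ} (N : ℕ) (f : L2TV T D) (n : ℕ) : L2V D :=
  (T / N)⁻¹ • ∫ t in Ico ((n : ℝ) * (T / N)) (((n : ℝ) + 1) * (T / N)), f t

/-- The piecewise constant process `m_N` of the algorithm, as a function of the path `b = G W`. -/
def schemeProcess {D : Set E3} {T : ℝ} (hT : 0 ≤ T) (θ : ℝ) (Gf : ℕ → L2V D) (m₀ : L2V D)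
    (N : ℕ) (b : C(Icc (0 : ℝ) T, L2V D)) : L2TV T D :=
  stepFunction T N (schemeState D θ (T / N) Gf m₀ (pathIncrement hT N b))

/-- `w^n = (v^n - A^n)/Δt`, for a piecewise constant process `f` with values `m^n` and a noise path
`b`: here `A^n = m^n × (b((n+1)Δt) - b(nΔt))`, and `v^n` is the solution of the variational problem
with data `m^n` and `b((n+1)Δt) - b(nΔt)`. -/
def stepW {D : Set E3} {T : ℝ} (hT : 0 ≤ T) (θ : ℝ) (Gf : ℕ → L2V D) (N : ℕ) (f : L2TV T D)
    (b : C(Icc (0 : ℝ) T, L2V D)) (n : ℕ) : L2V D :=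
  (T / N)⁻¹ • (stepSolution D θ (T / N) Gf (stepValue N f n) (pathIncrement hT N b n)
    - crossL2 D (stepValue N f n) (pathIncrement hT N b n))

/-! ### Probability -/

/-- `GW` is the process `G W(t) = ∑ᵢ βᵢ(t) Gᵢ`, `t ∈ [0,T]`, with continuous paths in `L²(D)³`,
where the `βᵢ` are independent Brownian motions. -/
structure IsNoise {Ω : Type*} [MeasurableSpace Ω] (P : Measure Ω) {D : Set E3} {T : ℝ}
    (Gf : ℕ → L2V D) (β : ℕ → ℝ≥0 → Ω → ℝ) (GW : Ω → C(Icc (0 : ℝ) T, L2V D)) : Prop where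
  measurable : ∀ i t, Measurable (β i t)
  brownian : ∀ i, IsBrownianReal (β i) P
  indep : iIndepFun (fun i ω t => β i t ω) P
  stronglyMeasurable : ∀ t, StronglyMeasurable fun ω => GW ω t
  series : ∀ t : Icc (0 : ℝ) T, Tendsto (fun n => eLpNorm
    (fun ω => GW ω t - ∑ i ∈ Finset.range n, β i (Real.toNNReal t) ω • Gf i) 2 P) atTop (𝓝 0)

/-- `X` and `Y` are random variables (for the Borel sets of `Z`) with the same law. -/
def EqualLaw {Ω Ω' Z : Type*} [MeasurableSpace Ω] [MeasurableSpace Ω'] [TopologicalSpace Z]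
    (X : Ω → Z) (P : Measure Ω) (Y : Ω' → Z) (P' : Measure Ω') : Prop :=
  @IdentDistrib Ω Ω' Z _ _ (borel Z) X Y P P'

/-- Weak convergence of `f j` to `f∞` in the Hilbert space `L²(Ω;H)`. For `H = L²(0,T;L²(D)³)` this
is the space `L²(Ω×[0,T]×D)³`, for `H = L²(D)³` it is `L²(Ω×D)³`. -/
def WeakConvL2 {Ω H : Type*} [MeasurableSpace Ω] [NormedAddCommGroup H] [InnerProductSpace ℝ H]
    (P : Measure Ω) (f : ℕ → Ω → H) (fLim : Ω → H) : Prop :=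
  (∀ j, MemLp (f j) 2 P) ∧ MemLp fLim 2 P ∧
    ∀ Φ : Ω → H, MemLp Φ 2 P →
      Tendsto (fun j => ∫ ω, inner ℝ (f j ω) (Φ ω) ∂P) atTop (𝓝 (∫ ω, inner ℝ (fLim ω) (Φ ω) ∂P))

/-! ### The limit drift -/

/-- `L ∈ L¹(D)³` is the weak Laplacian of `m ∈ H¹(D)³`, with homogeneous Neumann boundary condition:
the test fields need not vanish on the boundary of `D`. In particular `L` is the Laplacian of `m` in
the sense of distributions on `D`. -/
def IsWeakLaplacian (D : Set E3) (m : L2V D) (L : E3 → E3) : Prop :=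
  MemH1 D m ∧ IntegrableOn L D ∧
    ∀ φ : E3 → E3, ContDiff ℝ (⊤ : ℕ∞) φ → HasCompactSupport φ →
      ∫ x in D, inner ℝ (L x) (φ x) = -∑ k : Fin 3, ∫ x in D,
        inner ℝ (weakPartial D k m x) (fderiv ℝ φ x (EuclideanSpace.single k 1))

/-- `w = Δm + m|∇m|² + m × Δm + ½ Π_{mᗮ} ∑ᵢ (m × Gᵢ) × Gᵢ`, almost everywhere in `D`. -/
def IsDrift (D : Set E3) (Gf : ℕ → L2V D) (m w : L2V D) : Prop :=
  ∃ L : E3 → E3, IsWeakLaplacian D m L ∧ ∀ᵐ x ∂volume.restrict D,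
    w x = L x + (∑ k, ‖weakPartial D k m x‖ ^ 2) • m x + cross (m x) (L x)
      + (1 / 2 : ℝ) • projPerp (m x) (∑' i, cross (cross (m x) (Gf i x)) (Gf i x))

end

end LLG

open LLG

namespace LLG

noncomputable section

open scoped Convolution

/-! ### Mollification -/

/-! The drift `w^n` is controlled by an energy estimate, a weak limit exists by compactness, and the
equation of one step, tested with fields `m × ψ`, determines that limit.

Energy. The cone condition gives the embedding of `H²(D)³` into `L^∞(D)³` (`exists_sobolev_const`),
so the `Gᵢ` are bounded and `m ↦ ∑ᵢ (m × Gᵢ) × Gᵢ` is a bounded multiplication operator. Testing one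
step with `v - m × g`, where `g` is the noise increment, leaves the gain `(2θ-1)/2 ‖∇v‖² + τ/2
‖w‖²`, and here `θ > 1/2` is essential (`energy_step`). Normalization does not raise the Dirichlet
energy: `|m + v| ≥ 1`, so it is the nearest point retraction onto the unit ball, which is
1-Lipschitz (`exists_hasWeakPartial_ballProjL2`). In `(∇m, ∇(m × g))` the part `∂m × g` is
orthogonal to `∂m`; the rest is linear in the increment and has mean zero. Expectations and a
discrete Gronwall argument bound `E‖∇m^n‖²`, `∑ E‖∇v^n‖²` and `τ ∑ E‖w^n‖²` uniformly in `N`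
(`exists_schemeBounds`).

Transfer. These quantities are integrals of Borel functions of `(m^n, g^n)`, so equality of laws
carries the bounds to the new space (`SchemeBounds.transfer`). The step map is Borel by the
Lusin-Souslin theorem: its graph is an injective continuous image of a closed set of jets
(`exists_measurable_stepSolution`).

Limit. For bounded `ψ` the step equation tested with `m × ψ` reads `(w + m × w - noise, ψ) + 2 ∑ₖ (m
× ∂ₖm, ∂ₖψ) = 2θ ∑ₖ (∂ₖv, ∂ₖ(m × ψ))` (`driftField_inner`). Since `|m_N| = 1`, almost sure
convergence becomes strong convergence in `L²`; on the left strong limits are paired with weak ones,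
and the right side vanishes in `L¹` because `‖∇v_N‖ = O(√τ)` (`exists_limitField`). Putting `ψ = m ×
φ` into the limit equation shows `Δm = -|∇m|² m - ½ m × y` with `y = w + m × w - noise`; together
with `w ⟂ m`, linear algebra recovers `w` (`isDrift_of_tested`, `drift_algebra`).

Sums. The sum up to time `t` is the integral of `w_N` over the completed steps, which miss at most
one step of `[0,t)`; the error is `O(√τ)` in `L²` (`weakTendsto_sums`). -/

/-- A sequence of bump functions shrinking to the origin of `ℝ³`. -/
def shrinkingBump (n : ℕ) : ContDiffBump (0 : E3) where
  rIn := 1 / (2 * ((n : ℝ) + 1))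
  rOut := 1 / ((n : ℝ) + 1)
  rIn_pos := by positivity
  rIn_lt_rOut := by
    have : (0 : ℝ) < (n : ℝ) + 1 := by positivity
    rw [div_lt_div_iff₀ (by positivity) this]; linarith

lemma shrinkingBump_rOut_tendsto : Tendsto (fun n => (shrinkingBump n).rOut) atTop (𝓝 0) :=
  tendsto_one_div_add_atTop_nhds_zero_nat

/-- The mollification of `f` by the `n`-th bump function. -/
def mollify (n : ℕ) (f : E3 → E3) : E3 → E3 :=
  (shrinkingBump n).normed volume ⋆[ContinuousLinearMap.lsmul ℝ ℝ, volume] f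

/-- The probability measure with the mollifying kernel as its density. -/
def bumpMeasure (n : ℕ) : Measure E3 :=
  volume.withDensity fun t => ENNReal.ofReal ((shrinkingBump n).normed volume t)

instance (n : ℕ) : IsProbabilityMeasure (bumpMeasure n) := ⟨by
  rw [bumpMeasure, withDensity_apply _ MeasurableSet.univ, Measure.restrict_univ,
    ← ofReal_integral_eq_lintegral_ofReal (shrinkingBump n).integrable_normed
      (Eventually.of_forall (shrinkingBump n).nonneg_normed), (shrinkingBump n).integral_normed,
    ENNReal.ofReal_one]⟩

lemma integral_bumpMeasure (n : ℕ) (g : E3 → E3) :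
    ∫ t, g t ∂bumpMeasure n = ∫ t, (shrinkingBump n).normed volume t • g t := by
  rw [bumpMeasure, integral_withDensity_eq_integral_toReal_smul
    ((shrinkingBump n).continuous_normed.measurable.ennreal_ofReal)
    (Eventually.of_forall fun _ => ENNReal.ofReal_lt_top)]
  simp [ENNReal.toReal_ofReal ((shrinkingBump n).nonneg_normed _)]

/-- As a mean over a probability measure the mollification is accessible to Jensen's inequality and
Tonelli's theorem. -/
lemma mollify_apply (n : ℕ) (f : E3 → E3) (x : E3) :
    mollify n f x = ∫ t, f (x - t) ∂bumpMeasure n := by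
  rw [integral_bumpMeasure]; rfl

lemma integrable_bumpMeasure {n : ℕ} {f : E3 → E3} (hf : LocallyIntegrable f volume) (x : E3) :
    Integrable (fun t => f (x - t)) (bumpMeasure n) := by
  rw [bumpMeasure, integrable_withDensity_iff_integrable_smul'
    ((shrinkingBump n).continuous_normed.measurable.ennreal_ofReal)
    (Eventually.of_forall fun _ => ENNReal.ofReal_lt_top)]
  have := (shrinkingBump n).hasCompactSupport_normed (μ := volume)
    |>.convolutionExists_left (L := ContinuousLinearMap.lsmul ℝ ℝ)
      (shrinkingBump n).continuous_normed hf x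
  simpa [ConvolutionExistsAt, ENNReal.toReal_ofReal ((shrinkingBump n).nonneg_normed _)] using this

lemma mollify_contDiff (n : ℕ) {f : E3 → E3} (hf : LocallyIntegrable f volume) :
    ContDiff ℝ (⊤ : ℕ∞) (mollify n f) :=
  (shrinkingBump n).hasCompactSupport_normed.contDiff_convolution_left _
    (shrinkingBump n).contDiff_normed hf

lemma mollify_tendsto_ae {f : E3 → E3} (hf : LocallyIntegrable f volume) :
    ∀ᵐ x, Tendsto (fun n => mollify n f x) atTop (𝓝 (f x)) := by
  refine ContDiffBump.ae_convolution_tendsto_right_of_locallyIntegrable (K := 2)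
    shrinkingBump_rOut_tendsto (Eventually.of_forall fun n => ?_) hf
  simp only [shrinkingBump]
  have : (0 : ℝ) < (n : ℝ) + 1 := by positivity
  field_simp; norm_num

lemma ae_bumpMeasure_norm_lt (n : ℕ) : ∀ᵐ t ∂bumpMeasure n, ‖t‖ < (shrinkingBump n).rOut := by
  rw [bumpMeasure, ae_withDensity_iff
    ((shrinkingBump n).continuous_normed.measurable.ennreal_ofReal)]
  refine Eventually.of_forall fun t ht => ?_
  have : t ∈ Function.support ((shrinkingBump n).normed volume) := by
    intro h; simp [h] at ht
  rw [(shrinkingBump n).support_normed_eq] at this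
  simpa using this

/-- Translations act strongly continuously on `Lp`; the statement is this continuity at `t = 0`,
with the norm written as an integral. -/
lemma translation_tendsto {f : E3 → E3} (hf : MemLp f 2 volume) :
    Tendsto (fun t : E3 => ∫⁻ x, ‖f (x - t) - f x‖ₑ ^ 2) (𝓝 0) (𝓝 0) := by
  have : Fact ((2 : ℝ≥0∞) ≠ ∞) := ⟨by norm_num⟩
  set F := hf.toLp
  have hc : Continuous fun t : E3 => ((DomAddAct.mk (-t)) +ᵥ F) - F := by
    refine Continuous.sub (Continuous.vadd (f := fun t : E3 => DomAddAct.mk (-t)) ?_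
      continuous_const) continuous_const
    exact DomAddAct.continuous_mk.comp (continuous_neg (G := E3))
  have h0 := ((ENNReal.continuous_pow 2).comp hc.enorm).tendsto 0
  have he : ∀ t : E3, ‖((DomAddAct.mk (-t)) +ᵥ F) - F‖ₑ ^ 2 = ∫⁻ x, ‖f (x - t) - f x‖ₑ ^ 2 := by
    intro t
    have h1 : (DomAddAct.mk (-t)) +ᵥ F =
        (hf.comp_measurePreserving (measurePreserving_vadd (-t) (volume : Measure E3))).toLp := rfl
    rw [h1, ← MemLp.toLp_sub, Lp.enorm_toLp]
    have := eLpNorm_nnreal_pow_eq_lintegral (p := 2) (μ := (volume : Measure E3))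
      (f := (f ∘ fun x => -t +ᵥ x) - f) two_ne_zero
    simp only [NNReal.coe_ofNat, ENNReal.coe_ofNat, ENNReal.rpow_ofNat] at this
    rw [this]
    refine lintegral_congr fun x => ?_
    simp [sub_eq_neg_add]
  have h2 : (DomAddAct.mk (-(0 : E3)) +ᵥ F) - F = 0 := by
    rw [neg_zero, DomAddAct.mk_zero, zero_vadd, sub_self]
  simpa only [Function.comp_def, he, h2, enorm_zero, ne_eq, OfNat.ofNat_ne_zero,
    not_false_eq_true, zero_pow] using h0

/-- Jensen and Tonelli bound the squared error by the mean, over `bumpMeasure n`, of the squared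
translation error, and this measure concentrates at the origin. -/
lemma mollify_tendsto_L2 {f : E3 → E3} (hfm : StronglyMeasurable f) (hf : MemLp f 2 volume) :
    Tendsto (fun n => eLpNorm (mollify n f - f) 2 volume) atTop (𝓝 0) := by
  have hloc : LocallyIntegrable f volume := hf.locallyIntegrable (by norm_num)
  have key : ∀ n, eLpNorm (mollify n f - f) 2 volume ^ 2 ≤
      ∫⁻ t, ∫⁻ x, ‖f (x - t) - f x‖ₑ ^ 2 ∂volume ∂bumpMeasure n := by
    intro n
    have h1 := eLpNorm_nnreal_pow_eq_lintegral (p := 2) (μ := (volume : Measure E3))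
      (f := mollify n f - f) two_ne_zero
    simp only [NNReal.coe_ofNat, ENNReal.coe_ofNat, ENNReal.rpow_ofNat] at h1
    have hm : Measurable fun p : E3 × E3 => ‖f (p.1 - p.2) - f p.1‖ₑ ^ 2 :=
      ((((hfm.comp_measurable (measurable_fst.sub measurable_snd)).sub
        (hfm.comp_measurable measurable_fst)).enorm).pow_const 2)
    rw [h1, lintegral_lintegral_swap (by
      exact (hm.comp measurable_swap).aemeasurable)]
    refine lintegral_mono fun x => ?_
    have h2 : (mollify n f - f) x = ∫ t, (f (x - t) - f x) ∂bumpMeasure n := by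
      rw [integral_sub (integrable_bumpMeasure hloc x) (integrable_const _), Pi.sub_apply,
        mollify_apply]; simp
    rw [h2]
    have h3 : ‖∫ t, (f (x - t) - f x) ∂bumpMeasure n‖ₑ ≤
        eLpNorm (fun t => f (x - t) - f x) 2 (bumpMeasure n) := by
      refine (enorm_integral_le_lintegral_enorm _).trans ?_
      rw [← eLpNorm_one_eq_lintegral_enorm]
      exact eLpNorm_le_eLpNorm_of_exponent_le (by norm_num)
        ((integrable_bumpMeasure hloc x).sub (integrable_const _)).aestronglyMeasurable
    have h4 := eLpNorm_nnreal_pow_eq_lintegral (p := 2) (μ := bumpMeasure n)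
      (f := fun t => f (x - t) - f x) two_ne_zero
    simp only [NNReal.coe_ofNat, ENNReal.coe_ofNat, ENNReal.rpow_ofNat] at h4
    calc _ ≤ _ := pow_le_pow_left' h3 2
      _ = _ := h4
  have h5 : Tendsto (fun n => eLpNorm (mollify n f - f) 2 volume ^ 2) atTop (𝓝 0) := by
    rw [ENNReal.tendsto_nhds_zero]
    intro ε hε
    have h6 := (ENNReal.tendsto_nhds_zero.1 (translation_tendsto hf)) ε hε
    obtain ⟨δ, hδ, h7⟩ := Metric.eventually_nhds_iff.1 h6
    filter_upwards [shrinkingBump_rOut_tendsto.eventually (gt_mem_nhds hδ)] with n hn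
    refine (key n).trans ?_
    calc _ ≤ ∫⁻ _, ε ∂bumpMeasure n := lintegral_mono_ae (by
          filter_upwards [ae_bumpMeasure_norm_lt n] with t ht
          exact h7 (by simpa using ht.trans hn))
      _ = ε := by simp
  have h8 := (ENNReal.continuous_rpow_const (y := (1 / 2 : ℝ))).tendsto 0 |>.comp h5
  simp only [one_div, inv_pos, Nat.ofNat_pos, ENNReal.zero_rpow_of_pos] at h8
  refine h8.congr fun n => ?_
  rw [Function.comp_apply, ← ENNReal.rpow_natCast, ← ENNReal.rpow_mul]; norm_num

/-! ### Weak derivatives -/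

/-- The `k`-th coordinate vector of `ℝ³`. -/
abbrev stdVec (k : Fin 3) : E3 := EuclideanSpace.single k 1

/-- The extension of a field on `D` by zero. -/
def extZero (D : Set E3) (u : L2V D) : E3 → E3 := D.indicator u

lemma extZero_stronglyMeasurable {D : Set E3} (hD : IsOpen D) (u : L2V D) :
    StronglyMeasurable (extZero D u) :=
  (Lp.stronglyMeasurable u).indicator hD.measurableSet

lemma extZero_memLp {D : Set E3} (hD : IsOpen D) (u : L2V D) : MemLp (extZero D u) 2 volume :=
  (memLp_indicator_iff_restrict hD.measurableSet).2 (Lp.memLp u)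

lemma extZero_locallyIntegrable {D : Set E3} (hD : IsOpen D) (u : L2V D) :
    LocallyIntegrable (extZero D u) volume :=
  (extZero_memLp hD u).locallyIntegrable (by norm_num)

lemma integral_extZero {D : Set E3} (hD : IsOpen D) (u : L2V D) (η : E3 → ℝ) :
    ∫ x, η x • extZero D u x = ∫ x in D, η x • u x := by
  rw [← integral_indicator hD.measurableSet]
  congr 1; ext1 x
  by_cases hx : x ∈ D <;> simp [extZero, hx]

/-- The derivative falls on the kernel, and `t ↦ φ(x - t)` is an admissible test function as soon as
its support, a ball around `x`, lies in `D`. The jump of the zero extension at the boundary is then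
not seen. -/
lemma fderiv_mollify {D : Set E3} (hD : IsOpen D) {k : Fin 3} {u g : L2V D}
    (h : HasWeakPartial D k u g) {n : ℕ} {x : E3}
    (hx : Metric.closedBall x (shrinkingBump n).rOut ⊆ D) :
    fderiv ℝ (mollify n (extZero D u)) x (stdVec k) = mollify n (extZero D g) x := by
  set φ := (shrinkingBump n).normed (volume : Measure E3) with hφ
  have hφd : ContDiff ℝ (⊤ : ℕ∞) φ := (shrinkingBump n).contDiff_normed
  have hφc : HasCompactSupport φ := (shrinkingBump n).hasCompactSupport_normed
  have h1 : HasFDerivAt (mollify n (extZero D u)) _ x :=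
    hφc.hasFDerivAt_convolution_left (ContinuousLinearMap.lsmul ℝ ℝ) (hφd.of_le (by simp))
      (extZero_locallyIntegrable hD u) x
  have h2 : fderiv ℝ (mollify n (extZero D u)) x (stdVec k) =
      ∫ t, (fderiv ℝ φ (x - t) (stdVec k)) • extZero D u t := by
    rw [h1.fderiv, convolution_eq_swap]
    rw [ContinuousLinearMap.integral_apply]
    · rfl
    · have := (hφc.fderiv ℝ).convolutionExists_left
        ((ContinuousLinearMap.lsmul ℝ ℝ).precompL E3 : (E3 →L[ℝ] ℝ) →L[ℝ] E3 →L[ℝ] E3 →L[ℝ] E3)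
        (hφd.continuous_fderiv (by simp)) (extZero_locallyIntegrable hD u) x
      exact this.integrable_swap
  have h3 : mollify n (extZero D g) x = ∫ t, φ (x - t) • extZero D g t := by
    rw [mollify, convolution_eq_swap]; rfl
  have hη : ContDiff ℝ (⊤ : ℕ∞) fun t => φ (x - t) := hφd.comp (contDiff_const.sub contDiff_id)
  have hsupp : tsupport (fun t => φ (x - t)) ⊆ Metric.closedBall x (shrinkingBump n).rOut := by
    refine closure_minimal ?_ Metric.isClosed_closedBall
    intro t ht
    have : x - t ∈ Function.support φ := ht
    rw [hφ, (shrinkingBump n).support_normed_eq] at this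
    simp only [Metric.mem_ball, dist_zero_right] at this
    rw [Metric.mem_closedBall, dist_comm, dist_eq_norm]; exact this.le
  have hcs : HasCompactSupport fun t => φ (x - t) :=
    (isCompact_closedBall _ _).of_isClosed_subset (isClosed_tsupport _) hsupp
  have h4 := h _ hη hcs (hsupp.trans hx)
  have h5 : ∀ t, fderiv ℝ (fun t => φ (x - t)) t (stdVec k) = -fderiv ℝ φ (x - t) (stdVec k) := by
    intro t
    have : HasFDerivAt (fun t => φ (x - t)) ((fderiv ℝ φ (x - t)).comp
        (-ContinuousLinearMap.id ℝ E3)) t :=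
      ((hφd.differentiable (by simp)) (x - t)).hasFDerivAt.comp t
        ((hasFDerivAt_id t).const_sub x)
    rw [this.fderiv]; simp
  simp only [h5, neg_smul, integral_neg, neg_inj] at h4
  rw [h2, h3, integral_extZero hD u (fun t => fderiv ℝ φ (x - t) (stdVec k)),
    integral_extZero hD g (fun t => φ (x - t)), h4]

/-! ### Calculus of weak derivatives -/

/-! ### Integrals of bilinear expressions in square integrable fields -/

section Pairing

variable {α E F G : Type*} [MeasurableSpace α] {μ : Measure α} [NormedAddCommGroup E]
  [NormedSpace ℝ E] [NormedAddCommGroup F] [NormedSpace ℝ F] [NormedAddCommGroup G]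
  [NormedSpace ℝ G]

lemma eLpNorm_one_bilin_le (B : E →L[ℝ] F →L[ℝ] G) {a : α → E} {b : α → F}
    (ha : AEStronglyMeasurable a μ) (hb : AEStronglyMeasurable b μ) :
    eLpNorm (fun x => B (a x) (b x)) 1 μ ≤ ‖B‖₊ * eLpNorm a 2 μ * eLpNorm b 2 μ := by
  refine eLpNorm_le_eLpNorm_mul_eLpNorm_of_nnnorm (p := 2) (q := 2) (r := 1) ha hb
    (fun x y => B x y) ‖B‖₊ (Eventually.of_forall fun x => ?_)
  exact B.le_opNorm₂ _ _

lemma integrable_bilin (B : E →L[ℝ] F →L[ℝ] G) {a : α → E} {b : α → F}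
    (ha : MemLp a 2 μ) (hb : MemLp b 2 μ) : Integrable (fun x => B (a x) (b x)) μ := by
  rw [← memLp_one_iff_integrable]
  refine ⟨B.aestronglyMeasurable_comp₂ ha.1 hb.1,
    (eLpNorm_one_bilin_le B ha.1 hb.1).trans_lt ?_⟩
  exact ENNReal.mul_lt_top (ENNReal.mul_lt_top (by simp) ha.2) hb.2

lemma tendsto_integral_bilin (B : E →L[ℝ] F →L[ℝ] G) {a : α → E} {b : ℕ → α → F} {b' : α → F}
    (ha : MemLp a 2 μ) (hb : ∀ n, MemLp (b n) 2 μ) (hb' : MemLp b' 2 μ)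
    (h : Tendsto (fun n => eLpNorm (b n - b') 2 μ) atTop (𝓝 0)) :
    Tendsto (fun n => ∫ x, B (a x) (b n x) ∂μ) atTop (𝓝 (∫ x, B (a x) (b' x) ∂μ)) := by
  refine tendsto_integral_of_L1' _ (integrable_bilin B ha hb').aestronglyMeasurable
    (Eventually.of_forall fun n => integrable_bilin B ha (hb n)) ?_
  have h1 : ∀ n, eLpNorm ((fun x => B (a x) (b n x)) - fun x => B (a x) (b' x)) 1 μ ≤
      ‖B‖₊ * eLpNorm a 2 μ * eLpNorm (b n - b') 2 μ := by
    intro n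
    have := eLpNorm_one_bilin_le B ha.1 ((hb n).1.sub hb'.1)
    refine le_trans (le_of_eq ?_) this
    congr 1; ext x; simp
  refine tendsto_of_tendsto_of_tendsto_of_le_of_le tendsto_const_nhds ?_ (fun _ => zero_le) h1
  have := ENNReal.Tendsto.const_mul (a := ‖B‖₊ * eLpNorm a 2 μ) h
    (Or.inr (ENNReal.mul_ne_top (by simp) ha.2.ne))
  simpa using this

end Pairing

/-- Smooth functions with compact support in `D`. -/
def IsTestField {V : Type*} [NormedAddCommGroup V] [NormedSpace ℝ V] (D : Set E3) (φ : E3 → V) :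
    Prop :=
  ContDiff ℝ (⊤ : ℕ∞) φ ∧ HasCompactSupport φ ∧ tsupport φ ⊆ D

/-! ### Test fields, and weak derivatives as orthogonality relations -/

section TestField

variable {V : Type*} [NormedAddCommGroup V] [NormedSpace ℝ V] {D : Set E3} {φ : E3 → V}

lemma IsTestField.memLp (h : IsTestField D φ) : MemLp φ 2 (volume.restrict D) :=
  (h.1.continuous.memLp_of_hasCompactSupport h.2.1).restrict D

lemma IsTestField.differentiable (h : IsTestField D φ) : Differentiable ℝ φ :=
  h.1.differentiable (by simp)

lemma IsTestField.lineDeriv (h : IsTestField D φ) (e : E3) :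
    IsTestField D fun x => fderiv ℝ φ x e := by
  refine ⟨(h.1.fderiv_right (m := (⊤ : ℕ∞)) (by simp)).clm_apply contDiff_const,
    h.2.1.fderiv_apply ℝ e, ?_⟩
  refine (closure_mono ?_).trans ((tsupport_fderiv_subset ℝ).trans h.2.2)
  intro x hx hx'
  exact hx (by simp [hx'])

lemma IsTestField.mul {η : E3 → ℝ} (h : IsTestField D η) {f : E3 → V}
    (hf : ContDiff ℝ (⊤ : ℕ∞) f) : IsTestField D fun x => η x • f x :=
  ⟨h.1.smul hf, h.2.1.smul_right,
    (closure_mono (Function.support_smul_subset_left η f)).trans h.2.2⟩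

lemma IsTestField.clm_comp {W : Type*} [NormedAddCommGroup W] [NormedSpace ℝ W]
    (h : IsTestField D φ) (L : V →L[ℝ] W) : IsTestField D fun x => L (φ x) :=
  ⟨L.contDiff.comp h.1, h.2.1.comp_left (map_zero L),
    (closure_mono (Function.support_comp_subset (map_zero L) φ)).trans h.2.2⟩

lemma IsTestField.bounded (h : IsTestField D φ) : ∃ C, ∀ x, ‖φ x‖ ≤ C :=
  h.2.1.exists_bound_of_continuous h.1.continuous

end TestField

lemma hasWeakPartial_def {D : Set E3} {k : Fin 3} {u g : L2V D} : HasWeakPartial D k u g ↔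
    ∀ φ : E3 → ℝ, IsTestField D φ →
      ∫ x in D, (fderiv ℝ φ x (stdVec k)) • u x = -∫ x in D, φ x • g x :=
  ⟨fun h φ hφ => h φ hφ.1 hφ.2.1 hφ.2.2, fun h φ h1 h2 h3 => h φ ⟨h1, h2, h3⟩⟩

lemma integrable_smul_L2 {D : Set E3} {φ : E3 → ℝ} (hφ : IsTestField D φ) (u : L2V D) :
    Integrable (fun x => φ x • u x) (volume.restrict D) :=
  integrable_bilin (ContinuousLinearMap.lsmul ℝ ℝ) hφ.memLp (Lp.memLp u)

/-- The pairs `(∂_k φ, φ)` of square integrable fields, for `φ = η c` with a scalar test function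
`η` and a constant vector `c`. -/
def testPairs (D : Set E3) (k : Fin 3) : Set (L2V D × L2V D) :=
  {p | ∃ φ : E3 → ℝ, ∃ _ : IsTestField D φ, ∃ c : E3,
    (p.1 =ᵐ[volume.restrict D] fun x => fderiv ℝ φ x (stdVec k) • c) ∧
    p.2 =ᵐ[volume.restrict D] fun x => φ x • c}

lemma inner_eq_of_ae_smul {D : Set E3} {φ : E3 → ℝ} (hφ : IsTestField D φ) (u a : L2V D) (c : E3)
    (h : a =ᵐ[volume.restrict D] fun x => φ x • c) :
    inner ℝ u a = inner ℝ (∫ x in D, φ x • u x) c := by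
  rw [L2.inner_def, real_inner_comm, ← integral_inner (integrable_smul_L2 hφ u)]
  refine integral_congr_ae ?_
  filter_upwards [h] with x hx
  rw [hx, real_inner_smul_right, real_inner_smul_right, real_inner_comm]

/-- Pairing the vector identity with constant vectors `c` turns it into linear conditions continuous
in `(u, g)`. Linearity, closedness and stability under weak limits of weak derivatives are read off
from this form. -/
lemma hasWeakPartial_iff {D : Set E3} {k : Fin 3} {u g : L2V D} :
    HasWeakPartial D k u g ↔ ∀ p ∈ testPairs D k, inner ℝ u p.1 + inner ℝ g p.2 = 0 := by
  rw [hasWeakPartial_def]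
  constructor
  · rintro h p ⟨φ, hφ, c, h1, h2⟩
    rw [inner_eq_of_ae_smul (hφ.lineDeriv _) u _ c h1, inner_eq_of_ae_smul hφ g _ c h2, h φ hφ]
    simp
  · intro h φ hφ
    refine ext_inner_right ℝ fun c => ?_
    have hm1 : MemLp (fun x => fderiv ℝ φ x (stdVec k) • c) 2 (volume.restrict D) :=
      ((hφ.lineDeriv (stdVec k)).clm_comp (ContinuousLinearMap.toSpanSingleton ℝ c)).memLp
    have hm2 : MemLp (fun x => φ x • c) 2 (volume.restrict D) :=
      (hφ.clm_comp (ContinuousLinearMap.toSpanSingleton ℝ c)).memLp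
    have := h (hm1.toLp, hm2.toLp) ⟨φ, hφ, c, hm1.coeFn_toLp, hm2.coeFn_toLp⟩
    rw [inner_eq_of_ae_smul (hφ.lineDeriv _) u _ c hm1.coeFn_toLp,
      inner_eq_of_ae_smul hφ g _ c hm2.coeFn_toLp] at this
    rw [inner_neg_left]; linarith

lemma HasWeakPartial.add {D : Set E3} {k : Fin 3} {u g u' g' : L2V D}
    (h : HasWeakPartial D k u g) (h' : HasWeakPartial D k u' g') :
    HasWeakPartial D k (u + u') (g + g') := by
  rw [hasWeakPartial_iff] at *
  intro p hp
  rw [inner_add_left, inner_add_left]; linarith [h p hp, h' p hp]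

lemma HasWeakPartial.smul {D : Set E3} {k : Fin 3} {u g : L2V D} (c : ℝ)
    (h : HasWeakPartial D k u g) : HasWeakPartial D k (c • u) (c • g) := by
  rw [hasWeakPartial_iff] at *
  intro p hp
  rw [real_inner_smul_left, real_inner_smul_left, ← mul_add, h p hp, mul_zero]

lemma HasWeakPartial.sub {D : Set E3} {k : Fin 3} {u g u' g' : L2V D}
    (h : HasWeakPartial D k u g) (h' : HasWeakPartial D k u' g') :
    HasWeakPartial D k (u - u') (g - g') := by
  simpa [sub_eq_add_neg] using h.add (h'.smul (-1))

lemma hasWeakPartial_zero {D : Set E3} {k : Fin 3} : HasWeakPartial D k 0 0 := by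
  rw [hasWeakPartial_iff]; simp

lemma isClosed_hasWeakPartial (D : Set E3) (k : Fin 3) :
    IsClosed {p : L2V D × L2V D | HasWeakPartial D k p.1 p.2} := by
  simp only [hasWeakPartial_iff, ofPred_forall]
  refine isClosed_iInter fun p => isClosed_iInter fun _ => ?_
  exact isClosed_eq (by fun_prop) continuous_const

lemma ae_eq_zero_of_test {D : Set E3} (hD : IsOpen D) {F : Type*} [NormedAddCommGroup F]
    [NormedSpace ℝ F] [CompleteSpace F] {f : E3 → F} (hf : IntegrableOn f D volume)
    (h : ∀ φ : E3 → ℝ, IsTestField D φ → ∫ x in D, φ x • f x = 0) :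
    ∀ᵐ x ∂volume.restrict D, f x = 0 := by
  rw [ae_restrict_iff' hD.measurableSet]
  refine hD.ae_eq_zero_of_integral_contDiff_smul_eq_zero hf.locallyIntegrableOn
    fun φ h1 h2 h3 => ?_
  rw [← h φ ⟨h1, h2, h3⟩, setIntegral_eq_integral_of_forall_compl_eq_zero]
  intro x hx
  rw [image_eq_zero_of_notMem_tsupport (fun h => hx (h3 h)), zero_smul]

lemma L2V.integrable {D : Set E3} (hb : Bornology.IsBounded D) (u : L2V D) :
    IntegrableOn u D volume := by
  have : IsFiniteMeasure (volume.restrict D) := ⟨by simpa using hb.measure_lt_top⟩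
  exact (Lp.memLp u).integrable (by norm_num)

lemma HasWeakPartial.unique {D : Set E3} (hD : IsOpen D) (hb : Bornology.IsBounded D) {k : Fin 3}
    {u g g' : L2V D} (h : HasWeakPartial D k u g) (h' : HasWeakPartial D k u g') : g = g' := by
  have h0 := h.sub h'
  rw [sub_self, hasWeakPartial_def] at h0
  rw [← sub_eq_zero, Lp.eq_zero_iff_ae_eq_zero]
  refine ae_eq_zero_of_test hD (L2V.integrable hb _) fun φ hφ => ?_
  have h1 := h0 φ hφ
  have h2 : ∫ x in D, fderiv ℝ φ x (stdVec k) • (0 : L2V D) x = 0 := by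
    rw [integral_congr_ae (g := fun _ => (0 : E3))]
    · simp
    · filter_upwards [Lp.coeFn_zero E3 2 (volume.restrict D)] with x hx
      rw [hx]; simp
  rw [h2] at h1
  exact neg_eq_zero.1 h1.symm

lemma HasWeakPartial.weakPartial_eq {D : Set E3} (hD : IsOpen D) (hb : Bornology.IsBounded D)
    {k : Fin 3} {u g : L2V D} (h : HasWeakPartial D k u g) : weakPartial D k u = g := by
  have hex : ∃ g, HasWeakPartial D k u g := ⟨g, h⟩
  rw [weakPartial, dif_pos hex]
  exact hex.choose_spec.unique hD hb h

lemma MemH1.hasWeakPartial {D : Set E3} {u : L2V D} (h : MemH1 D u) (k : Fin 3) :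
    HasWeakPartial D k u (weakPartial D k u) := by
  rw [weakPartial, dif_pos (h k)]
  exact (h k).choose_spec

lemma eventually_closedBall_subset {D : Set E3} (hD : IsOpen D) {K : Set E3} (hK : IsCompact K)
    (hKD : K ⊆ D) :
    ∀ᶠ n in atTop, ∀ x ∈ K, Metric.closedBall x (shrinkingBump n).rOut ⊆ D := by
  obtain ⟨δ, hδ, h⟩ := hK.exists_cthickening_subset_open hD hKD
  filter_upwards [shrinkingBump_rOut_tendsto.eventually (gt_mem_nhds hδ)] with n hn x hx
  exact (Metric.closedBall_subset_cthickening hx _).trans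
    ((Metric.cthickening_mono hn.le K).trans h)

lemma mollify_extZero_tendsto {D : Set E3} (hD : IsOpen D) (u : L2V D) :
    Tendsto (fun n => eLpNorm (mollify n (extZero D u) - (u : E3 → E3)) 2 (volume.restrict D))
      atTop (𝓝 0) := by
  have h := mollify_tendsto_L2 (extZero_stronglyMeasurable hD u) (extZero_memLp hD u)
  refine tendsto_of_tendsto_of_tendsto_of_le_of_le tendsto_const_nhds h (fun _ => zero_le)
    fun n => ?_
  refine le_trans (le_of_eq ?_) (eLpNorm_mono_measure _ (Measure.restrict_le_self (s := D)))
  refine eLpNorm_congr_ae ?_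
  filter_upwards [ae_restrict_mem hD.measurableSet] with x hx
  simp [extZero, hx]

lemma mollify_memLp {D : Set E3} (hD : IsOpen D) (hb : Bornology.IsBounded D) (n : ℕ)
    (u : L2V D) : MemLp (mollify n (extZero D u)) 2 volume := by
  refine (mollify_contDiff n (extZero_locallyIntegrable hD u)).continuous.memLp_of_hasCompactSupport
    ?_
  refine (shrinkingBump n).hasCompactSupport_normed.convolution _ ?_
  exact HasCompactSupport.of_support_subset_isCompact hb.isCompact_closure
    ((Function.support_subset_iff'.2 fun x hx => by simp [extZero, hx]).trans subset_closure)

lemma integral_partial_eq_zero {φ : E3 → ℝ} {D : Set E3} (hφ : IsTestField D φ) (k : Fin 3) :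
    ∫ x in D, fderiv ℝ φ x (stdVec k) = 0 := by
  rw [setIntegral_eq_integral_of_forall_compl_eq_zero (fun x hx =>
    image_eq_zero_of_notMem_tsupport fun h => hx ((hφ.lineDeriv (stdVec k)).2.2 h))]
  have hd := (hφ.lineDeriv (stdVec k)).1.continuous.integrable_of_hasCompactSupport
    (μ := (volume : Measure E3)) (hφ.lineDeriv (stdVec k)).2.1
  have hi := hφ.1.continuous.integrable_of_hasCompactSupport (μ := (volume : Measure E3)) hφ.2.1
  have h := integral_smul_fderiv_eq_neg_fderiv_smul_of_integrable (μ := (volume : Measure E3))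
    (f := fun _ => (1 : ℝ)) (g := φ) (v := stdVec k) (by simp) (by simpa using hd)
    (by simpa using hi) (by simp) (fun x _ => hφ.differentiable x)
  simpa using h

/-! ### Product rules -/

lemma IsTestField.memLp_smul {D : Set E3} {φ : E3 → ℝ} (hφ : IsTestField D φ) (u : L2V D) :
    MemLp (fun x => φ x • u x) 2 (volume.restrict D) := by
  obtain ⟨C, hC⟩ := hφ.bounded
  refine MemLp.of_le_mul (c := C) (Lp.memLp u)
    (hφ.1.continuous.aestronglyMeasurable.smul (Lp.memLp u).1) (Eventually.of_forall fun x => ?_)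
  rw [norm_smul]
  exact mul_le_mul_of_nonneg_right (hC x) (norm_nonneg _)

lemma fderiv_coord {v : E3 → E3} (hv : ContDiff ℝ (⊤ : ℕ∞) v) (x e : E3) (j : Fin 3) :
    fderiv ℝ (fun x => v x j) x e = (fderiv ℝ v x e) j := by
  have h1 := (hv.differentiable (by simp) x).hasFDerivAt
  have h2 := ((EuclideanSpace.proj j : E3 →L[ℝ] ℝ).hasFDerivAt (x := v x)).comp x h1
  have h3 : fderiv ℝ (fun x => v x j) x =
      (EuclideanSpace.proj j : E3 →L[ℝ] ℝ).comp (fderiv ℝ v x) :=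
    h2.fderiv
  rw [h3]; rfl

lemma clm_sum_coord {F : Type*} [NormedAddCommGroup F] [NormedSpace ℝ F] (L : E3 →L[ℝ] F)
    (a : E3) : L a = ∑ j, a j • L (stdVec j) := by
  have h : a = ∑ j, a j • stdVec j := by
    ext i
    simp [Finset.sum_apply, Pi.single_apply]
  conv_lhs => rw [h]
  simp

variable {F : Type*} [NormedAddCommGroup F] [NormedSpace ℝ F] [CompleteSpace F]

/-- When the second factor is smooth, `φ` times a coordinate of `v` is again a test function, so the
definition of the weak derivative applies coordinate by coordinate. -/
lemma integral_partial_bilin_smooth {D : Set E3} {k : Fin 3} {u g : L2V D}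
    (h : HasWeakPartial D k u g) (B : E3 →L[ℝ] E3 →L[ℝ] F) {v : E3 → E3}
    (hv : ContDiff ℝ (⊤ : ℕ∞) v) {φ : E3 → ℝ} (hφ : IsTestField D φ) :
    ∫ x in D, fderiv ℝ φ x (stdVec k) • B (u x) (v x) =
      (-∫ x in D, φ x • B (g x) (v x)) - ∫ x in D, φ x • B (u x) (fderiv ℝ v x (stdVec k)) := by
  have hvj : ∀ j, ContDiff ℝ (⊤ : ℕ∞) fun x => v x j := fun j =>
    (EuclideanSpace.proj j : E3 →L[ℝ] ℝ).contDiff.comp hv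
  have hdv : ContDiff ℝ (⊤ : ℕ∞) fun x => fderiv ℝ v x (stdVec k) :=
    (hv.fderiv_right (m := (⊤ : ℕ∞)) (by simp)).clm_apply contDiff_const
  have hdvj : ∀ j, ContDiff ℝ (⊤ : ℕ∞) fun x => (fderiv ℝ v x (stdVec k)) j := fun j =>
    (EuclideanSpace.proj j : E3 →L[ℝ] ℝ).contDiff.comp hdv
  have key : ∀ j, ∫ x in D, (fderiv ℝ φ x (stdVec k) * v x j) • B (u x) (stdVec j) =
      (-∫ x in D, (φ x * v x j) • B (g x) (stdVec j))
        - ∫ x in D, (φ x * (fderiv ℝ v x (stdVec k)) j) • B (u x) (stdVec j) := by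
    intro j
    have ht : IsTestField D fun x => φ x * v x j := hφ.mul (hvj j)
    have ht1 : IsTestField D fun x => fderiv ℝ φ x (stdVec k) * v x j :=
      (hφ.lineDeriv (stdVec k)).mul (hvj j)
    have ht2 : IsTestField D fun x => φ x * (fderiv ℝ v x (stdVec k)) j := hφ.mul (hdvj j)
    have h1 := hasWeakPartial_def.1 h _ ht
    have hd : ∀ x, fderiv ℝ (fun x => φ x * v x j) x (stdVec k) =
        fderiv ℝ φ x (stdVec k) * v x j + φ x * (fderiv ℝ v x (stdVec k)) j := by
      intro x
      rw [fderiv_fun_mul (hφ.differentiable x) ((hvj j).differentiable (by simp) x),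
        _root_.add_apply, _root_.smul_apply,
        _root_.smul_apply, fderiv_coord hv]
      simp only [smul_eq_mul]; ring
    simp only [hd, add_smul] at h1
    rw [integral_add (integrable_smul_L2 ht1 u) (integrable_smul_L2 ht2 u)] at h1
    have h2 := congrArg (B.flip (stdVec j)) h1
    rw [map_add, map_neg, ← ContinuousLinearMap.integral_comp_comm _ (integrable_smul_L2 ht1 u),
      ← ContinuousLinearMap.integral_comp_comm _ (integrable_smul_L2 ht2 u),
      ← ContinuousLinearMap.integral_comp_comm _ (integrable_smul_L2 ht g)] at h2
    simp only [map_smul, ContinuousLinearMap.flip_apply] at h2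
    rw [eq_sub_iff_add_eq]; exact h2
  have hint : ∀ {ζ : E3 → ℝ} (_ : IsTestField D ζ) (w : L2V D) (j : Fin 3),
      Integrable (fun x => ζ x • B (w x) (stdVec j)) (volume.restrict D) := by
    intro ζ hζ w j
    have := (B.flip (stdVec j)).integrable_comp (integrable_smul_L2 hζ w)
    simpa only [map_smul, ContinuousLinearMap.flip_apply] using this
  have expand : ∀ (ζ : E3 → ℝ) (w : L2V D) (f : E3 → E3), IsTestField D ζ →
      (∀ j, ContDiff ℝ (⊤ : ℕ∞) fun x => f x j) →
      ∫ x in D, ζ x • B (w x) (f x) = ∑ j, ∫ x in D, (ζ x * f x j) • B (w x) (stdVec j) := by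
    intro ζ w f hζ hf
    have hi : ∀ j, Integrable (fun x => (ζ x * f x j) • B (w x) (stdVec j)) (volume.restrict D) :=
      fun j => hint (hζ.mul (hf j)) w j
    rw [← integral_finsetSum _ fun j _ => hi j]
    congr 1; ext1 x
    rw [clm_sum_coord (B (w x)) (f x), Finset.smul_sum]
    simp only [smul_smul]
  rw [expand _ u v (hφ.lineDeriv _) hvj, expand _ g v hφ hvj, expand _ u _ hφ hdvj,
    ← Finset.sum_neg_distrib, ← Finset.sum_sub_distrib]
  exact Finset.sum_congr rfl fun j _ => key j

/-- The second factor is mollified. On the support of `φ` the derivative of the mollified field is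
eventually the mollified derivative, and all three integrals converge by the `L²` convergence of
mollifications. -/
lemma integral_partial_bilin {D : Set E3} (hD : IsOpen D) (hb : Bornology.IsBounded D) {k : Fin 3}
    {u g f h : L2V D} (hu : HasWeakPartial D k u g) (hf : HasWeakPartial D k f h)
    (B : E3 →L[ℝ] E3 →L[ℝ] F) {φ : E3 → ℝ} (hφ : IsTestField D φ) :
    ∫ x in D, fderiv ℝ φ x (stdVec k) • B (u x) (f x) =
      -∫ x in D, φ x • (B (g x) (f x) + B (u x) (h x)) := by
  set v := fun n => mollify n (extZero D f)
  set w := fun n => mollify n (extZero D h)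
  have hv : ∀ n, MemLp (v n) 2 (volume.restrict D) := fun n => (mollify_memLp hD hb n f).restrict D
  have hw : ∀ n, MemLp (w n) 2 (volume.restrict D) := fun n => (mollify_memLp hD hb n h).restrict D
  have e1 : ∀ᶠ n in atTop, ∫ x in D, B (fderiv ℝ φ x (stdVec k) • u x) (v n x) =
      (-∫ x in D, B (φ x • g x) (v n x)) - ∫ x in D, B (φ x • u x) (w n x) := by
    filter_upwards [eventually_closedBall_subset hD hφ.2.1.isCompact hφ.2.2] with n hn
    have := integral_partial_bilin_smooth hu B
      (mollify_contDiff n (extZero_locallyIntegrable hD f)) hφ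
    simp only [map_smul, _root_.smul_apply]
    rw [this]
    congr 1; congr 1; ext1 x
    by_cases hx : x ∈ tsupport φ
    · rw [fderiv_mollify hD hf (hn x hx)]
    · rw [image_eq_zero_of_notMem_tsupport hx]; simp
  have l1 := tendsto_integral_bilin B ((hφ.lineDeriv (stdVec k)).memLp_smul u) hv (Lp.memLp f)
    (mollify_extZero_tendsto hD f)
  have l2 := tendsto_integral_bilin B (hφ.memLp_smul g) hv (Lp.memLp f)
    (mollify_extZero_tendsto hD f)
  have l3 := tendsto_integral_bilin B (hφ.memLp_smul u) hw (Lp.memLp h)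
    (mollify_extZero_tendsto hD h)
  have := tendsto_nhds_unique (l1.congr' e1) (l2.neg.sub l3)
  simp only [map_smul, _root_.smul_apply] at this
  rw [this, ← neg_add', ← integral_add]
  · simp only [smul_add]
  · simpa only [map_smul, _root_.smul_apply] using
      integrable_bilin B (hφ.memLp_smul g) (Lp.memLp f)
  · simpa only [map_smul, _root_.smul_apply] using
      integrable_bilin B (hφ.memLp_smul u) (Lp.memLp h)

/-- The cross product as a continuous bilinear map. -/
def crossCLM : E3 →L[ℝ] E3 →L[ℝ] E3 :=
  LinearMap.toContinuousLinearMap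
    { toFun := fun a => LinearMap.toContinuousLinearMap
        { toFun := fun b => cross a b
          map_add' := fun b c => by simp [cross]
          map_smul' := fun r b => by simp [cross] }
      map_add' := fun a b => by ext1 c; simp [cross]
      map_smul' := fun r b => by ext1 c; simp [cross] }

lemma HasWeakPartial.cross {D : Set E3} (hD : IsOpen D) (hb : Bornology.IsBounded D) {k : Fin 3}
    {u g f h c d : L2V D} (hu : HasWeakPartial D k u g) (hf : HasWeakPartial D k f h)
    (hc : c =ᵐ[volume.restrict D] fun x => cross (u x) (f x))
    (hd : d =ᵐ[volume.restrict D] fun x => LLG.cross (g x) (f x) + LLG.cross (u x) (h x)) :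
    HasWeakPartial D k c d := by
  rw [hasWeakPartial_def]
  intro φ hφ
  rw [integral_congr_ae (g := fun x => fderiv ℝ φ x (stdVec k) • crossCLM (u x) (f x)),
    integral_congr_ae (f := fun x => φ x • d x)
      (g := fun x => φ x • (crossCLM (g x) (f x) + crossCLM (u x) (h x)))]
  · exact integral_partial_bilin hD hb hu hf crossCLM hφ
  · filter_upwards [hd] with x hx; rw [hx]; rfl
  · filter_upwards [hc] with x hx; rw [hx]; rfl

/-- Differentiate `|m|² = 1`: by the product rule `2 ∫ φ (m · ∂m)` equals minus the integral of
`∂φ`, which is zero. -/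
lemma HasWeakPartial.inner_eq_zero {D : Set E3} (hD : IsOpen D) (hb : Bornology.IsBounded D)
    {k : Fin 3} {m g : L2V D} (hm : HasWeakPartial D k m g)
    (h1 : ∀ᵐ x ∂volume.restrict D, ‖m x‖ = 1) :
    ∀ᵐ x ∂volume.restrict D, inner ℝ (m x) (g x) = 0 := by
  have hint : IntegrableOn (fun x => inner ℝ (m x) (g x)) D volume :=
    integrable_bilin (innerSL ℝ) (Lp.memLp m) (Lp.memLp g)
  refine ae_eq_zero_of_test hD hint fun φ hφ => ?_
  have h := integral_partial_bilin hD hb hm hm (innerSL ℝ) hφ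
  have hB : ∀ a b : E3, (innerSL ℝ : E3 →L[ℝ] E3 →L[ℝ] ℝ) a b = inner ℝ a b := fun _ _ => rfl
  simp only [hB] at h
  rw [integral_congr_ae (g := fun x => fderiv ℝ φ x (stdVec k)), integral_partial_eq_zero hφ,
    integral_congr_ae (g := fun x => 2 * (φ x * inner ℝ (m x) (g x)))
      (Eventually.of_forall fun x => by
        simp only [real_inner_comm (m x) (g x), smul_eq_mul]; ring), integral_const_mul] at h
  · simp only [smul_eq_mul]
    linarith
  · filter_upwards [h1] with x hx
    simp [hx]

/-! ### The retraction onto the unit ball -/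

/-- The nearest point retraction of `ℝ³` onto its closed unit ball. -/
def ballProj (x : E3) : E3 := (max 1 ‖x‖)⁻¹ • x

lemma norm_ballProj_le (x : E3) : ‖ballProj x‖ ≤ 1 := by
  rw [ballProj, norm_smul, norm_inv, Real.norm_of_nonneg (by positivity), inv_mul_le_iff₀
    (by positivity), mul_one]
  exact le_max_right _ _

lemma ballProj_of_norm_le {x : E3} (h : ‖x‖ ≤ 1) : ballProj x = x := by
  simp [ballProj, max_eq_left h]

lemma ballProj_of_one_le {x : E3} (h : 1 ≤ ‖x‖) : ballProj x = ‖x‖⁻¹ • x := by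
  simp [ballProj, max_eq_right h]

/-- The variational inequality that characterizes the nearest point of a convex set; outside the
ball, `a - ballProj a` is a nonnegative multiple of the unit vector `ballProj a`. -/
lemma ballProj_inner_le (a y : E3) (hy : ‖y‖ ≤ 1) :
    inner ℝ (a - ballProj a) (y - ballProj a) ≤ 0 := by
  rcases le_total ‖a‖ 1 with h | h
  · simp [ballProj_of_norm_le h]
  · have hpos : 0 < ‖a‖ := by linarith
    have h1 : a - ballProj a = (‖a‖ - 1) • ballProj a := by
      rw [ballProj_of_one_le h, sub_smul, smul_smul, mul_inv_cancel₀ hpos.ne', one_smul, one_smul]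
    have h2 : ‖ballProj a‖ = 1 := by
      rw [ballProj_of_one_le h, norm_smul, norm_inv, norm_norm, inv_mul_cancel₀ hpos.ne']
    rw [h1, real_inner_smul_left, inner_sub_right, real_inner_self_eq_norm_sq, h2]
    have h3 := real_inner_le_norm (ballProj a) y
    rw [h2] at h3
    nlinarith

/-- Adding the two variational inequalities gives `|Pa - Pb|² ≤ (a - b) · (Pa - Pb)` for the
projection `P`, and Cauchy-Schwarz finishes. -/
lemma lipschitzWith_ballProj : LipschitzWith 1 ballProj := by
  refine LipschitzWith.of_dist_le_mul fun a b => ?_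
  rw [NNReal.coe_one, one_mul, dist_eq_norm, dist_eq_norm]
  have h1 := ballProj_inner_le a (ballProj b) (norm_ballProj_le b)
  have h2 := ballProj_inner_le b (ballProj a) (norm_ballProj_le a)
  have h3 : ‖ballProj a - ballProj b‖ ^ 2 ≤ inner ℝ (a - b) (ballProj a - ballProj b) := by
    rw [← real_inner_self_eq_norm_sq]
    simp only [inner_sub_left, inner_sub_right] at *
    linarith
  have h4 := real_inner_le_norm (a - b) (ballProj a - ballProj b)
  by_contra! hlt
  have := norm_nonneg (a - b)
  nlinarith

lemma ballProj_zero : ballProj 0 = 0 := by simp [ballProj]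

/-- The retraction onto the unit ball, applied pointwise. -/
def ballProjL2 {D : Set E3} (u : L2V D) : L2V D := lipschitzWith_ballProj.compLp ballProj_zero u

lemma coeFn_ballProjL2 {D : Set E3} (u : L2V D) :
    ballProjL2 u =ᵐ[volume.restrict D] fun x => ballProj (u x) :=
  lipschitzWith_ballProj.coeFn_compLp ballProj_zero u

lemma continuous_ballProjL2 {D : Set E3} : Continuous (ballProjL2 (D := D)) :=
  lipschitzWith_ballProj.continuous_compLp ballProj_zero

/-! ### Weak derivatives of retracted fields -/

lemma tendsto_differenceQuotient {f : E3 → E3} {x : E3} (hf : DifferentiableAt ℝ f x) (e : E3) :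
    Tendsto (fun j : ℕ => ((1 / ((j : ℝ) + 1)))⁻¹ • (f (x + (1 / ((j : ℝ) + 1)) • e) - f x)) atTop
      (𝓝 (fderiv ℝ f x e)) := by
  have h1 : HasDerivAt (fun t : ℝ => f (x + t • e)) (fderiv ℝ f x e) 0 := by
    have h2 : HasDerivAt (fun t : ℝ => x + t • e) e 0 := by
      simpa using ((hasDerivAt_id (0 : ℝ)).smul_const e).const_add x
    have h3 : HasFDerivAt f (fderiv ℝ f x) (x + (0 : ℝ) • e) := by simpa using hf.hasFDerivAt
    exact h3.comp_hasDerivAt 0 h2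
  have h4 := h1.tendsto_slope_zero
  have h5 : Tendsto (fun j : ℕ => 1 / ((j : ℝ) + 1)) atTop (𝓝[≠] 0) :=
    tendsto_nhdsWithin_iff.2 ⟨tendsto_one_div_add_atTop_nhds_zero_nat,
      Eventually.of_forall fun j => by
        have : (0 : ℝ) < 1 / ((j : ℝ) + 1) := by positivity
        exact this.ne'⟩
  simpa [Function.comp_def] using h4.comp h5

lemma norm_differenceQuotient_le {v : E3 → E3} {C : ℝ≥0} (hv : LipschitzWith C v) {t : ℝ}
    (ht : 0 < t) (x e : E3) : ‖t⁻¹ • (v (x + t • e) - v x)‖ ≤ C * ‖e‖ := by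
  rw [norm_smul, norm_inv, Real.norm_of_nonneg ht.le, inv_mul_le_iff₀ ht]
  have := hv.dist_le_mul (x + t • e) x
  simp only [dist_eq_norm, add_sub_cancel_left, norm_smul, Real.norm_of_nonneg ht.le] at this
  linarith

/-- A chain rule for the merely Lipschitz map `ballProj` is avoided: the difference quotient is
moved from `η` to `ballProj ∘ v` by translation invariance, bounded there by the difference quotient
of `v`, and only then the step tends to zero. The Lipschitz constant `C` serves for domination only.
-/
lemma abs_integral_inner_ballProj_le {v η : E3 → E3} (hv : ContDiff ℝ (⊤ : ℕ∞) v) {C : ℝ≥0}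
    (hvC : LipschitzWith C v) (hη : ContDiff ℝ (⊤ : ℕ∞) η) (hηc : HasCompactSupport η) (e : E3) :
    |∫ x, inner ℝ (ballProj (v x)) (fderiv ℝ η x e)| ≤ ∫ x, ‖fderiv ℝ v x e‖ * ‖η x‖ := by
  set t : ℕ → ℝ := fun j => 1 / ((j : ℝ) + 1) with ht
  have htpos : ∀ j, 0 < t j := fun j => by simp only [ht]; positivity
  have ht1 : ∀ j, t j ≤ 1 := fun j => by
    simp only [ht]; rw [div_le_one (by positivity)]; linarith [(Nat.cast_nonneg j : (0 : ℝ) ≤ j)]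
  obtain ⟨Cη, hCη⟩ := hη.lipschitzWith_of_hasCompactSupport hηc (by simp)
  have hp : Continuous fun x => ballProj (v x) :=
    lipschitzWith_ballProj.continuous.comp hv.continuous
  have hηi : Integrable η volume := hη.continuous.integrable_of_hasCompactSupport hηc
  have hint : ∀ a b : E3,
      Integrable (fun x => inner ℝ (ballProj (v (x + a))) (η (x + b))) volume := by
    intro a b
    refine Integrable.mono' (hηi.comp_add_right b).norm
      ((hp.comp (continuous_id.add continuous_const)).inner
        (hη.continuous.comp (continuous_id.add continuous_const))).aestronglyMeasurable
      (Eventually.of_forall fun x => ?_)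
    refine (norm_inner_le_norm _ _).trans ?_
    exact mul_le_of_le_one_left (norm_nonneg _) (norm_ballProj_le _)
  have hqb : ∀ j x, ‖‖(t j)⁻¹ • (v (x + t j • (-e)) - v x)‖ * ‖η x‖‖ ≤ C * ‖e‖ * ‖η x‖ := by
    intro j x
    rw [norm_mul, norm_norm, norm_norm]
    have := norm_differenceQuotient_le hvC (htpos j) x (-e)
    rw [norm_neg] at this
    exact mul_le_mul_of_nonneg_right this (norm_nonneg _)
  have hqi : ∀ j, Integrable (fun x => ‖(t j)⁻¹ • (v (x + t j • (-e)) - v x)‖ * ‖η x‖) volume := by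
    intro j
    have hvc := hv.continuous
    have hηc' := hη.continuous
    have hc : Continuous fun x => ‖(t j)⁻¹ • (v (x + t j • (-e)) - v x)‖ * ‖η x‖ := by fun_prop
    exact Integrable.mono' (hηi.norm.const_mul (C * ‖e‖)) hc.aestronglyMeasurable
      (Eventually.of_forall (hqb j))
  have hle : ∀ j, |∫ x, inner ℝ (ballProj (v x)) ((t j)⁻¹ • (η (x + t j • e) - η x))| ≤
      ∫ x, ‖(t j)⁻¹ • (v (x + t j • (-e)) - v x)‖ * ‖η x‖ := by
    intro j
    have h1 : ∫ x, inner ℝ (ballProj (v x)) ((t j)⁻¹ • (η (x + t j • e) - η x)) =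
        ∫ x, inner ℝ ((t j)⁻¹ • (ballProj (v (x + t j • (-e))) - ballProj (v x))) (η x) := by
      simp only [real_inner_smul_left, real_inner_smul_right, inner_sub_left, inner_sub_right]
      rw [integral_const_mul, integral_const_mul, integral_sub, integral_sub]
      · congr 2
        rw [← integral_add_right_eq_self _ (t j • (-e))]
        simp
      · simpa using hint (t j • (-e)) 0
      · simpa using hint 0 0
      · simpa using hint 0 (t j • e)
      · simpa using hint 0 0
    rw [h1]
    refine (abs_integral_le_integral_abs).trans (integral_mono_of_nonneg
      (Eventually.of_forall fun _ => abs_nonneg _) ?_ (Eventually.of_forall fun x => ?_))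
    · exact hqi j
    · refine (abs_real_inner_le_norm _ _).trans (mul_le_mul_of_nonneg_right ?_ (norm_nonneg _))
      rw [norm_smul, norm_smul]
      refine mul_le_mul_of_nonneg_left ?_ (norm_nonneg _)
      simpa [dist_eq_norm] using lipschitzWith_ballProj.dist_le_mul (v (x + t j • (-e))) (v x)
  have l1 : Tendsto (fun j => ∫ x, inner ℝ (ballProj (v x)) ((t j)⁻¹ • (η (x + t j • e) - η x)))
      atTop (𝓝 (∫ x, inner ℝ (ballProj (v x)) (fderiv ℝ η x e))) := by
    set K := Metric.cthickening ‖e‖ (tsupport η)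
    have hK : IsCompact K := hηc.isCompact.cthickening
    refine tendsto_integral_of_dominated_convergence (K.indicator fun _ => Cη * ‖e‖)
      (fun j => ?_) ?_ (fun j => Eventually.of_forall fun x => ?_)
      (Eventually.of_forall fun x => ?_)
    · have hηc' := hη.continuous
      have hc : Continuous fun x =>
            inner ℝ (ballProj (v x)) ((t j)⁻¹ • (η (x + t j • e) - η x)) := by
        fun_prop
      exact hc.aestronglyMeasurable
    · exact (integrable_indicator_iff hK.measurableSet).2
        (integrableOn_const hK.measure_lt_top.ne)
    · refine (norm_inner_le_norm _ _).trans ((mul_le_of_le_one_left (norm_nonneg _)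
        (norm_ballProj_le _)).trans ?_)
      by_cases hx : x ∈ K
      · rw [indicator_of_mem hx]
        exact norm_differenceQuotient_le hCη (htpos j) x e
      · have h1 : x ∉ tsupport η := fun h => hx (Metric.self_subset_cthickening _ h)
        have h2 : x + t j • e ∉ tsupport η := fun h => hx (Metric.mem_cthickening_of_dist_le x _ _ _
          h (by
            simp only [dist_eq_norm, sub_add_cancel_left, norm_neg, norm_smul,
              Real.norm_of_nonneg (htpos j).le]
            exact mul_le_of_le_one_left (norm_nonneg _) (ht1 j)))
        rw [indicator_of_notMem hx, image_eq_zero_of_notMem_tsupport h1,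
          image_eq_zero_of_notMem_tsupport h2]
        simp
    · exact tendsto_const_nhds.inner
        (tendsto_differenceQuotient (hη.differentiable (by simp) x) e)
  have l2 : Tendsto (fun j => ∫ x, ‖(t j)⁻¹ • (v (x + t j • (-e)) - v x)‖ * ‖η x‖) atTop
      (𝓝 (∫ x, ‖fderiv ℝ v x e‖ * ‖η x‖)) := by
    refine tendsto_integral_of_dominated_convergence (fun x => (C * ‖e‖) * ‖η x‖)
      (fun j => ?_) (hηi.norm.const_mul _) (fun j => Eventually.of_forall fun x => ?_)
      (Eventually.of_forall fun x => ?_)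
    · exact (hqi j).aestronglyMeasurable
    · exact hqb j x
    · have := (tendsto_differenceQuotient (hv.differentiable (by simp) x) (-e)).norm
      rw [map_neg, norm_neg] at this
      exact this.mul_const _
  exact le_of_tendsto_of_tendsto' l1.abs l2 hle

/-- The bound forces `(f, p.1) = 0` whenever `p.2 = 0`, so `p.2 ↦ -(f, p.1)` is a well defined
bounded functional on the second components. Hahn-Banach extends it with the same norm and Riesz
represents it. With test pairs for `S`, the representative is a weak derivative of `f`. -/
lemma exists_adjoint_of_bound {H : Type*} [NormedAddCommGroup H] [InnerProductSpace ℝ H]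
    [CompleteSpace H] (S : Submodule ℝ (H × H)) (f : H) {C : ℝ} (hC : 0 ≤ C)
    (h : ∀ p ∈ S, |inner ℝ f p.1| ≤ C * ‖p.2‖) :
    ∃ g : H, ‖g‖ ≤ C ∧ ∀ p ∈ S, inner ℝ f p.1 + inner ℝ g p.2 = 0 := by
  have hz : ∀ x, (x, (0 : H)) ∈ S → inner ℝ f x = 0 := fun x hx => by
    have := h _ hx
    simpa using this
  set q := S.map (LinearMap.snd ℝ H H)
  have hq : ∀ y : q, ∃ x, (x, (y : H)) ∈ S := by
    rintro ⟨y, hy⟩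
    obtain ⟨p, hp, rfl⟩ := hy
    exact ⟨p.1, hp⟩
  choose a ha using hq
  have huniq : ∀ (y : q) (x : H), (x, (y : H)) ∈ S → inner ℝ f (a y) = inner ℝ f x := by
    intro y x hx
    have := hz (a y - x) (by simpa using S.sub_mem (ha y) hx)
    rw [inner_sub_right] at this; linarith
  let φ : q →ₗ[ℝ] ℝ :=
    { toFun := fun y => -inner ℝ f (a y)
      map_add' := fun y y' => by
        rw [huniq (y + y') (a y + a y') (by simpa using S.add_mem (ha y) (ha y')),
          inner_add_right]; ring
      map_smul' := fun r y => by
        rw [huniq (r • y) (r • a y) (by simpa using S.smul_mem r (ha y)),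
          real_inner_smul_right]; simp }
  let φc : q →L[ℝ] ℝ := φ.mkContinuous C fun y => by
    have := h _ (ha y)
    simpa [φ] using this
  obtain ⟨ψ, hψ, hn⟩ := exists_extension_norm_eq q φc
  refine ⟨(InnerProductSpace.toDual ℝ H).symm ψ, ?_, fun p hp => ?_⟩
  · rw [LinearIsometryEquiv.norm_map, hn]
    exact φ.mkContinuous_norm_le hC _
  · rw [InnerProductSpace.toDual_symm_apply]
    have hy : p.2 ∈ q := ⟨p, hp, rfl⟩
    have h1 := hψ ⟨p.2, hy⟩
    have h2 : φc ⟨p.2, hy⟩ = -inner ℝ f (a ⟨p.2, hy⟩) := rfl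
    rw [h2, huniq ⟨p.2, hy⟩ p.1 hp] at h1
    simp only at h1
    rw [h1]; ring

/-- The submodule of the pairs `(∂_k η, η)` of square integrable fields, for vector valued test
functions `η`. -/
def testPairsSubmodule (D : Set E3) (k : Fin 3) : Submodule ℝ (L2V D × L2V D) where
  carrier := {p | ∃ η : E3 → E3, IsTestField D η ∧
    (p.1 =ᵐ[volume.restrict D] fun x => fderiv ℝ η x (stdVec k)) ∧ p.2 =ᵐ[volume.restrict D] η}
  zero_mem' := by
    refine ⟨0, ⟨contDiff_const, HasCompactSupport.zero, by simp⟩, ?_, ?_⟩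
    · filter_upwards [Lp.coeFn_zero E3 2 (volume.restrict D)] with x hx
      simpa using hx
    · exact Lp.coeFn_zero E3 2 (volume.restrict D)
  add_mem' := by
    rintro p q ⟨η, h1, h2, h3⟩ ⟨ζ, h4, h5, h6⟩
    refine ⟨η + ζ, ⟨h1.1.add h4.1, h1.2.1.add h4.2.1, (tsupport_add η ζ).trans
      (union_subset h1.2.2 h4.2.2)⟩, ?_, ?_⟩
    · filter_upwards [h2, h5, Lp.coeFn_add p.1 q.1] with x hx hx' hs
      rw [Prod.fst_add, hs, Pi.add_apply, hx, hx', fderiv_add (h1.differentiable x)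
        (h4.differentiable x)]
      rfl
    · filter_upwards [h3, h6, Lp.coeFn_add p.2 q.2] with x hx hx' hs
      rw [Prod.snd_add, hs, Pi.add_apply, hx, hx']; rfl
  smul_mem' := by
    rintro r p ⟨η, h1, h2, h3⟩
    refine ⟨r • η, h1.clm_comp (r • ContinuousLinearMap.id ℝ E3), ?_, ?_⟩
    · filter_upwards [h2, Lp.coeFn_smul r p.1] with x hx hs
      rw [Prod.smul_fst, hs, Pi.smul_apply, hx, fderiv_const_smul (h1.differentiable x)]
      rfl
    · filter_upwards [h3, Lp.coeFn_smul r p.2] with x hx hs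
      rw [Prod.smul_snd, hs, Pi.smul_apply, hx]; rfl

lemma testPairs_subset (D : Set E3) (k : Fin 3) : testPairs D k ⊆ testPairsSubmodule D k := by
  rintro p ⟨φ, hφ, c, h1, h2⟩
  refine ⟨fun x => φ x • c, hφ.clm_comp (ContinuousLinearMap.toSpanSingleton ℝ c), ?_, h2⟩
  filter_upwards [h1] with x hx
  rw [hx, fderiv_smul_const (hφ.differentiable x)]
  rfl

/-- By duality it suffices that `|(ballProj u, ∂η)| ≤ ‖g‖ ‖η‖`. This holds for mollifications of `u`
by `abs_integral_inner_ballProj_le`, and survives the limit. The norm bound on `g'` is what makes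
normalization decrease the energy. -/
lemma exists_hasWeakPartial_ballProjL2 {D : Set E3} (hD : IsOpen D) (hb : Bornology.IsBounded D)
    {k : Fin 3} {u g : L2V D} (h : HasWeakPartial D k u g) :
    ∃ g', HasWeakPartial D k (ballProjL2 u) g' ∧ ‖g'‖ ≤ ‖g‖ := by
  suffices hS : ∀ p ∈ testPairsSubmodule D k, |inner ℝ (ballProjL2 u) p.1| ≤ ‖g‖ * ‖p.2‖ by
    obtain ⟨g', h1, h2⟩ := exists_adjoint_of_bound _ _ (norm_nonneg g) hS
    exact ⟨g', hasWeakPartial_iff.2 fun p hp => h2 p (testPairs_subset D k hp), h1⟩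
  rintro ⟨a, b⟩ ⟨η, hη, ha, hbη⟩
  simp only at ha hbη ⊢
  set v := fun n => mollify n (extZero D u) with hvdef
  set w := fun n => mollify n (extZero D g) with hwdef
  have hvm : ∀ n, MemLp (v n) 2 (volume.restrict D) := fun n => (mollify_memLp hD hb n u).restrict D
  have hwm : ∀ n, MemLp (w n) 2 (volume.restrict D) := fun n => (mollify_memLp hD hb n g).restrict D
  have hvs : ∀ n, ContDiff ℝ (⊤ : ℕ∞) (v n) := fun n =>
    mollify_contDiff n (extZero_locallyIntegrable hD u)
  have hcs : ∀ n, HasCompactSupport (v n) := fun n =>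
    (shrinkingBump n).hasCompactSupport_normed.convolution _
      (HasCompactSupport.of_support_subset_isCompact hb.isCompact_closure
        ((Function.support_subset_iff'.2 fun x hx => by simp [extZero, hx]).trans subset_closure))
  have hη2 : MemLp η 2 (volume.restrict D) := hη.memLp
  have e1 : ∀ᶠ n in atTop, |∫ x in D, inner ℝ (a x) (ballProj (v n x))| ≤
      ∫ x in D, ‖η x‖ * ‖w n x‖ := by
    filter_upwards [eventually_closedBall_subset hD hη.2.1.isCompact hη.2.2] with n hn
    obtain ⟨C, hC⟩ := (hvs n).lipschitzWith_of_hasCompactSupport (hcs n) (by simp)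
    have h1 := abs_integral_inner_ballProj_le (hvs n) hC hη.1 hη.2.1 (stdVec k)
    have h2 : ∫ x in D, inner ℝ (a x) (ballProj (v n x)) =
        ∫ x, inner ℝ (ballProj (v n x)) (fderiv ℝ η x (stdVec k)) := by
      rw [← setIntegral_eq_integral_of_forall_compl_eq_zero (s := D)
        (f := fun x => inner ℝ (ballProj (v n x)) (fderiv ℝ η x (stdVec k))) (fun x hx => by
        rw [show fderiv ℝ η x (stdVec k) = 0 from
          image_eq_zero_of_notMem_tsupport (f := fun x => fderiv ℝ η x (stdVec k))
            fun h => hx ((hη.lineDeriv (stdVec k)).2.2 h), inner_zero_right])]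
      refine integral_congr_ae ?_
      filter_upwards [ha] with x hx
      rw [hx, real_inner_comm]
    have h3 : ∫ x in D, ‖η x‖ * ‖w n x‖ = ∫ x, ‖fderiv ℝ (v n) x (stdVec k)‖ * ‖η x‖ := by
      rw [← setIntegral_eq_integral_of_forall_compl_eq_zero (s := D)
        (f := fun x => ‖fderiv ℝ (v n) x (stdVec k)‖ * ‖η x‖) (fun x hx => by
        rw [image_eq_zero_of_notMem_tsupport fun h => hx (hη.2.2 h), norm_zero, mul_zero])]
      refine integral_congr_ae (Eventually.of_forall fun x => ?_)
      simp only
      by_cases hx : x ∈ tsupport η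
      · rw [hvdef, fderiv_mollify hD h (hn x hx), mul_comm]
      · rw [image_eq_zero_of_notMem_tsupport hx]; simp
    rw [h2, h3]; exact h1
  have l1 : Tendsto (fun n => ∫ x in D, inner ℝ (a x) (ballProj (v n x))) atTop
      (𝓝 (∫ x in D, inner ℝ (a x) (ballProj (u x)))) := by
    have hcomp : ∀ {f : E3 → E3}, MemLp f 2 (volume.restrict D) →
        MemLp (fun x => ballProj (f x)) 2 (volume.restrict D) := fun hf =>
      lipschitzWith_ballProj.comp_memLp ballProj_zero hf
    refine tendsto_integral_bilin (innerSL ℝ : E3 →L[ℝ] E3 →L[ℝ] ℝ) (Lp.memLp a)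
      (fun n => hcomp (hvm n)) (hcomp (Lp.memLp u)) ?_
    refine tendsto_of_tendsto_of_tendsto_of_le_of_le tendsto_const_nhds
      (mollify_extZero_tendsto hD u) (fun _ => zero_le) fun n => ?_
    refine eLpNorm_mono fun x => ?_
    simpa [dist_eq_norm] using lipschitzWith_ballProj.dist_le_mul (v n x) (u x)
  have l2 : Tendsto (fun n => ∫ x in D, ‖η x‖ * ‖w n x‖) atTop (𝓝 (∫ x in D, ‖η x‖ * ‖g x‖)) := by
    refine tendsto_integral_bilin (ContinuousLinearMap.mul ℝ ℝ) hη2.norm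
      (fun n => (hwm n).norm) (Lp.memLp g).norm ?_
    refine tendsto_of_tendsto_of_tendsto_of_le_of_le tendsto_const_nhds
      (mollify_extZero_tendsto hD g) (fun _ => zero_le) fun n => ?_
    refine eLpNorm_mono fun x => ?_
    exact abs_norm_sub_norm_le _ _
  have h4 := le_of_tendsto_of_tendsto l1.abs l2 e1
  have h5 : inner ℝ (ballProjL2 u) a = ∫ x in D, inner ℝ (a x) (ballProj (u x)) := by
    rw [L2.inner_def]
    refine integral_congr_ae ?_
    filter_upwards [coeFn_ballProjL2 u] with x hx
    rw [hx, real_inner_comm]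
  rw [h5]
  refine h4.trans ?_
  have h6 := integral_mul_norm_le_Lp_mul_Lq (μ := volume.restrict D) (f := b) (g := g)
    (p := 2) (q := 2) (Real.holderConjugate_iff.2 ⟨by norm_num, by norm_num⟩)
    (by simpa using Lp.memLp b) (by simpa using Lp.memLp g)
  have h7 : ∀ c : L2V D, (∫ x in D, ‖c x‖ ^ (2 : ℝ)) ^ (1 / (2 : ℝ)) = ‖c‖ := by
    intro c
    have h8 : inner ℝ c c = ∫ x in D, ‖c x‖ ^ (2 : ℝ) := by
      rw [L2.inner_def]
      simp
    rw [← h8, real_inner_self_eq_norm_sq, ← Real.sqrt_eq_rpow, Real.sqrt_sq (norm_nonneg _)]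
  rw [h7, h7] at h6
  rw [mul_comm]
  refine le_trans (le_of_eq (integral_congr_ae ?_)) h6
  filter_upwards [hbη] with x hx
  rw [hx]

/-! ### The embedding of `H²(D)³` into `L^∞(D)³` -/

/-- The constant `∫₀¹ s^{-1/2} ds`. -/
def rootConst : ℝ≥0∞ := ∫⁻ s in Ioc (0 : ℝ) 1, ENNReal.ofReal (s ^ (-(1 / 2) : ℝ))

lemma rootConst_lt_top : rootConst < ∞ := by
  have h : IntervalIntegrable (fun s : ℝ => s ^ (-(1 / 2) : ℝ)) volume 0 1 :=
    intervalIntegral.intervalIntegrable_rpow' (by norm_num)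
  rw [intervalIntegrable_iff_integrableOn_Ioc_of_le zero_le_one] at h
  exact h.lintegral_lt_top

/-- The Jacobian of `z ↦ s z` in dimension three gives `s⁻³` for the square of the norm. -/
lemma eLpNorm_comp_smul {W : E3 → E3} (hW : Continuous W) (x : E3) {s : ℝ} (hs : 0 < s) :
    eLpNorm (fun z => W (x + s • z)) 2 volume =
      ENNReal.ofReal (s ^ (-(3 / 2) : ℝ)) * eLpNorm W 2 volume := by
  have h1 : ∫⁻ z, ‖W (x + s • z)‖ₑ ^ (2 : ℝ) =
      ENNReal.ofReal (s ^ (-3 : ℝ)) * ∫⁻ z, ‖W z‖ₑ ^ (2 : ℝ) := by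
    have hm : Measurable fun z => ‖W (x + z)‖ₑ ^ (2 : ℝ) :=
      ((hW.comp (continuous_const.add continuous_id)).measurable.enorm).pow_const _
    have h2 := lintegral_map (μ := (volume : Measure E3)) hm
      (measurable_const_smul s : Measurable fun z : E3 => s • z)
    rw [← h2, Measure.map_addHaar_smul _ hs.ne', lintegral_smul_measure,
      lintegral_add_left_eq_self (fun z => ‖W z‖ₑ ^ (2 : ℝ)) x]
    simp only [finrank_euclideanSpace, Fintype.card_fin, smul_eq_mul]
    congr 2
    rw [abs_of_pos (by positivity), Real.rpow_neg hs.le]; norm_cast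
  rw [eLpNorm_eq_lintegral_rpow_enorm_toReal two_ne_zero (by simp),
    eLpNorm_eq_lintegral_rpow_enorm_toReal two_ne_zero (by simp)]
  simp only [ENNReal.toReal_ofNat]
  rw [h1, ENNReal.mul_rpow_of_nonneg _ _ (by norm_num), ENNReal.ofReal_rpow_of_pos (by positivity),
    ← Real.rpow_mul hs.le]
  norm_num

lemma lintegral_comp_smul_le {W : E3 → E3} (hW : Continuous W) (B : Set E3) (x : E3) {s : ℝ}
    (hs : 0 < s) :
    ∫⁻ z in B, ‖W (x + s • z)‖ₑ ≤
      volume B ^ (1 / 2 : ℝ) * (ENNReal.ofReal (s ^ (-(3 / 2) : ℝ)) * eLpNorm W 2 volume) := by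
  have hc : Continuous fun z : E3 => W (x + s • z) := by fun_prop
  have h1 := eLpNorm_le_eLpNorm_mul_rpow_measure_univ (p := 1) (q := 2)
    (μ := volume.restrict B) (f := fun z : E3 => W (x + s • z)) (by norm_num)
    hc.aestronglyMeasurable
  rw [eLpNorm_one_eq_lintegral_enorm] at h1
  refine h1.trans ?_
  rw [mul_comm, ← eLpNorm_comp_smul hW x hs, Measure.restrict_apply_univ]
  refine mul_le_mul' (le_of_eq ?_) (eLpNorm_mono_measure _ Measure.restrict_le_self)
  norm_num

/-- Taylor's formula based at the far end of the segment: `U(x) = U(x+z) - DU(x+z)z + ∫₀¹ s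
D²U(x+sz)(z,z) ds`. The weight `s` damps the second derivatives near the vertex `x`. -/
lemma enorm_le_of_cone {U : E3 → E3} {U1 : Fin 3 → E3 → E3} {U2 : Fin 3 → Fin 3 → E3 → E3}
    (hU : ContDiff ℝ (⊤ : ℕ∞) U) (hU1 : ∀ k, ContDiff ℝ (⊤ : ℕ∞) (U1 k))
    (hU2 : ∀ k l, ContDiff ℝ (⊤ : ℕ∞) (U2 k l)) (x z : E3)
    (h1 : ∀ s ∈ Icc (0 : ℝ) 1, ∀ k, fderiv ℝ U (x + s • z) (stdVec k) = U1 k (x + s • z))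
    (h2 : ∀ s ∈ Icc (0 : ℝ) 1, ∀ k l,
      fderiv ℝ (U1 k) (x + s • z) (stdVec l) = U2 k l (x + s • z)) :
    ‖U x‖ₑ ≤ ‖U (x + (1 : ℝ) • z)‖ₑ + ∑ k, ‖z‖ₑ * ‖U1 k (x + (1 : ℝ) • z)‖ₑ +
      ∑ k, ∑ l, ‖z‖ₑ ^ 2 * ∫⁻ s in Ioc (0 : ℝ) 1, ENNReal.ofReal s * ‖U2 k l (x + s • z)‖ₑ := by
  have hline : ∀ s : ℝ, HasDerivAt (fun s : ℝ => x + s • z) z s := fun s => by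
    simpa using ((hasDerivAt_id s).smul_const z).const_add x
  have hd : ∀ {V : E3 → E3}, ContDiff ℝ (⊤ : ℕ∞) V → ∀ s : ℝ,
      HasDerivAt (fun s : ℝ => V (x + s • z)) (∑ k, z k • fderiv ℝ V (x + s • z) (stdVec k)) s := by
    intro V hV s
    have h3 := (hV.differentiable (by simp) (x + s • z)).hasFDerivAt.comp_hasDerivAt s (hline s)
    rwa [clm_sum_coord (fderiv ℝ V (x + s • z)) z] at h3
  set f1 : ℝ → E3 := fun s => ∑ k, z k • U1 k (x + s • z) with hf1
  set f2 : ℝ → E3 := fun s => ∑ k, ∑ l, (z k * z l) • U2 k l (x + s • z) with hf2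
  have hcU2 : ∀ k l, Continuous (U2 k l) := fun k l => (hU2 k l).continuous
  have hf2c : Continuous f2 := by fun_prop
  -- The function `U(x+sz) - s (d/ds)U(x+sz)` equals `U(x)` at `s = 0`, and in its derivative the
  -- first order terms cancel.
  have hder : ∀ s ∈ uIcc (0 : ℝ) 1,
      HasDerivAt (fun s => U (x + s • z) - s • f1 s) (-(s • f2 s)) s := by
    intro s hs
    rw [uIcc_of_le zero_le_one] at hs
    have d0 : HasDerivAt (fun s : ℝ => U (x + s • z)) (f1 s) s := by
      have := hd hU s
      simpa only [h1 s hs] using this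
    have d1 : HasDerivAt f1 (f2 s) s := by
      have h4 : ∀ k, HasDerivAt (fun s : ℝ => z k • U1 k (x + s • z))
          (∑ l, (z k * z l) • U2 k l (x + s • z)) s := by
        intro k
        refine ((hd (hU1 k) s).const_smul (z k)).congr_deriv ?_
        simp only [h2 s hs, Finset.smul_sum, smul_smul]
      exact HasDerivAt.fun_sum fun k _ => h4 k
    refine (d0.sub ((hasDerivAt_id s).smul d1)).congr_deriv ?_
    rw [id, one_smul]; abel
  have hftc := intervalIntegral.integral_eq_sub_of_hasDerivAt hder
    (Continuous.intervalIntegrable (by fun_prop) _ _)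
  have hrep : U x = U (x + (1 : ℝ) • z) - f1 1 + ∫ s in (0 : ℝ)..1, s • f2 s := by
    rw [intervalIntegral.integral_neg] at hftc
    have : ∫ s in (0 : ℝ)..1, s • f2 s = -((U (x + (1 : ℝ) • z) - (1 : ℝ) • f1 1) -
      (U (x + (0 : ℝ) • z) - (0 : ℝ) • f1 0)) := by rw [← hftc, neg_neg]
    rw [this]; simp
  have hzk : ∀ k, ‖z k‖ₑ ≤ ‖z‖ₑ := fun k => by
    rw [← ofReal_norm, ← ofReal_norm]
    exact ENNReal.ofReal_le_ofReal (PiLp.norm_apply_le z k)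
  rw [hrep]
  refine (enorm_add_le _ _).trans (add_le_add ((enorm_sub_le).trans (add_le_add le_rfl ?_)) ?_)
  · refine (enorm_sum_le _ _).trans (Finset.sum_le_sum fun k _ => ?_)
    rw [enorm_smul]
    exact mul_le_mul' (hzk k) le_rfl
  · rw [intervalIntegral.integral_of_le zero_le_one]
    refine (enorm_integral_le_lintegral_enorm _).trans ?_
    have hm : ∀ k l, Measurable fun s : ℝ => ENNReal.ofReal s * ‖U2 k l (x + s • z)‖ₑ := fun k l =>
      (ENNReal.measurable_ofReal).mul
        (Continuous.measurable (by fun_prop : Continuous fun s : ℝ => U2 k l (x + s • z))).enorm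
    calc ∫⁻ s in Ioc (0 : ℝ) 1, ‖s • f2 s‖ₑ
        ≤ ∫⁻ s in Ioc (0 : ℝ) 1, ∑ k, ∑ l, ‖z‖ₑ ^ 2 *
            (ENNReal.ofReal s * ‖U2 k l (x + s • z)‖ₑ) := by
          refine setLIntegral_mono' measurableSet_Ioc fun s hs => ?_
          rw [enorm_smul, Real.enorm_of_nonneg hs.1.le]
          refine (mul_le_mul' le_rfl ((enorm_sum_le _ _).trans
            (Finset.sum_le_sum fun k _ => enorm_sum_le _ _))).trans ?_
          rw [Finset.mul_sum]
          refine Finset.sum_le_sum fun k _ => ?_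
          rw [Finset.mul_sum]
          refine Finset.sum_le_sum fun l _ => ?_
          rw [enorm_smul, enorm_mul, pow_two]
          calc _ ≤ ENNReal.ofReal s * (‖z‖ₑ * ‖z‖ₑ * ‖U2 k l (x + s • z)‖ₑ) :=
                mul_le_mul' le_rfl (mul_le_mul' (mul_le_mul' (hzk k) (hzk l)) le_rfl)
            _ = _ := by ring
      _ = _ := by
          rw [lintegral_finsetSum _ fun k _ => Finset.measurable_fun_sum _ fun l _ =>
            (hm k l).const_mul _]
          refine Finset.sum_congr rfl fun k _ => ?_
          rw [lintegral_finsetSum _ fun l _ => (hm k l).const_mul _]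
          exact Finset.sum_congr rfl fun l _ => lintegral_const_mul _ (hm k l)

/-- Tonelli and Cauchy-Schwarz in `z` produce the factor `s · s^(-3/2) = s^(-1/2)`, integrable at
zero. This is where dimension three suffices for two derivatives in `L²`. -/
lemma lintegral_lintegral_comp_smul_le {W : E3 → E3} (hW : Continuous W) {B : Set E3}
    (x : E3) :
    ∫⁻ z in B, ∫⁻ s in Ioc (0 : ℝ) 1, ENNReal.ofReal s * ‖W (x + s • z)‖ₑ ≤
      volume B ^ (1 / 2 : ℝ) * (rootConst * eLpNorm W 2 volume) := by
  rw [lintegral_lintegral_swap]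
  · calc _ ≤ ∫⁻ s in Ioc (0 : ℝ) 1, ENNReal.ofReal (s ^ (-(1 / 2) : ℝ)) *
            (volume B ^ (1 / 2 : ℝ) * eLpNorm W 2 volume) := by
          refine setLIntegral_mono' measurableSet_Ioc fun s hs => ?_
          have hc : Continuous fun z : E3 => W (x + s • z) := by fun_prop
          rw [lintegral_const_mul _ hc.measurable.enorm]
          refine (mul_le_mul' le_rfl (lintegral_comp_smul_le hW B x hs.1)).trans (le_of_eq ?_)
          have : ENNReal.ofReal (s ^ (-(1 / 2) : ℝ)) =
              ENNReal.ofReal s * ENNReal.ofReal (s ^ (-(3 / 2) : ℝ)) := by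
            rw [← ENNReal.ofReal_mul hs.1.le]
            congr 1
            nth_rewrite 2 [← Real.rpow_one s]
            rw [← Real.rpow_add hs.1]; norm_num
          rw [this]; ring
      _ = _ := by
          rw [lintegral_mul_const _ (by fun_prop)]
          rw [rootConst]; ring
  · have hc : Continuous fun p : E3 × ℝ => W (x + p.2 • p.1) := by fun_prop
    have : Measurable fun p : E3 × ℝ => ENNReal.ofReal p.2 * ‖W (x + p.2 • p.1)‖ₑ :=
      (ENNReal.measurable_ofReal.comp measurable_snd).mul hc.measurable.enorm
    exact this.aemeasurable

/-- The pointwise Taylor bound is averaged over a ball of directions `z`, so that values on segments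
become `L²` norms. -/
lemma enorm_le_of_cone_ball {U : E3 → E3} {U1 : Fin 3 → E3 → E3} {U2 : Fin 3 → Fin 3 → E3 → E3}
    (hU : ContDiff ℝ (⊤ : ℕ∞) U) (hU1 : ∀ k, ContDiff ℝ (⊤ : ℕ∞) (U1 k))
    (hU2 : ∀ k l, ContDiff ℝ (⊤ : ℕ∞) (U2 k l)) (x c : E3) (r : ℝ) (R : ℝ≥0∞)
    (hR : ∀ z ∈ Metric.closedBall c r, ‖z‖ₑ ≤ R)
    (h1 : ∀ z ∈ Metric.closedBall c r, ∀ s ∈ Icc (0 : ℝ) 1, ∀ k,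
      fderiv ℝ U (x + s • z) (stdVec k) = U1 k (x + s • z))
    (h2 : ∀ z ∈ Metric.closedBall c r, ∀ s ∈ Icc (0 : ℝ) 1, ∀ k l,
      fderiv ℝ (U1 k) (x + s • z) (stdVec l) = U2 k l (x + s • z)) :
    ‖U x‖ₑ * volume (Metric.closedBall c r) ≤ volume (Metric.closedBall c r) ^ (1 / 2 : ℝ) *
      ((1 + R + R ^ 2 * rootConst) * (eLpNorm U 2 volume + ∑ k, eLpNorm (U1 k) 2 volume +
        ∑ k, ∑ l, eLpNorm (U2 k l) 2 volume)) := by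
  set B := Metric.closedBall c r
  have hB : MeasurableSet B := Metric.isClosed_closedBall.measurableSet
  have hcU := hU.continuous
  have hcU1 := fun k => (hU1 k).continuous
  have hcU2 := fun k l => (hU2 k l).continuous
  have one : ∀ {W : E3 → E3}, Continuous W → ∫⁻ z in B, ‖W (x + (1 : ℝ) • z)‖ₑ ≤
      volume B ^ (1 / 2 : ℝ) * eLpNorm W 2 volume := fun hW => by
    simpa using lintegral_comp_smul_le hW B x one_pos
  have hmW : ∀ {W : E3 → E3}, Continuous W → Measurable fun z => ‖W (x + (1 : ℝ) • z)‖ₑ :=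
    fun hW => (Continuous.measurable (by fun_prop)).enorm
  have hmI : ∀ {W : E3 → E3}, Continuous W → Measurable fun z : E3 =>
      ∫⁻ s in Ioc (0 : ℝ) 1, ENNReal.ofReal s * ‖W (x + s • z)‖ₑ := fun {W} hW => by
    have hc : Continuous fun p : E3 × ℝ => W (x + p.2 • p.1) := by fun_prop
    exact Measurable.lintegral_prod_right' (f := fun p : E3 × ℝ =>
      ENNReal.ofReal p.2 * ‖W (x + p.2 • p.1)‖ₑ)
      ((ENNReal.measurable_ofReal.comp measurable_snd).mul hc.measurable.enorm)
  set N0 := eLpNorm U 2 volume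
  set V := volume B ^ (1 / 2 : ℝ)
  calc ‖U x‖ₑ * volume B = ∫⁻ _ in B, ‖U x‖ₑ := by simp
    _ ≤ ∫⁻ z in B, (‖U (x + (1 : ℝ) • z)‖ₑ + ∑ k, R * ‖U1 k (x + (1 : ℝ) • z)‖ₑ +
      ∑ k, ∑ l, R ^ 2 * ∫⁻ s in Ioc (0 : ℝ) 1, ENNReal.ofReal s * ‖U2 k l (x + s • z)‖ₑ) := by
        refine setLIntegral_mono' hB fun z hz => ?_
        refine (enorm_le_of_cone hU hU1 hU2 x z (h1 z hz) (h2 z hz)).trans ?_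
        gcongr <;> exact hR z hz
    _ = (∫⁻ z in B, ‖U (x + (1 : ℝ) • z)‖ₑ) + (∑ k, R * ∫⁻ z in B, ‖U1 k (x + (1 : ℝ) • z)‖ₑ) +
      ∑ k, ∑ l, R ^ 2 * ∫⁻ z in B, ∫⁻ s in Ioc (0 : ℝ) 1,
        ENNReal.ofReal s * ‖U2 k l (x + s • z)‖ₑ := by
        have hM : Measurable fun z => ‖U (x + (1 : ℝ) • z)‖ₑ +
            ∑ k, R * ‖U1 k (x + (1 : ℝ) • z)‖ₑ :=
          (hmW hcU).add (Finset.measurable_fun_sum _ fun k _ => (hmW (hcU1 k)).const_mul _)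
        rw [lintegral_add_left hM, lintegral_add_left (hmW hcU),
          lintegral_finsetSum _ fun k _ => (hmW (hcU1 k)).const_mul _,
          lintegral_finsetSum _ fun k _ => Finset.measurable_fun_sum _ fun l _ =>
            (hmI (hcU2 k l)).const_mul _]
        congr 1
        · congr 1
          exact Finset.sum_congr rfl fun k _ => lintegral_const_mul _ (hmW (hcU1 k))
        · refine Finset.sum_congr rfl fun k _ => ?_
          rw [lintegral_finsetSum _ fun l _ => (hmI (hcU2 k l)).const_mul _]
          exact Finset.sum_congr rfl fun l _ => lintegral_const_mul _ (hmI (hcU2 k l))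
    _ ≤ V * N0 + (∑ k, R * (V * eLpNorm (U1 k) 2 volume)) +
      ∑ k, ∑ l, R ^ 2 * (V * (rootConst * eLpNorm (U2 k l) 2 volume)) := by
        refine add_le_add (add_le_add (one hcU) (Finset.sum_le_sum fun k _ =>
          mul_le_mul' le_rfl (one (hcU1 k)))) (Finset.sum_le_sum fun k _ =>
          Finset.sum_le_sum fun l _ => mul_le_mul' le_rfl
            (lintegral_lintegral_comp_smul_le (hcU2 k l) x))
    _ = V * (1 * N0 + R * (∑ k, eLpNorm (U1 k) 2 volume) +
        R ^ 2 * rootConst * ∑ k, ∑ l, eLpNorm (U2 k l) 2 volume) := by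
        simp only [Finset.mul_sum, mul_add]
        congr 1
        · congr 1
          · rw [one_mul]
          · exact Finset.sum_congr rfl fun k _ => by ring
        · exact Finset.sum_congr rfl fun k _ => Finset.sum_congr rfl fun l _ => by ring
    _ ≤ V * ((1 + R + R ^ 2 * rootConst) * N0 +
        (1 + R + R ^ 2 * rootConst) * (∑ k, eLpNorm (U1 k) 2 volume) +
        (1 + R + R ^ 2 * rootConst) * ∑ k, ∑ l, eLpNorm (U2 k l) 2 volume) := by
        gcongr
        · rw [add_assoc]; exact le_self_add
        · exact le_add_right le_add_self
        · exact le_add_self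
    _ = _ := by ring

/-- The cone contains a ball around the midpoint of its axis, whose radius depends only on height
and aperture; hence the Sobolev constant is the same for all vertices. -/
lemma cone_ball {h κ : ℝ} (hh : 0 < h) (hκ : κ < 1) :
    ∃ r : ℝ, 0 < r ∧ ∀ ξ : E3, ‖ξ‖ = 1 → ∀ z ∈ Metric.closedBall ((h / 2) • ξ) r,
      ‖z‖ ≤ h ∧ κ * ‖z‖ ≤ inner ℝ z ξ := by
  -- The aperture parameter may be negative, and `κ'` is nonnegative. For `‖w‖ ≤ r` the claim
  -- reduces to `κ'(h/2 + r) ≤ h/2 - r`, which the radius `r = h/4 (1 - κ')` satisfies because `1 +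
  -- κ' ≤ 2`.
  set κ' := max κ 0
  have hκ' : κ' < 1 := max_lt hκ one_pos
  have hκ0 : 0 ≤ κ' := le_max_right _ _
  refine ⟨h / 4 * (1 - κ'), by have : 0 < 1 - κ' := by linarith
                               positivity, fun ξ hξ z hz => ?_⟩
  rw [Metric.mem_closedBall, dist_eq_norm] at hz
  set w := z - (h / 2) • ξ with hw
  have hzw : z = (h / 2) • ξ + w := by rw [hw]; abel
  have hr : h / 4 * (1 - κ') ≤ h / 4 := by nlinarith
  have h1 : ‖z‖ ≤ h / 2 + ‖w‖ := by
    rw [hzw]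
    refine (norm_add_le _ _).trans ?_
    rw [norm_smul, hξ, Real.norm_of_nonneg (by positivity), mul_one]
  have h2 : h / 2 - ‖w‖ ≤ inner ℝ z ξ := by
    rw [hzw, inner_add_left, real_inner_smul_left, real_inner_self_eq_norm_sq, hξ]
    have := abs_le.1 (abs_real_inner_le_norm w ξ)
    rw [hξ, mul_one] at this
    linarith
  refine ⟨by linarith, ?_⟩
  have h3 : κ * ‖z‖ ≤ κ' * ‖z‖ := mul_le_mul_of_nonneg_right (le_max_left _ _) (norm_nonneg _)
  have h4 : κ' * ‖z‖ ≤ κ' * (h / 2 + ‖w‖) := mul_le_mul_of_nonneg_left h1 hκ0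
  nlinarith [mul_nonneg (norm_nonneg w) (sub_nonneg.2 hκ'.le)]

/-- The Sobolev embedding of `H²(D)³` into `L^∞(D)³`, for domains with the cone condition. -/
theorem exists_sobolev_const {D : Set E3} (hD : IsOpen D) (hb : Bornology.IsBounded D)
    (hcone : ConeCondition D) :
    ∃ C : ℝ, 0 ≤ C ∧ ∀ (u : L2V D) (g : Fin 3 → L2V D) (f : Fin 3 → Fin 3 → L2V D),
      (∀ k, HasWeakPartial D k u (g k)) → (∀ k l, HasWeakPartial D l (g k) (f k l)) →
      ∀ᵐ x ∂volume.restrict D, ‖u x‖ ≤ C * (‖u‖ + ∑ k, ‖g k‖ + ∑ k, ∑ l, ‖f k l‖) := by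
  obtain ⟨h, hh, κ, hκ, hcone⟩ := hcone
  obtain ⟨r, hr, hball⟩ := cone_ball hh hκ
  set VB := volume (Metric.closedBall (0 : E3) r) with hVB
  have hVBpos : VB ≠ 0 := (Metric.measure_closedBall_pos _ _ hr).ne'
  have hVBtop : VB ≠ ∞ := measure_closedBall_lt_top.ne
  set R := ENNReal.ofReal h
  set C := VB⁻¹ * (VB ^ (1 / 2 : ℝ) * (1 + R + R ^ 2 * rootConst)) with hC
  have hCtop : C ≠ ∞ := by
    refine ENNReal.mul_ne_top (ENNReal.inv_ne_top.2 hVBpos) (ENNReal.mul_ne_top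
      (ENNReal.rpow_ne_top_of_nonneg (by norm_num) hVBtop) ?_)
    exact ENNReal.add_ne_top.2 ⟨by simp [R], ENNReal.mul_ne_top (by simp [R]) rootConst_lt_top.ne⟩
  refine ⟨C.toReal, ENNReal.toReal_nonneg, fun u g f hg hf => ?_⟩
  set S : L2V D → ℕ → ℝ≥0∞ := fun w n =>
    eLpNorm (mollify n (extZero D w) - extZero D w) 2 volume + ‖w‖ₑ with hS
  have hSlim : ∀ w, Tendsto (S w) atTop (𝓝 ‖w‖ₑ) := fun w => by
    simpa using (mollify_tendsto_L2 (extZero_stronglyMeasurable hD w)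
      (extZero_memLp hD w)).add_const ‖w‖ₑ
  have hSle : ∀ w n, eLpNorm (mollify n (extZero D w)) 2 volume ≤ S w n := by
    intro w n
    have h1 : eLpNorm (extZero D w) 2 volume = ‖w‖ₑ := by
      rw [extZero, eLpNorm_indicator_eq_eLpNorm_restrict hD.measurableSet, Lp.enorm_def]
    have h2 := eLpNorm_add_le ((mollify_memLp hD hb n w).1.sub (extZero_memLp hD w).1)
      (extZero_memLp hD w).1 (p := 2) (by norm_num)
    rw [sub_add_cancel, h1] at h2
    exact h2
  have hae : ∀ᵐ x ∂volume.restrict D, Tendsto (fun n => mollify n (extZero D u) x) atTop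
      (𝓝 (extZero D u x)) :=
    ae_restrict_of_ae (mollify_tendsto_ae (extZero_locallyIntegrable hD u))
  filter_upwards [hae, ae_restrict_mem hD.measurableSet] with x hx hxD
  obtain ⟨ξ, hξ, hK⟩ := hcone x hxD
  set K : Set E3 := (fun y => x + y) '' {y | ‖y‖ ≤ h ∧ κ * ‖y‖ ≤ inner ℝ y ξ} with hKdef
  have hKc : IsCompact K := by
    refine IsCompact.image ?_ (by fun_prop)
    refine (isCompact_closedBall (0 : E3) h).of_isClosed_subset ?_ fun y hy => by simpa using hy.1
    have hc1 : IsClosed {y : E3 | ‖y‖ ≤ h} := isClosed_le (by fun_prop) (by fun_prop)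
    have hc2 : IsClosed {y : E3 | κ * ‖y‖ ≤ inner ℝ y ξ} :=
      isClosed_le (by fun_prop) (by fun_prop)
    exact hc1.inter hc2
  have hKD : K ⊆ D := by
    rintro _ ⟨y, hy, rfl⟩
    exact hK y hy.1 hy.2
  -- The cone is star-shaped about its vertex, so the whole segment to `x + z` stays in the compact
  -- set `K ⊆ D`, on a neighbourhood of which mollification commutes with derivatives.
  have hseg : ∀ z ∈ Metric.closedBall ((h / 2) • ξ) r, ∀ s ∈ Icc (0 : ℝ) 1, x + s • z ∈ K := by
    intro z hz s hs
    obtain ⟨h1, h2⟩ := hball ξ hξ z hz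
    refine ⟨s • z, ⟨?_, ?_⟩, rfl⟩
    · rw [norm_smul, Real.norm_of_nonneg hs.1]
      exact (mul_le_of_le_one_left (norm_nonneg _) hs.2).trans h1
    · rw [norm_smul, Real.norm_of_nonneg hs.1, real_inner_smul_left]
      nlinarith [mul_le_mul_of_nonneg_left h2 hs.1]
  have hev : ∀ᶠ n in atTop, ‖mollify n (extZero D u) x‖ₑ ≤
      C * (S u n + ∑ k, S (g k) n + ∑ k, ∑ l, S (f k l) n) := by
    filter_upwards [eventually_closedBall_subset hD hKc hKD] with n hn
    have hsm : ∀ w : L2V D, ContDiff ℝ (⊤ : ℕ∞) (mollify n (extZero D w)) := fun w =>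
      mollify_contDiff n (extZero_locallyIntegrable hD w)
    have h3 := enorm_le_of_cone_ball (hsm u) (fun k => hsm (g k)) (fun k l => hsm (f k l)) x
      ((h / 2) • ξ) r R
      (fun z hz => by
        rw [← ofReal_norm]; exact ENNReal.ofReal_le_ofReal (hball ξ hξ z hz).1)
      (fun z hz s hs k => fderiv_mollify hD (hg k) (hn _ (hseg z hz s hs)))
      (fun z hz s hs k l => fderiv_mollify hD (hf k l) (hn _ (hseg z hz s hs)))
    rw [Measure.addHaar_closedBall_center, ← hVB] at h3
    have h4 : ‖mollify n (extZero D u) x‖ₑ ≤ VB⁻¹ * (VB ^ (1 / 2 : ℝ) *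
      ((1 + R + R ^ 2 * rootConst) * (eLpNorm (mollify n (extZero D u)) 2 volume +
        ∑ k, eLpNorm (mollify n (extZero D (g k))) 2 volume +
        ∑ k, ∑ l, eLpNorm (mollify n (extZero D (f k l))) 2 volume))) := by
      refine le_trans (le_of_eq ?_) (mul_le_mul' (le_refl VB⁻¹) h3)
      rw [mul_comm _ VB, ← mul_assoc, ENNReal.inv_mul_cancel hVBpos hVBtop, one_mul]
    refine h4.trans ?_
    rw [hC, mul_assoc, mul_assoc]
    gcongr
    · exact hSle _ _
    · exact hSle _ _
    · exact hSle _ _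
  have hlim : Tendsto (fun n => C * (S u n + ∑ k, S (g k) n + ∑ k, ∑ l, S (f k l) n)) atTop
      (𝓝 (C * (‖u‖ₑ + ∑ k, ‖g k‖ₑ + ∑ k, ∑ l, ‖f k l‖ₑ))) := by
    refine ENNReal.Tendsto.const_mul (((hSlim u).add (tendsto_finsetSum _ fun k _ => hSlim _)).add
      (tendsto_finsetSum _ fun k _ => tendsto_finsetSum _ fun l _ => hSlim _)) (Or.inr hCtop)
  have hfin := le_of_tendsto_of_tendsto hx.enorm hlim hev
  have h5 : extZero D u x = u x := by simp [extZero, hxD]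
  rw [h5] at hfin
  have h6 : (‖u x‖ₑ).toReal ≤ _ := ENNReal.toReal_mono ?_ hfin
  · rw [ENNReal.toReal_mul, ENNReal.toReal_add, ENNReal.toReal_add, ENNReal.toReal_sum,
      ENNReal.toReal_sum] at h6
    · simpa [ENNReal.toReal_sum] using h6
    all_goals simp
  · exact ENNReal.mul_ne_top hCtop (by simp)

/-! ### Algebra of the cross product -/

lemma inner_eq_coord (a b : E3) : inner ℝ a b = a 0 * b 0 + a 1 * b 1 + a 2 * b 2 := by
  simp [PiLp.inner_apply, Fin.sum_univ_three]; ring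

lemma norm_sq_eq_coord (a : E3) : ‖a‖ ^ 2 = a 0 ^ 2 + a 1 ^ 2 + a 2 ^ 2 := by
  rw [← real_inner_self_eq_norm_sq, inner_eq_coord]; ring

lemma cross_zero_coord (a b : E3) : cross a b 0 = a 1 * b 2 - a 2 * b 1 := by
  simp [cross, crossProduct]

lemma cross_one_coord (a b : E3) : cross a b 1 = a 2 * b 0 - a 0 * b 2 := by
  simp [cross, crossProduct]

lemma cross_two_coord (a b : E3) : cross a b 2 = a 0 * b 1 - a 1 * b 0 := by
  simp [cross, crossProduct]

lemma ext_coord {a b : E3} (h0 : a 0 = b 0) (h1 : a 1 = b 1) (h2 : a 2 = b 2) : a = b := by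
  ext i; fin_cases i <;> assumption

lemma inner_cross_swap (a b c : E3) : inner ℝ (cross a b) c = -inner ℝ b (cross a c) := by
  simp only [inner_eq_coord, cross_zero_coord, cross_one_coord, cross_two_coord]; ring

lemma inner_cross_self_left (a b : E3) : inner ℝ (cross a b) a = 0 := by
  simp only [inner_eq_coord, cross_zero_coord, cross_one_coord, cross_two_coord]; ring

lemma cross_anticomm' (a b : E3) : cross a b = -cross b a := by
  refine ext_coord ?_ ?_ ?_ <;>
    simp only [PiLp.neg_apply, cross_zero_coord, cross_one_coord, cross_two_coord] <;> ring

lemma cross_add_right (a b c : E3) : cross a (b + c) = cross a b + cross a c := by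
  simp [cross]

lemma cross_sub_right (a b c : E3) : cross a (b - c) = cross a b - cross a c := by
  simp [cross]

lemma cross_neg_right (a b : E3) : cross a (-b) = -cross a b :=
  map_neg (crossCLM a) b

lemma cross_smul_right (r : ℝ) (a b : E3) : cross a (r • b) = r • cross a b := by
  simp [cross]

lemma cross_cross_self (a b : E3) : cross a (cross a b) = inner ℝ a b • a - ‖a‖ ^ 2 • b := by
  refine ext_coord ?_ ?_ ?_ <;>
    simp only [PiLp.sub_apply, PiLp.smul_apply, smul_eq_mul, cross_zero_coord, cross_one_coord,
      cross_two_coord, inner_eq_coord, norm_sq_eq_coord] <;> ring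

lemma norm_cross_sq (a b : E3) : ‖cross a b‖ ^ 2 = ‖a‖ ^ 2 * ‖b‖ ^ 2 - inner ℝ a b ^ 2 := by
  simp only [norm_sq_eq_coord, inner_eq_coord, cross_zero_coord, cross_one_coord, cross_two_coord]
  ring

lemma norm_cross_le (a b : E3) : ‖cross a b‖ ≤ ‖a‖ * ‖b‖ := by
  refine abs_le_of_sq_le_sq' ?_ (by positivity) |>.2
  rw [norm_cross_sq, mul_pow]
  linarith [sq_nonneg (inner ℝ a b)]

lemma continuous_cross : Continuous fun p : E3 × E3 => cross p.1 p.2 :=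
  crossCLM.continuous₂

/-! ### Bounded actions and their lifts to `L²` -/

/-- A continuous family of linear contractions of `H`, parametrized by `H`. -/
structure IsBoundedAction {H : Type*} [NormedAddCommGroup H] [NormedSpace ℝ H] (Θ : H → H → H) :
    Prop where
  cont : Continuous fun p : H × H => Θ p.1 p.2
  add : ∀ a b c, Θ a (b + c) = Θ a b + Θ a c
  smul : ∀ (r : ℝ) a b, Θ a (r • b) = r • Θ a b
  le : ∀ a b, ‖Θ a b‖ ≤ ‖b‖

namespace IsBoundedAction

section

variable {H : Type*} [NormedAddCommGroup H] [NormedSpace ℝ H] {Θ : H → H → H}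

/-- The linear contraction belonging to a parameter. -/
def clm (h : IsBoundedAction Θ) (a : H) : H →L[ℝ] H :=
  LinearMap.mkContinuous { toFun := Θ a, map_add' := h.add a, map_smul' := fun r b => h.smul r a b }
    1 fun b => by simpa using h.le a b

lemma clm_apply (h : IsBoundedAction Θ) (a b : H) : h.clm a b = Θ a b := rfl

lemma zero (h : IsBoundedAction Θ) (a : H) : Θ a 0 = 0 := map_zero (h.clm a)

lemma sub (h : IsBoundedAction Θ) (a b c : H) : Θ a (b - c) = Θ a b - Θ a c :=
  map_sub (h.clm a) b c

variable {α : Type*} [MeasurableSpace α] {μ : Measure α}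

lemma memLp (h : IsBoundedAction Θ) (f b : Lp H 2 μ) : MemLp (fun x => Θ (f x) (b x)) 2 μ :=
  (Lp.memLp b).of_le (h.cont.comp_aestronglyMeasurable ((Lp.memLp f).1.prodMk (Lp.memLp b).1))
    (Eventually.of_forall fun _ => h.le _ _)

end

end IsBoundedAction

lemma enorm_sq_eq_lintegral {H : Type*} [NormedAddCommGroup H] {α : Type*} [MeasurableSpace α]
    {μ : Measure α} (g : Lp H 2 μ) : ‖g‖ₑ ^ 2 = ∫⁻ x, ‖g x‖ₑ ^ 2 ∂μ := by
  have := eLpNorm_nnreal_pow_eq_lintegral (p := 2) (μ := μ) (f := g) two_ne_zero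
  simpa only [NNReal.coe_ofNat, ENNReal.coe_ofNat, ENNReal.rpow_ofNat, ← Lp.enorm_def] using this

lemma tendsto_of_enorm_sq {E : Type*} [NormedAddCommGroup E] {f : ℕ → E} {g : E}
    (h : Tendsto (fun j => ‖f j - g‖ₑ ^ 2) atTop (𝓝 0)) : Tendsto f atTop (𝓝 g) := by
  rw [tendsto_iff_norm_sub_tendsto_zero]
  have h1 := (ENNReal.tendsto_toReal ENNReal.zero_ne_top).comp h
  have h2 : Tendsto (fun j => ‖f j - g‖ ^ 2) atTop (𝓝 0) := by
    simpa [Function.comp_def] using h1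
  have h3 := h2.sqrt
  simpa [Real.sqrt_sq (norm_nonneg _)] using h3

lemma tendsto_Lp_of_dominated {H H' : Type*} [NormedAddCommGroup H] [NormedAddCommGroup H']
    {α : Type*} [MeasurableSpace α] {μ : Measure α} {f : ℕ → Lp H 2 μ} {f' : Lp H 2 μ}
    (b : Lp H' 2 μ) (hb : ∀ j, ∀ᵐ x ∂μ, ‖f j x - f' x‖ ≤ ‖b x‖)
    (hf : ∀ᵐ x ∂μ, Tendsto (fun j => f j x) atTop (𝓝 (f' x))) : Tendsto f atTop (𝓝 f') := by
  refine tendsto_of_enorm_sq ?_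
  have h2 : Tendsto (fun j => ∫⁻ x, ‖f j x - f' x‖ₑ ^ 2 ∂μ) atTop (𝓝 (∫⁻ _, 0 ∂μ)) := by
    refine tendsto_lintegral_of_dominated_convergence' (fun x => ‖b x‖ₑ ^ 2)
      (fun j => ?_) (fun j => ?_) ?_ ?_
    · exact (((Lp.memLp (f j)).1.sub (Lp.memLp f').1).enorm).pow_const 2
    · filter_upwards [hb j] with x hx
      refine pow_le_pow_left' ?_ 2
      rw [← ofReal_norm, ← ofReal_norm]
      exact ENNReal.ofReal_le_ofReal hx
    · rw [← enorm_sq_eq_lintegral]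
      exact ENNReal.pow_ne_top enorm_ne_top
    · filter_upwards [hf] with x hx
      have h4 := (hx.sub_const (f' x)).enorm
      rw [sub_self, enorm_zero] at h4
      simpa [Function.comp_def] using ((ENNReal.continuous_pow 2).tendsto 0).comp h4
  rw [lintegral_zero] at h2
  refine h2.congr fun j => ?_
  rw [enorm_sq_eq_lintegral]
  refine lintegral_congr_ae ?_
  filter_upwards [Lp.coeFn_sub (f j) f'] with x h3
  rw [h3, Pi.sub_apply]

section Lift

variable {H : Type*} [NormedAddCommGroup H] [NormedSpace ℝ H] {Θ : H → H → H}
  {α : Type*} [MeasurableSpace α]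

/-- The pointwise application of a bounded action. -/
def liftAction (h : IsBoundedAction Θ) (μ : Measure α) (f b : Lp H 2 μ) : Lp H 2 μ :=
  (h.memLp f b).toLp

variable {μ : Measure α}

lemma coeFn_liftAction (h : IsBoundedAction Θ) (f b : Lp H 2 μ) :
    liftAction h μ f b =ᵐ[μ] fun x => Θ (f x) (b x) :=
  (h.memLp f b).coeFn_toLp

lemma liftAction_le (h : IsBoundedAction Θ) (f b : Lp H 2 μ) : ‖liftAction h μ f b‖ ≤ ‖b‖ := by
  refine Lp.norm_le_norm_of_ae_le ?_
  filter_upwards [coeFn_liftAction h f b] with x hx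
  rw [hx]; exact h.le _ _

lemma liftAction_add (h : IsBoundedAction Θ) (f b c : Lp H 2 μ) :
    liftAction h μ f (b + c) = liftAction h μ f b + liftAction h μ f c := by
  refine Lp.ext ?_
  filter_upwards [coeFn_liftAction h f b, coeFn_liftAction h f c, coeFn_liftAction h f (b + c),
    Lp.coeFn_add b c, Lp.coeFn_add (liftAction h μ f b) (liftAction h μ f c)] with x h1 h2 h3 h4 h5
  rw [h3, h5, Pi.add_apply, h1, h2, h4, Pi.add_apply, h.add]

lemma liftAction_smul (h : IsBoundedAction Θ) (r : ℝ) (f b : Lp H 2 μ) :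
    liftAction h μ f (r • b) = r • liftAction h μ f b := by
  refine Lp.ext ?_
  filter_upwards [coeFn_liftAction h f b, coeFn_liftAction h f (r • b),
    Lp.coeFn_smul r b, Lp.coeFn_smul r (liftAction h μ f b)] with x h1 h2 h3 h4
  rw [h2, h4, Pi.smul_apply, h1, h3, Pi.smul_apply, h.smul]

/-- Along a subsequence the parameters converge almost everywhere, and `2‖b‖` dominates because
every `Θ a` is a contraction; no uniform continuity in the parameter is needed. -/
lemma tendsto_liftAction_left (h : IsBoundedAction Θ) {f : ℕ → Lp H 2 μ} {f' : Lp H 2 μ}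
    (hf : Tendsto f atTop (𝓝 f')) (b : Lp H 2 μ) :
    Tendsto (fun j => liftAction h μ (f j) b) atTop (𝓝 (liftAction h μ f' b)) := by
  refine tendsto_of_subseq_tendsto fun ns hns => ?_
  have h1 := tendstoInMeasure_of_tendsto_Lp (hf.comp hns)
  obtain ⟨ms, -, hms⟩ := h1.exists_seq_tendsto_ae
  refine ⟨ms, tendsto_Lp_of_dominated ((2 : ℝ) • b) (fun j => ?_) ?_⟩
  · filter_upwards [coeFn_liftAction h (f (ns (ms j))) b, coeFn_liftAction h f' b,
      Lp.coeFn_smul (2 : ℝ) b] with x h1 h2 h3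
    rw [h1, h2, h3, Pi.smul_apply, norm_smul, Real.norm_eq_abs, abs_two, two_mul]
    exact (norm_sub_le _ _).trans (add_le_add (h.le _ _) (h.le _ _))
  · filter_upwards [hms, ae_all_iff.2 fun j => coeFn_liftAction h (f (ns (ms j))) b,
      coeFn_liftAction h f' b] with x hx h1 h2
    simp only [h1, h2]
    exact (h.cont.tendsto (f' x, b x)).comp (hx.prodMk_nhds tendsto_const_nhds)

/-- The properties are inherited by `L²`, so the same construction can be repeated for space, time
and probability. Joint continuity follows from the contraction property in the second variable and
continuity in the first. -/
lemma IsBoundedAction.lift (h : IsBoundedAction Θ) (μ : Measure α) :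
    IsBoundedAction (liftAction h μ) where
  add := liftAction_add h
  smul := fun r f b => liftAction_smul h r f b
  le := liftAction_le h
  cont := by
    rw [continuous_iff_seqContinuous]
    intro p p' hp
    have h1 : Tendsto (fun j => (p j).1) atTop (𝓝 p'.1) := (continuous_fst.tendsto p').comp hp
    have h2 : Tendsto (fun j => (p j).2) atTop (𝓝 p'.2) := (continuous_snd.tendsto p').comp hp
    have h3 : Tendsto (fun j => liftAction h μ (p j).1 ((p j).2 - p'.2)) atTop (𝓝 0) := by
      rw [tendsto_zero_iff_norm_tendsto_zero]
      refine squeeze_zero (fun _ => norm_nonneg _) (fun j => liftAction_le h _ _) ?_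
      rw [← tendsto_iff_norm_sub_tendsto_zero]; exact h2
    have h4 := h3.add (tendsto_liftAction_left h h1 p'.2)
    rw [zero_add] at h4
    refine h4.congr fun j => ?_
    rw [Function.comp_apply, ← liftAction_add, sub_add_cancel]

end Lift

lemma liftAction_antisymm {H : Type*} [NormedAddCommGroup H] [InnerProductSpace ℝ H]
    {Θ : H → H → H} {α : Type*} [MeasurableSpace α] {μ : Measure α} (h : IsBoundedAction Θ)
    (hs : ∀ a b c, inner ℝ (Θ a b) c = -inner ℝ b (Θ a c)) (f b c : Lp H 2 μ) :
    inner ℝ (liftAction h μ f b) c = -inner ℝ b (liftAction h μ f c) := by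
  rw [L2.inner_def, L2.inner_def, ← integral_neg]
  refine integral_congr_ae ?_
  filter_upwards [coeFn_liftAction h f b, coeFn_liftAction h f c] with x h1 h2
  rw [h1, h2, hs]

/-- The cross product with the retraction of `a` onto the unit ball. -/
def unitCross (a b : E3) : E3 := cross (ballProj a) b

/-- The retraction makes the product a contraction for every parameter, so its lift is defined and
continuous on all of `L²(D)³`; on unit fields nothing changes (`unitCross_eq`). -/
lemma unitCross_isBoundedAction : IsBoundedAction unitCross where
  cont := continuous_cross.comp
    ((lipschitzWith_ballProj.continuous.comp continuous_fst).prodMk continuous_snd)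
  add _ _ _ := cross_add_right _ _ _
  smul _ _ _ := cross_smul_right _ _ _
  le a _ := (norm_cross_le _ _).trans (mul_le_of_le_one_left (norm_nonneg _) (norm_ballProj_le a))

lemma unitCross_antisymm (a b c : E3) :
    inner ℝ (unitCross a b) c = -inner ℝ b (unitCross a c) := inner_cross_swap _ _ _

lemma unitCross_eq {a : E3} (h : ‖a‖ = 1) (b : E3) : unitCross a b = cross a b := by
  rw [unitCross, ballProj_of_norm_le h.le]

/-- The pointwise cross product `m × u` of fields on `D`, for `|m| ≤ 1`. -/
def crossV {D : Set E3} : L2V D → L2V D → L2V D := liftAction unitCross_isBoundedAction _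

lemma crossV_isBoundedAction {D : Set E3} : IsBoundedAction (crossV (D := D)) :=
  unitCross_isBoundedAction.lift _

lemma crossV_antisymm {D : Set E3} (m u v : L2V D) :
    inner ℝ (crossV m u) v = -inner ℝ u (crossV m v) :=
  liftAction_antisymm _ unitCross_antisymm _ _ _

lemma coeFn_crossV {D : Set E3} {m : L2V D} (hm : ∀ᵐ x ∂volume.restrict D, ‖m x‖ = 1)
    (u : L2V D) : crossV m u =ᵐ[volume.restrict D] fun x => cross (m x) (u x) := by
  filter_upwards [coeFn_liftAction unitCross_isBoundedAction m u, hm] with x h1 h2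
  exact h1.trans (unitCross_eq h2 _)

lemma crossL2_eq_crossV {D : Set E3} {m : L2V D} (hm : ∀ᵐ x ∂volume.restrict D, ‖m x‖ = 1)
    (u : L2V D) : crossL2 D m u = crossV m u := by
  have h : MemLp (fun x => cross (m x) (u x)) 2 (volume.restrict D) :=
    (memLp_congr_ae (coeFn_crossV hm u)).1 (Lp.memLp _)
  rw [crossL2, dif_pos h]
  exact Lp.ext (h.coeFn_toLp.trans (coeFn_crossV hm u).symm)

/-- The pointwise cross product of time dependent fields. -/
def crossT {T : ℝ} {D : Set E3} : L2TV T D → L2TV T D → L2TV T D :=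
  liftAction crossV_isBoundedAction _

lemma crossT_isBoundedAction {T : ℝ} {D : Set E3} : IsBoundedAction (crossT (T := T) (D := D)) :=
  crossV_isBoundedAction.lift _

lemma crossT_antisymm {T : ℝ} {D : Set E3} (m u v : L2TV T D) :
    inner ℝ (crossT m u) v = -inner ℝ u (crossT m v) :=
  liftAction_antisymm _ crossV_antisymm _ _ _

/-! ### Multiplication by bounded fields of matrices -/

/-- A measurable field of matrices on `D`, bounded by `c`. -/
structure FieldBound (D : Set E3) (A : E3 → E3 →L[ℝ] E3) (c : ℝ) : Prop where
  aestronglyMeasurable : AEStronglyMeasurable A (volume.restrict D)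
  le : ∀ᵐ x ∂volume.restrict D, ‖A x‖ ≤ c

section FieldOp

variable {D : Set E3} {A : E3 → E3 →L[ℝ] E3} {c : ℝ}

lemma FieldBound.memLp (h : FieldBound D A c) (m : L2V D) :
    MemLp (fun x => A x (m x)) 2 (volume.restrict D) := by
  refine MemLp.of_le_mul (c := c) (Lp.memLp m)
    ((ContinuousLinearMap.id ℝ (E3 →L[ℝ] E3)).aestronglyMeasurable_comp₂
      h.aestronglyMeasurable (Lp.memLp m).1) ?_
  filter_upwards [h.le] with x hx
  exact (A x).le_of_opNorm_le hx _

lemma FieldBound.norm_toLp_le (h : FieldBound D A c) (m : L2V D) :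
    ‖MemLp.toLp _ (h.memLp m)‖ ≤ c * ‖m‖ := by
  refine Lp.norm_le_mul_norm_of_ae_le_mul ?_
  filter_upwards [(h.memLp m).coeFn_toLp, h.le] with x hx hx'
  rw [hx]
  exact (A x).le_of_opNorm_le hx' _

lemma FieldBound.toLp_add (h : FieldBound D A c) (m m' : L2V D) :
    MemLp.toLp _ (h.memLp (m + m')) =
      MemLp.toLp _ (h.memLp m) + MemLp.toLp _ (h.memLp m') := by
  rw [← MemLp.toLp_add]
  refine MemLp.toLp_congr _ _ ?_
  filter_upwards [Lp.coeFn_add m m'] with x hx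
  simp only [hx, Pi.add_apply, map_add]

lemma FieldBound.toLp_smul (h : FieldBound D A c) (r : ℝ) (m : L2V D) :
    MemLp.toLp _ (h.memLp (r • m)) = r • MemLp.toLp _ (h.memLp m) := by
  rw [← MemLp.toLp_const_smul]
  refine MemLp.toLp_congr _ _ ?_
  filter_upwards [Lp.coeFn_smul r m] with x hx
  simp only [hx, Pi.smul_apply, map_smul]

/-- The multiplication operator of a bounded field of matrices. -/
def fieldOp (h : FieldBound D A c) : L2V D →L[ℝ] L2V D :=
  LinearMap.mkContinuous
    { toFun := fun m => MemLp.toLp _ (h.memLp m)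
      map_add' := h.toLp_add
      map_smul' := h.toLp_smul } _ h.norm_toLp_le

lemma coeFn_fieldOp (h : FieldBound D A c) (m : L2V D) :
    fieldOp h m =ᵐ[volume.restrict D] fun x => A x (m x) :=
  (h.memLp m).coeFn_toLp

lemma norm_fieldOp_le (h : FieldBound D A c) (m : L2V D) : ‖fieldOp h m‖ ≤ c * ‖m‖ :=
  h.norm_toLp_le m

end FieldOp

lemma fieldBound_cross {D : Set E3} {ψ : L2V D} {c : ℝ}
    (h : ∀ᵐ x ∂volume.restrict D, ‖ψ x‖ ≤ c) :
    FieldBound D (fun x => crossCLM.flip (ψ x)) c where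
  aestronglyMeasurable := crossCLM.flip.continuous.comp_aestronglyMeasurable (Lp.memLp _).1
  le := by
    filter_upwards [h] with x hx
    refine ContinuousLinearMap.opNorm_le_bound _ ((norm_nonneg _).trans hx) fun a => ?_
    refine (norm_cross_le a (ψ x)).trans ?_
    rw [mul_comm]
    exact mul_le_mul_of_nonneg_right hx (norm_nonneg _)

/-- The operator `u ↦ u × ψ`, for a bounded field `ψ`. -/
def crossBdd {D : Set E3} {ψ : L2V D} {c : ℝ} (h : ∀ᵐ x ∂volume.restrict D, ‖ψ x‖ ≤ c) :
    L2V D →L[ℝ] L2V D :=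
  fieldOp (fieldBound_cross h)

lemma coeFn_crossBdd {D : Set E3} {ψ : L2V D} {c : ℝ} (h : ∀ᵐ x ∂volume.restrict D, ‖ψ x‖ ≤ c)
    (u : L2V D) : crossBdd h u =ᵐ[volume.restrict D] fun x => cross (u x) (ψ x) :=
  coeFn_fieldOp (fieldBound_cross h) u

lemma norm_crossBdd_le {D : Set E3} {ψ : L2V D} {c : ℝ}
    (h : ∀ᵐ x ∂volume.restrict D, ‖ψ x‖ ≤ c) (u : L2V D) : ‖crossBdd h u‖ ≤ c * ‖u‖ :=
  norm_fieldOp_le (fieldBound_cross h) u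

/-! ### The operator `m ↦ ∑ᵢ (m × Gᵢ) × Gᵢ` -/

/-- The matrix field of the operator `a ↦ ∑ᵢ (a × Gᵢ) × Gᵢ`. -/
def noiseField {D : Set E3} (Gf : ℕ → L2V D) (x : E3) : E3 →L[ℝ] E3 :=
  ∑' i, (crossCLM.flip (Gf i x)).comp (crossCLM.flip (Gf i x))

/-- The coefficients are bounded, with square summable bounds. -/
def NoiseBound {D : Set E3} (Gf : ℕ → L2V D) (c : ℕ → ℝ) : Prop :=
  (Summable fun i => c i ^ 2) ∧ ∀ i, ∀ᵐ x ∂volume.restrict D, ‖Gf i x‖ ≤ c i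

lemma norm_cross_flip_comp_le (b : E3) :
    ‖(crossCLM.flip b).comp (crossCLM.flip b)‖ ≤ ‖b‖ ^ 2 := by
  refine ContinuousLinearMap.opNorm_le_bound _ (by positivity) fun a => ?_
  change ‖cross (cross a b) b‖ ≤ _
  refine (norm_cross_le _ _).trans ?_
  nlinarith [norm_cross_le a b, norm_nonneg b]

section Noise

variable {D : Set E3} {Gf : ℕ → L2V D} {c : ℕ → ℝ}

/-- The operator `a ↦ (a × b) × b` has norm at most `|b|²`, so the series converges absolutely at
almost every point. -/
lemma NoiseBound.ae_summable (h : NoiseBound Gf c) : ∀ᵐ x ∂volume.restrict D,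
    Summable (fun i => (crossCLM.flip (Gf i x)).comp (crossCLM.flip (Gf i x))) ∧
      ‖noiseField Gf x‖ ≤ ∑' i, c i ^ 2 := by
  filter_upwards [ae_all_iff.2 h.2] with x hx
  have hle : ∀ i, ‖(crossCLM.flip (Gf i x)).comp (crossCLM.flip (Gf i x))‖ ≤ c i ^ 2 := fun i =>
    (norm_cross_flip_comp_le _).trans (pow_le_pow_left₀ (norm_nonneg _) (hx i) 2)
  exact ⟨Summable.of_norm_bounded h.1 hle, tsum_of_norm_bounded h.1.hasSum hle⟩

lemma NoiseBound.aestronglyMeasurable (h : NoiseBound Gf c) :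
    AEStronglyMeasurable (noiseField Gf) (volume.restrict D) := by
  refine aestronglyMeasurable_of_tendsto_ae atTop
    (f := fun n x => ∑ i ∈ Finset.range n,
      (crossCLM.flip (Gf i x)).comp (crossCLM.flip (Gf i x))) (fun n => ?_) ?_
  · refine Finset.aestronglyMeasurable_fun_sum _ fun i _ => ?_
    have h1 : AEStronglyMeasurable (fun x => crossCLM.flip (Gf i x)) (volume.restrict D) :=
      crossCLM.flip.continuous.comp_aestronglyMeasurable (Lp.memLp _).1
    exact (ContinuousLinearMap.compL ℝ E3 E3 E3).aestronglyMeasurable_comp₂ h1 h1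
  · filter_upwards [h.ae_summable] with x hx
    exact hx.1.hasSum.tendsto_sum_nat

lemma NoiseBound.fieldBound (h : NoiseBound Gf c) :
    FieldBound D (noiseField Gf) (∑' i, c i ^ 2) :=
  ⟨h.aestronglyMeasurable, h.ae_summable.mono fun _ hx => hx.2⟩

/-- The operator `m ↦ ∑ᵢ (m × Gᵢ) × Gᵢ` of `L²(D)³`. -/
def noiseOp (h : NoiseBound Gf c) : L2V D →L[ℝ] L2V D := fieldOp h.fieldBound

lemma coeFn_noiseOp (h : NoiseBound Gf c) (m : L2V D) : ∀ᵐ x ∂volume.restrict D,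
    HasSum (fun i => cross (cross (m x) (Gf i x)) (Gf i x)) (noiseOp h m x) := by
  filter_upwards [coeFn_fieldOp h.fieldBound m, h.ae_summable] with x hx hx'
  rw [noiseOp, hx]
  have h2 := hx'.1.hasSum.mapL (ContinuousLinearMap.apply ℝ E3 (m x))
  exact h2

end Noise

/-! ### The variational problem of one step -/

/-- `m ∈ H¹(D)³` with `|m| = 1`. -/
def IsUnitField (D : Set E3) (m : L2V D) : Prop :=
  MemH1 D m ∧ ∀ᵐ x ∂volume.restrict D, ‖m x‖ = 1

lemma crossV_sub {D : Set E3} (m u v : L2V D) : crossV m (u - v) = crossV m u - crossV m v :=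
  crossV_isBoundedAction.sub _ _ _

lemma crossV_add {D : Set E3} (m u v : L2V D) : crossV m (u + v) = crossV m u + crossV m v :=
  crossV_isBoundedAction.add _ _ _

lemma crossV_smul {D : Set E3} (r : ℝ) (m u : L2V D) : crossV m (r • u) = r • crossV m u :=
  crossV_isBoundedAction.smul _ _ _

lemma crossV_inner_self {D : Set E3} (m u : L2V D) : inner ℝ (crossV m u) u = 0 := by
  have h := crossV_antisymm m u u
  rw [real_inner_comm (crossV m u) u] at h
  linarith

lemma norm_crossV_le {D : Set E3} (m u : L2V D) : ‖crossV m u‖ ≤ ‖u‖ :=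
  crossV_isBoundedAction.le _ _

lemma continuous_crossV {D : Set E3} : Continuous fun p : L2V D × L2V D => crossV p.1 p.2 :=
  crossV_isBoundedAction.cont

/-- For a unit vector, `m × (m × u) = (m · u) m - u`. Tangency becomes an equation in `L²(D)³` that
is linear in `u` and continuous in both fields, which suits closed sets and weak limits. -/
lemma crossV_crossV_eq_neg_iff {D : Set E3} {m : L2V D}
    (hm : ∀ᵐ x ∂volume.restrict D, ‖m x‖ = 1) {u : L2V D} :
    crossV m (crossV m u) = -u ↔ ∀ᵐ x ∂volume.restrict D, inner ℝ (u x) (m x) = 0 := by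
  have key : ∀ᵐ x ∂volume.restrict D,
      (crossV m (crossV m u) x = (-u) x ↔ inner ℝ (u x) (m x) = 0) := by
    filter_upwards [coeFn_crossV hm u, coeFn_crossV hm (crossV m u), Lp.coeFn_neg u, hm]
      with x h1 h2 h3 h4
    rw [h2, h1, h3, cross_cross_self, h4, Pi.neg_apply, real_inner_comm (m x) (u x)]
    generalize inner ℝ (m x) (u x) = r
    have hm0 : m x ≠ 0 := by rw [← norm_ne_zero_iff, h4]; exact one_ne_zero
    constructor
    · intro h
      have : r • m x = 0 := by simpa [sub_eq_neg_self] using h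
      exact (smul_eq_zero.1 this).resolve_right hm0
    · intro h; rw [h]; simp
  constructor
  · intro h
    rw [h] at key
    filter_upwards [key] with x hx using hx.1 rfl
  · intro h
    refine Lp.ext ?_
    filter_upwards [key, h] with x hx h'x using hx.2 h'x

lemma crossV_crossV_crossV {D : Set E3} {m : L2V D}
    (hm : ∀ᵐ x ∂volume.restrict D, ‖m x‖ = 1) (u : L2V D) :
    crossV m (crossV m (crossV m u)) = -crossV m u := by
  rw [crossV_crossV_eq_neg_iff hm]
  filter_upwards [coeFn_crossV hm u] with x hx
  rw [hx, inner_cross_self_left]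

/-- The weak gradient of `m × ψ`, for a bounded field `ψ`. -/
lemma HasWeakPartial.crossV_bdd {D : Set E3} (hD : IsOpen D) (hb : Bornology.IsBounded D)
    {k : Fin 3} {m dm ψ dψ : L2V D} {R : ℝ} (hm : ∀ᵐ x ∂volume.restrict D, ‖m x‖ = 1)
    (hψ : ∀ᵐ x ∂volume.restrict D, ‖ψ x‖ ≤ R) (h : HasWeakPartial D k m dm)
    (h' : HasWeakPartial D k ψ dψ) :
    HasWeakPartial D k (crossV m ψ) (crossBdd hψ dm + crossV m dψ) := by
  refine h.cross hD hb h' (coeFn_crossV hm ψ) ?_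
  filter_upwards [coeFn_crossV hm dψ, coeFn_crossBdd hψ dm,
    Lp.coeFn_add (crossBdd hψ dm) (crossV m dψ)] with x h1 h2 h3
  rw [h3, Pi.add_apply, h1, h2]

/-- The zeroth order part of the variational problem. -/
def stepResidual {D : Set E3} (τ : ℝ) (K : L2V D →L[ℝ] L2V D) (m g v : L2V D) : L2V D :=
  (v - crossV m g - (τ / 2) • K m) - crossV m (v - crossV m g - (τ / 2) • K m)

/-- Dominated convergence for series with the bounds `2 cᵢ² |m| |φ|`; it exchanges the sum over the
noise modes with the integral and so brings `noiseOp` into the variational problem. -/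
lemma NoiseBound.hasSum_integral {D : Set E3} {Gf : ℕ → L2V D} {c : ℕ → ℝ} (hc : NoiseBound Gf c)
    {m : L2V D} (hm : ∀ᵐ x ∂volume.restrict D, ‖m x‖ = 1) (φ : L2V D) :
    HasSum (fun i => ∫ x in D, inner ℝ (cross (cross (m x) (Gf i x)) (Gf i x)
        - cross (m x) (cross (cross (m x) (Gf i x)) (Gf i x))) (φ x))
      (inner ℝ (noiseOp hc m - crossV m (noiseOp hc m)) φ) := by
  have e : inner ℝ (noiseOp hc m - crossV m (noiseOp hc m)) φ
      = ∫ x in D, inner ℝ (noiseOp hc m x - cross (m x) (noiseOp hc m x)) (φ x) := by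
    rw [L2.inner_def]
    refine integral_congr_ae ?_
    filter_upwards [coeFn_crossV hm (noiseOp hc m),
      Lp.coeFn_sub (noiseOp hc m) (crossV m (noiseOp hc m))] with x h1 h2
    rw [h2, Pi.sub_apply, h1]
  rw [e]
  have hmeas : ∀ u v : E3 → E3, AEStronglyMeasurable u (volume.restrict D) →
      AEStronglyMeasurable v (volume.restrict D) →
      AEStronglyMeasurable (fun x => cross (u x) (v x)) (volume.restrict D) := fun u v hu hv =>
    continuous_cross.comp_aestronglyMeasurable (hu.prodMk hv)
  have hM := (Lp.memLp m).1
  refine hasSum_integral_of_dominated_convergence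
    (fun i x => 2 * c i ^ 2 * (‖m x‖ * ‖φ x‖)) (fun i => ?_) (fun i => ?_) ?_ ?_ ?_
  · have h1 := hmeas _ _ (hmeas _ _ hM (Lp.memLp (Gf i)).1) (Lp.memLp (Gf i)).1
    exact (h1.sub (hmeas _ _ hM h1)).inner (Lp.memLp φ).1
  · filter_upwards [hc.2 i, hm] with x hx h1
    have h2 : ‖cross (cross (m x) (Gf i x)) (Gf i x)‖ ≤ c i ^ 2 := by
      refine (norm_cross_le _ _).trans ?_
      have := norm_cross_le (m x) (Gf i x)
      rw [h1, one_mul] at this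
      rw [sq]
      exact mul_le_mul (this.trans hx) hx (norm_nonneg _) ((norm_nonneg _).trans hx)
    have h3 := norm_cross_le (m x) (cross (cross (m x) (Gf i x)) (Gf i x))
    rw [h1, one_mul] at h3
    refine (norm_inner_le_norm _ _).trans ?_
    rw [h1, one_mul]
    refine mul_le_mul_of_nonneg_right ((norm_sub_le _ _).trans ?_) (norm_nonneg _)
    linarith
  · exact Eventually.of_forall fun x => (hc.1.mul_left 2).mul_right _
  · have h2 : Integrable (fun x => ‖m x‖ * ‖φ x‖) (volume.restrict D) :=
      integrable_bilin (ContinuousLinearMap.mul ℝ ℝ) (Lp.memLp m).norm (Lp.memLp φ).norm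
    refine (h2.const_mul (∑' i, 2 * c i ^ 2)).congr (Eventually.of_forall fun x => ?_)
    simp only [tsum_mul_right]
  · filter_upwards [coeFn_noiseOp hc m] with x hx
    have h1 := hx.sub (hx.mapL (crossCLM (m x)))
    exact h1.mapL ((innerSL ℝ).flip (φ x))

lemma isStepSolution_iff {D : Set E3} {Gf : ℕ → L2V D} {c : ℕ → ℝ} (hc : NoiseBound Gf c)
    {θ τ : ℝ} {m g v : L2V D} (hm : ∀ᵐ x ∂volume.restrict D, ‖m x‖ = 1) :
    IsStepSolution D θ τ Gf m g v ↔ MemTangent D m v ∧ ∀ φ, MemTangent D m φ →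
      inner ℝ (stepResidual τ (noiseOp hc) m g v) φ
        + 2 * τ * ∑ k, inner ℝ (weakPartial D k m + θ • weakPartial D k v) (weakPartial D k φ)
        = 0 := by
  refine and_congr_right fun _ => forall_congr' fun φ => imp_congr_right fun _ => ?_
  have e1 : (∫ x in D, inner ℝ (v x - cross (m x) (v x)) (φ x)) = inner ℝ (v - crossV m v) φ := by
    rw [L2.inner_def]
    refine integral_congr_ae ?_
    filter_upwards [coeFn_crossV hm v, Lp.coeFn_sub v (crossV m v)] with x h1 h2
    rw [h2, Pi.sub_apply, h1]
  have e2 : (∫ x in D, inner ℝ (cross (m x) (g x) - cross (m x) (cross (m x) (g x))) (φ x))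
      = inner ℝ (crossV m g - crossV m (crossV m g)) φ := by
    rw [L2.inner_def]
    refine integral_congr_ae ?_
    filter_upwards [coeFn_crossV hm g, coeFn_crossV hm (crossV m g),
      Lp.coeFn_sub (crossV m g) (crossV m (crossV m g))] with x h1 h2 h3
    rw [h3, Pi.sub_apply, h2, h1]
  rw [e1, e2, (hc.hasSum_integral hm φ).tsum_eq, gradInner, gradInner, stepResidual]
  simp only [crossV_sub, crossV_smul, inner_sub_left, inner_add_left, real_inner_smul_left,
    Finset.sum_add_distrib, ← Finset.mul_sum]
  constructor <;> intro h <;> linarith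

/-- A field together with its weak gradient. -/
abbrev Jet (D : Set E3) : Type := PiLp 2 fun _ : Option (Fin 3) => L2V D

/-- The fields of `H¹(D)³` tangent to `m`. -/
def tangentJets (D : Set E3) (m : L2V D) : Submodule ℝ (Jet D) where
  carrier := {p | (∀ k, HasWeakPartial D k (p none) (p (some k))) ∧
    crossV m (crossV m (p none)) = -p none}
  add_mem' := fun {p q} hp hq => by
    refine ⟨fun k => (hp.1 k).add (hq.1 k), ?_⟩
    rw [PiLp.add_apply, crossV_add, crossV_add, hp.2, hq.2, neg_add]
  zero_mem' := ⟨fun k => hasWeakPartial_zero, by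
    rw [PiLp.zero_apply, crossV_isBoundedAction.zero, crossV_isBoundedAction.zero, neg_zero]⟩
  smul_mem' := fun r p hp => by
    refine ⟨fun k => (hp.1 k).smul r, ?_⟩
    rw [PiLp.smul_apply, crossV_smul, crossV_smul, hp.2, smul_neg]

lemma isClosed_tangentJets (D : Set E3) (m : L2V D) : IsClosed (tangentJets D m : Set (Jet D)) := by
  have h1 : ∀ i, Continuous fun p : Jet D => p i := fun i => PiLp.continuous_apply 2 _ i
  refine IsClosed.inter (?_ : IsClosed {p : Jet D | ∀ k, _}) (?_ : IsClosed {p : Jet D | _})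
  · rw [ofPred_forall]
    exact isClosed_iInter fun k => (isClosed_hasWeakPartial D k).preimage
      ((h1 none).prodMk (h1 (some k)))
  · exact isClosed_eq (((crossV_isBoundedAction.clm m).continuous.comp
      (crossV_isBoundedAction.clm m).continuous).comp (h1 none)) (h1 none).neg

lemma mem_tangentJets_iff {D : Set E3} (hD : IsOpen D) (hb : Bornology.IsBounded D) {m : L2V D}
    (hm : ∀ᵐ x ∂volume.restrict D, ‖m x‖ = 1) {p : Jet D} :
    p ∈ tangentJets D m ↔ MemTangent D m (p none) ∧ ∀ k, p (some k) = weakPartial D k (p none) := by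
  constructor
  · rintro ⟨h1, h2⟩
    exact ⟨⟨fun k => ⟨_, h1 k⟩, (crossV_crossV_eq_neg_iff hm).1 h2⟩,
      fun k => ((h1 k).weakPartial_eq hD hb).symm⟩
  · rintro ⟨⟨h1, h2⟩, h3⟩
    exact ⟨fun k => by rw [h3 k]; exact h1.hasWeakPartial k, (crossV_crossV_eq_neg_iff hm).2 h2⟩

/-- The jet of a field. -/
def jet (D : Set E3) (u : L2V D) : Jet D :=
  WithLp.toLp 2 fun i => i.elim u fun k => weakPartial D k u

lemma jet_mem_tangentJets {D : Set E3} (hD : IsOpen D) (hb : Bornology.IsBounded D) {m φ : L2V D}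
    (hm : ∀ᵐ x ∂volume.restrict D, ‖m x‖ = 1) (h : MemTangent D m φ) :
    jet D φ ∈ tangentJets D m :=
  (mem_tangentJets_iff hD hb hm).2 ⟨h, fun _ => rfl⟩

/-- The components of a jet. -/
def jetProj (D : Set E3) (i : Option (Fin 3)) : Jet D →L[ℝ] L2V D :=
  PiLp.proj 2 (fun _ : Option (Fin 3) => L2V D) i

lemma jetProj_apply {D : Set E3} (i : Option (Fin 3)) (p : Jet D) : jetProj D i p = p i := rfl

/-- The inner product of `L²(D)³` as a bilinear map. -/
def innerL2V (D : Set E3) : L2V D →L[ℝ] L2V D →L[ℝ] ℝ := innerSL ℝ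

lemma innerL2V_apply {D : Set E3} (u v : L2V D) : innerL2V D u v = inner ℝ u v := rfl

/-- The bilinear form of the variational problem. -/
def stepForm {D : Set E3} (θ τ : ℝ) (m : L2V D) : Jet D →L[ℝ] Jet D →L[ℝ] ℝ :=
  (innerL2V D).bilinearComp ((ContinuousLinearMap.id ℝ _ - crossV_isBoundedAction.clm m) ∘L
      jetProj D none) (jetProj D none)
    + (2 * τ * θ) • ∑ k : Fin 3, (innerL2V D).bilinearComp (jetProj D (some k))
      (jetProj D (some k))

lemma stepForm_apply {D : Set E3} (θ τ : ℝ) (m : L2V D) (p q : Jet D) :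
    stepForm θ τ m p q = inner ℝ (p none - crossV m (p none)) (q none)
      + 2 * τ * θ * ∑ k : Fin 3, inner ℝ (p (some k)) (q (some k)) := by
  simp [stepForm, IsBoundedAction.clm_apply, jetProj_apply, innerL2V_apply, inner_sub_left]

/-- The skew part `m × p` is orthogonal to `p`, which leaves the mass term and the gradient term. -/
lemma stepForm_coercive {D : Set E3} {θ τ : ℝ} (m : L2V D) (p : Jet D) :
    min 1 (2 * τ * θ) * ‖p‖ * ‖p‖ ≤ stepForm θ τ m p p := by
  rw [stepForm_apply, inner_sub_left, crossV_inner_self, sub_zero]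
  have h1 : ‖p‖ * ‖p‖ = ‖p none‖ ^ 2 + ∑ k, ‖p (some k)‖ ^ 2 := by
    rw [← sq, PiLp.norm_sq_eq_of_L2, Fintype.sum_option]
  rw [mul_assoc, h1, mul_add]
  simp only [real_inner_self_eq_norm_sq]
  exact add_le_add (mul_le_of_le_one_left (sq_nonneg _) (min_le_left _ _))
    (mul_le_mul_of_nonneg_right (min_le_right _ _) (Finset.sum_nonneg fun _ _ => sq_nonneg _))

/-- The right hand side of the variational problem. -/
def stepFunctional {D : Set E3} (τ : ℝ) (K : L2V D →L[ℝ] L2V D) (m g : L2V D) : Jet D →L[ℝ] ℝ :=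
  -(innerL2V D (stepResidual τ K m g 0) ∘L jetProj D none)
    - (2 * τ) • ∑ k : Fin 3, innerL2V D (weakPartial D k m) ∘L jetProj D (some k)

lemma stepFunctional_apply {D : Set E3} (τ : ℝ) (K : L2V D →L[ℝ] L2V D) (m g : L2V D)
    (q : Jet D) : stepFunctional τ K m g q = -inner ℝ (stepResidual τ K m g 0) (q none)
      - 2 * τ * ∑ k : Fin 3, inner ℝ (weakPartial D k m) (q (some k)) := by
  simp [stepFunctional, jetProj_apply, innerL2V_apply]

lemma stepResidual_eq {D : Set E3} (τ : ℝ) (K : L2V D →L[ℝ] L2V D) (m g v : L2V D) :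
    stepResidual τ K m g v = (v - crossV m v) + stepResidual τ K m g 0 := by
  simp only [stepResidual, crossV_sub, crossV_isBoundedAction.zero]
  abel

lemma stepForm_sub_stepFunctional {D : Set E3} (θ τ : ℝ) (K : L2V D →L[ℝ] L2V D)
    (m g v φ : L2V D) : stepForm θ τ m (jet D v) (jet D φ) - stepFunctional τ K m g (jet D φ) =
      inner ℝ (stepResidual τ K m g v) φ + 2 * τ *
        ∑ k, inner ℝ (weakPartial D k m + θ • weakPartial D k v) (weakPartial D k φ) := by
  rw [stepForm_apply, stepFunctional_apply, stepResidual_eq τ K m g v, inner_add_left]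
  simp only [jet, Option.elim, inner_add_left, real_inner_smul_left, Finset.sum_add_distrib,
    ← Finset.mul_sum]
  ring

lemma eq_jet_of_mem_tangentJets {D : Set E3} (hD : IsOpen D) (hb : Bornology.IsBounded D)
    {m : L2V D} {p : Jet D} (hp : p ∈ tangentJets D m) : p = jet D (p none) := by
  refine PiLp.ext fun i => ?_
  cases i with
  | none => rfl
  | some k => exact ((hp.1 k).weakPartial_eq hD hb).symm

lemma isStepSolution_iff_stepForm {D : Set E3} (hD : IsOpen D) (hb : Bornology.IsBounded D)
    {Gf : ℕ → L2V D} {c : ℕ → ℝ} (hc : NoiseBound Gf c)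
    {θ τ : ℝ} {m g v : L2V D} (hm : ∀ᵐ x ∂volume.restrict D, ‖m x‖ = 1) :
    IsStepSolution D θ τ Gf m g v ↔ jet D v ∈ tangentJets D m ∧ ∀ q ∈ tangentJets D m,
      stepForm θ τ m (jet D v) q = stepFunctional τ (noiseOp hc) m g q := by
  have h0 : ∀ φ, jet D φ ∈ tangentJets D m ↔ MemTangent D m φ := fun φ =>
    ⟨fun h => ((mem_tangentJets_iff hD hb hm).1 h).1, jet_mem_tangentJets hD hb hm⟩
  rw [isStepSolution_iff hc hm, h0]
  refine and_congr_right fun _ => ⟨fun h q hq => ?_, fun h φ hφ => ?_⟩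
  · have e := eq_jet_of_mem_tangentJets hD hb hq
    rw [e] at hq
    rw [e]
    rw [← sub_eq_zero, stepForm_sub_stepFunctional]
    exact h _ ((h0 _).1 hq)
  · rw [← stepForm_sub_stepFunctional, sub_eq_zero]
    exact h _ ((h0 _).2 hφ)

/-- Lax-Milgram on the Hilbert space of tangent jets, which is closed because weak derivatives and
tangency are closed conditions. -/
lemma exists_isStepSolution {D : Set E3} (hD : IsOpen D) (hb : Bornology.IsBounded D)
    {Gf : ℕ → L2V D} {c : ℕ → ℝ} (hc : NoiseBound Gf c) {θ τ : ℝ} (hθ : 0 < θ) (hτ : 0 < τ)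
    {m : L2V D} (hm : ∀ᵐ x ∂volume.restrict D, ‖m x‖ = 1) (g : L2V D) :
    ∃ v, IsStepSolution D θ τ Gf m g v := by
  set W := tangentJets D m
  have : CompleteSpace W := (isClosed_tangentJets D m).completeSpace_coe
  set B : W →L[ℝ] W →L[ℝ] ℝ := (stepForm θ τ m).bilinearComp W.subtypeL W.subtypeL
  have hBa : ∀ p q : W, B p q = stepForm θ τ m p q := fun _ _ => rfl
  have hco : IsCoercive B :=
    ⟨min 1 (2 * τ * θ), by positivity, fun p => stepForm_coercive m (p : Jet D)⟩
  set ℓ : W →L[ℝ] ℝ := stepFunctional τ (noiseOp hc) m g ∘L W.subtypeL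
  set p : W := hco.continuousLinearEquivOfBilin.symm ((InnerProductSpace.toDual ℝ W).symm ℓ)
  have hp : ∀ q : W, B p q = ℓ q := fun q => by
    rw [← hco.continuousLinearEquivOfBilin_apply, ContinuousLinearEquiv.apply_symm_apply,
      InnerProductSpace.toDual_symm_apply]
  have hpj := eq_jet_of_mem_tangentJets hD hb p.2
  refine ⟨(p : Jet D) none, (isStepSolution_iff_stepForm hD hb hc hm).2 ?_⟩
  rw [← hpj]
  exact ⟨p.2, fun q hq => hp ⟨q, hq⟩⟩

lemma IsStepSolution.unique {D : Set E3} (hD : IsOpen D) (hb : Bornology.IsBounded D)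
    {Gf : ℕ → L2V D} {c : ℕ → ℝ} (hc : NoiseBound Gf c) {θ τ : ℝ} (hθ : 0 < θ) (hτ : 0 < τ)
    {m g v v' : L2V D} (hm : ∀ᵐ x ∂volume.restrict D, ‖m x‖ = 1)
    (h : IsStepSolution D θ τ Gf m g v) (h' : IsStepSolution D θ τ Gf m g v') : v = v' := by
  rw [isStepSolution_iff_stepForm hD hb hc hm] at h h'
  have ht := (tangentJets D m).sub_mem h.1 h'.1
  have h1 : stepForm θ τ m (jet D v - jet D v') (jet D v - jet D v') = 0 := by
    rw [(stepForm θ τ m).map_sub (jet D v), _root_.sub_apply, h.2 _ ht, h'.2 _ ht, sub_self]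
  have h2 := stepForm_coercive (θ := θ) (τ := τ) m (jet D v - jet D v')
  rw [h1, mul_assoc] at h2
  have h3 : (0 : ℝ) < min 1 (2 * τ * θ) := by positivity
  have h4 := nonpos_of_mul_nonpos_right h2 h3
  have h5 : ‖jet D v - jet D v'‖ = 0 := mul_self_eq_zero.1 (le_antisymm h4 (mul_self_nonneg _))
  have h6 : jet D v = jet D v' := sub_eq_zero.1 (norm_eq_zero.1 h5)
  exact congrArg (fun p : Jet D => p none) h6

lemma stepSolution_spec {D : Set E3} (hD : IsOpen D) (hb : Bornology.IsBounded D)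
    {Gf : ℕ → L2V D} {c : ℕ → ℝ} (hc : NoiseBound Gf c) {θ τ : ℝ} (hθ : 0 < θ) (hτ : 0 < τ)
    {m : L2V D} (hm : ∀ᵐ x ∂volume.restrict D, ‖m x‖ = 1) (g : L2V D) :
    IsStepSolution D θ τ Gf m g (stepSolution D θ τ Gf m g) := by
  have h := exists_isStepSolution hD hb hc hθ hτ hm g
  rw [stepSolution, dif_pos h]
  exact h.choose_spec

/-! ### Weak convergence of gradients, truncation -/

/-- The vectors `y` for which the convergence holds form a subspace, closed because `x n` is bounded
and dense because it contains a total set. -/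
lemma tendsto_inner_of_total {H : Type*} [NormedAddCommGroup H] [InnerProductSpace ℝ H]
    [CompleteSpace H] {S : Set H} (hS : ∀ z : H, (∀ s ∈ S, inner ℝ z s = 0) → z = 0)
    {x : ℕ → H} {x' : H} {C : ℝ} (hC : ∀ n, ‖x n‖ ≤ C)
    (h : ∀ s ∈ S, Tendsto (fun n => inner ℝ (x n) s) atTop (𝓝 (inner ℝ x' s))) (y : H) :
    Tendsto (fun n => inner ℝ (x n) y) atTop (𝓝 (inner ℝ x' y)) := by
  set V : Submodule ℝ H :=
    { carrier := {y | Tendsto (fun n => inner ℝ (x n) y) atTop (𝓝 (inner ℝ x' y))}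
      add_mem' := fun {a b} ha hb => by
        simpa only [mem_ofPred_eq, inner_add_right] using ha.add hb
      zero_mem' := by simp
      smul_mem' := fun r a ha => by
        simpa only [mem_ofPred_eq, real_inner_smul_right] using ha.const_mul r } with hV
  have hcl : IsClosed (V : Set H) := by
    refine isClosed_of_closure_subset fun y hy => ?_
    change Tendsto _ _ _
    rw [Metric.tendsto_atTop]
    intro ε hε
    have hC0 : 0 ≤ C := (norm_nonneg _).trans (hC 0)
    set M := C + ‖x'‖ + 1
    have hM : 0 < M := by positivity
    obtain ⟨z, hz, hyz⟩ := Metric.mem_closure_iff.1 hy (ε / (2 * M)) (by positivity)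
    obtain ⟨N, hN⟩ := Metric.tendsto_atTop.1 (show Tendsto _ _ _ from hz) (ε / 2) (by positivity)
    refine ⟨N, fun n hn => ?_⟩
    have h1 := hN n hn
    rw [Real.dist_eq] at h1 ⊢
    have e : inner ℝ (x n) y - inner ℝ x' y =
        (inner ℝ (x n) z - inner ℝ x' z) + inner ℝ (x n - x') (y - z) := by
      rw [inner_sub_left, inner_sub_right, inner_sub_right]; ring
    rw [e]
    have h2 : |inner ℝ (x n - x') (y - z)| ≤ M * ‖y - z‖ := by
      refine (abs_real_inner_le_norm _ _).trans (mul_le_mul_of_nonneg_right ?_ (norm_nonneg _))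
      exact (norm_sub_le _ _).trans (by have := hC n; simp only [M]; linarith)
    rw [dist_eq_norm] at hyz
    have h3 : M * ‖y - z‖ < ε / 2 := by
      have := mul_lt_mul_of_pos_left hyz hM
      rwa [show M * (ε / (2 * M)) = ε / 2 by field_simp] at this
    exact (abs_add_le _ _).trans_lt (by linarith)
  have : CompleteSpace V := hcl.completeSpace_coe
  have htop : V = ⊤ := by
    rw [← Submodule.orthogonal_eq_bot_iff, Submodule.eq_bot_iff]
    intro z hz
    refine hS z fun s hs => ?_
    rw [real_inner_comm]
    exact hz s (h s hs)
  exact (htop ▸ Submodule.mem_top : y ∈ V)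

/-- Strong convergence of `u` gives convergence against test fields. These are total, since a field
orthogonal to all of them is a weak derivative of zero. -/
lemma HasWeakPartial.tendsto_inner {D : Set E3} (hD : IsOpen D) (hb : Bornology.IsBounded D)
    {k : Fin 3} {u g : ℕ → L2V D} {u' g' : L2V D} {C : ℝ} (h : ∀ n, HasWeakPartial D k (u n) (g n))
    (h' : HasWeakPartial D k u' g') (hC : ∀ n, ‖g n‖ ≤ C) (hu : Tendsto u atTop (𝓝 u'))
    (y : L2V D) : Tendsto (fun n => inner ℝ (g n) y) atTop (𝓝 (inner ℝ g' y)) := by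
  refine tendsto_inner_of_total (S := {b | ∃ a, (a, b) ∈ testPairs D k}) (fun z hz => ?_) hC
    (fun s ⟨a, ha⟩ => ?_) y
  · refine HasWeakPartial.unique hD hb (k := k) (u := 0) ?_ hasWeakPartial_zero
    rw [hasWeakPartial_iff]
    intro p hp
    rw [inner_zero_left, zero_add]
    exact hz _ ⟨p.1, hp⟩
  · have h1 : ∀ n, inner ℝ (g n) s = -inner ℝ (u n) a := fun n =>
      eq_neg_of_add_eq_zero_right (hasWeakPartial_iff.1 (h n) _ ha)
    have h2 : inner ℝ g' s = -inner ℝ u' a :=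
      eq_neg_of_add_eq_zero_right (hasWeakPartial_iff.1 h' _ ha)
    simp only [h1, h2]
    exact (hu.inner tendsto_const_nhds).neg

/-- The truncation of a field at level `R`. -/
def truncate {D : Set E3} (R : ℝ) (u : L2V D) : L2V D := R • ballProjL2 (R⁻¹ • u)

lemma coeFn_truncate {D : Set E3} (R : ℝ) (u : L2V D) :
    truncate R u =ᵐ[volume.restrict D] fun x => R • ballProj (R⁻¹ • u x) := by
  filter_upwards [Lp.coeFn_smul R (ballProjL2 (R⁻¹ • u)), coeFn_ballProjL2 (R⁻¹ • u),
    Lp.coeFn_smul R⁻¹ u] with x h1 h2 h3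
  rw [truncate, h1, Pi.smul_apply, h2, h3, Pi.smul_apply]

lemma norm_truncate_le {D : Set E3} {R : ℝ} (hR : 0 < R) (u : L2V D) :
    ∀ᵐ x ∂volume.restrict D, ‖truncate R u x‖ ≤ R := by
  filter_upwards [coeFn_truncate R u] with x hx
  rw [hx, norm_smul, Real.norm_of_nonneg hR.le]
  exact mul_le_of_le_one_right hR.le (norm_ballProj_le _)

lemma exists_hasWeakPartial_truncate {D : Set E3} (hD : IsOpen D) (hb : Bornology.IsBounded D)
    {k : Fin 3} {u g : L2V D} (h : HasWeakPartial D k u g) {R : ℝ} (hR : 0 < R) :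
    ∃ g', HasWeakPartial D k (truncate R u) g' ∧ ‖g'‖ ≤ ‖g‖ := by
  obtain ⟨g', h1, h2⟩ := exists_hasWeakPartial_ballProjL2 hD hb (h.smul R⁻¹)
  refine ⟨R • g', h1.smul R, ?_⟩
  rw [norm_smul, Real.norm_of_nonneg (inv_nonneg.2 hR.le)] at h2
  rw [norm_smul, Real.norm_of_nonneg hR.le]
  calc R * ‖g'‖ ≤ R * (R⁻¹ * ‖g‖) := mul_le_mul_of_nonneg_left h2 hR.le
    _ = ‖g‖ := by field_simp

lemma tendsto_truncate {D : Set E3} (u : L2V D) :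
    Tendsto (fun n : ℕ => truncate ((n : ℝ) + 1) u) atTop (𝓝 u) := by
  refine tendsto_Lp_of_dominated ((2 : ℝ) • u) (fun n => ?_) ?_
  · filter_upwards [coeFn_truncate ((n : ℝ) + 1) u, Lp.coeFn_smul (2 : ℝ) u] with x h1 h3
    rw [h1, h3, Pi.smul_apply, norm_smul, Real.norm_eq_abs, abs_two, two_mul]
    refine (norm_sub_le _ _).trans (add_le_add ?_ le_rfl)
    have h4 := lipschitzWith_ballProj.dist_le_mul (((n : ℝ) + 1)⁻¹ • u x) 0
    have hn : (0 : ℝ) < (n : ℝ) + 1 := by positivity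
    rw [ballProj_zero, dist_zero_right, dist_zero_right, NNReal.coe_one, one_mul, norm_smul,
      Real.norm_of_nonneg (inv_nonneg.2 hn.le)] at h4
    rw [norm_smul, Real.norm_of_nonneg hn.le]
    calc _ ≤ ((n : ℝ) + 1) * (((n : ℝ) + 1)⁻¹ * ‖u x‖) := mul_le_mul_of_nonneg_left h4 hn.le
      _ = ‖u x‖ := by field_simp
  · filter_upwards [ae_all_iff.2 fun n : ℕ => coeFn_truncate ((n : ℝ) + 1) u] with x hx
    refine tendsto_const_nhds.congr' ?_
    filter_upwards [eventually_ge_atTop ⌈‖u x‖⌉₊] with n hn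
    have hn0 : (0 : ℝ) < (n : ℝ) + 1 := by positivity
    have h1 : ‖u x‖ ≤ (n : ℝ) + 1 :=
      (Nat.le_ceil _).trans (by exact_mod_cast hn.trans (Nat.le_succ n))
    rw [hx, ballProj_of_norm_le, smul_smul, mul_inv_cancel₀ hn0.ne', one_smul]
    rw [norm_smul, Real.norm_of_nonneg (inv_nonneg.2 hn0.le)]
    rwa [inv_mul_le_iff₀ hn0, mul_one]

lemma inner_truncate_eq_zero {D : Set E3} {m u : L2V D} (R : ℝ)
    (h : ∀ᵐ x ∂volume.restrict D, inner ℝ (u x) (m x) = 0) :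
    ∀ᵐ x ∂volume.restrict D, inner ℝ (truncate R u x) (m x) = 0 := by
  filter_upwards [coeFn_truncate R u, h] with x h1 h2
  rw [h1, ballProj]
  simp only [real_inner_smul_left, h2, mul_zero]

/-- It suffices to test the variational problem with the fields `m × ψ`, `ψ` bounded. -/
lemma isStepSolution_of_bounded {D : Set E3} (hD : IsOpen D) (hb : Bornology.IsBounded D)
    {Gf : ℕ → L2V D} {c : ℕ → ℝ} (hc : NoiseBound Gf c) {θ τ : ℝ} {m g v : L2V D}
    (hm : IsUnitField D m) (hv : MemTangent D m v)
    (h : ∀ (ψ : L2V D) (R : ℝ) (hψ : ∀ᵐ x ∂volume.restrict D, ‖ψ x‖ ≤ R), MemH1 D ψ →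
      inner ℝ (stepResidual τ (noiseOp hc) m g v) (crossV m ψ) + 2 * τ * ∑ k,
        inner ℝ (weakPartial D k m + θ • weakPartial D k v)
          (crossBdd hψ (weakPartial D k m) + crossV m (weakPartial D k ψ)) = 0) :
    IsStepSolution D θ τ Gf m g v := by
  refine (isStepSolution_iff hc hm.2).2 ⟨hv, fun φ hφ => ?_⟩
  have hR : ∀ n : ℕ, (0 : ℝ) < (n : ℝ) + 1 := fun n => by positivity
  choose d hd hdn using fun (n : ℕ) (k : Fin 3) =>
    exists_hasWeakPartial_truncate hD hb (hφ.1.hasWeakPartial k) (hR n)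
  -- Radial truncation keeps `φ` tangent to `m` and does not increase the norm of its gradient, so
  -- the truncated fields converge strongly and their gradients weakly.
  set F : ℕ → L2V D := fun n => truncate ((n : ℝ) + 1) φ with hF
  have hFt : Tendsto F atTop (𝓝 φ) := tendsto_truncate φ
  have hFp : ∀ n, crossV m (crossV m (F n)) = -F n := fun n =>
    (crossV_crossV_eq_neg_iff hm.2).2 (inner_truncate_eq_zero _ hφ.2)
  have hFb : ∀ n : ℕ, ∀ᵐ x ∂volume.restrict D, ‖F n x‖ ≤ (n : ℝ) + 1 := fun n =>
    norm_truncate_le (hR n) φ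
  have hψ1 : ∀ (n : ℕ) k, HasWeakPartial D k (crossV m (F n))
      (crossBdd (hFb n) (weakPartial D k m) + crossV m (d n k)) := fun n k =>
    (hm.1.hasWeakPartial k).crossV_bdd hD hb hm.2 (hFb n) (hd n k)
  -- The test field is `ψ = -m × F n`; since `F n ⟂ m`, this gives `m × ψ = F n`.
  have hψb : ∀ n : ℕ, ∀ᵐ x ∂volume.restrict D, ‖((-1 : ℝ) • crossV m (F n)) x‖ ≤ (n : ℝ) + 1 :=
    fun n => by
      filter_upwards [hFb n, coeFn_crossV hm.2 (F n), hm.2,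
        Lp.coeFn_smul (-1 : ℝ) (crossV m (F n))] with x h1 h2 h3 h4
      rw [h4, Pi.smul_apply, norm_smul, h2]
      have := norm_cross_le (m x) (F n x)
      rw [h3, one_mul] at this
      simpa using this.trans h1
  have hψH : ∀ n : ℕ, MemH1 D ((-1 : ℝ) • crossV m (F n)) := fun n k => ⟨_, (hψ1 n k).smul _⟩
  have e1 : ∀ n, crossV m ((-1 : ℝ) • crossV m (F n)) = F n := fun n => by
    rw [crossV_smul, hFp, neg_one_smul, neg_neg]
  have e2 : ∀ n k, crossBdd (hψb n) (weakPartial D k m)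
      + crossV m (weakPartial D k ((-1 : ℝ) • crossV m (F n))) = d n k := fun n k => by
    have h1 := (hm.1.hasWeakPartial k).crossV_bdd hD hb hm.2 (hψb n) ((hψH n).hasWeakPartial k)
    rw [e1] at h1
    exact h1.unique hD hb (hd n k)
  have h0 : ∀ n, inner ℝ (stepResidual τ (noiseOp hc) m g v) (F n) + 2 * τ * ∑ k,
      inner ℝ (weakPartial D k m + θ • weakPartial D k v) (d n k) = 0 := fun n => by
    have := h _ _ (hψb n) (hψH n)
    rw [e1] at this
    simpa only [e2] using this
  have hlim : Tendsto (fun n => inner ℝ (stepResidual τ (noiseOp hc) m g v) (F n) + 2 * τ * ∑ k,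
      inner ℝ (weakPartial D k m + θ • weakPartial D k v) (d n k)) atTop
      (𝓝 (inner ℝ (stepResidual τ (noiseOp hc) m g v) φ + 2 * τ * ∑ k,
      inner ℝ (weakPartial D k m + θ • weakPartial D k v) (weakPartial D k φ))) := by
    refine (tendsto_const_nhds.inner hFt).add (Tendsto.const_mul _ (tendsto_finsetSum _
      fun k _ => ?_))
    have := HasWeakPartial.tendsto_inner hD hb (fun n => hd n k) (hφ.1.hasWeakPartial k)
      (fun n => hdn n k) hFt (weakPartial D k m + θ • weakPartial D k v)
    simpa only [real_inner_comm] using this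
  simp only [h0] at hlim
  exact (tendsto_nhds_unique hlim tendsto_const_nhds)

/-! ### Measurability -/

instance instMeasurableSpaceLp {α H : Type*} [MeasurableSpace α] {μ : Measure α}
    [NormedAddCommGroup H] : MeasurableSpace (Lp H 2 μ) := borel _

instance instBorelSpaceLp {α H : Type*} [MeasurableSpace α] {μ : Measure α}
    [NormedAddCommGroup H] : BorelSpace (Lp H 2 μ) := ⟨rfl⟩

instance instSecondCountableLp {α H : Type*} [MeasurableSpace α] {μ : Measure α}
    [NormedAddCommGroup H] [IsSeparable μ] [TopologicalSpace.SeparableSpace H] :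
    SecondCountableTopology (Lp H 2 μ) := by
  have : Fact ((2 : ℝ≥0∞) ≠ ∞) := ⟨by norm_num⟩
  infer_instance

instance instSecondCountableL2V (D : Set E3) : SecondCountableTopology (L2V D) := inferInstance

instance instSecondCountableL2TV (T : ℝ) (D : Set E3) : SecondCountableTopology (L2TV T D) :=
  inferInstance

/-- A function whose graph is the image of a closed set in a Polish space is measurable. -/
lemma exists_measurable_of_isClosed {Z A B : Type*} [TopologicalSpace Z] [PolishSpace Z]
    [TopologicalSpace A] [T2Space A] [MeasurableSpace A] [BorelSpace A] [TopologicalSpace B]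
    [MeasurableSpace B] [BorelSpace B] [Nonempty B] {S : Set Z} (hS : IsClosed S)
    {p : Z → A} (hp : Continuous p) {q : Z → B} (hq : Continuous q) (hinj : InjOn p S) :
    MeasurableSet (p '' S) ∧ ∃ F : A → B, Measurable F ∧ ∀ z ∈ S, F (p z) = q z := by
  have : PolishSpace S := hS.polishSpace
  let : MeasurableSpace S := borel S
  have : BorelSpace S := ⟨rfl⟩
  have h1 : MeasurableEmbedding (fun z : S => p z) :=
    (hp.comp continuous_subtype_val).measurableEmbedding (injOn_iff_injective.1 hinj)
  obtain ⟨F, hF, h2⟩ := h1.exists_measurable_extend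
    (hq.comp continuous_subtype_val).measurable fun _ => inferInstance
  refine ⟨hS.measurableSet_image_of_continuousOn_injOn hp.continuousOn hinj,
    F, hF, fun z hz => congrFun h2 ⟨z, hz⟩⟩

lemma isClosed_norm_eq_one {D : Set E3} (hb : Bornology.IsBounded D) :
    IsClosed {u : L2V D | ∀ᵐ x ∂volume.restrict D, ‖u x‖ = 1} := by
  have : IsFiniteMeasure (volume.restrict D) := ⟨by
    rw [Measure.restrict_apply_univ]; exact hb.measure_lt_top⟩
  have h0 : LipschitzWith 1 (fun x : E3 => ‖x‖) := lipschitzWith_one_norm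
  have e : {u : L2V D | ∀ᵐ x ∂volume.restrict D, ‖u x‖ = 1} =
      {u : L2V D | h0.compLp norm_zero u = Lp.const 2 (volume.restrict D) (1 : ℝ)} := by
    ext u
    constructor
    · intro h
      refine Lp.ext ?_
      filter_upwards [h0.coeFn_compLp norm_zero u, Lp.coeFn_const 2 (volume.restrict D) (1 : ℝ), h]
        with x h1 h2 h3
      rw [h1, h2]
      exact h3
    · intro h
      have h1 := h0.coeFn_compLp norm_zero u
      rw [show h0.compLp norm_zero u = _ from h] at h1
      filter_upwards [h1, Lp.coeFn_const 2 (volume.restrict D) (1 : ℝ)] with x h1 h2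
      rw [h2] at h1
      exact h1.symm
  rw [e]
  exact isClosed_eq (h0.continuous_compLp norm_zero) continuous_const

lemma continuous_crossV_comp {X : Type*} [TopologicalSpace X] {D : Set E3} {f g : X → L2V D}
    (hf : Continuous f) (hg : Continuous g) : Continuous fun x => crossV (f x) (g x) := by
  have h := Continuous.comp continuous_crossV (hf.prodMk hg)
  exact h

/-- `weakPartial` is defined by choice, so measurability comes from its closed graph, whose
projection to the first factor is injective. -/
lemma exists_measurable_weakPartial {D : Set E3} (hD : IsOpen D) (hb : Bornology.IsBounded D)
    (k : Fin 3) : ∃ F : L2V D → L2V D, Measurable F ∧ ∀ u, MemH1 D u → F u = weakPartial D k u := by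
  obtain ⟨-, F, hF, h⟩ := exists_measurable_of_isClosed (isClosed_hasWeakPartial D k)
    continuous_fst continuous_snd (fun p hp q hq e => Prod.ext e (by
      have hp' : HasWeakPartial D k p.1 p.2 := hp
      have hq' : HasWeakPartial D k q.1 q.2 := hq
      rw [← e] at hq'
      exact hp'.unique hD hb hq'))
  exact ⟨F, hF, fun u hu => h (u, _) (hu.hasWeakPartial k)⟩

/-- The space of the data and the solutions of the variational problem. -/
abbrev StepSpace (D : Set E3) : Type :=
  (L2V D × (Fin 3 → L2V D)) × L2V D × (L2V D × (Fin 3 → L2V D))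

instance instPolishSpaceStepSpace (D : Set E3) : PolishSpace (StepSpace D) :=
  inferInstance

/-- The jets of the unit fields, the noise increments, and the jets of the solutions of the
variational problem. -/
def stepGraph {D : Set E3} (θ τ : ℝ) (K : L2V D →L[ℝ] L2V D) :
    Set (StepSpace D) :=
  {z | (∀ k, HasWeakPartial D k z.1.1 (z.1.2 k)) ∧ (∀ᵐ x ∂volume.restrict D, ‖z.1.1 x‖ = 1) ∧
    (∀ k, HasWeakPartial D k z.2.2.1 (z.2.2.2 k)) ∧
    crossV z.1.1 (crossV z.1.1 z.2.2.1) = -z.2.2.1 ∧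
    ∀ (ψ : L2V D) (R : ℝ) (hψ : ∀ᵐ x ∂volume.restrict D, ‖ψ x‖ ≤ R), MemH1 D ψ →
      inner ℝ (stepResidual τ K z.1.1 z.2.1 z.2.2.1) (crossV z.1.1 ψ) + 2 * τ * ∑ k,
        inner ℝ (z.1.2 k + θ • z.2.2.2 k)
          (crossBdd hψ (z.1.2 k) + crossV z.1.1 (weakPartial D k ψ)) = 0}

section

variable {D : Set E3} {X : Type*} [TopologicalSpace X]

lemma continuous_stepResidual {m g v : X → L2V D} (hm : Continuous m) (hg : Continuous g)
    (hv : Continuous v) (τ : ℝ) (K : L2V D →L[ℝ] L2V D) :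
    Continuous fun x => stepResidual τ K (m x) (g x) (v x) := by
  have h0 : Continuous fun x => v x - crossV (m x) (g x) - (τ / 2) • K (m x) :=
    (hv.sub (continuous_crossV_comp hm hg)).sub ((K.continuous.comp hm).const_smul (τ / 2))
  unfold stepResidual
  exact h0.sub (continuous_crossV_comp hm h0)

lemma isClosed_forall_hasWeakPartial {m : X → L2V D} {dm : X → Fin 3 → L2V D}
    (hm : Continuous m) (hdm : Continuous dm) :
    IsClosed {x | ∀ k, HasWeakPartial D k (m x) (dm x k)} := by
  rw [ofPred_forall]
  exact isClosed_iInter fun k => (isClosed_hasWeakPartial D k).preimage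
    (hm.prodMk ((continuous_apply k).comp hdm))

lemma isClosed_bounded_tests {m : X → L2V D} {dm dv : X → Fin 3 → L2V D} {r : X → L2V D}
    (hm : Continuous m) (hr : Continuous r) (hdm : Continuous dm) (hdv : Continuous dv)
    (θ τ : ℝ) :
    IsClosed {x | ∀ (ψ : L2V D) (R : ℝ) (hψ : ∀ᵐ x ∂volume.restrict D, ‖ψ x‖ ≤ R), MemH1 D ψ →
      inner ℝ (r x) (crossV (m x) ψ) + 2 * τ * ∑ k, inner ℝ (dm x k + θ • dv x k)
        (crossBdd hψ (dm x k) + crossV (m x) (weakPartial D k ψ)) = 0} := by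
  simp only [ofPred_forall]
  refine isClosed_iInter fun ψ => isClosed_iInter fun R => isClosed_iInter fun hψ =>
    isClosed_iInter fun _ => isClosed_eq ?_ continuous_const
  refine (hr.inner (continuous_crossV_comp hm continuous_const)).add (continuous_const.mul
    (continuous_finsetSum _ fun k _ => ?_))
  have h1 : Continuous fun x => dm x k := (continuous_apply k).comp hdm
  have h2 : Continuous fun x => dv x k := (continuous_apply k).comp hdv
  exact (h1.add (h2.const_smul θ)).inner
    (((crossBdd hψ).continuous.comp h1).add (continuous_crossV_comp hm continuous_const))

end

/-- With `ψ` bounded, `∂m × ψ` depends continuously on `∂m` in `L²`, so each tested identity is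
closed. Tangent test fields would not do, since the set of them varies with `m`;
`isStepSolution_of_bounded` shows that nothing is lost. -/
lemma isClosed_stepGraph {D : Set E3} (hb : Bornology.IsBounded D) (θ τ : ℝ)
    (K : L2V D →L[ℝ] L2V D) : IsClosed (stepGraph θ τ K) := by
  have hm : Continuous fun z : StepSpace D => z.1.1 := continuous_fst.fst
  have hdm : Continuous fun z : StepSpace D => z.1.2 := continuous_fst.snd
  have hg : Continuous fun z : StepSpace D => z.2.1 := continuous_snd.fst
  have hv : Continuous fun z : StepSpace D => z.2.2.1 := continuous_snd.snd.fst
  have hdv : Continuous fun z : StepSpace D => z.2.2.2 := continuous_snd.snd.snd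
  refine (isClosed_forall_hasWeakPartial hm hdm).inter
    (((isClosed_norm_eq_one hb).preimage hm).inter ((isClosed_forall_hasWeakPartial hv hdv).inter
    (IsClosed.inter (isClosed_eq (continuous_crossV_comp hm (continuous_crossV_comp hm hv)) hv.neg)
    (isClosed_bounded_tests hm (continuous_stepResidual hm hg hv τ K)
      hdm hdv θ τ))))

/-- The one step map is Borel measurable. -/
lemma exists_measurable_stepSolution {D : Set E3} (hD : IsOpen D) (hb : Bornology.IsBounded D)
    {Gf : ℕ → L2V D} {c : ℕ → ℝ} (hc : NoiseBound Gf c) {θ τ : ℝ} (hθ : 0 < θ) (hτ : 0 < τ) :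
    MeasurableSet {m : L2V D | IsUnitField D m} ∧
    ∃ F : L2V D × L2V D → L2V D, Measurable F ∧
      ∀ m g, IsUnitField D m → F (m, g) = stepSolution D θ τ Gf m g := by
  have hu : ∀ z ∈ stepGraph θ τ (noiseOp hc), IsUnitField D z.1.1 ∧
      (∀ k, z.1.2 k = weakPartial D k z.1.1) ∧ (∀ k, z.2.2.2 k = weakPartial D k z.2.2.1) ∧
      IsStepSolution D θ τ Gf z.1.1 z.2.1 z.2.2.1 := by
    rintro z ⟨h1, h2, h3, h4, h5⟩
    have e1 : ∀ k, z.1.2 k = weakPartial D k z.1.1 := fun k => ((h1 k).weakPartial_eq hD hb).symm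
    have e3 : ∀ k, z.2.2.2 k = weakPartial D k z.2.2.1 :=
      fun k => ((h3 k).weakPartial_eq hD hb).symm
    have hm : IsUnitField D z.1.1 := ⟨fun k => ⟨_, h1 k⟩, h2⟩
    refine ⟨hm, e1, e3, isStepSolution_of_bounded hD hb hc hm
      ⟨fun k => ⟨_, h3 k⟩, (crossV_crossV_eq_neg_iff h2).1 h4⟩ fun ψ R hψ hH => ?_⟩
    simpa only [e1, e3] using h5 ψ R hψ hH
  have hex : ∀ m g : L2V D, IsUnitField D m →
      ((m, fun k => weakPartial D k m), g, (stepSolution D θ τ Gf m g,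
        fun k => weakPartial D k (stepSolution D θ τ Gf m g))) ∈ stepGraph θ τ (noiseOp hc) := by
    intro m g hm
    have hs := stepSolution_spec hD hb hc hθ hτ hm.2 g
    obtain ⟨h1, h2⟩ := (isStepSolution_iff hc hm.2).1 hs
    refine ⟨hm.1.hasWeakPartial, hm.2, h1.1.hasWeakPartial,
      (crossV_crossV_eq_neg_iff hm.2).2 h1.2, fun ψ R hψ hH => ?_⟩
    have h3 : ∀ k, HasWeakPartial D k (crossV m ψ) _ := fun k =>
      (hm.1.hasWeakPartial k).crossV_bdd hD hb hm.2 hψ (hH.hasWeakPartial k)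
    have h4 := h2 (crossV m ψ) ⟨fun k => ⟨_, h3 k⟩, by
      filter_upwards [coeFn_crossV hm.2 ψ] with x hx
      rw [hx, inner_cross_self_left]⟩
    simpa only [(h3 _).weakPartial_eq hD hb] using h4
  -- The state and the increment determine the solution, and all gradient coordinates are determined
  -- by their fields.
  have hinj : InjOn (fun z : StepSpace D =>
      (z.1.1, z.2.1)) (stepGraph θ τ (noiseOp hc)) := by
    rintro z hz z' hz' e
    obtain ⟨a1, a2, a3, a4⟩ := hu z hz
    obtain ⟨b1, b2, b3, b4⟩ := hu z' hz'
    have e1 : z.1.1 = z'.1.1 := (Prod.ext_iff.1 e).1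
    have e2 : z.2.1 = z'.2.1 := (Prod.ext_iff.1 e).2
    rw [e1, e2] at a4
    have e3 : z.2.2.1 = z'.2.2.1 := a4.unique hD hb hc hθ hτ b1.2 b4
    refine Prod.ext (Prod.ext e1 (funext fun k => ?_)) (Prod.ext e2 (Prod.ext e3
      (funext fun k => ?_)))
    · rw [a2, b2, e1]
    · rw [a3, b3, e3]
  obtain ⟨h1, F, hF, h2⟩ := exists_measurable_of_isClosed (isClosed_stepGraph hb θ τ (noiseOp hc))
    (p := fun z => (z.1.1, z.2.1)) (q := fun z => z.2.2.1) (by fun_prop) (by fun_prop) hinj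
  refine ⟨?_, F, hF, fun m g hm => h2 _ (hex m g hm)⟩
  have h3 : {m : L2V D | IsUnitField D m} = (fun m => (m, (0 : L2V D))) ⁻¹'
      ((fun z : StepSpace D =>
        (z.1.1, z.2.1)) '' stepGraph θ τ (noiseOp hc)) := by
    ext m
    constructor
    · intro hm
      exact ⟨_, hex m 0 hm, rfl⟩
    · rintro ⟨z, hz, e⟩
      have e1 : z.1.1 = m := (Prod.ext_iff.1 e).1
      have := (hu z hz).1
      rwa [e1] at this
  rw [h3]
  exact (measurable_id.prodMk measurable_const) h1

/-! ### The space `H²(D)³` -/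

/-- A field with its first and second weak partial derivatives. -/
abbrev Jet2 (D : Set E3) : Type :=
  PiLp 2 fun _ : Option (Fin 3 ⊕ Fin 3 × Fin 3) => L2V D

/-- The space `H²(D)³`, as a space of jets. -/
def h2Space (D : Set E3) : Submodule ℝ (Jet2 D) where
  carrier := {p | (∀ k, HasWeakPartial D k (p none) (p (some (.inl k)))) ∧
    ∀ k l, HasWeakPartial D l (p (some (.inl k))) (p (some (.inr (k, l))))}
  add_mem' := fun hp hq => ⟨fun k => (hp.1 k).add (hq.1 k), fun k l => (hp.2 k l).add (hq.2 k l)⟩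
  zero_mem' := ⟨fun _ => hasWeakPartial_zero, fun _ _ => hasWeakPartial_zero⟩
  smul_mem' := fun r _ hp => ⟨fun k => (hp.1 k).smul r, fun k l => (hp.2 k l).smul r⟩

lemma isClosed_h2Space (D : Set E3) : IsClosed (h2Space D : Set (Jet2 D)) := by
  have h1 : ∀ i, Continuous fun p : Jet2 D => p i := fun i => PiLp.continuous_apply 2 _ i
  refine IsClosed.inter (?_ : IsClosed {p : Jet2 D | ∀ k, _})
    (?_ : IsClosed {p : Jet2 D | ∀ k l, _})
  · rw [ofPred_forall]
    exact isClosed_iInter fun k => (isClosed_hasWeakPartial D k).preimage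
      ((h1 none).prodMk (h1 _))
  · simp only [ofPred_forall]
    exact isClosed_iInter fun k => isClosed_iInter fun l => (isClosed_hasWeakPartial D l).preimage
      ((h1 _).prodMk (h1 _))

lemma exists_sobolev_const_h2Space {D : Set E3} (hD : IsOpen D) (hb : Bornology.IsBounded D)
    (hcone : ConeCondition D) :
    ∃ C, 0 ≤ C ∧ ∀ p ∈ h2Space D, ∀ᵐ x ∂volume.restrict D, ‖p none x‖ ≤ C * ‖p‖ := by
  obtain ⟨C, hC, h⟩ := exists_sobolev_const hD hb hcone
  -- A jet has `1 + 3 + 9` components.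
  refine ⟨C * 13, by positivity, fun p hp => ?_⟩
  filter_upwards [h (p none) (fun k => p (some (.inl k))) (fun k l => p (some (.inr (k, l))))
    hp.1 hp.2] with x hx
  refine hx.trans ?_
  rw [mul_assoc]
  refine mul_le_mul_of_nonneg_left ?_ hC
  have h1 : ∀ i, ‖p i‖ ≤ ‖p‖ := fun i => PiLp.norm_apply_le p i
  have h2 : ∑ k : Fin 3, ‖p (some (.inl k))‖ ≤ 3 * ‖p‖ :=
    (Finset.sum_le_sum fun k _ => h1 _).trans (by simp)
  have h3 : ∑ k : Fin 3, ∑ l : Fin 3, ‖p (some (.inr (k, l)))‖ ≤ 9 * ‖p‖ :=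
    (Finset.sum_le_sum fun k _ => Finset.sum_le_sum fun l _ => h1 _).trans
      (by simp; linarith)
  linarith [h1 none]

/-- The jet of a field in `H²(D)³`. -/
def jet2 (D : Set E3) (u : L2V D) : Jet2 D := WithLp.toLp 2 fun i => i.elim u
  (Sum.elim (fun k => weakPartial D k u) fun p => weakPartial D p.2 (weakPartial D p.1 u))

lemma jet2_mem {D : Set E3} {u : L2V D} (h : MemH2 D u) : jet2 D u ∈ h2Space D :=
  ⟨fun k => h.1.hasWeakPartial k, fun k l => (h.2 k).hasWeakPartial l⟩

lemma norm_jet2_sq (D : Set E3) (u : L2V D) : ‖jet2 D u‖ ^ 2 = normSqH2 D u := by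
  rw [PiLp.norm_sq_eq_of_L2, Fintype.sum_option, Fintype.sum_sum_type, Fintype.sum_prod_type,
    normSqH2, add_assoc]
  rfl

/-! ### The energy estimate for one step -/

/-- The Dirichlet energy. -/
def gradSq (D : Set E3) (u : L2V D) : ℝ := ∑ k, ‖weakPartial D k u‖ ^ 2

lemma gradSq_nonneg (D : Set E3) (u : L2V D) : 0 ≤ gradSq D u :=
  Finset.sum_nonneg fun _ _ => sq_nonneg _

lemma MemH1.weakPartial_sub {D : Set E3} (hD : IsOpen D) (hb : Bornology.IsBounded D)
    {u v : L2V D} (hu : MemH1 D u) (hv : MemH1 D v) (k : Fin 3) :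
    weakPartial D k (u - v) = weakPartial D k u - weakPartial D k v :=
  ((hu.hasWeakPartial k).sub (hv.hasWeakPartial k)).weakPartial_eq hD hb

lemma inner_crossBdd_self {D : Set E3} {ψ : L2V D} {R : ℝ}
    (hψ : ∀ᵐ x ∂volume.restrict D, ‖ψ x‖ ≤ R) (u : L2V D) : inner ℝ u (crossBdd hψ u) = 0 := by
  rw [L2.inner_def, integral_eq_zero_of_ae]
  filter_upwards [coeFn_crossBdd hψ u] with x hx
  rw [hx, real_inner_comm, inner_cross_self_left, Pi.zero_apply]

lemma norm_sq_of_unit {D : Set E3} {m : L2V D} (hm : ∀ᵐ x ∂volume.restrict D, ‖m x‖ = 1) :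
    ‖m‖ ^ 2 = (volume.restrict D).real univ := by
  rw [← real_inner_self_eq_norm_sq, L2.inner_def,
    integral_congr_ae (g := fun _ => (1 : ℝ)) (by
      filter_upwards [hm] with x hx
      rw [real_inner_self_eq_norm_sq, hx, one_pow])]
  simp

/-- Normalization of a tangential update. -/
lemma normalizeL2_add {D : Set E3} {m v : L2V D} (hm : ∀ᵐ x ∂volume.restrict D, ‖m x‖ = 1)
    (hv : ∀ᵐ x ∂volume.restrict D, inner ℝ (v x) (m x) = 0) :
    normalizeL2 D (m + v) = ballProjL2 (m + v) ∧
      ∀ᵐ x ∂volume.restrict D, ‖normalizeL2 D (m + v) x‖ = 1 := by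
  -- Tangency gives `|m + v|² = 1 + |v|² ≥ 1`, so normalization never divides by zero and agrees
  -- with the retraction onto the ball.
  have h1 : ∀ᵐ x ∂volume.restrict D, 1 ≤ ‖(m + v) x‖ := by
    filter_upwards [hm, hv, Lp.coeFn_add m v] with x h1 h2 h3
    rw [h3, Pi.add_apply]
    have h4 := norm_add_sq_real (m x) (v x)
    rw [real_inner_comm, h2, h1] at h4
    nlinarith [sq_nonneg ‖v x‖, norm_nonneg (m x + v x)]
  have h2 : (fun x => ‖(m + v) x‖⁻¹ • (m + v) x) =ᵐ[volume.restrict D] ballProjL2 (m + v) := by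
    filter_upwards [h1, coeFn_ballProjL2 (m + v)] with x h1 h2
    rw [h2, ballProj_of_one_le h1]
  have h3 : MemLp (fun x => ‖(m + v) x‖⁻¹ • (m + v) x) 2 (volume.restrict D) :=
    (memLp_congr_ae h2).2 (Lp.memLp _)
  have h4 : normalizeL2 D (m + v) = ballProjL2 (m + v) := by
    rw [normalizeL2, dif_pos h3]
    exact Lp.ext (h3.coeFn_toLp.trans h2)
  refine ⟨h4, ?_⟩
  rw [h4]
  filter_upwards [h1, h2] with x h1 h2
  rw [← h2, norm_smul, norm_inv, norm_norm, inv_mul_cancel₀]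
  exact (zero_lt_one.trans_le h1).ne'

/-- Facts about one step that do not involve the variational problem. -/
lemma isUnitField_normalizeL2 {D : Set E3} (hD : IsOpen D) (hb : Bornology.IsBounded D)
    {m v : L2V D} (hm : IsUnitField D m) (hv : MemTangent D m v) :
    IsUnitField D (normalizeL2 D (m + v)) ∧ gradSq D (normalizeL2 D (m + v)) ≤
      ∑ k, ‖weakPartial D k m + weakPartial D k v‖ ^ 2 := by
  obtain ⟨h1, h2⟩ := normalizeL2_add hm.2 hv.2
  have h3 : ∀ k, ∃ g, HasWeakPartial D k (normalizeL2 D (m + v)) g ∧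
      ‖g‖ ≤ ‖weakPartial D k m + weakPartial D k v‖ := fun k => by
    rw [h1]
    exact exists_hasWeakPartial_ballProjL2 hD hb
      ((hm.1.hasWeakPartial k).add (hv.1.hasWeakPartial k))
  choose g hg hgn using h3
  refine ⟨⟨fun k => ⟨_, hg k⟩, h2⟩, Finset.sum_le_sum fun k _ => ?_⟩
  rw [(hg k).weakPartial_eq hD hb]
  exact pow_le_pow_left₀ (norm_nonneg _) (hgn k) 2

/-- The algebra of the energy estimate. -/
lemma energy_algebra {θ τ W a s EM MV MA VV VA AA : ℝ} (hτ : 0 < τ)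
    (heq : τ ^ 2 * W - τ / 2 * (τ * a) + 2 * τ * (MV - MA + θ * VV - θ * VA) = 0)
    (ha : a ≤ W + s) (hVA : 2 * θ * VA ≤ (2 * θ - 1) / 2 * VV + 2 * θ ^ 2 / (2 * θ - 1) * AA) :
    EM + 2 * MV + VV + (2 * θ - 1) / 2 * VV + τ / 2 * W ≤
      EM + 2 * θ ^ 2 / (2 * θ - 1) * AA + 2 * MA + s / 2 * τ := by
  have h1 : τ * W - τ / 2 * a + 2 * (MV - MA + θ * VV - θ * VA) = 0 := by
    have : τ * (τ * W - τ / 2 * a + 2 * (MV - MA + θ * VV - θ * VA)) = 0 := by linarith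
    exact (mul_eq_zero.1 this).resolve_left hτ.ne'
  have h2 := mul_le_mul_of_nonneg_left ha hτ.le
  linarith

/-- Here `∂(m × p) = ∂m × p + m × ∂p`, with `p` bounded by the Sobolev constant. The first part is
orthogonal to `∂m`, so `(∂m, ∂(m × p))` is the linear functional of `∂p` in the third claim; this
term has mean zero later on. -/
lemma gradSq_crossV_le {D : Set E3} (hD : IsOpen D) (hb : Bornology.IsBounded D)
    {C : ℝ}
    (hCb : ∀ p ∈ h2Space D, ∀ᵐ x ∂volume.restrict D, ‖p none x‖ ≤ C * ‖p‖) {m : L2V D}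
    (hm : IsUnitField D m) {p : Jet2 D} (hp : p ∈ h2Space D) :
    MemTangent D m (crossV m (p none)) ∧
    gradSq D (crossV m (p none)) ≤ (2 * C ^ 2 + 2) * (‖p‖ ^ 2 * (1 + gradSq D m)) ∧
    ∀ k, inner ℝ (weakPartial D k m) (weakPartial D k (crossV m (p none)))
      = inner ℝ (weakPartial D k m) (crossV m (p (some (.inl k)))) := by
  have h1 : ∀ k, HasWeakPartial D k (crossV m (p none))
      (crossBdd (hCb p hp) (weakPartial D k m) + crossV m (p (some (.inl k)))) := fun k =>
    (hm.1.hasWeakPartial k).crossV_bdd hD hb hm.2 (hCb p hp) (hp.1 k)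
  refine ⟨⟨fun k => ⟨_, h1 k⟩, ?_⟩, ?_, fun k => ?_⟩
  · filter_upwards [coeFn_crossV hm.2 (p none)] with x hx
    rw [hx, inner_cross_self_left]
  · have h2 : ∀ k, ‖weakPartial D k (crossV m (p none))‖ ^ 2 ≤
        2 * C ^ 2 * ‖p‖ ^ 2 * ‖weakPartial D k m‖ ^ 2 + 2 * ‖p (some (.inl k))‖ ^ 2 := fun k => by
      rw [(h1 k).weakPartial_eq hD hb]
      have h3 := norm_crossBdd_le (hCb p hp) (weakPartial D k m)
      have h4 := norm_crossV_le m (p (some (.inl k)))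
      calc _ ≤ (C * ‖p‖ * ‖weakPartial D k m‖ + ‖p (some (.inl k))‖) ^ 2 :=
            pow_le_pow_left₀ (norm_nonneg _) ((norm_add_le _ _).trans (add_le_add h3 h4)) 2
        _ ≤ _ := by
            nlinarith [sq_nonneg (C * ‖p‖ * ‖weakPartial D k m‖ - ‖p (some (.inl k))‖)]
    have h5 : ∑ k : Fin 3, ‖p (some (.inl k))‖ ^ 2 ≤ ‖p‖ ^ 2 := by
      rw [PiLp.norm_sq_eq_of_L2, Fintype.sum_option, Fintype.sum_sum_type]
      have h6 : 0 ≤ ∑ q : Fin 3 × Fin 3, ‖p (some (.inr q))‖ ^ 2 :=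
        Finset.sum_nonneg fun _ _ => sq_nonneg _
      linarith [sq_nonneg ‖p none‖]
    refine (Finset.sum_le_sum fun k _ => h2 k).trans ?_
    rw [Finset.sum_add_distrib, ← Finset.mul_sum, ← Finset.mul_sum]
    change 2 * C ^ 2 * ‖p‖ ^ 2 * gradSq D m + _ ≤ _
    have h7 := gradSq_nonneg D m
    nlinarith [mul_nonneg (sq_nonneg ‖p‖) h7, mul_nonneg (sq_nonneg C) (sq_nonneg ‖p‖)]
  · rw [(h1 k).weakPartial_eq hD hb, inner_add_right, inner_crossBdd_self, zero_add]

/-- The energy estimate of one step of the scheme. -/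
lemma energy_step {D : Set E3} (hD : IsOpen D) (hb : Bornology.IsBounded D)
    {Gf : ℕ → L2V D} {c : ℕ → ℝ} (hc : NoiseBound Gf c) {C : ℝ}
    (hCb : ∀ p ∈ h2Space D, ∀ᵐ x ∂volume.restrict D, ‖p none x‖ ≤ C * ‖p‖)
    {θ τ : ℝ} (hθ : 1 / 2 < θ) (hτ : 0 < τ)
    {m : L2V D} (hm : IsUnitField D m) {p : Jet2 D} (hp : p ∈ h2Space D) {v : L2V D}
    (hv : IsStepSolution D θ τ Gf m (p none) v) :
    IsUnitField D (normalizeL2 D (m + v)) ∧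
    gradSq D (normalizeL2 D (m + v)) + (2 * θ - 1) / 2 * gradSq D v
      + τ / 2 * ‖τ⁻¹ • (v - crossV m (p none))‖ ^ 2 ≤
    gradSq D m + 2 * θ ^ 2 / (2 * θ - 1) * (2 * C ^ 2 + 2) * (‖p‖ ^ 2 * (1 + gradSq D m))
      + 2 * ∑ k, inner ℝ (weakPartial D k m) (crossV m (p (some (.inl k))))
      + ‖noiseOp hc‖ ^ 2 * (volume.restrict D).real univ / 2 * τ := by
  obtain ⟨hvT, hveq⟩ := (isStepSolution_iff hc hm.2).1 hv
  obtain ⟨hu, hE⟩ := isUnitField_normalizeL2 hD hb hm hvT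
  obtain ⟨hAT, hA, hMA⟩ := gradSq_crossV_le hD hb hCb hm hp
  refine ⟨hu, ?_⟩
  set A := crossV m (p none) with hAdef
  obtain ⟨w, hw⟩ : ∃ w, w = τ⁻¹ • (v - A) := ⟨_, rfl⟩
  rw [← hw]
  have hwv : v - A = τ • w := by rw [hw, smul_smul, mul_inv_cancel₀ hτ.ne', one_smul]
  set S := noiseOp hc m
  have hT : MemTangent D m (v - A) :=
    ⟨fun k => ⟨_, (hvT.1.hasWeakPartial k).sub (hAT.1.hasWeakPartial k)⟩, by
      filter_upwards [hvT.2, hAT.2, Lp.coeFn_sub v A] with x h1 h2 h3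
      rw [h3, Pi.sub_apply, inner_sub_left, h1, h2, sub_zero]⟩
  -- The test field is `v - A = τ w`: it produces `τ² ‖w‖²`, while the noise term `m × g` has been
  -- absorbed into `A`.
  have heq := hveq _ hT
  have hres : inner ℝ (stepResidual τ (noiseOp hc) m (p none) v) (v - A)
      = τ ^ 2 * ‖w‖ ^ 2 - τ / 2 * (τ * inner ℝ (S - crossV m S) w) := by
    have e1 : stepResidual τ (noiseOp hc) m (p none) v
        = (v - A) - crossV m (v - A) - (τ / 2) • (S - crossV m S) := by
      rw [stepResidual, crossV_sub m (v - A), crossV_smul, smul_sub]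
      abel
    rw [e1, inner_sub_left, inner_sub_left, crossV_inner_self, sub_zero, hwv]
    simp only [real_inner_smul_left, real_inner_smul_right]
    rw [real_inner_self_eq_norm_sq]
    ring
  rw [hres] at heq
  have hgrad : ∑ k, inner ℝ (weakPartial D k m + θ • weakPartial D k v) (weakPartial D k (v - A))
      = (∑ k, inner ℝ (weakPartial D k m) (weakPartial D k v))
        - (∑ k, inner ℝ (weakPartial D k m) (crossV m (p (some (.inl k)))))
        + θ * gradSq D v - θ * ∑ k, inner ℝ (weakPartial D k v) (weakPartial D k A) := by
    simp only [hvT.1.weakPartial_sub hD hb hAT.1, inner_add_left, inner_sub_right,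
      real_inner_smul_left, Finset.sum_add_distrib, Finset.sum_sub_distrib, hMA, gradSq,
      real_inner_self_eq_norm_sq, ← Finset.mul_sum]
    ring
  rw [hgrad] at heq
  have ha : inner ℝ (S - crossV m S) w ≤ ‖w‖ ^ 2
      + ‖noiseOp hc‖ ^ 2 * (volume.restrict D).real univ := by
    have h1 := real_inner_le_norm (S - crossV m S) w
    have h2 : ‖S - crossV m S‖ ≤ 2 * ‖S‖ :=
      (norm_sub_le _ _).trans (by linarith [norm_crossV_le m S])
    have h3 : ‖S‖ ^ 2 ≤ ‖noiseOp hc‖ ^ 2 * (volume.restrict D).real univ := by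
      rw [← norm_sq_of_unit hm.2, ← mul_pow]
      exact pow_le_pow_left₀ (norm_nonneg _) ((noiseOp hc).le_opNorm m) 2
    have h4 := mul_le_mul_of_nonneg_right h2 (norm_nonneg w)
    nlinarith [sq_nonneg (‖S‖ - ‖w‖)]
  have hδ : 0 < 2 * θ - 1 := by linarith
  have hVA : 2 * θ * ∑ k, inner ℝ (weakPartial D k v) (weakPartial D k A) ≤
      (2 * θ - 1) / 2 * gradSq D v + 2 * θ ^ 2 / (2 * θ - 1) * gradSq D A := by
    rw [gradSq, gradSq, Finset.mul_sum, Finset.mul_sum, Finset.mul_sum, ← Finset.sum_add_distrib]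
    refine Finset.sum_le_sum fun k _ => ?_
    have h1 := real_inner_le_norm (weakPartial D k v) (weakPartial D k A)
    have h2 : 2 * θ * inner ℝ (weakPartial D k v) (weakPartial D k A) ≤
        2 * θ * (‖weakPartial D k v‖ * ‖weakPartial D k A‖) :=
      mul_le_mul_of_nonneg_left h1 (by linarith)
    refine h2.trans ?_
    set x := ‖weakPartial D k v‖
    set y := ‖weakPartial D k A‖
    -- Young's inequality by a completed square, weighted so that exactly half of the surplus
    -- `(2θ-1) ‖∂v‖²` is spent.
    have h3 : 0 ≤ ((2 * θ - 1) * x - 2 * θ * y) ^ 2 / (2 * (2 * θ - 1)) := by positivity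
    have h4 : ((2 * θ - 1) * x - 2 * θ * y) ^ 2 / (2 * (2 * θ - 1)) =
        (2 * θ - 1) / 2 * x ^ 2 + 2 * θ ^ 2 / (2 * θ - 1) * y ^ 2 - 2 * θ * (x * y) := by
      field_simp
      ring
    linarith
  have key := energy_algebra (EM := gradSq D m) hτ heq ha hVA
  have hE2 : ∑ k, ‖weakPartial D k m + weakPartial D k v‖ ^ 2 = gradSq D m
      + 2 * ∑ k, inner ℝ (weakPartial D k m) (weakPartial D k v) + gradSq D v := by
    simp only [norm_add_sq_real, gradSq, Finset.sum_add_distrib, Finset.mul_sum]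
  have hA2 : 2 * θ ^ 2 / (2 * θ - 1) * gradSq D A ≤
      2 * θ ^ 2 / (2 * θ - 1) * (2 * C ^ 2 + 2) * (‖p‖ ^ 2 * (1 + gradSq D m)) := by
    rw [mul_assoc]
    exact mul_le_mul_of_nonneg_left hA (by positivity)
  linarith

/-! ### Series with uncorrelated random coefficients -/

section Series

variable {Ω : Type*} {mΩ : MeasurableSpace Ω} {P : Measure Ω} {H : Type*} [NormedAddCommGroup H]
  [InnerProductSpace ℝ H]

lemma memLp_smul_vec {f : Ω → ℝ} (hf : MemLp f 2 P) (a : H) : MemLp (fun ω => f ω • a) 2 P := by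
  have h := (ContinuousLinearMap.toSpanSingleton ℝ a).comp_memLp' hf
  simpa [Function.comp_def] using h

lemma inner_toLp_eq {f g : Ω → H} (hf : MemLp f 2 P) (hg : MemLp g 2 P) :
    inner ℝ hf.toLp hg.toLp = ∫ ω, inner ℝ (f ω) (g ω) ∂P := by
  rw [L2.inner_def]
  refine integral_congr_ae ?_
  filter_upwards [hf.coeFn_toLp, hg.coeFn_toLp] with ω h1 h2
  rw [h1, h2]

lemma norm_toLp_sq {f : Ω → H} (hf : MemLp f 2 P) : ‖hf.toLp‖ ^ 2 = ∫ ω, ‖f ω‖ ^ 2 ∂P := by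
  rw [← real_inner_self_eq_norm_sq, inner_toLp_eq hf hf]
  simp only [real_inner_self_eq_norm_sq]

lemma summable_of_pairwise_orthogonal {E : Type*} [NormedAddCommGroup E] [InnerProductSpace ℝ E]
    [CompleteSpace E] {x : ℕ → E} (hxo : ∀ i j, i ≠ j → inner ℝ (x i) (x j) = 0)
    (hsn : Summable fun i => ‖x i‖ ^ 2) :
    Summable x ∧ ∀ s : Finset ℕ, ‖∑ i ∈ s, x i‖ ^ 2 = ∑ i ∈ s, ‖x i‖ ^ 2 := by
  have hV : OrthogonalFamily ℝ (fun i => Submodule.span ℝ {x i})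
      (fun i => (Submodule.span ℝ {x i}).subtypeₗᵢ) := fun i j hij v w => by
    obtain ⟨r, hr⟩ := Submodule.mem_span_singleton.1 v.2
    obtain ⟨s, hs⟩ := Submodule.mem_span_singleton.1 w.2
    change inner ℝ (v : E) (w : E) = 0
    rw [← hr, ← hs, real_inner_smul_left, real_inner_smul_right, hxo i j hij]
    simp
  set f : ∀ i, Submodule.span ℝ {x i} := fun i => ⟨x i, Submodule.mem_span_singleton_self _⟩
  exact ⟨(hV.summable_iff_norm_sq_summable f).2 hsn, fun s => hV.norm_sum f s⟩

/-- The sum of a series with uncorrelated coefficients. -/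
lemma exists_random_series [CompleteSpace H] {𝓖 : MeasurableSpace Ω} (h𝓖 : 𝓖 ≤ mΩ) {ξ : ℕ → Ω → ℝ}
    (hξm : ∀ i, Measurable[𝓖] (ξ i)) (hξ : ∀ i, MemLp (ξ i) 2 P)
    (horth : ∀ i j, i ≠ j → ∫ ω, ξ i ω * ξ j ω ∂P = 0) {τ : ℝ} (hvar : ∀ i, ∫ ω, ξ i ω ^ 2 ∂P ≤ τ)
    {a : ℕ → H} (ha : Summable fun i => ‖a i‖ ^ 2) :
    ∃ y : Ω → H, StronglyMeasurable[𝓖] y ∧ MemLp y 2 P ∧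
      ∫ ω, ‖y ω‖ ^ 2 ∂P ≤ τ * ∑' i, ‖a i‖ ^ 2 ∧
      Tendsto (fun n => eLpNorm (fun ω => y ω - ∑ i ∈ Finset.range n, ξ i ω • a i) 2 P) atTop
        (𝓝 0) := by
  have hx : ∀ i, MemLp (fun ω => ξ i ω • a i) 2 P := fun i => memLp_smul_vec (hξ i) (a i)
  set x : ℕ → Lp H 2 P := fun i => (hx i).toLp with hxdef
  have hxn : ∀ i, ‖x i‖ ^ 2 ≤ τ * ‖a i‖ ^ 2 := fun i => by
    rw [norm_toLp_sq]
    simp only [norm_smul, mul_pow, Real.norm_eq_abs, sq_abs]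
    rw [integral_mul_const]
    exact mul_le_mul_of_nonneg_right (hvar i) (sq_nonneg _)
  have hxo : ∀ i j, i ≠ j → inner ℝ (x i) (x j) = 0 := fun i j hij => by
    rw [inner_toLp_eq]
    rw [integral_congr_ae (g := fun ω => ξ i ω * ξ j ω * inner ℝ (a i) (a j))
      (Eventually.of_forall fun ω => by
        simp only [real_inner_smul_left, real_inner_smul_right]; ring)]
    rw [integral_mul_const, horth i j hij, zero_mul]
  have hsn : Summable fun i => ‖x i‖ ^ 2 :=
    Summable.of_nonneg_of_le (fun i => sq_nonneg _) hxn (ha.mul_left τ)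
  obtain ⟨⟨Y, hY⟩, hfin⟩ := summable_of_pairwise_orthogonal hxo hsn
  have hYt := hY.tendsto_sum_nat
  have hYn : ‖Y‖ ^ 2 ≤ τ * ∑' i, ‖a i‖ ^ 2 := by
    refine le_of_tendsto (hYt.norm.pow 2) (Eventually.of_forall fun n => ?_)
    refine (hfin (Finset.range n)).le.trans ((Finset.sum_le_sum fun i _ => hxn i).trans ?_)
    rw [← Finset.mul_sum]
    have hτ : 0 ≤ τ := (integral_nonneg fun ω => sq_nonneg _).trans (hvar 0)
    exact mul_le_mul_of_nonneg_left (ha.sum_le_tsum _ fun i _ => sq_nonneg _) hτ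
  have hpm : ∀ n, AEStronglyMeasurable[𝓖] (∑ i ∈ Finset.range n, x i : Lp H 2 P) P := fun n => by
    refine ⟨fun ω => ∑ i ∈ Finset.range n, ξ i ω • a i, ?_, ?_⟩
    · refine Finset.stronglyMeasurable_fun_sum _ fun i _ => ?_
      exact (hξm i).stronglyMeasurable.smul_const (a i)
    · filter_upwards [Lp.coeFn_finsetSum (Finset.range n) x,
        ae_all_iff.2 fun i => (hx i).coeFn_toLp] with ω h1 h2
      rw [h1, Finset.sum_apply]
      exact Finset.sum_congr rfl fun i _ => h2 i
  have : Fact ((1 : ℝ≥0∞) ≤ 2) := ⟨by norm_num⟩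
  -- Functions measurable for the smaller σ-algebra form a closed set in `L²`, so the sum of the
  -- series inherits measurability from its partial sums.
  have hYm : AEStronglyMeasurable[𝓖] Y P :=
    (isClosed_aestronglyMeasurable (F := H) (p := 2) (μ := P) h𝓖).mem_of_tendsto hYt
      (Eventually.of_forall hpm)
  have hae : Y =ᵐ[P] hYm.mk Y := hYm.ae_eq_mk
  refine ⟨hYm.mk Y, hYm.stronglyMeasurable_mk, (memLp_congr_ae hae).1 (Lp.memLp Y), ?_, ?_⟩
  · rw [← real_inner_self_eq_norm_sq, L2.inner_def] at hYn
    refine le_trans (le_of_eq (integral_congr_ae ?_)) hYn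
    filter_upwards [hae] with ω h
    rw [real_inner_self_eq_norm_sq, h]
  · have h1 : Tendsto (fun n => ‖Y - ∑ i ∈ Finset.range n, x i‖ₑ) atTop (𝓝 0) := by
      have := (hYt.const_sub Y).enorm
      rwa [sub_self, enorm_zero] at this
    refine h1.congr fun n => ?_
    rw [Lp.enorm_def]
    refine eLpNorm_congr_ae ?_
    filter_upwards [Lp.coeFn_sub Y (∑ i ∈ Finset.range n, x i), hae,
      Lp.coeFn_finsetSum (Finset.range n) x, ae_all_iff.2 fun i => (hx i).coeFn_toLp]
      with ω h1 h2 h3 h4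
    rw [h1, Pi.sub_apply, h3, h2, Finset.sum_apply]
    exact congrArg _ (Finset.sum_congr rfl fun i _ => h4 i)

/-- Each partial sum is uncorrelated with `U`, and the pairing with `U` is continuous in `L²`. This
supplies the martingale property of the increments. -/
lemma integral_inner_eq_zero_of_series {ξ : ℕ → Ω → ℝ} (hξ : ∀ i, MemLp (ξ i) 2 P) {a : ℕ → H}
    {y U : Ω → H} (hy : MemLp y 2 P) (hU : MemLp U 2 P)
    (hlim : Tendsto (fun n => eLpNorm (fun ω => y ω - ∑ i ∈ Finset.range n, ξ i ω • a i) 2 P) atTop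
        (𝓝 0)) (h0 : ∀ i, ∫ ω, inner ℝ (U ω) (a i) * ξ i ω ∂P = 0) :
    ∫ ω, inner ℝ (U ω) (y ω) ∂P = 0 := by
  have hx : ∀ i, MemLp (fun ω => ξ i ω • a i) 2 P := fun i => memLp_smul_vec (hξ i) (a i)
  have hs : ∀ n, MemLp (fun ω => ∑ i ∈ Finset.range n, ξ i ω • a i) 2 P := fun n =>
    memLp_finsetSum _ fun i _ => hx i
  have hB : ∀ a b : H, (innerSL ℝ : H →L[ℝ] H →L[ℝ] ℝ) a b = inner ℝ a b := fun _ _ => rfl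
  have h1 := tendsto_integral_bilin (innerSL ℝ : H →L[ℝ] H →L[ℝ] ℝ) hU hs hy (by
    refine hlim.congr fun n => ?_
    rw [← eLpNorm_neg]
    exact congrArg (fun f => eLpNorm f 2 P) (funext fun ω => by simp))
  simp only [hB] at h1
  refine tendsto_nhds_unique h1 ((tendsto_const_nhds (x := (0 : ℝ))).congr fun n => ?_)
  simp only [inner_sum]
  rw [integral_finsetSum]
  · refine (Finset.sum_eq_zero fun i _ => ?_).symm
    rw [← h0 i]
    refine integral_congr_ae (Eventually.of_forall fun ω => ?_)
    simp only [real_inner_smul_right, mul_comm]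
  · intro i _
    exact integrable_bilin (innerSL ℝ) hU (hx i)

lemma ae_eq_of_series {ξ : ℕ → Ω → ℝ} {a : ℕ → H} {y z : Ω → H}
    (hy : AEStronglyMeasurable y P) (hz : AEStronglyMeasurable z P) (hξ : ∀ i, MemLp (ξ i) 2 P)
    (hlim : Tendsto (fun n => eLpNorm (fun ω => y ω - ∑ i ∈ Finset.range n, ξ i ω • a i) 2 P) atTop
      (𝓝 0))
    (hlim' : Tendsto (fun n => eLpNorm (fun ω => z ω - ∑ i ∈ Finset.range n, ξ i ω • a i) 2 P) atTop
      (𝓝 0)) : y =ᵐ[P] z := by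
  have hs : ∀ n, AEStronglyMeasurable (fun ω => ∑ i ∈ Finset.range n, ξ i ω • a i) P := fun n =>
    (memLp_finsetSum _ fun i _ => memLp_smul_vec (hξ i) (a i)).1
  have h1 : eLpNorm (fun ω => y ω - z ω) 2 P = 0 := by
    have h2 := hlim.add hlim'
    rw [add_zero] at h2
    refine le_antisymm (ge_of_tendsto h2 (Eventually.of_forall fun n => ?_)) bot_le
    have h3 : (fun ω => y ω - z ω) = (fun ω => y ω - ∑ i ∈ Finset.range n, ξ i ω • a i)
        - fun ω => z ω - ∑ i ∈ Finset.range n, ξ i ω • a i := by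
      funext ω; simp
    rw [h3]
    exact eLpNorm_sub_le (hy.sub (hs n)) (hz.sub (hs n)) (by norm_num)
  have h4 := (eLpNorm_eq_zero_iff (hy.sub hz) (by norm_num)).1 h1
  filter_upwards [h4] with ω h
  exact sub_eq_zero.1 h

end Series

/-! ### The increments of the noise -/

/-- The grid points `nΔt`, stopped at `T`. -/
def gridTime {T : ℝ} (hT : 0 ≤ T) (N n : ℕ) : ℝ≥0 :=
  Real.toNNReal (projIcc 0 T hT ((n : ℝ) * (T / N)))

lemma gridTime_mono {T : ℝ} (hT : 0 ≤ T) (N : ℕ) : Monotone (gridTime hT N) := by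
  intro a b hab
  refine Real.toNNReal_le_toNNReal ?_
  have h : (a : ℝ) * (T / N) ≤ b * (T / N) :=
    mul_le_mul_of_nonneg_right (by exact_mod_cast hab) (by positivity)
  exact_mod_cast monotone_projIcc hT h

/-- From index `N` on all grid times equal `T` and the increments vanish. The scheme can thus be run
over all natural numbers at the price of an inequality for the variance. -/
lemma gridTime_dist {T : ℝ} (hT : 0 ≤ T) (N n : ℕ) :
    dist (gridTime hT N (n + 1) : ℝ) (gridTime hT N n) ≤ T / N := by
  have e : ∀ k, (gridTime hT N k : ℝ) = projIcc 0 T hT ((k : ℝ) * (T / N)) := fun k =>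
    Real.coe_toNNReal _ (projIcc 0 T hT _).2.1
  have h1 : (gridTime hT N n : ℝ) ≤ gridTime hT N (n + 1) := by
    exact_mod_cast gridTime_mono hT N (Nat.le_succ n)
  rw [Real.dist_eq, abs_of_nonneg (sub_nonneg.2 h1), e, e, coe_projIcc, coe_projIcc]
  have h2 : (0 : ℝ) ≤ T / N := by positivity
  have h3 : 0 ≤ (n : ℝ) * (T / N) := by positivity
  push_cast
  rw [max_eq_right (le_min hT (by linarith)), max_eq_right (le_min hT h3)]
  rcases le_total T ((n : ℝ) * (T / N)) with h | h
  · rw [min_eq_left h, min_eq_left (by linarith)]; linarith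
  · rw [min_eq_right h]
    have := min_le_right T (((n : ℝ) + 1) * (T / N))
    linarith

section Noise

variable {Ω : Type*} {mΩ : MeasurableSpace Ω} {P : Measure Ω}

/-- The increments of the Brownian motions over the time steps. -/
def noiseIncrement (β : ℕ → ℝ≥0 → Ω → ℝ) {T : ℝ} (hT : 0 ≤ T) (N i n : ℕ) (ω : Ω) : ℝ :=
  β i (gridTime hT N (n + 1)) ω - β i (gridTime hT N n) ω

/-- Independence of the paths in `i` and of the increments in `n` for fixed `i` combine to joint
independence over all pairs. -/
lemma indep_noiseIncrement {D : Set E3} {T : ℝ} {Gf : ℕ → L2V D}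
    {β : ℕ → ℝ≥0 → Ω → ℝ} {GW : Ω → C(Icc (0 : ℝ) T, L2V D)} (h : IsNoise P Gf β GW) (hT : 0 ≤ T)
    (N : ℕ) : iIndepFun (fun (p : ℕ × ℕ) ω => noiseIncrement β hT N p.1 p.2 ω) P := by
  refine iIndepFun_uncurry' (X := fun i n ω => noiseIncrement β hT N i n ω)
    (fun i n => (h.measurable i _).sub (h.measurable i _)) ?_ fun i => ?_
  · exact h.indep.comp (fun _ f n => f (gridTime hT N (n + 1)) - f (gridTime hT N n))
      fun i => by fun_prop
  · exact (h.brownian i).toIsPreBrownianReal.hasIndepIncrements.nat (gridTime_mono hT N)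

lemma moments_noiseIncrement [IsProbabilityMeasure P] {D : Set E3} {T : ℝ} {Gf : ℕ → L2V D}
    {β : ℕ → ℝ≥0 → Ω → ℝ} {GW : Ω → C(Icc (0 : ℝ) T, L2V D)} (h : IsNoise P Gf β GW) (hT : 0 ≤ T)
    (N i n : ℕ) : MemLp (noiseIncrement β hT N i n) 2 P ∧ ∫ ω, noiseIncrement β hT N i n ω ∂P = 0 ∧
      ∫ ω, noiseIncrement β hT N i n ω ^ 2 ∂P ≤ T / N := by
  have h1 := (h.brownian i).toIsPreBrownianReal.hasLaw_sub (gridTime hT N (n + 1)) (gridTime hT N n)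
  have e : noiseIncrement β hT N i n = β i (gridTime hT N (n + 1)) - β i (gridTime hT N n) := rfl
  rw [← e] at h1
  have h2 : MemLp (noiseIncrement β hT N i n) 2 P := by
    have h3 := memLp_id_gaussianReal (μ := 0)
      (v := nndist (gridTime hT N (n + 1)).1 (gridTime hT N n).1) 2
    rw [← h1.map_eq] at h3
    exact (memLp_map_measure_iff h3.1 h1.aemeasurable).1 h3
  have h4 : ∫ ω, noiseIncrement β hT N i n ω ∂P = 0 := by
    rw [h1.integral_eq, integral_id_gaussianReal]
  refine ⟨h2, h4, ?_⟩
  have h5 := h1.variance_eq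
  rw [variance_id_gaussianReal, variance_of_integral_eq_zero h1.aemeasurable h4] at h5
  have h6 : ∫ ω, noiseIncrement β hT N i n ω ^ 2 ∂P = _ := h5
  rw [h6, coe_nndist]
  exact gridTime_dist hT N n

/-- The increments of the noise as `H²(D)³`-valued random variables, with the filtration. -/
structure IsIncrementData (P : Measure Ω) (D : Set E3) (τ S : ℝ) (𝓕 𝓖 : ℕ → MeasurableSpace Ω)
    (y : ℕ → Ω → h2Space D) : Prop where
  le : ∀ n, 𝓕 n ≤ mΩ
  mono : ∀ n, 𝓕 n ≤ 𝓕 (n + 1)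
  le_succ : ∀ n, 𝓖 n ≤ 𝓕 (n + 1)
  indep : ∀ n, Indep (𝓕 n) (𝓖 n) P
  meas : ∀ n, StronglyMeasurable[𝓖 n] (y n)
  memLp : ∀ n, MemLp (y n) 2 P
  sq_le : ∀ n, ∫ ω, ‖y n ω‖ ^ 2 ∂P ≤ τ * S
  inner_eq : ∀ n (U : Ω → h2Space D), StronglyMeasurable[𝓕 n] U → MemLp U 2 P →
    ∫ ω, inner ℝ (U ω) (y n ω) ∂P = 0

/-- The paths live in `L²(D)³` only, whereas the energy estimate needs increments in `H²(D)³`. The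
series is therefore summed again in `h2Space D` with the jets of the `Gᵢ`; its zeroth component is
almost surely the path increment. -/
lemma exists_increments [IsProbabilityMeasure P] {D : Set E3} {T : ℝ} (hT : 0 ≤ T)
    {Gf : ℕ → L2V D} (hG : ∀ i, MemH2 D (Gf i)) (hS : Summable fun i => normSqH2 D (Gf i))
    {β : ℕ → ℝ≥0 → Ω → ℝ} {GW : Ω → C(Icc (0 : ℝ) T, L2V D)} (h : IsNoise P Gf β GW) (N : ℕ) :
    ∃ (𝓕 𝓖 : ℕ → MeasurableSpace Ω) (y : ℕ → Ω → h2Space D),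
      IsIncrementData P D (T / N) (∑' i, normSqH2 D (Gf i)) 𝓕 𝓖 y ∧
      ∀ᵐ ω ∂P, ∀ n, (y n ω : Jet2 D) none = pathIncrement hT N (GW ω) n := by
  have : CompleteSpace (h2Space D) := (isClosed_h2Space D).completeSpace_coe
  set ξ := fun i n => noiseIncrement β hT N i n with hξ
  have hm : ∀ i n, Measurable (ξ i n) := fun i n => (h.measurable i _).sub (h.measurable i _)
  have hind := indep_noiseIncrement h hT N
  set ms : ℕ × ℕ → MeasurableSpace Ω := fun p => MeasurableSpace.comap (ξ p.1 p.2) inferInstance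
  have hms : ∀ p, ms p ≤ mΩ := fun p => (hm p.1 p.2).comap_le
  -- `𝓕 n` contains the increments before step `n`, `𝓖 n` those of step `n`: disjoint index sets,
  -- hence independent σ-algebras.
  set 𝓕 : ℕ → MeasurableSpace Ω := fun n => ⨆ p ∈ {p : ℕ × ℕ | p.2 < n}, ms p
  set 𝓖 : ℕ → MeasurableSpace Ω := fun n => ⨆ p ∈ {p : ℕ × ℕ | p.2 = n}, ms p
  have h𝓕 : ∀ n, 𝓕 n ≤ mΩ := fun n => iSup₂_le fun p _ => hms p
  have h𝓖 : ∀ n, 𝓖 n ≤ mΩ := fun n => iSup₂_le fun p _ => hms p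
  have hξ𝓖 : ∀ n i, Measurable[𝓖 n] (ξ i n) := fun n i => by
    refine Measurable.mono (comap_measurable (ξ i n)) ?_ le_rfl
    exact le_iSup₂_of_le (f := fun p (_ : p ∈ {p : ℕ × ℕ | p.2 = n}) => ms p) (i, n) rfl le_rfl
  have hindep : ∀ n, Indep (𝓕 n) (𝓖 n) P := fun n => by
    refine indep_iSup_of_disjoint hms hind.iIndep ?_
    rw [Set.disjoint_left]
    intro p hp hp'
    exact absurd hp' (ne_of_lt hp)
  have hmom := fun i n => moments_noiseIncrement h hT N i n
  set a : ℕ → h2Space D := fun i => ⟨jet2 D (Gf i), jet2_mem (hG i)⟩ with ha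
  have han : ∀ i, ‖a i‖ ^ 2 = normSqH2 D (Gf i) := fun i => norm_jet2_sq D (Gf i)
  have hy := fun n => exists_random_series (H := h2Space D) (h𝓖 n) (ξ := fun i => ξ i n)
    (fun i => hξ𝓖 n i) (fun i => (hmom i n).1) (fun i j hij => by
      have h1 : IndepFun (ξ i n) (ξ j n) P := hind.indepFun (i := (i, n)) (j := (j, n))
        (fun e => hij (Prod.ext_iff.1 e).1)
      have h2 := h1.integral_mul_eq_mul_integral (hm i n).aestronglyMeasurable
        (hm j n).aestronglyMeasurable
      rw [(hmom i n).2.1, zero_mul] at h2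
      exact h2) (fun i => (hmom i n).2.2) (a := a) (by simpa only [han] using hS)
  choose y hy1 hy2 hy3 hy4 using hy
  refine ⟨𝓕, 𝓖, y, ⟨h𝓕, fun n => ?_, fun n => ?_, hindep, hy1, hy2, fun n => ?_, ?_⟩, ?_⟩
  · exact biSup_mono fun p (hp : p.2 < n) => (hp.trans (Nat.lt_succ_self n) : p.2 < n + 1)
  · exact biSup_mono fun p (hp : p.2 = n) => (hp ▸ Nat.lt_succ_self n : p.2 < n + 1)
  · simpa only [han] using hy3 n
  · intro n U hUm hU
    refine integral_inner_eq_zero_of_series (fun i => (hmom i n).1) (hy2 n) hU (hy4 n) fun i => ?_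
    have hUi : StronglyMeasurable[𝓕 n] fun ω => inner ℝ (U ω) (a i) :=
      hUm.inner stronglyMeasurable_const
    have h1 : IndepFun (fun ω => inner ℝ (U ω) (a i)) (ξ i n) P := by
      rw [IndepFun_iff_Indep]
      exact indep_of_indep_of_le_left (indep_of_indep_of_le_right (hindep n) (hξ𝓖 n i).comap_le)
        hUi.measurable.comap_le
    have h2 := h1.integral_mul_eq_mul_integral (hUi.mono (h𝓕 n)).aestronglyMeasurable
      (hm i n).aestronglyMeasurable
    rw [(hmom i n).2.1, mul_zero] at h2
    exact h2
  · rw [ae_all_iff]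
    intro n
    have hgrid : ∀ k : ℕ, ((gridTime hT N k : ℝ≥0) : ℝ) = projIcc 0 T hT ((k : ℝ) * (T / N)) :=
      fun k => Real.coe_toNNReal _ (projIcc 0 T hT _).2.1
    refine ae_eq_of_series (ξ := fun i => ξ i n) (a := Gf) ?_ ?_ (fun i => (hmom i n).1) ?_ ?_
    · have hc : Continuous fun p : h2Space D => (p : Jet2 D) none :=
        (PiLp.continuous_apply 2 _ none).comp continuous_subtype_val
      exact hc.comp_aestronglyMeasurable (hy2 n).1
    · exact ((h.stronglyMeasurable _).sub (h.stronglyMeasurable _)).aestronglyMeasurable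
    · refine tendsto_of_tendsto_of_tendsto_of_le_of_le tendsto_const_nhds (hy4 n)
        (fun _ => zero_le) fun k => eLpNorm_mono fun ω => ?_
      have h1 : (y n ω : Jet2 D) none - ∑ i ∈ Finset.range k, ξ i n ω • Gf i
          = ((y n ω - ∑ i ∈ Finset.range k, ξ i n ω • a i : h2Space D) : Jet2 D) none := by
        simp [ha, jet2]
      rw [h1]
      exact PiLp.norm_apply_le _ none
    · have h1 := (h.series (projIcc 0 T hT (((n : ℝ) + 1) * (T / N)))).add
        (h.series (projIcc 0 T hT ((n : ℝ) * (T / N))))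
      rw [add_zero] at h1
      have hsm : ∀ (t : Icc (0 : ℝ) T) (s : ℝ≥0) (k : ℕ), AEStronglyMeasurable
          (fun ω => GW ω t - ∑ i ∈ Finset.range k, β i s ω • Gf i) P := fun t s k =>
        (h.stronglyMeasurable t).aestronglyMeasurable.sub
          (Finset.aestronglyMeasurable_fun_sum _ fun i _ =>
            ((h.measurable i s).stronglyMeasurable.smul_const (Gf i)).aestronglyMeasurable)
      refine tendsto_of_tendsto_of_tendsto_of_le_of_le tendsto_const_nhds h1
        (fun _ => zero_le) fun k => ?_
      refine le_trans (le_of_eq ?_) (eLpNorm_sub_le (hsm _ _ k) (hsm _ _ k) (by norm_num))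
      refine congrArg (fun f => eLpNorm f 2 P) (funext fun ω => ?_)
      simp only [Pi.sub_apply, pathIncrement, hξ, noiseIncrement, gridTime, sub_smul,
        Finset.sum_sub_distrib]
      push_cast
      abel

end Noise

/-! ### Moments of the scheme -/

/-- The quantity `1 + E n` grows at most by the factor `1 + Aτ ≤ exp(Aτ)`. Summing the inequality
telescopes `E` and bounds the dissipated terms `d`. -/
lemma discrete_gronwall {E d : ℕ → ℝ} {A τ : ℝ} (hA : 0 ≤ A) (hτ : 0 ≤ τ) (hE : ∀ n, 0 ≤ E n)
    (hd : ∀ n, 0 ≤ d n) (h : ∀ n, E (n + 1) + d n ≤ E n + A * τ * (1 + E n)) (n : ℕ) :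
    1 + E n ≤ (1 + E 0) * Real.exp (A * (n * τ)) ∧
      ∑ i ∈ Finset.range n, d i ≤ E 0 + A * (n * τ) * ((1 + E 0) * Real.exp (A * (n * τ))) := by
  have h1 : ∀ n : ℕ, 1 + E n ≤ (1 + E 0) * Real.exp (A * (n * τ)) := by
    intro n
    induction n with
    | zero => simp
    | succ n ih =>
      have e : A * (((n + 1 : ℕ) : ℝ) * τ) = A * (n * τ) + A * τ := by push_cast; ring
      rw [e, Real.exp_add, ← mul_assoc]
      have h2 : 1 + E (n + 1) ≤ (1 + E n) * (A * τ + 1) := by linarith [h n, hd n]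
      refine h2.trans (mul_le_mul ih (Real.add_one_le_exp _) (by positivity) ?_)
      linarith [hE n]
  refine ⟨h1 n, ?_⟩
  have h3 : ∀ n, ∑ i ∈ Finset.range n, d i + E n ≤
      E 0 + A * τ * ∑ i ∈ Finset.range n, (1 + E i) := by
    intro n
    induction n with
    | zero => simp
    | succ n ih => rw [Finset.sum_range_succ, Finset.sum_range_succ]; linarith [h n]
  have h4 : ∑ i ∈ Finset.range n, (1 + E i) ≤ n * ((1 + E 0) * Real.exp (A * (n * τ))) := by
    refine (Finset.sum_le_sum (g := fun _ => (1 + E 0) * Real.exp (A * (n * τ)))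
      fun i hi => (h1 i).trans (mul_le_mul_of_nonneg_left
        (Real.exp_le_exp.2 ?_) (by linarith [hE 0]))).trans (by simp)
    have : (i : ℝ) ≤ n := by exact_mod_cast (Finset.mem_range.1 hi).le
    gcongr
  have h5 := mul_le_mul_of_nonneg_left h4 (mul_nonneg hA hτ)
  have := h3 n
  have e : A * (n * τ) * ((1 + E 0) * Real.exp (A * (n * τ)))
      = A * τ * (n * ((1 + E 0) * Real.exp (A * (n * τ)))) := by ring
  rw [e]
  linarith [hE n]

/-- The components of an element of `H²(D)³`. -/
def h2Proj (D : Set E3) (i : Option (Fin 3 ⊕ Fin 3 × Fin 3)) : h2Space D →L[ℝ] L2V D :=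
  PiLp.proj 2 (fun _ : Option (Fin 3 ⊕ Fin 3 × Fin 3) => L2V D) i ∘L (h2Space D).subtypeL

lemma h2Proj_apply {D : Set E3} (i : Option (Fin 3 ⊕ Fin 3 × Fin 3)) (p : h2Space D) :
    h2Proj D i p = (p : Jet2 D) i := rfl

lemma norm_h2Proj_le {D : Set E3} (i : Option (Fin 3 ⊕ Fin 3 × Fin 3)) : ‖h2Proj D i‖ ≤ 1 :=
  ContinuousLinearMap.opNorm_le_bound _ zero_le_one fun p => by
    rw [one_mul]; exact PiLp.norm_apply_le (p : Jet2 D) i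

instance instCompleteSpaceH2 (D : Set E3) : CompleteSpace (h2Space D) :=
  (isClosed_h2Space D).completeSpace_coe

/-- The functional `y ↦ ∑ₖ (∂ₖm, m × ∂ₖy)`. -/
def gradNoise {D : Set E3} (m : L2V D) (dm : Fin 3 → L2V D) : h2Space D :=
  ∑ k, (ContinuousLinearMap.adjoint (h2Proj D (some (.inl k)))) (-crossV m (dm k))

/-- The linear noise term of the energy estimate is a pairing in `h2Space D` whose left entry
depends only on the past; this is the form to which the zero correlation of the increments applies.
-/
lemma inner_gradNoise {D : Set E3} (m : L2V D) (dm : Fin 3 → L2V D) (p : h2Space D) :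
    inner ℝ (gradNoise m dm) p = ∑ k, inner ℝ (dm k) (crossV m ((p : Jet2 D) (some (.inl k)))) := by
  rw [gradNoise, sum_inner]
  refine Finset.sum_congr rfl fun k _ => ?_
  rw [ContinuousLinearMap.adjoint_inner_left, inner_neg_left, crossV_antisymm, neg_neg,
    h2Proj_apply]

lemma norm_gradNoise_sq_le {D : Set E3} (m : L2V D) (dm : Fin 3 → L2V D) :
    ‖gradNoise m dm‖ ^ 2 ≤ 3 * ∑ k, ‖dm k‖ ^ 2 := by
  have h1 : ∀ k, ‖(ContinuousLinearMap.adjoint (h2Proj D (some (.inl k)))) (-crossV m (dm k))‖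
      ≤ ‖dm k‖ := fun k => by
    refine (ContinuousLinearMap.le_opNorm _ _).trans ?_
    rw [ContinuousLinearMap.adjoint.norm_map, norm_neg]
    exact (mul_le_of_le_one_left (norm_nonneg _) (norm_h2Proj_le _)).trans (norm_crossV_le _ _)
  have h2 : ‖gradNoise m dm‖ ≤ ∑ k, ‖dm k‖ := (norm_sum_le _ _).trans
    (Finset.sum_le_sum fun k _ => h1 k)
  refine (pow_le_pow_left₀ (norm_nonneg _) h2 2).trans ?_
  have := sq_sum_le_card_mul_sum_sq (s := Finset.univ) (f := fun k : Fin 3 => ‖dm k‖)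
  simpa using this

/-- A bound for the expected energy of one step. -/
structure StepMoments {Ω : Type*} [MeasurableSpace Ω] (P : Measure Ω) (D : Set E3) (θ τ A : ℝ)
    (M v w M' : Ω → L2V D) : Prop where
  int_grad : Integrable (fun ω => gradSq D (M' ω)) P
  int_v : Integrable (fun ω => gradSq D (v ω)) P
  int_w : Integrable (fun ω => ‖w ω‖ ^ 2) P
  le : ∫ ω, gradSq D (M' ω) ∂P + ((2 * θ - 1) / 2 * ∫ ω, gradSq D (v ω) ∂P
    + τ / 2 * ∫ ω, ‖w ω‖ ^ 2 ∂P) ≤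
    ∫ ω, gradSq D (M ω) ∂P + A * τ * (1 + ∫ ω, gradSq D (M ω) ∂P)

lemma measurable_gradSq {D : Set E3} {F : Fin 3 → L2V D → L2V D} (hF : ∀ k, Measurable (F k))
    (h : ∀ k u, MemH1 D u → F k u = weakPartial D k u) {Ω : Type*} {m : MeasurableSpace Ω}
    {M : Ω → L2V D} (hM : Measurable M) (hH : ∀ ω, MemH1 D (M ω)) :
    Measurable fun ω => gradSq D (M ω) := by
  simp only [gradSq]
  refine Finset.measurable_fun_sum _ fun k _ => ?_
  have h1 : (fun ω => weakPartial D k (M ω)) = fun ω => F k (M ω) :=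
    funext fun ω => (h k _ (hH ω)).symm
  have h2 : Measurable fun ω => weakPartial D k (M ω) := by
    rw [h1]; exact (hF k).comp hM
  exact h2.norm.pow_const 2

lemma measurable_crossV {D : Set E3} {Ω : Type*} {mΩ : MeasurableSpace Ω} {f g : Ω → L2V D}
    (hf : Measurable f) (hg : Measurable g) : Measurable fun ω => crossV (f ω) (g ω) := by
  have h := continuous_crossV.measurable.comp (hf.prodMk hg)
  exact h

/-- Expectation of `energy_step`. The factors of `‖y‖² (1 + ‖∇M‖²)` are independent, so its mean is
at most `τ S (1 + E‖∇M‖²)`, and the term linear in `y` has mean zero. -/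
lemma stepMoments {D : Set E3} (hD : IsOpen D) (hb : Bornology.IsBounded D)
    {Gf : ℕ → L2V D} {c : ℕ → ℝ} (hc : NoiseBound Gf c) {C : ℝ}
    (hCb : ∀ p ∈ h2Space D, ∀ᵐ x ∂volume.restrict D, ‖p none x‖ ≤ C * ‖p‖)
    {θ τ S : ℝ} (hθ : 1 / 2 < θ) (hτ : 0 < τ) {Ω : Type*} {𝓕 𝓖 mΩ : MeasurableSpace Ω}
    {P : Measure Ω} [IsProbabilityMeasure P] (h𝓕 : 𝓕 ≤ mΩ) (h𝓖 : 𝓖 ≤ mΩ)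
    (hind : Indep 𝓕 𝓖 P) {y : Ω → h2Space D} (hy : StronglyMeasurable[𝓖] y) (hy2 : MemLp y 2 P)
    (hyS : ∫ ω, ‖y ω‖ ^ 2 ∂P ≤ τ * S)
    (hy0 : ∀ U : Ω → h2Space D, StronglyMeasurable[𝓕] U → MemLp U 2 P →
      ∫ ω, inner ℝ (U ω) (y ω) ∂P = 0)
    {M : Ω → L2V D} (hM : Measurable[𝓕] M) (hMu : ∀ ω, IsUnitField D (M ω))
    (hMi : Integrable (fun ω => gradSq D (M ω)) P) {v : Ω → L2V D}
    (hv : ∀ ω, v ω = stepSolution D θ τ Gf (M ω) ((y ω : Jet2 D) none)) :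
    (∀ ω, IsUnitField D (normalizeL2 D (M ω + v ω))) ∧
    (Measurable[𝓕 ⊔ 𝓖] fun ω => normalizeL2 D (M ω + v ω)) ∧
    StepMoments P D θ τ (2 * θ ^ 2 / (2 * θ - 1) * (2 * C ^ 2 + 2) * S
      + ‖noiseOp hc‖ ^ 2 * (volume.restrict D).real univ / 2) M v
      (fun ω => τ⁻¹ • (v ω - crossV (M ω) ((y ω : Jet2 D) none)))
      (fun ω => normalizeL2 D (M ω + v ω)) := by
  have hθ0 : 0 < θ := by linarith
  have hδ : 0 < 2 * θ - 1 := by linarith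
  obtain ⟨-, F, hF, hFs⟩ := exists_measurable_stepSolution hD hb hc hθ0 hτ
  choose Fk hFk hFks using fun k => exists_measurable_weakPartial hD hb k
  have hsol : ∀ ω, IsStepSolution D θ τ Gf (M ω) ((y ω : Jet2 D) none) (v ω) := fun ω => by
    rw [hv]; exact stepSolution_spec hD hb hc hθ0 hτ (hMu ω).2 _
  have hen := fun ω => energy_step hD hb hc hCb hθ hτ (hMu ω) (y ω).2 (hsol ω)
  have hvT := fun ω => ((isStepSolution_iff hc (hMu ω).2).1 (hsol ω)).1
  set g : Ω → L2V D := fun ω => (y ω : Jet2 D) none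
  have hg : Measurable[𝓖] g := ((h2Proj D none).continuous.comp_stronglyMeasurable hy).measurable
  have hM' : Measurable[𝓕 ⊔ 𝓖] M := hM.mono le_sup_left le_rfl
  have hg' : Measurable[𝓕 ⊔ 𝓖] g := hg.mono le_sup_right le_rfl
  have hvm : Measurable[𝓕 ⊔ 𝓖] v := by
    have e : v = fun ω => F (M ω, g ω) := funext fun ω => by rw [hv, hFs _ _ (hMu ω)]
    rw [e]
    exact hF.comp (hM'.prodMk hg')
  have hle : 𝓕 ⊔ 𝓖 ≤ mΩ := sup_le h𝓕 h𝓖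
  have hnm : Measurable[𝓕 ⊔ 𝓖] fun ω => normalizeL2 D (M ω + v ω) := by
    have e : (fun ω => normalizeL2 D (M ω + v ω)) = fun ω => ballProjL2 (M ω + v ω) :=
      funext fun ω => (normalizeL2_add (hMu ω).2 (hvT ω).2).1
    rw [e]
    exact continuous_ballProjL2.measurable.comp (hM'.add hvm)
  refine ⟨fun ω => (hen ω).1, hnm, ?_⟩
  set C1 := 2 * θ ^ 2 / (2 * θ - 1) * (2 * C ^ 2 + 2) with hC1
  set C2 := ‖noiseOp hc‖ ^ 2 * (volume.restrict D).real univ / 2 with hC2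
  set U : Ω → h2Space D := fun ω => gradNoise (M ω) (fun k => Fk k (M ω)) with hU
  have hUm : StronglyMeasurable[𝓕] U := by
    refine Finset.stronglyMeasurable_fun_sum _ fun k _ => ?_
    refine (ContinuousLinearMap.adjoint (h2Proj D _)).continuous.comp_stronglyMeasurable ?_
    have h1 : Measurable[𝓕] fun ω => crossV (M ω) (Fk k (M ω)) :=
      measurable_crossV hM ((hFk k).comp hM)
    exact h1.stronglyMeasurable.neg
  have hUe : ∀ ω, inner ℝ (U ω) (y ω) = ∑ k, inner ℝ (weakPartial D k (M ω))
      (crossV (M ω) ((y ω : Jet2 D) (some (.inl k)))) := fun ω => by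
    rw [hU, inner_gradNoise]
    simp only [hFks _ _ (hMu ω).1]
  have hU2 : MemLp U 2 P := by
    rw [memLp_two_iff_integrable_sq_norm (hUm.mono h𝓕).aestronglyMeasurable]
    refine (hMi.const_mul 3).mono' ((hUm.mono h𝓕).norm.pow 2).aestronglyMeasurable
      (Eventually.of_forall fun ω => ?_)
    rw [Real.norm_of_nonneg (sq_nonneg _)]
    refine (norm_gradNoise_sq_le _ _).trans (le_of_eq ?_)
    simp only [gradSq, hFks _ _ (hMu ω).1]
  have hUint : Integrable (fun ω => inner ℝ (U ω) (y ω)) P := integrable_bilin (innerSL ℝ) hU2 hy2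
  have hyi : Integrable (fun ω => ‖y ω‖ ^ 2) P :=
    (memLp_two_iff_integrable_sq_norm hy2.1).1 hy2
  have hgm : Measurable[𝓕] fun ω => gradSq D (M ω) :=
    measurable_gradSq hFk hFks hM fun ω => (hMu ω).1
  have hindep : IndepFun (fun ω => ‖y ω‖ ^ 2) (fun ω => 1 + gradSq D (M ω)) P := by
    rw [IndepFun_iff_Indep]
    have h1 : StronglyMeasurable[𝓖] fun ω => ‖y ω‖ ^ 2 := hy.norm.pow 2
    have h2 : Measurable[𝓕] fun ω => 1 + gradSq D (M ω) := hgm.const_add 1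
    exact indep_of_indep_of_le_left (indep_of_indep_of_le_right hind.symm h2.comap_le)
      h1.measurable.comap_le
  have h1i : Integrable (fun ω => 1 + gradSq D (M ω)) P := (integrable_const 1).add hMi
  have hprod : Integrable (fun ω => ‖y ω‖ ^ 2 * (1 + gradSq D (M ω))) P :=
    hindep.integrable_mul hyi h1i
  have hprodle : ∫ ω, ‖y ω‖ ^ 2 * (1 + gradSq D (M ω)) ∂P
      ≤ τ * S * (1 + ∫ ω, gradSq D (M ω) ∂P) := by
    have h1 := hindep.integral_mul_eq_mul_integral hyi.1 h1i.1
    have h2 : ∫ ω, ‖y ω‖ ^ 2 * (1 + gradSq D (M ω)) ∂P =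
        (∫ ω, ‖y ω‖ ^ 2 ∂P) * ∫ ω, (1 + gradSq D (M ω)) ∂P := h1
    rw [h2, integral_add (integrable_const 1) hMi]
    simp only [integral_const, probReal_univ, smul_eq_mul, mul_one]
    refine mul_le_mul_of_nonneg_right hyS ?_
    have : 0 ≤ ∫ ω, gradSq D (M ω) ∂P := integral_nonneg fun ω => gradSq_nonneg _ _
    linarith
  set R : Ω → ℝ := fun ω => gradSq D (M ω) + C1 * (‖y ω‖ ^ 2 * (1 + gradSq D (M ω)))
    + 2 * inner ℝ (U ω) (y ω) + C2 * τ with hR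
  have hRi : Integrable R P := (((hMi.add (hprod.const_mul C1)).add (hUint.const_mul 2)).add
    (integrable_const _))
  have hpt : ∀ ω, gradSq D (normalizeL2 D (M ω + v ω)) + (2 * θ - 1) / 2 * gradSq D (v ω)
      + τ / 2 * ‖τ⁻¹ • (v ω - crossV (M ω) (g ω))‖ ^ 2 ≤ R ω := fun ω => by
    simp only [hR, hUe]
    exact (hen ω).2
  have hvg : Measurable fun ω => gradSq D (v ω) :=
    measurable_gradSq hFk hFks (hvm.mono hle le_rfl) fun ω => (hvT ω).1
  have hng : Measurable fun ω => gradSq D (normalizeL2 D (M ω + v ω)) :=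
    measurable_gradSq hFk hFks (hnm.mono hle le_rfl) fun ω => (hen ω).1.1
  have hwm : Measurable fun ω => τ⁻¹ • (v ω - crossV (M ω) (g ω)) :=
    ((hvm.mono hle le_rfl).sub (measurable_crossV
      (hM'.mono hle le_rfl) (hg'.mono hle le_rfl))).const_smul τ⁻¹
  have n1 := fun ω => gradSq_nonneg D (normalizeL2 D (M ω + v ω))
  have n2 := fun ω => mul_nonneg (by linarith : 0 ≤ (2 * θ - 1) / 2) (gradSq_nonneg D (v ω))
  have n3 := fun ω => mul_nonneg (by linarith : 0 ≤ τ / 2)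
    (sq_nonneg ‖τ⁻¹ • (v ω - crossV (M ω) (g ω))‖)
  -- All terms on the left of the energy estimate are nonnegative, so each is integrable because the
  -- right side `R` is.
  have i1 : Integrable (fun ω => gradSq D (normalizeL2 D (M ω + v ω))) P := by
    refine hRi.mono' hng.aestronglyMeasurable (Eventually.of_forall fun ω => ?_)
    rw [Real.norm_of_nonneg (n1 ω)]; linarith [hpt ω, n2 ω, n3 ω]
  have i2 : Integrable (fun ω => (2 * θ - 1) / 2 * gradSq D (v ω)) P := by
    refine hRi.mono' (hvg.const_mul _).aestronglyMeasurable (Eventually.of_forall fun ω => ?_)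
    rw [Real.norm_of_nonneg (n2 ω)]; linarith [hpt ω, n1 ω, n3 ω]
  have i3 : Integrable (fun ω => τ / 2 * ‖τ⁻¹ • (v ω - crossV (M ω) (g ω))‖ ^ 2) P := by
    refine hRi.mono' ((hwm.norm.pow_const 2).const_mul _).aestronglyMeasurable
      (Eventually.of_forall fun ω => ?_)
    rw [Real.norm_of_nonneg (n3 ω)]; linarith [hpt ω, n1 ω, n2 ω]
  refine ⟨i1, ?_, ?_, ?_⟩
  · have := i2.const_mul ((2 * θ - 1) / 2)⁻¹
    simpa only [inv_mul_cancel_left₀ (by positivity : (2 * θ - 1) / 2 ≠ 0)] using this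
  · have := i3.const_mul (τ / 2)⁻¹
    simpa only [inv_mul_cancel_left₀ (by positivity : τ / 2 ≠ 0)] using this
  · have h1 := integral_mono ((i1.add i2).add i3) hRi hpt
    have e1 := integral_add (i1.add i2) i3
    have e2 := integral_add i1 i2
    have e3 := integral_add ((hMi.add (hprod.const_mul C1)).add (hUint.const_mul 2))
      (integrable_const (C2 * τ))
    have e4 := integral_add (hMi.add (hprod.const_mul C1)) (hUint.const_mul 2)
    have e5 := integral_add hMi (hprod.const_mul C1)
    simp only [Pi.add_apply] at h1 e1 e2 e3 e4 e5
    rw [e1, e2, hR, e3, e4, e5] at h1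
    simp only [integral_const_mul, hy0 U hUm hU2, integral_const, probReal_univ, smul_eq_mul,
      one_mul, mul_zero, add_zero] at h1
    have hC1n : 0 ≤ C1 := by positivity
    have hC2n : 0 ≤ C2 := by positivity
    have h2 := mul_le_mul_of_nonneg_left hprodle hC1n
    have h3 : 0 ≤ ∫ ω, gradSq D (M ω) ∂P := integral_nonneg fun ω => gradSq_nonneg _ _
    have h4 : 0 ≤ C2 * τ * ∫ ω, gradSq D (M ω) ∂P := by positivity
    linarith

/-! ### Step functions -/

section StepFunction

variable {T : ℝ} {D : Set E3} {N : ℕ}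

/-- The interval number `n` of the time grid. -/
def gridIco (T : ℝ) (N n : ℕ) : Set ℝ := Ico ((n : ℝ) * (T / N)) (((n : ℝ) + 1) * (T / N))

lemma measurableSet_gridIco (T : ℝ) (N n : ℕ) : MeasurableSet (gridIco T N n) := measurableSet_Ico

lemma mem_gridIco_iff (hT : 0 < T) (hN : 1 ≤ N) {n : ℕ} {t : ℝ} (ht : 0 ≤ t) :
    t ∈ gridIco T N n ↔ ⌊t / (T / N)⌋₊ = n := by
  have hτ : 0 < T / N := by positivity
  rw [gridIco, mem_Ico, Nat.floor_eq_iff (by positivity), le_div_iff₀ hτ, div_lt_iff₀ hτ]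

lemma floor_lt (hT : 0 < T) (hN : 1 ≤ N) {t : ℝ} (ht : 0 ≤ t) (htT : t < T) :
    ⌊t / (T / N)⌋₊ < N := by
  have hN0 : (0 : ℝ) < N := by exact_mod_cast hN
  rw [Nat.floor_lt (by positivity), div_lt_iff₀ (by positivity)]
  rwa [mul_div_cancel₀ _ hN0.ne']

lemma gridIco_subset (hT : 0 < T) (hN : 1 ≤ N) {n : ℕ} (hn : n < N) : gridIco T N n ⊆ Icc 0 T := by
  intro t ht
  have hN0 : (0 : ℝ) < N := by exact_mod_cast hN
  have h1 : ((n : ℝ) + 1) ≤ N := by exact_mod_cast hn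
  have h2 : ((n : ℝ) + 1) * (T / N) ≤ T := by
    calc ((n : ℝ) + 1) * (T / N) ≤ N * (T / N) := by gcongr
      _ = T := mul_div_cancel₀ _ hN0.ne'
  exact ⟨le_trans (by positivity) ht.1, ht.2.le.trans h2⟩

lemma volume_gridIco (n : ℕ) : volume (gridIco T N n) = ENNReal.ofReal (T / N) := by
  rw [gridIco, Real.volume_Ico]; congr 1; ring

lemma ae_mem_Ico (T : ℝ) : ∀ᵐ t ∂volume.restrict (Icc 0 T), t ∈ Ico 0 T := by
  rw [Measure.restrict_congr_set Ico_ae_eq_Icc.symm]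
  exact ae_restrict_mem measurableSet_Ico

lemma coeFn_stepFunction (hT : 0 < T) (hN : 1 ≤ N) (a : ℕ → L2V D) :
    ∀ᵐ t ∂volume.restrict (Icc 0 T), stepFunction T N a t = a ⌊t / (T / N)⌋₊ := by
  have h1 : ∀ᵐ t ∂volume.restrict (Icc 0 T), ∀ n : ℕ, (indicatorConstLp 2
      (measurableSet_Ico (a := (n : ℝ) * (T / N)) (b := ((n : ℝ) + 1) * (T / N)))
      (measure_ne_top (volume.restrict (Icc 0 T)) _) (a n)) t
        = (gridIco T N n).indicator (fun _ => a n) t :=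
    ae_all_iff.2 fun n => indicatorConstLp_coeFn
  filter_upwards [ae_mem_Ico T, h1, Lp.coeFn_finsetSum (Finset.range N) fun n : ℕ =>
    indicatorConstLp 2 (measurableSet_Ico (a := (n : ℝ) * (T / N)) (b := ((n : ℝ) + 1) * (T / N)))
      (measure_ne_top (volume.restrict (Icc 0 T)) _) (a n)] with t ht h2 h3
  rw [stepFunction, h3, Finset.sum_apply]
  simp only [h2]
  rw [Finset.sum_eq_single ⌊t / (T / N)⌋₊]
  · rw [indicator_of_mem ((mem_gridIco_iff hT hN ht.1).2 rfl)]
  · intro n _ hn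
    rw [indicator_of_notMem]
    rw [mem_gridIco_iff hT hN ht.1]
    exact fun h => hn h.symm
  · intro h
    exact absurd (Finset.mem_range.2 (floor_lt hT hN ht.1 ht.2)) h

lemma stepFunction_sub (hT : 0 < T) (hN : 1 ≤ N) (a b : ℕ → L2V D) :
    stepFunction T N a - stepFunction T N b = stepFunction T N (fun n => a n - b n) := by
  refine Lp.ext ?_
  filter_upwards [coeFn_stepFunction hT hN a, coeFn_stepFunction hT hN b,
    coeFn_stepFunction hT hN (fun n => a n - b n),
    Lp.coeFn_sub (stepFunction T N a) (stepFunction T N b)] with t h1 h2 h3 h4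
  rw [h4, Pi.sub_apply, h1, h2, h3]

/-- Integrals of functions that are constant on the intervals of the grid. -/
lemma lintegral_grid (hT : 0 < T) (hN : 1 ≤ N) (f : ℕ → ℝ≥0∞) :
    ∫⁻ t in Icc 0 T, f ⌊t / (T / N)⌋₊ = ENNReal.ofReal (T / N) * ∑ n ∈ Finset.range N, f n := by
  have h1 : ∫⁻ t in Icc 0 T, f ⌊t / (T / N)⌋₊
      = ∫⁻ t in Icc 0 T, ∑ n ∈ Finset.range N, (gridIco T N n).indicator (fun _ => f n) t := by
    refine lintegral_congr_ae ?_
    filter_upwards [ae_mem_Ico T] with t ht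
    rw [Finset.sum_eq_single ⌊t / (T / N)⌋₊]
    · rw [indicator_of_mem ((mem_gridIco_iff hT hN ht.1).2 rfl)]
    · intro n _ hn
      rw [indicator_of_notMem]
      rw [mem_gridIco_iff hT hN ht.1]
      exact fun h => hn h.symm
    · intro h
      exact absurd (Finset.mem_range.2 (floor_lt hT hN ht.1 ht.2)) h
  rw [h1, lintegral_finsetSum _ fun n _ => measurable_const.indicator (measurableSet_gridIco T N n),
    Finset.mul_sum]
  refine Finset.sum_congr rfl fun n hn => ?_
  rw [lintegral_indicator_const (measurableSet_gridIco T N n),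
    Measure.restrict_apply (measurableSet_gridIco T N n),
    inter_eq_left.2 (gridIco_subset hT hN (Finset.mem_range.1 hn)), volume_gridIco, mul_comm]

lemma enorm_stepFunction_sq (hT : 0 < T) (hN : 1 ≤ N) (a : ℕ → L2V D) :
    ‖stepFunction T N a‖ₑ ^ 2 = ENNReal.ofReal (T / N) * ∑ n ∈ Finset.range N, ‖a n‖ₑ ^ 2 := by
  rw [enorm_sq_eq_lintegral, ← lintegral_grid hT hN]
  refine lintegral_congr_ae ?_
  filter_upwards [coeFn_stepFunction hT hN a] with t ht
  rw [ht]

lemma continuous_stepFunction (hT : 0 < T) (hN : 1 ≤ N) :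
    Continuous (stepFunction T N : (ℕ → L2V D) → L2TV T D) := by
  rw [continuous_iff_seqContinuous]
  intro a b hab
  refine tendsto_of_enorm_sq ?_
  have h1 : ∀ j, ‖(stepFunction T N ∘ a) j - stepFunction T N b‖ₑ ^ 2 =
      ENNReal.ofReal (T / N) * ∑ n ∈ Finset.range N, ‖a j n - b n‖ₑ ^ 2 := fun j => by
    rw [Function.comp_apply, stepFunction_sub hT hN, enorm_stepFunction_sq hT hN]
  simp only [h1]
  have h2 : Tendsto (fun j => ∑ n ∈ Finset.range N, ‖a j n - b n‖ₑ ^ 2) atTop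
      (𝓝 (∑ n ∈ Finset.range N, (0 : ℝ≥0∞))) := by
    refine tendsto_finsetSum _ fun n _ => ?_
    have h3 := (((continuous_apply n).tendsto b).comp hab).sub_const (b n) |>.enorm
    rw [sub_self, enorm_zero] at h3
    simpa [Function.comp_def] using ((ENNReal.continuous_pow 2).tendsto 0).comp h3
  have h4 := ENNReal.Tendsto.const_mul (a := ENNReal.ofReal (T / N)) h2
    (Or.inr ENNReal.ofReal_ne_top)
  simpa using h4

lemma continuous_setIntegral_L2TV {I : Set ℝ} (hI : MeasurableSet I) (hIT : I ⊆ Icc 0 T) :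
    Continuous fun f : L2TV T D => ∫ t in I, f t := by
  rw [continuous_iff_seqContinuous]
  intro f f' hf
  have h1 : MemLp (I.indicator fun _ => (1 : ℝ)) 2 (volume.restrict (Icc 0 T)) :=
    (memLp_const 1).indicator hI
  have e : ∀ g : L2TV T D, ∫ t in I, g t = ∫ t in Icc 0 T,
      (ContinuousLinearMap.lsmul ℝ ℝ : ℝ →L[ℝ] L2V D →L[ℝ] L2V D)
        (I.indicator (fun _ => (1 : ℝ)) t) (g t) := fun g => by
    have h2 : ∀ t, (ContinuousLinearMap.lsmul ℝ ℝ : ℝ →L[ℝ] L2V D →L[ℝ] L2V D)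
        (I.indicator (fun _ => (1 : ℝ)) t) (g t) = I.indicator (fun t => g t) t := fun t => by
      by_cases ht : t ∈ I <;> simp [ht]
    simp only [h2]
    rw [setIntegral_indicator hI, inter_eq_right.2 hIT]
  simp only [Function.comp_def, e]
  refine tendsto_integral_bilin _ h1 (fun n => Lp.memLp (f n)) (Lp.memLp f') ?_
  have h3 : Tendsto (fun n => ‖f n - f'‖ₑ) atTop (𝓝 0) := by
    have := (hf.sub_const f').enorm
    rwa [sub_self, enorm_zero] at this
  refine h3.congr fun n => ?_
  rw [Lp.enorm_def]
  exact eLpNorm_congr_ae (Lp.coeFn_sub _ _)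

lemma continuous_stepValue (hT : 0 < T) (hN : 1 ≤ N) {n : ℕ} (hn : n < N) :
    Continuous fun f : L2TV T D => stepValue N f n :=
  (continuous_setIntegral_L2TV (measurableSet_gridIco T N n)
    (gridIco_subset hT hN hn)).const_smul (T / N)⁻¹

lemma stepValue_stepFunction (hT : 0 < T) (hN : 1 ≤ N) (a : ℕ → L2V D) {n : ℕ} (hn : n < N) :
    stepValue N (stepFunction T N a) n = a n := by
  have hN0 : (0 : ℝ) < N := by exact_mod_cast hN
  have h1 : ∫ t in gridIco T N n, stepFunction T N a t = ∫ t in gridIco T N n, a n := by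
    refine integral_congr_ae ?_
    have h2 := ae_restrict_of_ae_restrict_of_subset (gridIco_subset hT hN hn)
      (coeFn_stepFunction hT hN a)
    filter_upwards [h2, ae_restrict_mem (measurableSet_gridIco T N n)] with t h3 h4
    rw [h3, (mem_gridIco_iff hT hN (gridIco_subset hT hN hn h4).1).1 h4]
  change (T / N)⁻¹ • ∫ t in gridIco T N n, stepFunction T N a t = a n
  rw [h1, setIntegral_const, measureReal_def, volume_gridIco, ENNReal.toReal_ofReal (by positivity),
    smul_smul, inv_mul_cancel₀ (by positivity), one_smul]

lemma stepFunction_congr {a b : ℕ → L2V D} (h : ∀ n < N, a n = b n) :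
    stepFunction T N a = stepFunction T N b := by
  unfold stepFunction
  exact Finset.sum_congr rfl fun n hn => by rw [h n (Finset.mem_range.1 hn)]

lemma isClosed_eq_stepFunction (hT : 0 < T) (hN : 1 ≤ N) :
    IsClosed {f : L2TV T D | stepFunction T N (stepValue N f) = f} := by
  -- Continuity of `stepValue` is available for intervals inside `[0,T]`; the values from index `N`
  -- on do not matter and are replaced by zero.
  have e : ∀ f : L2TV T D, stepFunction T N (stepValue N f) =
      stepFunction T N (fun n => if n < N then stepValue N f n else 0) := fun f =>
    stepFunction_congr fun n hn => by rw [if_pos hn]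
  simp only [e]
  refine isClosed_eq ((continuous_stepFunction hT hN).comp (continuous_pi fun n => ?_))
    continuous_id
  by_cases hn : n < N
  · simpa only [if_pos hn] using continuous_stepValue hT hN hn
  · simpa only [if_neg hn] using continuous_const

lemma continuous_pathIncrement (hT : 0 ≤ T) (n : ℕ) :
    Continuous fun b : C(Icc (0 : ℝ) T, L2V D) => pathIncrement hT N b n :=
  (continuous_eval_const _).sub (continuous_eval_const _)

end StepFunction

/-! ### Bounds for the scheme -/

section Scheme

variable {D : Set E3} {Gf : ℕ → L2V D} {c : ℕ → ℝ} {Ω : Type*} {mΩ : MeasurableSpace Ω}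
  {P : Measure Ω}

/-- The constant of the energy inequality of one step. -/
def stepConst {D : Set E3} {Gf : ℕ → L2V D} {c : ℕ → ℝ} (hc : NoiseBound Gf c) (θ C S : ℝ) : ℝ :=
  2 * θ ^ 2 / (2 * θ - 1) * (2 * C ^ 2 + 2) * S
    + ‖noiseOp hc‖ ^ 2 * (volume.restrict D).real univ / 2

lemma stepConst_nonneg (hc : NoiseBound Gf c) {θ C S : ℝ} (hθ : 1 / 2 < θ) (hS : 0 ≤ S) :
    0 ≤ stepConst hc θ C S := by
  have : 0 < 2 * θ - 1 := by linarith
  unfold stepConst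
  positivity

/-- Induction over the steps: the new state is measurable for `𝓕 n ⊔ 𝓖 n ≤ 𝓕 (n + 1)` and has
integrable energy, which is what the next step requires. -/
lemma schemeState_moments [IsProbabilityMeasure P] (hD : IsOpen D) (hb : Bornology.IsBounded D)
    (hc : NoiseBound Gf c) {C : ℝ}
    (hCb : ∀ p ∈ h2Space D, ∀ᵐ x ∂volume.restrict D, ‖p none x‖ ≤ C * ‖p‖)
    {θ τ S : ℝ} (hθ : 1 / 2 < θ) (hτ : 0 < τ) {𝓕 𝓖 : ℕ → MeasurableSpace Ω}
    {y : ℕ → Ω → h2Space D} (hy : IsIncrementData P D τ S 𝓕 𝓖 y) {m₀ : L2V D}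
    (hm₀ : IsUnitField D m₀) {M v w : ℕ → Ω → L2V D}
    (hM : ∀ n ω, M n ω = schemeState D θ τ Gf m₀ (fun k => (y k ω : Jet2 D) none) n)
    (hv : ∀ n ω, v n ω = stepSolution D θ τ Gf (M n ω) ((y n ω : Jet2 D) none))
    (hw : ∀ n ω, w n ω = τ⁻¹ • (v n ω - crossV (M n ω) ((y n ω : Jet2 D) none))) (n : ℕ) :
    ((∀ ω, IsUnitField D (M n ω)) ∧ Measurable[𝓕 n] (M n) ∧
      Integrable (fun ω => gradSq D (M n ω)) P) ∧
    StepMoments P D θ τ (stepConst hc θ C S) (M n) (v n) (w n) (M (n + 1)) := by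
  have hMs : ∀ n, M (n + 1) = fun ω => normalizeL2 D (M n ω + v n ω) := fun n => by
    funext ω; rw [hM, hv, hM]; rfl
  have hws : ∀ n, w n = fun ω => τ⁻¹ • (v n ω - crossV (M n ω) ((y n ω : Jet2 D) none)) :=
    fun n => funext fun ω => hw n ω
  have key : ∀ n, ((∀ ω, IsUnitField D (M n ω)) ∧ Measurable[𝓕 n] (M n) ∧
      Integrable (fun ω => gradSq D (M n ω)) P) → _ := fun n h =>
    stepMoments hD hb hc hCb hθ hτ (hy.le n)
      ((hy.le_succ n).trans (hy.le (n + 1))) (hy.indep n) (hy.meas n) (hy.memLp n) (hy.sq_le n)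
      (hy.inner_eq n) h.2.1 h.1 h.2.2 (hv n)
  have hind : ∀ n, ((∀ ω, IsUnitField D (M n ω)) ∧ Measurable[𝓕 n] (M n) ∧
      Integrable (fun ω => gradSq D (M n ω)) P) := fun n => by
    induction n with
    | zero =>
      have h0 : M 0 = fun _ => m₀ := funext fun ω => hM 0 ω
      rw [h0]
      exact ⟨fun _ => hm₀, measurable_const, integrable_const _⟩
    | succ n ih =>
      obtain ⟨h1, h2, h3⟩ := key n ih
      have h4 := h3.int_grad
      rw [hMs n]
      exact ⟨h1, h2.mono (sup_le (hy.mono n) (hy.le_succ n)) le_rfl, h4⟩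
  refine ⟨hind n, ?_⟩
  rw [hMs n, hws n]
  exact (key n (hind n)).2.2

/-- The bounds for the scheme that are uniform in the time step. -/
structure SchemeBounds (P : Measure Ω) (D : Set E3) (τ B : ℝ) (N : ℕ)
    (S v w : ℕ → Ω → L2V D) : Prop where
  unit : ∀ n < N, ∀ᵐ ω ∂P, IsUnitField D (S n ω)
  grad : ∀ n < N, ∫⁻ ω, ENNReal.ofReal (gradSq D (S n ω)) ∂P ≤ ENNReal.ofReal B
  step : ∑ n ∈ Finset.range N, ∫⁻ ω, ENNReal.ofReal (gradSq D (v n ω)) ∂P ≤ ENNReal.ofReal B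
  drift : ENNReal.ofReal τ * ∑ n ∈ Finset.range N, ∫⁻ ω, ‖w n ω‖ₑ ^ 2 ∂P ≤ ENNReal.ofReal B

/-- The constant of the discrete energy estimate. -/
def gronwallConst (θ A T E₀ : ℝ) : ℝ :=
  (1 + 2 / (2 * θ - 1) + 2) * (E₀ + A * T * ((1 + E₀) * Real.exp (A * T)) +
    (1 + E₀) * Real.exp (A * T))

/-- One constant serves for all three bounds: the factor `2/(2θ-1)` undoes the weight of `V`, the
factor `2` that of `W`. -/
lemma gronwall_bounds {E V W : ℕ → ℝ} {θ A τ T : ℝ} {N : ℕ} (hθ : 1 / 2 < θ) (hA : 0 ≤ A)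
    (hτ : 0 < τ) (hN : N * τ = T) (hE : ∀ n, 0 ≤ E n) (hV : ∀ n, 0 ≤ V n) (hW : ∀ n, 0 ≤ W n)
    (h : ∀ n, E (n + 1) + ((2 * θ - 1) / 2 * V n + τ / 2 * W n) ≤ E n + A * τ * (1 + E n)) :
    (∀ n < N, E n ≤ gronwallConst θ A T (E 0)) ∧
    ∑ n ∈ Finset.range N, V n ≤ gronwallConst θ A T (E 0) ∧
    τ * ∑ n ∈ Finset.range N, W n ≤ gronwallConst θ A T (E 0) := by
  have hθ' : 0 < 2 * θ - 1 := by linarith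
  have hT0 : 0 ≤ T := by rw [← hN]; positivity
  have hVW : ∀ n, 0 ≤ (2 * θ - 1) / 2 * V n ∧ 0 ≤ τ / 2 * W n := fun n =>
    ⟨mul_nonneg (by positivity) (hV n), mul_nonneg (by positivity) (hW n)⟩
  have hgr := discrete_gronwall hA hτ.le hE (fun n => add_nonneg (hVW n).1 (hVW n).2) h
  have hE0 := hE 0
  obtain ⟨X, hX⟩ : ∃ X, X = (1 + E 0) * Real.exp (A * T) := ⟨_, rfl⟩
  obtain ⟨Y, hY⟩ : ∃ Y, Y = E 0 + A * T * X := ⟨_, rfl⟩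
  have hX0 : 0 ≤ X := by rw [hX]; positivity
  have hY0 : 0 ≤ Y := by rw [hY]; positivity
  obtain ⟨q, hq⟩ : ∃ q, q = 2 / (2 * θ - 1) := ⟨_, rfl⟩
  have hq0 : 0 ≤ q := by rw [hq]; positivity
  have e : gronwallConst θ A T (E 0) = (1 + q + 2) * (Y + X) := by
    rw [gronwallConst, hY, hX, hq]
  have hdn : ∑ i ∈ Finset.range N, ((2 * θ - 1) / 2 * V i + τ / 2 * W i) ≤ Y := by
    have h1 := (hgr N).2
    rwa [hN, ← hX, ← hY] at h1
  have hqX : 0 ≤ q * X := mul_nonneg hq0 hX0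
  have hqY : 0 ≤ q * Y := mul_nonneg hq0 hY0
  rw [e]
  refine ⟨fun n hn => ?_, ?_, ?_⟩
  · have h1 := (hgr n).1
    have h2 : (n : ℝ) * τ ≤ T := by
      rw [← hN]; gcongr
    have h3 : (1 + E 0) * Real.exp (A * (n * τ)) ≤ X := by
      rw [hX]; gcongr
    linarith
  · have h1 : ∑ n ∈ Finset.range N, V n ≤
        q * ∑ i ∈ Finset.range N, ((2 * θ - 1) / 2 * V i + τ / 2 * W i) := by
      rw [Finset.mul_sum]
      refine Finset.sum_le_sum fun n _ => ?_
      have e1 : V n = q * ((2 * θ - 1) / 2 * V n) := by rw [hq]; field_simp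
      calc V n = q * ((2 * θ - 1) / 2 * V n) := e1
        _ ≤ _ := mul_le_mul_of_nonneg_left (by linarith [(hVW n).2]) hq0
    have := mul_le_mul_of_nonneg_left hdn hq0
    linarith
  · have h1 : τ * ∑ n ∈ Finset.range N, W n ≤
        2 * ∑ i ∈ Finset.range N, ((2 * θ - 1) / 2 * V i + τ / 2 * W i) := by
      rw [Finset.mul_sum, Finset.mul_sum]
      refine Finset.sum_le_sum fun n _ => ?_
      linarith [(hVW n).1]
    linarith

lemma schemeBounds_of_increments [IsProbabilityMeasure P] (hD : IsOpen D)
    (hb : Bornology.IsBounded D) (hc : NoiseBound Gf c) {C : ℝ}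
    (hCb : ∀ p ∈ h2Space D, ∀ᵐ x ∂volume.restrict D, ‖p none x‖ ≤ C * ‖p‖)
    {θ τ S T : ℝ} (hθ : 1 / 2 < θ) (hτ : 0 < τ) (hS : 0 ≤ S) {𝓕 𝓖 : ℕ → MeasurableSpace Ω}
    {y : ℕ → Ω → h2Space D} (hy : IsIncrementData P D τ S 𝓕 𝓖 y) {m₀ : L2V D}
    (hm₀ : IsUnitField D m₀) {M v w : ℕ → Ω → L2V D}
    (hM : ∀ n ω, M n ω = schemeState D θ τ Gf m₀ (fun k => (y k ω : Jet2 D) none) n)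
    (hv : ∀ n ω, v n ω = stepSolution D θ τ Gf (M n ω) ((y n ω : Jet2 D) none))
    (hw : ∀ n ω, w n ω = τ⁻¹ • (v n ω - crossV (M n ω) ((y n ω : Jet2 D) none)))
    {N : ℕ} (hN : N * τ = T) :
    SchemeBounds P D τ (gronwallConst θ (stepConst hc θ C S) T (gradSq D m₀)) N M v w := by
  have hmom := schemeState_moments hD hb hc hCb hθ hτ hy hm₀ hM hv hw
  have hg0 : ∀ u : L2V D, 0 ≤ gradSq D u := gradSq_nonneg D
  have hVn : ∀ n, 0 ≤ ∫ ω, gradSq D (v n ω) ∂P := fun n => integral_nonneg fun ω => hg0 _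
  have hWn : ∀ n, 0 ≤ ∫ ω, ‖w n ω‖ ^ 2 ∂P := fun n =>
    integral_nonneg fun ω => sq_nonneg ‖w n ω‖
  have hE0 : ∫ ω, gradSq D (M 0 ω) ∂P = gradSq D m₀ := by
    have : M 0 = fun _ => m₀ := funext fun ω => hM 0 ω
    rw [this, integral_const, probReal_univ, one_smul]
  have hgr := gronwall_bounds (E := fun n => ∫ ω, gradSq D (M n ω) ∂P) hθ
    (stepConst_nonneg (C := C) hc hθ hS) hτ hN
    (fun n => integral_nonneg fun ω => hg0 _) hVn hWn fun n => (hmom n).2.le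
  rw [hE0] at hgr
  obtain ⟨hE, hV, hW⟩ := hgr
  refine ⟨fun n _ => Eventually.of_forall (hmom n).1.1, fun n hn => ?_, ?_, ?_⟩
  · rw [← ofReal_integral_eq_lintegral_ofReal (hmom n).1.2.2 (Eventually.of_forall fun ω => hg0 _)]
    exact ENNReal.ofReal_le_ofReal (hE n hn)
  · have h1 : ∀ n, ∫⁻ ω, ENNReal.ofReal (gradSq D (v n ω)) ∂P =
        ENNReal.ofReal (∫ ω, gradSq D (v n ω) ∂P) := fun n =>
      (ofReal_integral_eq_lintegral_ofReal (hmom n).2.int_v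
        (Eventually.of_forall fun ω => hg0 _)).symm
    simp only [h1]
    rw [← ENNReal.ofReal_sum_of_nonneg fun n _ => hVn n]
    exact ENNReal.ofReal_le_ofReal hV
  · have h1 : ∀ n, ∫⁻ ω, ‖w n ω‖ₑ ^ 2 ∂P = ENNReal.ofReal (∫ ω, ‖w n ω‖ ^ 2 ∂P) := fun n => by
      rw [ofReal_integral_eq_lintegral_ofReal (hmom n).2.int_w
        (Eventually.of_forall fun ω => sq_nonneg ‖w n ω‖)]
      refine lintegral_congr fun ω => ?_
      rw [ENNReal.ofReal_pow (norm_nonneg _), ofReal_norm]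
    simp only [h1]
    rw [← ENNReal.ofReal_sum_of_nonneg fun n _ => hWn n, ← ENNReal.ofReal_mul hτ.le]
    exact ENNReal.ofReal_le_ofReal hW

/-- The process of the algorithm, driven by the path `b`. -/
def pathState {T : ℝ} (hT : 0 ≤ T) (θ : ℝ) (Gf : ℕ → L2V D) (m₀ : L2V D) (N : ℕ)
    (b : C(Icc (0 : ℝ) T, L2V D)) (n : ℕ) : L2V D :=
  schemeState D θ (T / N) Gf m₀ (pathIncrement hT N b) n

/-- The solution of the step problem with data `m` and `g`, without its noise part, divided by the
time step. -/
def driftField (D : Set E3) (θ τ : ℝ) (Gf : ℕ → L2V D) (m g : L2V D) : L2V D :=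
  τ⁻¹ • (stepSolution D θ τ Gf m g - crossV m g)

/-- The Sobolev embedding turns square summability in `H²(D)³` into square summable uniform bounds.
-/
lemma noiseBound_of_normSqH2 {C : ℝ} (hG : ∀ i, MemH2 D (Gf i))
    (hS : Summable fun i => normSqH2 D (Gf i))
    (hCb : ∀ p ∈ h2Space D, ∀ᵐ x ∂volume.restrict D, ‖p none x‖ ≤ C * ‖p‖) :
    NoiseBound Gf fun i => C * ‖jet2 D (Gf i)‖ := by
  have e : (fun i => (C * ‖jet2 D (Gf i)‖) ^ 2) = fun i => C ^ 2 * normSqH2 D (Gf i) :=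
    funext fun i => by rw [mul_pow, norm_jet2_sq]
  have h1 : Summable fun i => (C * ‖jet2 D (Gf i)‖) ^ 2 := by
    rw [e]; exact hS.mul_left (C ^ 2)
  exact ⟨h1, fun i => hCb (jet2 D (Gf i)) (jet2_mem (hG i))⟩

lemma exists_schemeBounds [IsProbabilityMeasure P] (hD : IsOpen D)
    (hb : Bornology.IsBounded D) (hc : NoiseBound Gf c) {C : ℝ}
    (hCb : ∀ p ∈ h2Space D, ∀ᵐ x ∂volume.restrict D, ‖p none x‖ ≤ C * ‖p‖)
    (hG : ∀ i, MemH2 D (Gf i)) (hS : Summable fun i => normSqH2 D (Gf i))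
    {θ T : ℝ} (hθ : 1 / 2 < θ) (hT : 0 < T) {m₀ : L2V D} (hm₀ : IsUnitField D m₀)
    {β : ℕ → ℝ≥0 → Ω → ℝ} {GW : Ω → C(Icc (0 : ℝ) T, L2V D)} (h : IsNoise P Gf β GW) :
    ∃ B : ℝ, ∀ N : ℕ, 1 ≤ N → SchemeBounds P D (T / N) B N
      (fun n ω => pathState hT.le θ Gf m₀ N (GW ω) n)
      (fun n ω => stepSolution D θ (T / N) Gf (pathState hT.le θ Gf m₀ N (GW ω) n)
        (pathIncrement hT.le N (GW ω) n))
      (fun n ω => driftField D θ (T / N) Gf (pathState hT.le θ Gf m₀ N (GW ω) n)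
        (pathIncrement hT.le N (GW ω) n)) := by
  refine ⟨gronwallConst θ (stepConst hc θ C (∑' i, normSqH2 D (Gf i))) T (gradSq D m₀),
    fun N hN => ?_⟩
  · have hN0 : (0 : ℝ) < N := by exact_mod_cast hN
    obtain ⟨𝓕, 𝓖, y, hy, hae⟩ := exists_increments hT.le hG hS h N
    have hS0 : 0 ≤ ∑' i, normSqH2 D (Gf i) :=
      tsum_nonneg fun i => by rw [← norm_jet2_sq]; positivity
    have hbd := schemeBounds_of_increments (T := T) hD hb hc hCb hθ (by positivity) hS0 hy hm₀
      (fun _ _ => rfl) (fun _ _ => rfl) (fun _ _ => rfl) (mul_div_cancel₀ _ hN0.ne')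
    -- The bounds are proved for the scheme driven by the `H²` increments; on a set of full measure
    -- it coincides with the scheme driven by the path.
    have e : ∀ᵐ ω ∂P, ∀ n, schemeState D θ (T / N) Gf m₀ (fun k => (y k ω : Jet2 D) none) n
        = pathState hT.le θ Gf m₀ N (GW ω) n ∧
        (y n ω : Jet2 D) none = pathIncrement hT.le N (GW ω) n := by
      filter_upwards [hae] with ω hω n
      refine ⟨?_, hω n⟩
      rw [pathState, funext hω]
    refine ⟨fun n hn => ?_, fun n hn => ?_, ?_, ?_⟩
    · filter_upwards [hbd.unit n hn, e] with ω h1 h2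
      rwa [← (h2 n).1]
    · refine le_of_eq_of_le (lintegral_congr_ae ?_) (hbd.grad n hn)
      filter_upwards [e] with ω h2
      rw [← (h2 n).1]
    · refine le_of_eq_of_le (Finset.sum_congr rfl fun n _ => lintegral_congr_ae ?_) hbd.step
      filter_upwards [e] with ω h2
      rw [← (h2 n).1, ← (h2 n).2]
    · refine le_of_eq_of_le ?_ hbd.drift
      congr 1
      refine Finset.sum_congr rfl fun n _ => lintegral_congr_ae ?_
      filter_upwards [e] with ω h2
      rw [← (h2 n).1, ← (h2 n).2, driftField]

end Scheme

/-! ### The equation of one step, tested with bounded fields -/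

section StepIdentity

variable {D : Set E3} {Gf : ℕ → L2V D} {c : ℕ → ℝ}

/-- The noise term of the tested equation. -/
def noiseDrift (K : L2V D →L[ℝ] L2V D) (m : L2V D) : L2V D :=
  (1 / 2 : ℝ) • (crossV m (K m) - crossV m (crossV m (K m)))

/-- Both the solution `v` and the product `m × g` are orthogonal to `m`. -/
lemma crossV_crossV_driftField (hD : IsOpen D) (hb : Bornology.IsBounded D)
    (hc : NoiseBound Gf c) {θ τ : ℝ} (hθ : 0 < θ) (hτ : 0 < τ) {m : L2V D}
    (hm : IsUnitField D m) (g : L2V D) :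
    crossV m (crossV m (driftField D θ τ Gf m g)) = -driftField D θ τ Gf m g := by
  have h1 := (stepSolution_spec hD hb hc hθ hτ hm.2 g).1.2
  rw [← crossV_crossV_eq_neg_iff hm.2] at h1
  rw [driftField, crossV_smul, crossV_smul, crossV_sub, crossV_sub, h1,
    crossV_crossV_crossV hm.2, ← smul_neg]
  congr 1
  abel

/-- The equation of one step, tested with `m × ψ` for bounded fields `ψ`. -/
lemma driftField_inner (hD : IsOpen D) (hb : Bornology.IsBounded D)
    (hc : NoiseBound Gf c) {θ τ : ℝ} (hθ : 0 < θ) (hτ : 0 < τ) {m : L2V D}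
    (hm : IsUnitField D m) (g : L2V D) {ψ : L2V D} {R : ℝ}
    (hψ : ∀ᵐ x ∂volume.restrict D, ‖ψ x‖ ≤ R) (hψ1 : MemH1 D ψ) :
    inner ℝ (driftField D θ τ Gf m g + crossV m (driftField D θ τ Gf m g)
        - noiseDrift (noiseOp hc) m) ψ
      + 2 * ∑ k, inner ℝ (crossV m (weakPartial D k m)) (weakPartial D k ψ) =
    2 * θ * ∑ k, inner ℝ (weakPartial D k (stepSolution D θ τ Gf m g))
      (crossBdd hψ (weakPartial D k m) + crossV m (weakPartial D k ψ)) := by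
  have hsp := stepSolution_spec hD hb hc hθ hτ hm.2 g
  have hcc := crossV_crossV_driftField hD hb hc hθ hτ hm g
  have hwp : ∀ k, HasWeakPartial D k (crossV m ψ)
      (crossBdd hψ (weakPartial D k m) + crossV m (weakPartial D k ψ)) := fun k =>
    HasWeakPartial.crossV_bdd hD hb hm.2 hψ (hm.1.hasWeakPartial k) (hψ1.hasWeakPartial k)
  have htan : MemTangent D m (crossV m ψ) := by
    refine ⟨fun k => ⟨_, hwp k⟩, ?_⟩
    rw [← crossV_crossV_eq_neg_iff hm.2, crossV_crossV_crossV hm.2]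
  have heq := ((isStepSolution_iff hc hm.2).1 hsp).2 _ htan
  obtain ⟨v, hv⟩ : ∃ v, v = stepSolution D θ τ Gf m g := ⟨_, rfl⟩
  obtain ⟨w, hw⟩ : ∃ w, w = driftField D θ τ Gf m g := ⟨_, rfl⟩
  have hvw : v - crossV m g = τ • w := by
    rw [hw, driftField, smul_smul, mul_inv_cancel₀ hτ.ne', one_smul, hv]
  rw [← hw] at hcc ⊢
  rw [← hv] at heq ⊢
  -- The cross product moves from the test field to the residual, and `m × (1 - m ×)` acts on the
  -- tangent field `w` as `w ↦ w + m × w`.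
  have hr : inner ℝ (stepResidual τ (noiseOp hc) m g v) (crossV m ψ) =
      -(τ * inner ℝ (w + crossV m w - noiseDrift (noiseOp hc) m) ψ) := by
    have h1 : inner ℝ (stepResidual τ (noiseOp hc) m g v) (crossV m ψ) =
        -inner ℝ (crossV m (stepResidual τ (noiseOp hc) m g v)) ψ := by
      rw [crossV_antisymm, neg_neg]
    rw [h1, ← real_inner_smul_left]
    congr 2
    rw [stepResidual, hvw, noiseDrift]
    simp only [crossV_sub, crossV_smul, hcc]
    module
  have hk : ∀ k, inner ℝ (weakPartial D k m + θ • weakPartial D k v)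
      (weakPartial D k (crossV m ψ)) =
      -inner ℝ (crossV m (weakPartial D k m)) (weakPartial D k ψ)
      + θ * inner ℝ (weakPartial D k v)
        (crossBdd hψ (weakPartial D k m) + crossV m (weakPartial D k ψ)) := fun k => by
    rw [(hwp k).weakPartial_eq hD hb, inner_add_left, inner_add_right (weakPartial D k m),
      inner_crossBdd_self, zero_add, real_inner_smul_left, crossV_antisymm m (weakPartial D k m),
      neg_neg]
  rw [hr] at heq
  simp only [hk, Finset.sum_add_distrib, Finset.sum_neg_distrib, ← Finset.mul_sum] at heq
  have h2 : τ * (inner ℝ (w + crossV m w - noiseDrift (noiseOp hc) m) ψ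
      + 2 * ∑ k, inner ℝ (crossV m (weakPartial D k m)) (weakPartial D k ψ)) =
      τ * (2 * θ * ∑ k, inner ℝ (weakPartial D k v)
      (crossBdd hψ (weakPartial D k m) + crossV m (weakPartial D k ψ))) := by
    linarith
  exact mul_left_cancel₀ hτ.ne' h2

end StepIdentity

/-! ### Transfer to the new probability space -/

section Transfer

/-- The functional `Φ` of interest involves choices and need not be measurable. It is replaced by
the measurable `Ψ` on the Borel set `U` in which both variables lie almost surely. -/
lemma lintegral_eq_of_identDistrib {Ω Ω' Z : Type*} {mΩ : MeasurableSpace Ω}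
    {mΩ' : MeasurableSpace Ω'} [MeasurableSpace Z] {P : Measure Ω} {P' : Measure Ω'}
    {X : Ω → Z} {X' : Ω' → Z} (h : IdentDistrib X' X P' P) {U : Set Z} (hU : MeasurableSet U)
    (hX : ∀ᵐ ω ∂P, X ω ∈ U) {Φ Ψ : Z → ℝ≥0∞} (hΨ : Measurable Ψ) (hΦ : ∀ p ∈ U, Φ p = Ψ p) :
    ∫⁻ ω, Φ (X' ω) ∂P' = ∫⁻ ω, Φ (X ω) ∂P := by
  have hX' : ∀ᵐ ω ∂P', X' ω ∈ U := h.symm.ae_snd (p := fun z => z ∈ U) hU hX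
  calc ∫⁻ ω, Φ (X' ω) ∂P' = ∫⁻ ω, Ψ (X' ω) ∂P' :=
        lintegral_congr_ae (hX'.mono fun ω hω => hΦ _ hω)
    _ = ∫⁻ ω, Ψ (X ω) ∂P := (h.comp hΨ).lintegral_eq
    _ = ∫⁻ ω, Φ (X ω) ∂P := lintegral_congr_ae (hX.mono fun ω hω => (hΦ _ hω).symm)

variable {D : Set E3} {Gf : ℕ → L2V D} {c : ℕ → ℝ}

/-- Measurable versions of the maps that occur in the algorithm. -/
lemma exists_measurable_step (hD : IsOpen D) (hb : Bornology.IsBounded D)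
    (hc : NoiseBound Gf c) {θ τ : ℝ} (hθ : 0 < θ) (hτ : 0 < τ) :
    MeasurableSet {p : L2V D × L2V D | IsUnitField D p.1} ∧
    (∃ F : L2V D × L2V D → L2V D, Measurable F ∧
      ∀ p ∈ {p : L2V D × L2V D | IsUnitField D p.1}, driftField D θ τ Gf p.1 p.2 = F p) ∧
    (∀ k, ∃ F : L2V D × L2V D → L2V D, Measurable F ∧
      ∀ p ∈ {p : L2V D × L2V D | IsUnitField D p.1}, weakPartial D k p.1 = F p) ∧
    ∀ k, ∃ F : L2V D × L2V D → L2V D, Measurable F ∧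
      ∀ p ∈ {p : L2V D × L2V D | IsUnitField D p.1},
        weakPartial D k (stepSolution D θ τ Gf p.1 p.2) = F p := by
  obtain ⟨hU, F, hF, hFe⟩ := exists_measurable_stepSolution hD hb hc hθ hτ
  choose W hW hWe using exists_measurable_weakPartial (D := D) hD hb
  refine ⟨hU.preimage measurable_fst, ⟨fun p => τ⁻¹ • (F p - crossV p.1 p.2), ?_, fun p hp => ?_⟩,
    fun k => ⟨fun p => W k p.1, (hW k).comp measurable_fst, fun p hp => (hWe k _ hp.1).symm⟩,
    fun k => ⟨fun p => W k (F p), (hW k).comp hF, fun p hp => ?_⟩⟩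
  · exact (hF.sub (measurable_crossV measurable_fst measurable_snd)).const_smul τ⁻¹
  · change driftField D θ τ Gf p.1 p.2 = τ⁻¹ • (F (p.1, p.2) - crossV p.1 p.2)
    rw [hFe _ _ hp, driftField]
  · change _ = W k (F (p.1, p.2))
    rw [hFe _ _ hp, hWe k]
    exact (stepSolution_spec hD hb hc hθ hτ hp.2 p.2).1.1

/-- The measurability of the fields that occur in the algorithm. -/
structure SchemeMeasurable {Ω : Type*} [MeasurableSpace Ω] (P : Measure Ω) (D : Set E3) (N : ℕ)
    (S v w : ℕ → Ω → L2V D) : Prop where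
  state : ∀ n < N, AEStronglyMeasurable (S n) P
  drift : ∀ n < N, AEStronglyMeasurable (w n) P
  grad : ∀ n < N, ∀ k, AEStronglyMeasurable (fun ω => weakPartial D k (S n ω)) P
  step : ∀ n < N, ∀ k, AEStronglyMeasurable (fun ω => weakPartial D k (v n ω)) P

/-- On the Borel set of unit fields the step map and the weak derivatives agree with Borel maps, so
the joint law of state and increment at each step determines all the bounds. Lower integrals avoid
the question of integrability on the new space. -/
lemma SchemeBounds.transfer (hD : IsOpen D) (hb : Bornology.IsBounded D)
    (hc : NoiseBound Gf c) {θ τ B : ℝ} (hθ : 0 < θ) (hτ : 0 < τ) {N : ℕ}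
    {Ω Ω' : Type*} {mΩ : MeasurableSpace Ω}
    {mΩ' : MeasurableSpace Ω'} {P : Measure Ω} {P' : Measure Ω'} {S g : ℕ → Ω → L2V D}
    {S' g' : ℕ → Ω' → L2V D}
    (hid : ∀ n < N, IdentDistrib (fun ω => (S' n ω, g' n ω)) (fun ω => (S n ω, g n ω)) P' P)
    (h : SchemeBounds P D τ B N S (fun n ω => stepSolution D θ τ Gf (S n ω) (g n ω))
      (fun n ω => driftField D θ τ Gf (S n ω) (g n ω))) :
    SchemeBounds P' D τ B N S' (fun n ω => stepSolution D θ τ Gf (S' n ω) (g' n ω))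
      (fun n ω => driftField D θ τ Gf (S' n ω) (g' n ω)) ∧
    SchemeMeasurable P' D N S' (fun n ω => stepSolution D θ τ Gf (S' n ω) (g' n ω))
      (fun n ω => driftField D θ τ Gf (S' n ω) (g' n ω)) := by
  obtain ⟨hU, ⟨F, hF, hFe⟩, hW, hV⟩ := exists_measurable_step hD hb hc hθ hτ
  choose W hW hWe using hW
  choose V hV hVe using hV
  have hunit : ∀ n < N, ∀ᵐ ω ∂P', (S' n ω, g' n ω) ∈ {p : L2V D × L2V D | IsUnitField D p.1} :=
    fun n hn => (hid n hn).symm.ae_snd (p := fun z => z ∈ {p : L2V D × L2V D | IsUnitField D p.1})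
      hU (h.unit n hn)
  have hm : ∀ n < N, ∀ (Φ Ψ : L2V D × L2V D → L2V D), Measurable Ψ →
      (∀ p ∈ {p : L2V D × L2V D | IsUnitField D p.1}, Φ p = Ψ p) →
      AEStronglyMeasurable (fun ω => Φ (S' n ω, g' n ω)) P' := fun n hn Φ Ψ hΨ hΦ => by
    have h1 : AEMeasurable (fun ω => Ψ (S' n ω, g' n ω)) P' :=
      hΨ.comp_aemeasurable (hid n hn).aemeasurable_fst
    exact h1.aestronglyMeasurable.congr ((hunit n hn).mono fun ω hω => (hΦ _ hω).symm)
  refine ⟨⟨hunit, fun n hn => ?_, ?_, ?_⟩, ⟨fun n hn => ?_, fun n hn => ?_, fun n hn k => ?_,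
    fun n hn k => ?_⟩⟩
  · refine le_of_eq_of_le ?_ (h.grad n hn)
    refine lintegral_eq_of_identDistrib (hid n hn) hU (h.unit n hn)
      (Φ := fun p => ENNReal.ofReal (gradSq D p.1))
      (Ψ := fun p => ENNReal.ofReal (∑ k, ‖W k p‖ ^ 2)) ?_ fun p hp => ?_
    · exact (Finset.measurable_fun_sum _ fun k _ => (hW k).norm.pow_const 2).ennreal_ofReal
    · simp only [gradSq, hWe _ p hp]
  · refine le_of_eq_of_le (Finset.sum_congr rfl fun n hn => ?_) h.step
    have hn := Finset.mem_range.1 hn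
    refine lintegral_eq_of_identDistrib (hid n hn) hU (h.unit n hn)
      (Φ := fun p => ENNReal.ofReal (gradSq D (stepSolution D θ τ Gf p.1 p.2)))
      (Ψ := fun p => ENNReal.ofReal (∑ k, ‖V k p‖ ^ 2)) ?_ fun p hp => ?_
    · exact (Finset.measurable_fun_sum _ fun k _ => (hV k).norm.pow_const 2).ennreal_ofReal
    · simp only [gradSq, hVe _ p hp]
  · refine le_of_eq_of_le ?_ h.drift
    congr 1
    refine Finset.sum_congr rfl fun n hn => ?_
    have hn := Finset.mem_range.1 hn
    exact lintegral_eq_of_identDistrib (hid n hn) hU (h.unit n hn)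
      (Φ := fun p => ‖driftField D θ τ Gf p.1 p.2‖ₑ ^ 2) (Ψ := fun p => ‖F p‖ₑ ^ 2)
      (hF.enorm.pow_const 2) fun p hp => by simp only [hFe p hp]
  · exact (measurable_fst.comp_aemeasurable (hid n hn).aemeasurable_fst).aestronglyMeasurable
  · exact hm n hn (fun p => driftField D θ τ Gf p.1 p.2) F hF hFe
  · exact hm n hn (fun p => weakPartial D k p.1) (W k) (hW k) (hWe k)
  · exact hm n hn (fun p => weakPartial D k (stepSolution D θ τ Gf p.1 p.2)) (V k) (hV k) (hVe k)

/-- Mean values over the grid intervals are continuous in the process, and being a step function is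
a closed condition; both pass to any variable with the same law. -/
lemma identDistrib_stepValue {Ω Ω' : Type*} {mΩ : MeasurableSpace Ω} {mΩ' : MeasurableSpace Ω'}
    {P : Measure Ω} {P' : Measure Ω'} {T : ℝ} (hT : 0 < T) {N : ℕ} (hN : 1 ≤ N)
    {a : Ω → ℕ → L2V D} {b : Ω → C(Icc (0 : ℝ) T, L2V D)} {f' : Ω' → L2TV T D}
    {b' : Ω' → C(Icc (0 : ℝ) T, L2V D)}
    (h : EqualLaw (fun ω => (f' ω, b' ω)) P' (fun ω => (stepFunction T N (a ω), b ω)) P) :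
    (∀ᵐ ω ∂P', stepFunction T N (stepValue N (f' ω)) = f' ω) ∧
    ∀ n < N, IdentDistrib (fun ω => (stepValue N (f' ω) n, pathIncrement hT.le N (b' ω) n))
      (fun ω => (a ω n, pathIncrement hT.le N (b ω) n)) P' P := by
  -- `EqualLaw` refers to the Borel sets of the product topology, so continuous maps on the product
  -- are the admissible ones.
  let _ : MeasurableSpace (L2TV T D × C(Icc (0 : ℝ) T, L2V D)) := borel _
  have _ : BorelSpace (L2TV T D × C(Icc (0 : ℝ) T, L2V D)) := ⟨rfl⟩
  have h' : IdentDistrib (fun ω => (f' ω, b' ω)) (fun ω => (stepFunction T N (a ω), b ω)) P' P := h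
  constructor
  · have hcl : IsClosed {z : L2TV T D × C(Icc (0 : ℝ) T, L2V D) |
        stepFunction T N (stepValue N z.1) = z.1} :=
      (isClosed_eq_stepFunction hT hN).preimage continuous_fst
    refine h'.symm.ae_snd (p := fun z => stepFunction T N (stepValue N z.1) = z.1)
      hcl.measurableSet (Eventually.of_forall fun ω => ?_)
    exact stepFunction_congr fun n hn => stepValue_stepFunction hT hN (a ω) hn
  · intro n hn
    have hj : Continuous fun z : L2TV T D × C(Icc (0 : ℝ) T, L2V D) =>
        (stepValue N z.1 n, pathIncrement hT.le N z.2 n) :=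
      ((continuous_stepValue hT hN hn).comp continuous_fst).prodMk
        ((continuous_pathIncrement hT.le n).comp continuous_snd)
    have h1 := h'.comp hj.measurable
    have e : (fun z : L2TV T D × C(Icc (0 : ℝ) T, L2V D) =>
        (stepValue N z.1 n, pathIncrement hT.le N z.2 n)) ∘
        (fun ω => (stepFunction T N (a ω), b ω)) =
        fun ω => (a ω n, pathIncrement hT.le N (b ω) n) :=
      funext fun ω => Prod.ext (stepValue_stepFunction hT hN (a ω) hn) rfl
    rw [e] at h1
    exact h1

end Transfer

/-! ### Weak convergence in Hilbert spaces -/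

section Weak

variable {H : Type*} [NormedAddCommGroup H] [InnerProductSpace ℝ H]
  {H' : Type*} [NormedAddCommGroup H'] [InnerProductSpace ℝ H']

/-- Weak convergence of a sequence in a Hilbert space. -/
def WeakTendsto (x : ℕ → H) (x' : H) : Prop :=
  ∀ y, Tendsto (fun n => inner ℝ (x n) y) atTop (𝓝 (inner ℝ x' y))

lemma WeakTendsto.of_tendsto {x : ℕ → H} {x' : H} (h : Tendsto x atTop (𝓝 x')) :
    WeakTendsto x x' := fun _ => h.inner tendsto_const_nhds

lemma WeakTendsto.add {x z : ℕ → H} {x' z' : H} (h : WeakTendsto x x') (h' : WeakTendsto z z') :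
    WeakTendsto (fun n => x n + z n) (x' + z') := fun y => by
  simpa only [inner_add_left] using (h y).add (h' y)

lemma WeakTendsto.smul {x : ℕ → H} {x' : H} (r : ℝ) (h : WeakTendsto x x') :
    WeakTendsto (fun n => r • x n) (r • x') := fun y => by
  simpa only [real_inner_smul_left] using (h y).const_mul r

lemma WeakTendsto.sub {x z : ℕ → H} {x' z' : H} (h : WeakTendsto x x') (h' : WeakTendsto z z') :
    WeakTendsto (fun n => x n - z n) (x' - z') := fun y => by
  simpa only [inner_sub_left] using (h y).sub (h' y)

lemma WeakTendsto.sum {ι : Type*} {s : Finset ι} {x : ι → ℕ → H} {x' : ι → H}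
    (h : ∀ i ∈ s, WeakTendsto (x i) (x' i)) :
    WeakTendsto (fun n => ∑ i ∈ s, x i n) (∑ i ∈ s, x' i) := fun y => by
  simp only [sum_inner]
  exact tendsto_finsetSum _ fun i hi => h i hi y

lemma WeakTendsto.clm [CompleteSpace H] [CompleteSpace H'] (A : H →L[ℝ] H') {x : ℕ → H} {x' : H}
    (h : WeakTendsto x x') : WeakTendsto (fun n => A (x n)) (A x') := fun y => by
  simpa only [ContinuousLinearMap.adjoint_inner_right] using h (A.adjoint y)

lemma WeakTendsto.unique {x : ℕ → H} {x' x'' : H} (h : WeakTendsto x x')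
    (h' : WeakTendsto x x'') : x' = x'' :=
  ext_inner_right ℝ fun y => tendsto_nhds_unique (h y) (h' y)

lemma WeakTendsto.comp {x : ℕ → H} {x' : H} (h : WeakTendsto x x') {φ : ℕ → ℕ}
    (hφ : StrictMono φ) : WeakTendsto (fun n => x (φ n)) x' :=
  fun y => (h y).comp hφ.tendsto_atTop

lemma WeakTendsto.inner_tendsto {x z : ℕ → H} {x' z' : H} {C : ℝ} (hC : ∀ n, ‖x n‖ ≤ C)
    (h : WeakTendsto x x') (hz : Tendsto z atTop (𝓝 z')) :
    Tendsto (fun n => inner ℝ (x n) (z n)) atTop (𝓝 (inner ℝ x' z')) := by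
  have h1 : Tendsto (fun n => inner ℝ (x n) (z n - z')) atTop (𝓝 0) := by
    refine squeeze_zero_norm (a := fun n => C * ‖z n - z'‖) (fun n => ?_) ?_
    · exact (norm_inner_le_norm _ _).trans (mul_le_mul_of_nonneg_right (hC n) (norm_nonneg _))
    · have h2 := (hz.sub_const z').norm.const_mul C
      rwa [sub_self, norm_zero, mul_zero] at h2
  have h3 := h1.add (h z')
  simpa only [← inner_add_right, sub_add_cancel, zero_add] using h3

/-- Bounded sequences in a Hilbert space have weakly convergent subsequences. -/
lemma exists_weakTendsto_subseq [CompleteSpace H] {x : ℕ → H} {C : ℝ} (hC : ∀ n, ‖x n‖ ≤ C) :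
    ∃ (x' : H) (φ : ℕ → ℕ), StrictMono φ ∧ WeakTendsto (fun n => x (φ n)) x' := by
  -- The closed span of the sequence is separable, which makes sequential Banach-Alaoglu available
  -- without separability of `H`.
  set K : Submodule ℝ H := (Submodule.span ℝ (range x)).topologicalClosure with hK
  have hxK : ∀ n, x n ∈ K := fun n =>
    Submodule.le_topologicalClosure _ (Submodule.subset_span (mem_range_self n))
  have hsep : TopologicalSpace.IsSeparable (K : Set H) := by
    rw [hK, Submodule.topologicalClosure_coe]
    exact ((countable_range x).isSeparable.span (R := ℝ)).closure
  have : TopologicalSpace.SeparableSpace K := hsep.separableSpace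
  have : CompleteSpace K := (Submodule.isClosed_topologicalClosure _).completeSpace_coe
  obtain ⟨f, -, φ, hφ, hf⟩ := WeakDual.isSeqCompact_closedBall ℝ K 0 C
    (x := fun n => StrongDual.toWeakDual (innerSL ℝ (⟨x n, hxK n⟩ : K))) fun n => by
      rw [mem_preimage, mem_closedBall_zero_iff]
      change ‖innerSL ℝ (⟨x n, hxK n⟩ : K)‖ ≤ C
      rw [innerSL_apply_norm]
      exact hC n
  set z : K := (InnerProductSpace.toDual ℝ K).symm (WeakDual.toStrongDual f) with hz
  refine ⟨z, φ, hφ, fun y => ?_⟩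
  have h1 := ((WeakDual.eval_continuous (𝕜 := ℝ) (K.orthogonalProjectionOnto y)).tendsto f).comp hf
  have h2 : ∀ u : K, inner ℝ (u : H) y = inner ℝ u (K.orthogonalProjectionOnto y) := fun u => by
    rw [Submodule.inner_orthogonalProjectionOnto_eq_of_mem_left]
  have h3 : f (K.orthogonalProjectionOnto y) = inner ℝ (z : H) y := by
    rw [h2, hz]
    exact (InnerProductSpace.toDual_symm_apply (𝕜 := ℝ)).symm
  rw [h3] at h1
  refine h1.congr fun n => ?_
  exact (h2 ⟨x (φ n), hxK (φ n)⟩).symm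

/-- One extraction in the finite Hilbert sum gives a common subsequence for all components. -/
lemma exists_weakTendsto_subseq_family [CompleteSpace H] {ι : Type*} [Fintype ι] {x : ℕ → ι → H}
    {C : ℝ} (hC : ∀ n i, ‖x n i‖ ≤ C) :
    ∃ (x' : ι → H) (φ : ℕ → ℕ), StrictMono φ ∧ ∀ i, WeakTendsto (fun n => x (φ n) i) (x' i) := by
  classical
  have hb : ∀ n, ‖(WithLp.toLp 2 (x n) : PiLp 2 fun _ : ι => H)‖ ≤ √(∑ _i : ι, C ^ 2) := fun n => by
    rw [PiLp.norm_eq_of_L2]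
    exact Real.sqrt_le_sqrt (Finset.sum_le_sum fun i _ => by
      have := hC n i
      have := norm_nonneg (x n i)
      change ‖x n i‖ ^ 2 ≤ C ^ 2
      gcongr)
  obtain ⟨X, φ, hφ, hX⟩ := exists_weakTendsto_subseq hb
  refine ⟨fun i => X i, φ, hφ, fun i y => ?_⟩
  have h1 := hX (WithLp.toLp 2 (Pi.single i y))
  have e : ∀ U : PiLp 2 fun _ : ι => H,
      inner ℝ U (WithLp.toLp 2 (Pi.single i y)) = inner ℝ (U i) y := fun U => by
    rw [PiLp.inner_apply, Finset.sum_eq_single i]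
    · simp
    · intro j _ hj
      simp [Pi.single_eq_of_ne hj]
    · simp
  simpa only [e] using h1

/-- By antisymmetry the action moves to the fixed test vector, where it converges strongly; what
remains is a weakly convergent sequence paired with a strongly convergent one. -/
lemma weakTendsto_action [CompleteSpace H] {Θ : H → H → H} (h : IsBoundedAction Θ)
    (hs : ∀ a b c, inner ℝ (Θ a b) c = -inner ℝ b (Θ a c)) {m u : ℕ → H} {m' u' : H} {C : ℝ}
    (hC : ∀ n, ‖u n‖ ≤ C) (hm : Tendsto m atTop (𝓝 m')) (hu : WeakTendsto u u') :
    WeakTendsto (fun n => Θ (m n) (u n)) (Θ m' u') := fun y => by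
  simp only [hs]
  refine (hu.inner_tendsto hC ?_).neg
  exact (h.cont.tendsto (m', y)).comp (hm.prodMk_nhds tendsto_const_nhds)

end Weak

/-! ### Iterated `L²` spaces -/

section

variable {Ω I E F : Type*} {mΩ : MeasurableSpace Ω} {mI : MeasurableSpace I} {P : Measure Ω}
  {μ : Measure I} [NormedAddCommGroup E] [NormedAddCommGroup F]

lemma rpow_lintegral_enorm_eq (e : Lp E 2 P) :
    (∫⁻ ω, ‖e ω‖ₑ ^ (2 : ℝ) ∂P) ^ (1 / 2 : ℝ) = ‖e‖ₑ := by
  have h3 := enorm_sq_eq_lintegral e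
  simp only [← ENNReal.rpow_two] at h3
  rw [← h3, ← ENNReal.rpow_mul]
  norm_num

lemma lintegral_enorm_mul_le (e : Lp E 2 P) (f : Lp F 2 P) :
    ∫⁻ ω, ‖e ω‖ₑ * ‖f ω‖ₑ ∂P ≤ ‖e‖ₑ * ‖f‖ₑ := by
  have h1 := ENNReal.lintegral_mul_le_Lp_mul_Lq P Real.HolderConjugate.two_two
    (Lp.aestronglyMeasurable e).enorm (Lp.aestronglyMeasurable f).enorm
  rw [rpow_lintegral_enorm_eq, rpow_lintegral_enorm_eq] at h1
  exact h1

lemma lintegral_lintegral_enorm_mul_le (e : Lp (Lp E 2 μ) 2 P) (f : Lp (Lp F 2 μ) 2 P) :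
    ∫⁻ ω, ∫⁻ t, ‖e ω t‖ₑ * ‖f ω t‖ₑ ∂μ ∂P ≤ ‖e‖ₑ * ‖f‖ₑ :=
  (lintegral_mono fun _ => lintegral_enorm_mul_le _ _).trans (lintegral_enorm_mul_le e f)

end

section Iterated

variable {Ω I : Type*} {mΩ : MeasurableSpace Ω} {mI : MeasurableSpace I} {P : Measure Ω}
  {μ : Measure I} {H : Type*} [NormedAddCommGroup H] [InnerProductSpace ℝ H]
  {H' : Type*} [NormedAddCommGroup H'] [InnerProductSpace ℝ H']

/-- The pointwise application of a continuous linear map in `L²(Ω;L²(I;H))`. -/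
def mapLp₂ (P : Measure Ω) (μ : Measure I) (A : H →L[ℝ] H') :
    Lp (Lp H 2 μ) 2 P →L[ℝ] Lp (Lp H' 2 μ) 2 P :=
  (A.compLpL 2 μ).compLpL 2 P

lemma coeFn_mapLp₂ (A : H →L[ℝ] H') (U : Lp (Lp H 2 μ) 2 P) :
    ∀ᵐ ω ∂P, ∀ᵐ t ∂μ, mapLp₂ P μ A U ω t = A (U ω t) := by
  filter_upwards [(A.compLpL 2 μ).coeFn_compLpL U] with ω hω
  have h1 : mapLp₂ P μ A U ω = A.compLpL 2 μ (U ω) := hω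
  rw [h1]
  exact A.coeFn_compLpL (U ω)

/-- A Lipschitz map that vanishes only at `0` and whose values point in the direction of the
argument. -/
structure IsSignLike (Φ : H → H) : Prop where
  lip : LipschitzWith 1 Φ
  zero : Φ 0 = 0
  nonneg : ∀ x, 0 ≤ inner ℝ x (Φ x)
  eq_zero : ∀ x, inner ℝ x (Φ x) = 0 → x = 0

/-- A nonnegative integrand with zero integral vanishes almost everywhere. Lifting twice makes
truncation available in `L²(Ω;L²(I))` without passing to the product space. -/
lemma IsSignLike.lift {Φ : H → H} (h : IsSignLike Φ) (P : Measure Ω) :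
    IsSignLike (h.lip.compLp h.zero : Lp H 2 P → Lp H 2 P) := by
  have e : ∀ f : Lp H 2 P, (fun x => inner ℝ (f x) (h.lip.compLp h.zero f x)) =ᵐ[P]
      fun x => inner ℝ (f x) (Φ (f x)) := fun f => by
    filter_upwards [h.lip.coeFn_compLp h.zero f] with x hx
    rw [hx, Function.comp_apply]
  have hn : ∀ f : Lp H 2 P, 0 ≤ᵐ[P] fun x => inner ℝ (f x) (h.lip.compLp h.zero f x) :=
    fun f => by
    filter_upwards [e f] with x hx
    rw [hx]
    exact h.nonneg _
  refine ⟨h.lip.lipschitzWith_compLp h.zero, ?_, fun f => ?_, fun f hf => ?_⟩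
  · refine Lp.ext ?_
    filter_upwards [h.lip.coeFn_compLp h.zero (0 : Lp H 2 P), Lp.coeFn_zero H 2 P] with x h1 h2
    rw [h1, Function.comp_apply, h2, Pi.zero_apply, h.zero]
  · rw [L2.inner_def]
    exact integral_nonneg_of_ae (hn f)
  · rw [L2.inner_def, integral_eq_zero_iff_of_nonneg_ae (hn f) (L2.integrable_inner _ _)] at hf
    refine Lp.ext ?_
    filter_upwards [hf, e f, Lp.coeFn_zero H 2 P] with x h1 h2 h3
    rw [h3]
    rw [h2] at h1
    exact h.eq_zero _ h1

/-- The truncation of real numbers at `-1` and `1`. -/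
def clamp (x : ℝ) : ℝ := max (-1) (min 1 x)

lemma clamp_isSignLike : IsSignLike clamp := by
  refine ⟨(LipschitzWith.id.const_min 1).const_max (-1), by simp [clamp], fun x => ?_,
    fun x hx => ?_⟩
  · change 0 ≤ clamp x * x
    rcases le_total 0 x with h | h
    · have : 0 ≤ clamp x := le_max_of_le_right (le_min zero_le_one h)
      positivity
    · have : clamp x ≤ 0 := max_le (by norm_num) ((min_le_right _ _).trans h)
      exact mul_nonneg_of_nonpos_of_nonpos this h
  · change clamp x * x = 0 at hx
    rcases mul_eq_zero.1 hx with h | h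
    · unfold clamp at h
      rcases le_total x (-1) with h1 | h1 <;> rcases le_total 1 x with h2 | h2
      · linarith
      · rw [min_eq_right h2, max_eq_left h1] at h; norm_num at h
      · rw [min_eq_left h2, max_eq_right (by norm_num)] at h; norm_num at h
      · rwa [min_eq_right h2, max_eq_right h1] at h
    · exact h

lemma abs_clamp_le (x : ℝ) : |clamp x| ≤ 1 :=
  abs_le.2 ⟨le_max_left _ _, max_le (by norm_num) (min_le_left _ _)⟩

/-- A weak limit in `L²` of a sequence that tends to zero in `L¹` vanishes. -/
lemma WeakTendsto.eq_zero_of_lintegral {Z : ℕ → Lp (Lp ℝ 2 μ) 2 P} {Z' : Lp (Lp ℝ 2 μ) 2 P}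
    (h : WeakTendsto Z Z')
    (h0 : Tendsto (fun j => ∫⁻ ω, ∫⁻ t, ‖Z j ω t‖ₑ ∂μ ∂P) atTop (𝓝 0)) : Z' = 0 := by
  have hΦ := clamp_isSignLike.lift μ
  have hΨ := hΦ.lift P
  -- The limit is tested with its own truncation `Y`. Since `|Y| ≤ 1`, the pairing of `Z j` with `Y`
  -- is bounded by the `L¹` norm of `Z j`, so `(Z', Y) = 0`.
  set Y : Lp (Lp ℝ 2 μ) 2 P := hΦ.lip.compLp hΦ.zero Z' with hY
  refine hΨ.eq_zero Z' (tendsto_nhds_unique (h Y) ?_)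
  have hY1 : ∀ᵐ ω ∂P, ∀ᵐ t ∂μ, ‖Y ω t‖ₑ ≤ 1 := by
    filter_upwards [hΦ.lip.coeFn_compLp hΦ.zero Z'] with ω hω
    have h1 : Y ω = clamp_isSignLike.lip.compLp clamp_isSignLike.zero (Z' ω) := hω
    rw [h1]
    filter_upwards [clamp_isSignLike.lip.coeFn_compLp clamp_isSignLike.zero (Z' ω)] with t ht
    rw [ht, Function.comp_apply, Real.enorm_eq_ofReal_abs]
    exact ENNReal.ofReal_le_one.2 (abs_clamp_le _)
  have hle : ∀ j, ‖(inner ℝ (Z j) Y : ℝ)‖ₑ ≤ ∫⁻ ω, ∫⁻ t, ‖Z j ω t‖ₑ ∂μ ∂P := fun j => by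
    rw [L2.inner_def]
    refine (enorm_integral_le_lintegral_enorm _).trans (lintegral_mono_ae ?_)
    filter_upwards [hY1] with ω hω
    rw [L2.inner_def]
    refine (enorm_integral_le_lintegral_enorm _).trans (lintegral_mono_ae ?_)
    filter_upwards [hω] with t ht
    change ‖Y ω t * Z j ω t‖ₑ ≤ _
    rw [enorm_mul]
    exact mul_le_of_le_one_left' ht
  have h2 := tendsto_of_tendsto_of_tendsto_of_le_of_le tendsto_const_nhds h0
    (fun _ => zero_le) hle
  rw [tendsto_zero_iff_norm_tendsto_zero]
  have h3 := (ENNReal.tendsto_toReal ENNReal.zero_ne_top).comp h2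
  simpa [Function.comp_def] using h3

/-- The exceptional sets for uncountably many test fields reduce to countably many through a
countable dense subset and continuity in `a`. -/
lemma ae_ae_forall_mem {A : Type*} [TopologicalSpace A] [SecondCountableTopology A]
    [TopologicalSpace.PseudoMetrizableSpace A] {S : Set A} {p : Ω → I → A → ℝ}
    (hp : ∀ ω t, Continuous (p ω t)) (h : ∀ a ∈ S, ∀ᵐ ω ∂P, ∀ᵐ t ∂μ, p ω t a = 0) :
    ∀ᵐ ω ∂P, ∀ᵐ t ∂μ, ∀ a ∈ S, p ω t a = 0 := by
  obtain ⟨s, hsS, hsc, hs⟩ :=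
    (TopologicalSpace.IsSeparable.of_separableSpace S).exists_countable_dense_subset
  have h1 : ∀ᵐ ω ∂P, ∀ a ∈ s, ∀ᵐ t ∂μ, p ω t a = 0 :=
    (ae_ball_iff hsc).2 fun a ha => h a (hsS ha)
  filter_upwards [h1] with ω hω
  filter_upwards [(ae_ball_iff hsc).2 hω] with t ht a ha
  have hcl : IsClosed {a | p ω t a = 0} := isClosed_eq (hp ω t) continuous_const
  exact closure_minimal (fun a ha => ht a ha) hcl (hs ha)

end Iterated

/-! ### The discrete fields as elements of `L²(Ω;L²(0,T;L²(D)³))` -/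

section StepProcess

variable {Ω : Type*} {mΩ : MeasurableSpace Ω} {P : Measure Ω} {T : ℝ} {D : Set E3} {N : ℕ}

lemma aestronglyMeasurable_stepFunction (hT : 0 < T) (hN : 1 ≤ N) {a : Ω → ℕ → L2V D}
    (ha : ∀ n < N, AEStronglyMeasurable (fun ω => a ω n) P) :
    AEStronglyMeasurable (fun ω => stepFunction T N (a ω)) P := by
  have e : (fun ω => stepFunction T N (a ω)) =
      fun ω => stepFunction T N (fun n => if n < N then a ω n else 0) :=
    funext fun ω => stepFunction_congr fun n hn => by rw [if_pos hn]
  rw [e]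
  refine (continuous_stepFunction hT hN).comp_aestronglyMeasurable ?_
  refine AEMeasurable.aestronglyMeasurable (aemeasurable_pi_iff.2 fun n => ?_)
  by_cases hn : n < N
  · simpa only [if_pos hn] using (ha n hn).aemeasurable
  · simpa only [if_neg hn] using aemeasurable_const

lemma lintegral_enorm_stepFunction (hT : 0 < T) (hN : 1 ≤ N) {a : Ω → ℕ → L2V D}
    (ha : ∀ n < N, AEStronglyMeasurable (fun ω => a ω n) P) :
    ∫⁻ ω, ‖stepFunction T N (a ω)‖ₑ ^ 2 ∂P =
      ENNReal.ofReal (T / N) * ∑ n ∈ Finset.range N, ∫⁻ ω, ‖a ω n‖ₑ ^ 2 ∂P := by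
  simp only [enorm_stepFunction_sq hT hN]
  rw [lintegral_const_mul' _ _ ENNReal.ofReal_ne_top, lintegral_finsetSum']
  exact fun n hn => (ha n (Finset.mem_range.1 hn)).enorm.pow_const 2

lemma exists_stepProcess (hT : 0 < T) (hN : 1 ≤ N) {a : Ω → ℕ → L2V D}
    (ha : ∀ n < N, AEStronglyMeasurable (fun ω => a ω n) P) {b : ℝ≥0∞} (hb : b ≠ ∞)
    (h : ENNReal.ofReal (T / N) * ∑ n ∈ Finset.range N, ∫⁻ ω, ‖a ω n‖ₑ ^ 2 ∂P ≤ b) :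
    ∃ U : Lp (L2TV T D) 2 P, U =ᵐ[P] (fun ω => stepFunction T N (a ω)) ∧ ‖U‖ₑ ^ 2 ≤ b ∧
      ∀ᵐ ω ∂P, ∀ᵐ t ∂volume.restrict (Icc 0 T), U ω t = a ω ⌊t / (T / N)⌋₊ := by
  have hm := aestronglyMeasurable_stepFunction hT hN ha
  have h1 := lintegral_enorm_stepFunction hT hN ha
  have h2 : MemLp (fun ω => stepFunction T N (a ω)) 2 P := by
    refine ⟨hm, ?_⟩
    rw [eLpNorm_lt_top_iff_lintegral_rpow_enorm_lt_top two_ne_zero ENNReal.ofNat_ne_top]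
    simp only [ENNReal.toReal_ofNat, ENNReal.rpow_two]
    rw [h1]
    exact h.trans_lt hb.lt_top
  refine ⟨h2.toLp, h2.coeFn_toLp, ?_, ?_⟩
  · rw [enorm_sq_eq_lintegral]
    refine le_of_eq_of_le ?_ (h1.trans_le h)
    refine lintegral_congr_ae ?_
    filter_upwards [h2.coeFn_toLp] with ω hω
    rw [hω]
  · filter_upwards [h2.coeFn_toLp] with ω hω
    rw [hω]
    exact coeFn_stepFunction hT hN (a ω)

end StepProcess

section DiscreteField

variable {Ω : Type*} {mΩ : MeasurableSpace Ω} {P : Measure Ω} {T : ℝ} {D : Set E3}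

/-- The properties of the discrete fields `M = m_N`, `W = w_N`, `d = ∇m_N`, `e = ∇v_N` that are
used for the passage to the limit. -/
structure DiscreteField (P : Measure Ω) (K : L2V D →L[ℝ] L2V D) (θ τ B : ℝ)
    (M W : Lp (L2TV T D) 2 P) (d e : Fin 3 → Lp (L2TV T D) 2 P) : Prop where
  norm_drift : ‖W‖ₑ ^ 2 ≤ ENNReal.ofReal B
  norm_grad : ∀ k, ‖d k‖ₑ ^ 2 ≤ ENNReal.ofReal T * ENNReal.ofReal B
  norm_step : ∀ k, ‖e k‖ₑ ^ 2 ≤ ENNReal.ofReal τ * ENNReal.ofReal B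
  unit : ∀ᵐ ω ∂P, ∀ᵐ t ∂volume.restrict (Icc 0 T), ∀ᵐ x ∂volume.restrict D, ‖M ω t x‖ = 1
  grad : ∀ k, ∀ᵐ ω ∂P, ∀ᵐ t ∂volume.restrict (Icc 0 T), HasWeakPartial D k (M ω t) (d k ω t)
  perp : ∀ᵐ ω ∂P, ∀ᵐ t ∂volume.restrict (Icc 0 T),
    crossV (M ω t) (crossV (M ω t) (W ω t)) = -W ω t
  eqn : ∀ᵐ ω ∂P, ∀ᵐ t ∂volume.restrict (Icc 0 T), ∀ (ψ : L2V D) (R : ℝ)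
    (hψ : ∀ᵐ x ∂volume.restrict D, ‖ψ x‖ ≤ R), MemH1 D ψ →
    inner ℝ (W ω t + crossV (M ω t) (W ω t) - noiseDrift K (M ω t)) ψ
      + 2 * ∑ k, inner ℝ (crossV (M ω t) (d k ω t)) (weakPartial D k ψ) =
    2 * θ * ∑ k, inner ℝ (e k ω t)
      (crossBdd hψ (d k ω t) + crossV (M ω t) (weakPartial D k ψ))

lemma enorm_sq_weakPartial_le (u : L2V D) (k : Fin 3) :
    ‖weakPartial D k u‖ₑ ^ 2 ≤ ENNReal.ofReal (gradSq D u) := by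
  rw [← ofReal_norm, ← ENNReal.ofReal_pow (norm_nonneg _)]
  refine ENNReal.ofReal_le_ofReal ?_
  exact Finset.single_le_sum (f := fun k => ‖weakPartial D k u‖ ^ 2)
    (fun k _ => sq_nonneg _) (Finset.mem_univ k)

lemma exists_discreteField_of_bounds [IsProbabilityMeasure P] (hD : IsOpen D)
    (hb : Bornology.IsBounded D) {Gf : ℕ → L2V D} {c : ℕ → ℝ} (hc : NoiseBound Gf c) {θ B : ℝ}
    (hθ : 0 < θ) (hT : 0 < T) {N : ℕ} (hN : 1 ≤ N) {S g : ℕ → Ω → L2V D}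
    (h : SchemeBounds P D (T / N) B N S (fun n ω => stepSolution D θ (T / N) Gf (S n ω) (g n ω))
      (fun n ω => driftField D θ (T / N) Gf (S n ω) (g n ω)))
    (hm : SchemeMeasurable P D N S (fun n ω => stepSolution D θ (T / N) Gf (S n ω) (g n ω))
      (fun n ω => driftField D θ (T / N) Gf (S n ω) (g n ω))) :
    ∃ (M W : Lp (L2TV T D) 2 P) (d e : Fin 3 → Lp (L2TV T D) 2 P),
      DiscreteField P (noiseOp hc) θ (T / N) B M W d e ∧
      M =ᵐ[P] (fun ω => stepFunction T N fun n => S n ω) ∧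
      W =ᵐ[P] fun ω => stepFunction T N fun n => driftField D θ (T / N) Gf (S n ω) (g n ω) := by
  have hN0 : (0 : ℝ) < N := by exact_mod_cast hN
  have hτ : 0 < T / N := by positivity
  have hTN : ENNReal.ofReal (T / N) * (N : ℝ≥0∞) = ENNReal.ofReal T := by
    rw [← ENNReal.ofReal_natCast, ← ENNReal.ofReal_mul hτ.le, div_mul_cancel₀ _ hN0.ne']
  have hunit : ∀ᵐ ω ∂P, ∀ n < N, IsUnitField D (S n ω) :=
    (ae_ball_iff (to_countable {n | n < N})).2 h.unit
  obtain ⟨M, hM, -, hMt⟩ := exists_stepProcess (P := P) (a := fun ω n => S n ω) hT hN hm.state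
    (b := ENNReal.ofReal T * ENNReal.ofReal ((volume.restrict D).real univ))
    (ENNReal.mul_ne_top ENNReal.ofReal_ne_top ENNReal.ofReal_ne_top) (by
      rw [← hTN, mul_assoc]
      refine mul_le_mul_right (le_of_eq ?_) _
      have h1 : ∀ n ∈ Finset.range N, ∫⁻ ω, ‖S n ω‖ₑ ^ 2 ∂P =
          ENNReal.ofReal ((volume.restrict D).real univ) := fun n hn => by
        have h2 : ∫⁻ ω, ‖S n ω‖ₑ ^ 2 ∂P =
            ∫⁻ _, ENNReal.ofReal ((volume.restrict D).real univ) ∂P := by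
          refine lintegral_congr_ae ?_
          filter_upwards [h.unit n (Finset.mem_range.1 hn)] with ω hω
          rw [← norm_sq_of_unit hω.2, ENNReal.ofReal_pow (norm_nonneg _), ofReal_norm]
        rw [h2, lintegral_const, measure_univ, mul_one]
      rw [Finset.sum_congr rfl h1, Finset.sum_const, Finset.card_range, nsmul_eq_mul])
  obtain ⟨W, hW, hWn, hWt⟩ := exists_stepProcess (P := P)
    (a := fun ω n => driftField D θ (T / N) Gf (S n ω) (g n ω)) hT hN hm.drift
    (b := ENNReal.ofReal B) ENNReal.ofReal_ne_top h.drift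
  have hd := fun k => exists_stepProcess (P := P) (a := fun ω n => weakPartial D k (S n ω)) hT hN
    (fun n hn => hm.grad n hn k) (b := ENNReal.ofReal T * ENNReal.ofReal B)
    (ENNReal.mul_ne_top ENNReal.ofReal_ne_top ENNReal.ofReal_ne_top) (by
      rw [← hTN, mul_assoc]
      refine mul_le_mul_right ?_ _
      refine (Finset.sum_le_card_nsmul (Finset.range N) _ (ENNReal.ofReal B) fun n hn => ?_).trans
        (le_of_eq ?_)
      · exact (lintegral_mono fun ω => enorm_sq_weakPartial_le _ k).trans
          (h.grad n (Finset.mem_range.1 hn))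
      · rw [Finset.card_range, nsmul_eq_mul])
  choose d _ hdn hdt using hd
  -- The sum over the steps of the expected `‖∇v‖²` is bounded without weight, so the time integral
  -- carries a factor `τ`. This smallness kills the remainder in the limit.
  have he := fun k => exists_stepProcess (P := P)
    (a := fun ω n => weakPartial D k (stepSolution D θ (T / N) Gf (S n ω) (g n ω))) hT hN
    (fun n hn => hm.step n hn k) (b := ENNReal.ofReal (T / N) * ENNReal.ofReal B)
    (ENNReal.mul_ne_top ENNReal.ofReal_ne_top ENNReal.ofReal_ne_top) (by
      refine mul_le_mul_right ?_ _
      exact (Finset.sum_le_sum fun n _ => lintegral_mono fun ω =>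
        enorm_sq_weakPartial_le _ k).trans h.step)
  choose e _ hen het using he
  have hlt : ∀ᵐ t ∂volume.restrict (Icc 0 T), ⌊t / (T / N)⌋₊ < N := by
    filter_upwards [ae_mem_Ico T] with t ht
    exact floor_lt hT hN ht.1 ht.2
  refine ⟨M, W, d, e, ⟨hWn, hdn, hen, ?_, fun k => ?_, ?_, ?_⟩, hM, hW⟩
  · filter_upwards [hunit, hMt] with ω h1 h2
    filter_upwards [hlt, h2] with t h3 h4
    rw [h4]
    exact (h1 _ h3).2
  · filter_upwards [hunit, hMt, hdt k] with ω h1 h2 h5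
    filter_upwards [hlt, h2, h5] with t h3 h4 h6
    rw [h4, h6]
    exact (h1 _ h3).1.hasWeakPartial k
  · filter_upwards [hunit, hMt, hWt] with ω h1 h2 h5
    filter_upwards [hlt, h2, h5] with t h3 h4 h6
    rw [h4, h6]
    exact crossV_crossV_driftField hD hb hc hθ hτ (h1 _ h3) _
  · filter_upwards [hunit, hMt, hWt, ae_all_iff.2 hdt, ae_all_iff.2 het] with ω h1 h2 h5 h7 h8
    filter_upwards [hlt, h2, h5, ae_all_iff.2 h7, ae_all_iff.2 h8] with t h3 h4 h6 h9 h10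
    intro ψ R hψ hψ1
    simp only [h4, h6, h9, h10]
    exact driftField_inner hD hb hc hθ hτ (h1 _ h3) _ hψ hψ1

/-- The discrete fields on a probability space that carries a copy of the scheme. -/
lemma exists_discreteField {Ω' : Type*} {mΩ' : MeasurableSpace Ω'} {P' : Measure Ω'}
    [IsProbabilityMeasure P'] (hD : IsOpen D)
    (hb : Bornology.IsBounded D) {Gf : ℕ → L2V D} {c : ℕ → ℝ} (hc : NoiseBound Gf c) {θ B : ℝ}
    (hθ : 0 < θ) (hT : 0 < T) {N : ℕ} (hN : 1 ≤ N) {m₀ : L2V D} {GW : Ω → C(Icc (0 : ℝ) T, L2V D)}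
    (hB : SchemeBounds P D (T / N) B N
      (fun n ω => pathState hT.le θ Gf m₀ N (GW ω) n)
      (fun n ω => stepSolution D θ (T / N) Gf (pathState hT.le θ Gf m₀ N (GW ω) n)
        (pathIncrement hT.le N (GW ω) n))
      (fun n ω => driftField D θ (T / N) Gf (pathState hT.le θ Gf m₀ N (GW ω) n)
        (pathIncrement hT.le N (GW ω) n)))
    {f' : Ω' → L2TV T D} {b' : Ω' → C(Icc (0 : ℝ) T, L2V D)}
    (h : EqualLaw (fun ω => (f' ω, b' ω)) P'
        (fun ω => (schemeProcess hT.le θ Gf m₀ N (GW ω), GW ω)) P) :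
    ∃ (M W : Lp (L2TV T D) 2 P') (d e : Fin 3 → Lp (L2TV T D) 2 P'),
      DiscreteField P' (noiseOp hc) θ (T / N) B M W d e ∧ M =ᵐ[P'] f' ∧
      ∀ᵐ ω ∂P', W ω = stepFunction T N (stepW hT.le θ Gf N (f' ω) (b' ω)) := by
  have hN0 : (0 : ℝ) < N := by exact_mod_cast hN
  have hτ : 0 < T / N := by positivity
  obtain ⟨hf, hid⟩ := identDistrib_stepValue hT hN
    (a := fun ω n => pathState hT.le θ Gf m₀ N (GW ω) n) h
  obtain ⟨h1, h2⟩ := hB.transfer hD hb hc hθ hτ (S' := fun n ω => stepValue N (f' ω) n)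
    (g' := fun n ω => pathIncrement hT.le N (b' ω) n) hid
  obtain ⟨M, W, d, e, h3, h4, h5⟩ := exists_discreteField_of_bounds hD hb hc hθ hT hN h1 h2
  have hunit : ∀ᵐ ω ∂P', ∀ n < N, IsUnitField D (stepValue N (f' ω) n) :=
    (ae_ball_iff (to_countable {n | n < N})).2 h1.unit
  refine ⟨M, W, d, e, h3, ?_, ?_⟩
  · filter_upwards [h4, hf] with ω h6 h7
    rw [h6]
    exact h7
  · filter_upwards [h5, hunit] with ω h6 h7
    rw [h6]
    -- `stepW` is written with `crossL2`, the estimates with `crossV`; they agree because the values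
    -- are unit fields.
    refine stepFunction_congr fun n hn => ?_
    rw [stepW, driftField, crossL2_eq_crossV (h7 n hn).2]

end DiscreteField

/-! ### Passage to the limit -/

/-! ### Pointwise operations in iterated `L²` spaces -/

section Pointwise

variable {Ω I : Type*} {mΩ : MeasurableSpace Ω} {mI : MeasurableSpace I} {P : Measure Ω}
  {μ : Measure I} {H : Type*} [NormedAddCommGroup H]

lemma isClosed_ae_mem {C : Set H} (hC : IsClosed C) :
    IsClosed {f : Lp H 2 μ | ∀ᵐ x ∂μ, f x ∈ C} := by
  refine IsSeqClosed.isClosed fun f f' hf hlim => ?_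
  obtain ⟨ns, -, hns⟩ := (tendstoInMeasure_of_tendsto_Lp hlim).exists_seq_tendsto_ae
  filter_upwards [hns, ae_all_iff.2 fun n => hf (ns n)] with x h1 h2
  exact hC.mem_of_tendsto h1 (Eventually.of_forall h2)

lemma compLp_norm_zero : lipschitzWith_one_norm.compLp norm_zero (0 : Lp H 2 μ) = 0 := by
  refine Lp.ext ?_
  filter_upwards [lipschitzWith_one_norm.coeFn_compLp norm_zero (0 : Lp H 2 μ),
    Lp.coeFn_zero H 2 μ, Lp.coeFn_zero ℝ 2 μ] with x h1 h2 h3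
  rw [h1, Function.comp_apply, h2, h3, Pi.zero_apply, norm_zero, Pi.zero_apply]

/-- The pointwise norm in `L²(Ω;L²(I;H))`. -/
def normLp₂ (U : Lp (Lp H 2 μ) 2 P) : Lp (Lp ℝ 2 μ) 2 P :=
  (lipschitzWith_one_norm.lipschitzWith_compLp (μ := μ) (p := 2) (E := H) norm_zero).compLp
    compLp_norm_zero U

lemma coeFn_normLp₂ (U : Lp (Lp H 2 μ) 2 P) : ∀ᵐ ω ∂P, ∀ᵐ t ∂μ, normLp₂ U ω t = ‖U ω t‖ := by
  filter_upwards [LipschitzWith.coeFn_compLp (lipschitzWith_one_norm.lipschitzWith_compLp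
    (μ := μ) (p := 2) (E := H) norm_zero) compLp_norm_zero U] with ω hω
  have h1 : normLp₂ U ω = lipschitzWith_one_norm.compLp norm_zero (U ω) := hω
  rw [h1]
  exact lipschitzWith_one_norm.coeFn_compLp norm_zero (U ω)

lemma norm_normLp₂_le (U : Lp (Lp H 2 μ) 2 P) : ‖normLp₂ U‖ ≤ ‖U‖ := by
  have h := LipschitzWith.norm_compLp_le (lipschitzWith_one_norm.lipschitzWith_compLp
    (μ := μ) (p := 2) (E := H) norm_zero) compLp_norm_zero U
  simpa [normLp₂] using h

lemma coeFn_add₂ (U V : Lp (Lp H 2 μ) 2 P) :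
    ∀ᵐ ω ∂P, ∀ᵐ t ∂μ, (U + V) ω t = U ω t + V ω t := by
  filter_upwards [Lp.coeFn_add U V] with ω hω
  rw [hω]
  exact Lp.coeFn_add _ _

lemma coeFn_sub₂ (U V : Lp (Lp H 2 μ) 2 P) :
    ∀ᵐ ω ∂P, ∀ᵐ t ∂μ, (U - V) ω t = U ω t - V ω t := by
  filter_upwards [Lp.coeFn_sub U V] with ω hω
  rw [hω]
  exact Lp.coeFn_sub _ _

lemma coeFn_zero₂ : ∀ᵐ ω ∂P, ∀ᵐ t ∂μ, (0 : Lp (Lp H 2 μ) 2 P) ω t = 0 := by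
  filter_upwards [Lp.coeFn_zero (Lp H 2 μ) 2 P] with ω hω
  rw [hω]
  exact Lp.coeFn_zero _ _ _

lemma eq_zero_iff₂ {U : Lp (Lp H 2 μ) 2 P} : U = 0 ↔ ∀ᵐ ω ∂P, ∀ᵐ t ∂μ, U ω t = 0 := by
  refine ⟨fun h => h ▸ coeFn_zero₂, fun h => Lp.ext ?_⟩
  filter_upwards [h, Lp.coeFn_zero (Lp H 2 μ) 2 P] with ω h1 h2
  rw [h2, Pi.zero_apply, Lp.eq_zero_iff_ae_eq_zero]
  exact h1

lemma coeFn_smul₂ [NormedSpace ℝ H] (r : ℝ) (U : Lp (Lp H 2 μ) 2 P) :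
    ∀ᵐ ω ∂P, ∀ᵐ t ∂μ, (r • U) ω t = r • U ω t := by
  filter_upwards [Lp.coeFn_smul r U] with ω hω
  rw [hω]
  exact Lp.coeFn_smul _ _

lemma coeFn_sum₂ {ι : Type*} [Fintype ι] (U : ι → Lp (Lp H 2 μ) 2 P) :
    ∀ᵐ ω ∂P, ∀ᵐ t ∂μ, (∑ i, U i) ω t = ∑ i, U i ω t := by
  filter_upwards [Lp.coeFn_finsetSum Finset.univ U] with ω hω
  rw [hω, Finset.sum_apply]
  filter_upwards [Lp.coeFn_finsetSum Finset.univ fun i => U i ω] with t ht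
  rw [ht, Finset.sum_apply]

end Pointwise

/-! ### The tested equation as a relation between random time dependent fields -/

section Limit

variable {Ω : Type*} {mΩ : MeasurableSpace Ω} {P : Measure Ω} {T : ℝ} {D : Set E3}

/-- The pointwise cross product in `L²(Ω;L²(0,T;L²(D)³))`. -/
def crossΩ (M U : Lp (L2TV T D) 2 P) : Lp (L2TV T D) 2 P := liftAction crossT_isBoundedAction P M U

lemma coeFn_crossΩ (M U : Lp (L2TV T D) 2 P) : ∀ᵐ ω ∂P, ∀ᵐ t ∂volume.restrict (Icc 0 T),
    crossΩ M U ω t = crossV (M ω t) (U ω t) := by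
  filter_upwards [coeFn_liftAction crossT_isBoundedAction M U] with ω hω
  have h1 : crossΩ M U ω = crossT (M ω) (U ω) := hω
  rw [h1]
  exact coeFn_liftAction crossV_isBoundedAction (M ω) (U ω)

lemma crossΩ_isBoundedAction : IsBoundedAction (crossΩ (P := P) (T := T) (D := D)) :=
  crossT_isBoundedAction.lift P

lemma crossΩ_antisymm (M U V : Lp (L2TV T D) 2 P) :
    inner ℝ (crossΩ M U) V = -inner ℝ U (crossΩ M V) :=
  liftAction_antisymm crossT_isBoundedAction crossT_antisymm M U V

lemma weakTendsto_crossΩ {m u : ℕ → Lp (L2TV T D) 2 P} {m' u' : Lp (L2TV T D) 2 P} {C : ℝ}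
    (hC : ∀ n, ‖u n‖ ≤ C) (hm : Tendsto m atTop (𝓝 m')) (hu : WeakTendsto u u') :
    WeakTendsto (fun n => crossΩ (m n) (u n)) (crossΩ m' u') :=
  weakTendsto_action crossΩ_isBoundedAction crossΩ_antisymm hC hm hu

/-- The noise term of the tested equation in `L²(Ω;L²(0,T;L²(D)³))`. -/
def noiseDriftΩ (K : L2V D →L[ℝ] L2V D) (M : Lp (L2TV T D) 2 P) : Lp (L2TV T D) 2 P :=
  (1 / 2 : ℝ) • (crossΩ M (mapLp₂ P _ K M) - crossΩ M (crossΩ M (mapLp₂ P _ K M)))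

lemma coeFn_noiseDriftΩ (K : L2V D →L[ℝ] L2V D) (M : Lp (L2TV T D) 2 P) :
    ∀ᵐ ω ∂P, ∀ᵐ t ∂volume.restrict (Icc 0 T), noiseDriftΩ K M ω t = noiseDrift K (M ω t) := by
  filter_upwards [coeFn_smul₂ (1 / 2 : ℝ)
    (crossΩ M (mapLp₂ P _ K M) - crossΩ M (crossΩ M (mapLp₂ P _ K M))),
    coeFn_sub₂ (crossΩ M (mapLp₂ P _ K M)) (crossΩ M (crossΩ M (mapLp₂ P _ K M))),
    coeFn_crossΩ M (mapLp₂ P _ K M), coeFn_crossΩ M (crossΩ M (mapLp₂ P _ K M)),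
    coeFn_mapLp₂ K M] with ω h1 h2 h3 h4 h5
  filter_upwards [h1, h2, h3, h4, h5] with t h1 h2 h3 h4 h5
  rw [noiseDriftΩ, h1, h2, h4, h3, h5, noiseDrift]

lemma continuous_noiseDriftΩ (K : L2V D →L[ℝ] L2V D) :
    Continuous (noiseDriftΩ (P := P) (T := T) K) := by
  have hc : ∀ {f g : Lp (L2TV T D) 2 P → Lp (L2TV T D) 2 P}, Continuous f → Continuous g →
      Continuous fun x => crossΩ (f x) (g x) := fun hf hg => by
    have h := crossΩ_isBoundedAction.cont.comp (hf.prodMk hg)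
    exact h
  have hK : Continuous fun M : Lp (L2TV T D) 2 P => mapLp₂ P _ K M :=
    (mapLp₂ P (volume.restrict (Icc 0 T)) K).continuous
  exact ((hc continuous_id hK).sub (hc continuous_id (hc continuous_id hK))).const_smul (1 / 2 : ℝ)

/-- The pointwise inner product with a field, in `L²(Ω;L²(0,T;L²(D)³))`. -/
def innerΩ (P : Measure Ω) (T : ℝ) (a : L2V D) :
    Lp (L2TV T D) 2 P →L[ℝ] Lp (Lp ℝ 2 (volume.restrict (Icc 0 T))) 2 P :=
  mapLp₂ P (volume.restrict (Icc 0 T)) (innerL2V D a)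

lemma coeFn_innerΩ (a : L2V D) (U : Lp (L2TV T D) 2 P) :
    ∀ᵐ ω ∂P, ∀ᵐ t ∂volume.restrict (Icc 0 T), innerΩ P T a U ω t = inner ℝ (U ω t) a := by
  filter_upwards [coeFn_mapLp₂ (innerL2V D a) U] with ω h1
  filter_upwards [h1] with t h1
  rw [innerΩ, h1, innerL2V_apply, real_inner_comm]

/-- The left side of the tested equation in `L²(Ω;L²(0,T))`. -/
def testedDrift (K : L2V D →L[ℝ] L2V D) (M W : Lp (L2TV T D) 2 P)
    (d : Fin 3 → Lp (L2TV T D) 2 P) (ψ : L2V D) (dψ : Fin 3 → L2V D) :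
    Lp (Lp ℝ 2 (volume.restrict (Icc 0 T))) 2 P :=
  innerΩ P T ψ (W + crossΩ M W - noiseDriftΩ K M)
    + (2 : ℝ) • ∑ k, innerΩ P T (dψ k) (crossΩ M (d k))

lemma coeFn_testedDrift (K : L2V D →L[ℝ] L2V D) (M W : Lp (L2TV T D) 2 P)
    (d : Fin 3 → Lp (L2TV T D) 2 P) (ψ : L2V D) (dψ : Fin 3 → L2V D) :
    ∀ᵐ ω ∂P, ∀ᵐ t ∂volume.restrict (Icc 0 T), testedDrift K M W d ψ dψ ω t =
      inner ℝ (W ω t + crossV (M ω t) (W ω t) - noiseDrift K (M ω t)) ψ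
      + 2 * ∑ k, inner ℝ (crossV (M ω t) (d k ω t)) (dψ k) := by
  filter_upwards [coeFn_add₂ (innerΩ P T ψ (W + crossΩ M W - noiseDriftΩ K M))
      ((2 : ℝ) • ∑ k, innerΩ P T (dψ k) (crossΩ M (d k))),
    coeFn_smul₂ (2 : ℝ) (∑ k, innerΩ P T (dψ k) (crossΩ M (d k))),
    coeFn_sum₂ fun k => innerΩ P T (dψ k) (crossΩ M (d k)),
    ae_all_iff.2 fun k => coeFn_innerΩ (dψ k) (crossΩ M (d k)),
    ae_all_iff.2 fun k => coeFn_crossΩ M (d k),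
    coeFn_innerΩ ψ (W + crossΩ M W - noiseDriftΩ K M),
    coeFn_sub₂ (W + crossΩ M W) (noiseDriftΩ K M), coeFn_add₂ W (crossΩ M W),
    coeFn_crossΩ M W, coeFn_noiseDriftΩ K M] with ω h1 h2 h3 h4 h5 h6 h7 h8 h9 h10
  filter_upwards [h1, h2, h3, ae_all_iff.2 h4, ae_all_iff.2 h5, h6, h7, h8, h9, h10] with t
    h1 h2 h3 h4 h5 h6 h7 h8 h9 h10
  rw [testedDrift, h1, h2, h3, h6, h7, h8, h9, h10, smul_eq_mul]
  simp only [h4, h5]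

/-- Every term is linear in a weakly convergent field with strongly convergent coefficients, except
the noise term, which converges strongly. -/
lemma weakTendsto_testedDrift (K : L2V D →L[ℝ] L2V D) {M W : ℕ → Lp (L2TV T D) 2 P}
    {d : ℕ → Fin 3 → Lp (L2TV T D) 2 P} {M' W' : Lp (L2TV T D) 2 P}
    {d' : Fin 3 → Lp (L2TV T D) 2 P} {C : ℝ} (hW : ∀ n, ‖W n‖ ≤ C) (hd : ∀ n k, ‖d n k‖ ≤ C)
    (hM : Tendsto M atTop (𝓝 M')) (hW' : WeakTendsto W W')
    (hd' : ∀ k, WeakTendsto (fun n => d n k) (d' k)) (ψ : L2V D) (dψ : Fin 3 → L2V D) :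
    WeakTendsto (fun n => testedDrift K (M n) (W n) (d n) ψ dψ) (testedDrift K M' W' d' ψ dψ) := by
  refine WeakTendsto.add (WeakTendsto.clm _ ((hW'.add (weakTendsto_crossΩ hW hM hW')).sub
    (WeakTendsto.of_tendsto (((continuous_noiseDriftΩ K).tendsto M').comp hM)))) ?_
  exact (WeakTendsto.sum fun k _ => WeakTendsto.clm _
    (weakTendsto_crossΩ (fun n => hd n k) hM (hd' k))).smul 2

lemma coeFn_innerΩ_add (a b : L2V D) (U V : Lp (L2TV T D) 2 P) :
    ∀ᵐ ω ∂P, ∀ᵐ t ∂volume.restrict (Icc 0 T), (innerΩ P T a U + innerΩ P T b V) ω t =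
      inner ℝ (U ω t) a + inner ℝ (V ω t) b := by
  filter_upwards [coeFn_add₂ (innerΩ P T a U) (innerΩ P T b V), coeFn_innerΩ a U,
    coeFn_innerΩ b V] with ω h1 h2 h3
  filter_upwards [h1, h2, h3] with t h1 h2 h3
  rw [h1, h2, h3]

lemma ae_inner_add_eq_zero_of_weakTendsto {M d : ℕ → Lp (L2TV T D) 2 P}
    {M' d' : Lp (L2TV T D) 2 P} (hM : WeakTendsto M M') (hd : WeakTendsto d d') (a b : L2V D)
    (h : ∀ n, ∀ᵐ ω ∂P, ∀ᵐ t ∂volume.restrict (Icc 0 T),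
      inner ℝ (M n ω t) a + inner ℝ (d n ω t) b = 0) :
    ∀ᵐ ω ∂P, ∀ᵐ t ∂volume.restrict (Icc 0 T),
      inner ℝ (M' ω t) a + inner ℝ (d' ω t) b = 0 := by
  have hz : ∀ n, innerΩ P T a (M n) + innerΩ P T b (d n) = 0 := fun n => by
    rw [eq_zero_iff₂]
    filter_upwards [coeFn_innerΩ_add a b (M n) (d n), h n] with ω h1 h2
    filter_upwards [h1, h2] with t h1 h2
    rw [h1, h2]
  have hlim := (hM.clm (innerΩ P T a)).add (hd.clm (innerΩ P T b))
  simp only [hz] at hlim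
  have h0 := hlim.unique (WeakTendsto.of_tendsto tendsto_const_nhds)
  rw [eq_zero_iff₂] at h0
  filter_upwards [coeFn_innerΩ_add a b M' d', h0] with ω h1 h2
  filter_upwards [h1, h2] with t h1 h2
  rw [← h1, h2]

/-- Weakly convergent sequences of fields with weakly convergent gradients. -/
lemma ae_hasWeakPartial_of_weakTendsto {k : Fin 3} {M d : ℕ → Lp (L2TV T D) 2 P}
    {M' d' : Lp (L2TV T D) 2 P} (hM : WeakTendsto M M') (hd : WeakTendsto d d')
    (h : ∀ n, ∀ᵐ ω ∂P, ∀ᵐ t ∂volume.restrict (Icc 0 T), HasWeakPartial D k (M n ω t) (d n ω t)) :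
    ∀ᵐ ω ∂P, ∀ᵐ t ∂volume.restrict (Icc 0 T), HasWeakPartial D k (M' ω t) (d' ω t) := by
  have h1 := ae_ae_forall_mem (P := P) (μ := volume.restrict (Icc 0 T)) (S := testPairs D k)
    (p := fun ω t a => inner ℝ (M' ω t) a.1 + inner ℝ (d' ω t) a.2)
    (fun ω t => (continuous_const.inner continuous_fst).add
      (continuous_const.inner continuous_snd)) fun a ha =>
    ae_inner_add_eq_zero_of_weakTendsto hM hd a.1 a.2 fun n =>
      (h n).mono fun ω hω => hω.mono fun t ht => hasWeakPartial_iff.1 ht a ha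
  exact h1.mono fun ω hω => hω.mono fun t ht => hasWeakPartial_iff.2 ht

end Limit

/-! ### The remainder and the limit equation -/

section LimitEquation

variable {Ω : Type*} {mΩ : MeasurableSpace Ω} {P : Measure Ω} {T : ℝ} {D : Set E3}

lemma norm_le_sqrt_of_enorm_sq {E : Type*} [NormedAddCommGroup E] {u : E} {x : ℝ}
    (h : ‖u‖ₑ ^ 2 ≤ ENNReal.ofReal x) : ‖u‖ ≤ √x := by
  rw [← ofReal_norm, ← ENNReal.ofReal_pow (norm_nonneg _), ENNReal.ofReal_le_ofReal_iff'] at h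
  rcases h with h | h
  · exact Real.le_sqrt_of_sq_le h
  · have h1 : ‖u‖ = 0 := by
      have := sq_nonneg ‖u‖
      exact pow_eq_zero_iff two_ne_zero |>.1 (le_antisymm h this)
    rw [h1]
    exact Real.sqrt_nonneg _

/-- A constant field as an element of `L²(Ω;L²(0,T;L²(D)³))`. -/
def constΩ (P : Measure Ω) [IsFiniteMeasure P] (T : ℝ) (a : L2V D) : Lp (L2TV T D) 2 P :=
  Lp.const 2 P (Lp.const 2 (volume.restrict (Icc 0 T)) a)

lemma coeFn_constΩ [IsFiniteMeasure P] (a : L2V D) :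
    ∀ᵐ ω ∂P, ∀ᵐ t ∂volume.restrict (Icc 0 T), constΩ P T a ω t = a := by
  filter_upwards [Lp.coeFn_const 2 P (Lp.const 2 (volume.restrict (Icc 0 T)) a)] with ω hω
  have h1 : constΩ P T a ω = Lp.const 2 (volume.restrict (Icc 0 T)) a := hω
  rw [h1]
  exact Lp.coeFn_const 2 _ a

/-- The factor of `∇v` in the remainder of the tested equation. -/
def remainderFactor [IsFiniteMeasure P] {ψ : L2V D} {R : ℝ}
    (hψ : ∀ᵐ x ∂volume.restrict D, ‖ψ x‖ ≤ R) (M : Lp (L2TV T D) 2 P)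
    (d : Fin 3 → Lp (L2TV T D) 2 P) (k : Fin 3) : Lp (L2TV T D) 2 P :=
  mapLp₂ P (volume.restrict (Icc 0 T)) (crossBdd hψ) (d k)
    + crossΩ M (constΩ P T (weakPartial D k ψ))

lemma coeFn_remainderFactor [IsFiniteMeasure P] {ψ : L2V D} {R : ℝ}
    (hψ : ∀ᵐ x ∂volume.restrict D, ‖ψ x‖ ≤ R) (M : Lp (L2TV T D) 2 P)
    (d : Fin 3 → Lp (L2TV T D) 2 P) (k : Fin 3) :
    ∀ᵐ ω ∂P, ∀ᵐ t ∂volume.restrict (Icc 0 T), remainderFactor hψ M d k ω t =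
      crossBdd hψ (d k ω t) + crossV (M ω t) (weakPartial D k ψ) := by
  filter_upwards [coeFn_add₂ (mapLp₂ P (volume.restrict (Icc 0 T)) (crossBdd hψ) (d k))
    (crossΩ M (constΩ P T (weakPartial D k ψ))), coeFn_mapLp₂ (crossBdd hψ) (d k),
    coeFn_crossΩ M (constΩ P T (weakPartial D k ψ)),
    coeFn_constΩ (P := P) (T := T) (weakPartial D k ψ)] with ω h1 h2 h3 h4
  filter_upwards [h1, h2, h3, h4] with t h1 h2 h3 h4
  rw [remainderFactor, h1, h2, h3, h4]

lemma coeFn_sum_normLp₂ {U : Fin 3 → Lp (L2TV T D) 2 P} :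
    ∀ᵐ ω ∂P, ∀ᵐ t ∂volume.restrict (Icc 0 T), (∑ k, normLp₂ (U k)) ω t = ∑ k, ‖U k ω t‖ := by
  filter_upwards [coeFn_sum₂ fun k => normLp₂ (U k), ae_all_iff.2 fun k => coeFn_normLp₂ (U k)]
    with ω h1 h2
  filter_upwards [h1, ae_all_iff.2 h2] with t h1 h2
  rw [h1]
  exact Finset.sum_congr rfl fun k _ => h2 k

lemma norm_sum_normLp₂_le (U : Fin 3 → Lp (L2TV T D) 2 P) :
    ‖∑ k, normLp₂ (U k)‖ ≤ ∑ k, ‖U k‖ :=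
  (norm_sum_le _ _).trans (Finset.sum_le_sum fun _ _ => norm_normLp₂_le _)

lemma norm_sum_inner_le {E : Type*} [NormedAddCommGroup E] [InnerProductSpace ℝ E]
    (a b : Fin 3 → E) : ‖∑ k, (inner ℝ (a k) (b k) : ℝ)‖ ≤ (∑ k, ‖a k‖) * ∑ k, ‖b k‖ := by
  refine (norm_sum_le _ _).trans ?_
  rw [Finset.sum_mul]
  refine Finset.sum_le_sum fun k _ => (norm_inner_le_norm _ _).trans ?_
  exact mul_le_mul_of_nonneg_left
    (Finset.single_le_sum (f := fun k => ‖b k‖) (fun k _ => norm_nonneg _) (Finset.mem_univ k))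
    (norm_nonneg _)

/-- Cauchy-Schwarz in space, time and probability. The remainder is a product of two `L²` quantities
and is therefore controlled only in `L¹`. -/
lemma DiscreteField.lintegral_testedDrift_le [IsFiniteMeasure P] {K : L2V D →L[ℝ] L2V D}
    {θ τ B : ℝ} (hθ : 0 ≤ θ) {M W : Lp (L2TV T D) 2 P} {d e : Fin 3 → Lp (L2TV T D) 2 P}
    (h : DiscreteField P K θ τ B M W d e) {ψ : L2V D} {R : ℝ}
    (hψ : ∀ᵐ x ∂volume.restrict D, ‖ψ x‖ ≤ R) (hψ1 : MemH1 D ψ) :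
    ∫⁻ ω, ∫⁻ t, ‖testedDrift K M W d ψ (fun k => weakPartial D k ψ) ω t‖ₑ
        ∂volume.restrict (Icc 0 T) ∂P ≤
      ENNReal.ofReal (2 * θ * ((∑ k, ‖e k‖) * ∑ k, ‖remainderFactor hψ M d k‖)) := by
  obtain ⟨E, hE⟩ : ∃ E, E = ∑ k, normLp₂ (e k) := ⟨_, rfl⟩
  obtain ⟨F, hF⟩ : ∃ F, F = ∑ k, normLp₂ (remainderFactor hψ M d k) := ⟨_, rfl⟩
  have h1 : ∀ᵐ ω ∂P, ∀ᵐ t ∂volume.restrict (Icc 0 T),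
      ‖testedDrift K M W d ψ (fun k => weakPartial D k ψ) ω t‖ₑ ≤
        ENNReal.ofReal (2 * θ) * (‖E ω t‖ₑ * ‖F ω t‖ₑ) := by
    filter_upwards [coeFn_testedDrift K M W d ψ (fun k => weakPartial D k ψ), h.eqn,
      ae_all_iff.2 fun k => coeFn_remainderFactor hψ M d k, coeFn_sum_normLp₂ (U := e),
      coeFn_sum_normLp₂ (U := remainderFactor hψ M d)] with ω h1 h2 h3 h4 h5
    filter_upwards [h1, h2, ae_all_iff.2 h3, h4, h5] with t h1 h2 h3 h4 h5
    rw [h1, h2 ψ R hψ hψ1, hE, hF, h4, h5]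
    simp only [← h3]
    have h6 := norm_sum_inner_le (fun k => e k ω t) (fun k => remainderFactor hψ M d k ω t)
    rw [enorm_mul, Real.enorm_of_nonneg (by positivity : 0 ≤ 2 * θ), ← enorm_mul]
    refine mul_le_mul_right ?_ _
    rw [← ofReal_norm, ← ofReal_norm, Real.norm_of_nonneg (by positivity :
      0 ≤ (∑ k, ‖e k ω t‖) * ∑ k, ‖remainderFactor hψ M d k ω t‖)]
    exact ENNReal.ofReal_le_ofReal h6
  calc ∫⁻ ω, ∫⁻ t, ‖testedDrift K M W d ψ (fun k => weakPartial D k ψ) ω t‖ₑ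
        ∂volume.restrict (Icc 0 T) ∂P
      ≤ ∫⁻ ω, ∫⁻ t, ENNReal.ofReal (2 * θ) * (‖E ω t‖ₑ * ‖F ω t‖ₑ) ∂volume.restrict (Icc 0 T) ∂P :=
        lintegral_mono_ae (h1.mono fun ω hω => lintegral_mono_ae hω)
    _ = ENNReal.ofReal (2 * θ) * ∫⁻ ω, ∫⁻ t, ‖E ω t‖ₑ * ‖F ω t‖ₑ ∂volume.restrict (Icc 0 T) ∂P := by
        rw [← lintegral_const_mul' _ _ ENNReal.ofReal_ne_top]
        refine lintegral_congr fun ω => ?_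
        rw [lintegral_const_mul' _ _ ENNReal.ofReal_ne_top]
    _ ≤ ENNReal.ofReal (2 * θ) * (‖E‖ₑ * ‖F‖ₑ) :=
        mul_le_mul_right (lintegral_lintegral_enorm_mul_le E F) _
    _ ≤ _ := by
        rw [← ofReal_norm, ← ofReal_norm, ← ENNReal.ofReal_mul (norm_nonneg _),
          ← ENNReal.ofReal_mul (by positivity)]
        refine ENNReal.ofReal_le_ofReal (mul_le_mul_of_nonneg_left ?_ (by positivity))
        rw [hE, hF]
        exact mul_le_mul (norm_sum_normLp₂_le _) (norm_sum_normLp₂_le _) (norm_nonneg _)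
          (by positivity)

/-- The properties of the limits of discrete fields. -/
structure LimitField (P : Measure Ω) (K : L2V D →L[ℝ] L2V D) (M W : Lp (L2TV T D) 2 P)
    (d : Fin 3 → Lp (L2TV T D) 2 P) : Prop where
  unit : ∀ᵐ ω ∂P, ∀ᵐ t ∂volume.restrict (Icc 0 T), ∀ᵐ x ∂volume.restrict D, ‖M ω t x‖ = 1
  grad : ∀ k, ∀ᵐ ω ∂P, ∀ᵐ t ∂volume.restrict (Icc 0 T), HasWeakPartial D k (M ω t) (d k ω t)
  perp : ∀ᵐ ω ∂P, ∀ᵐ t ∂volume.restrict (Icc 0 T),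
    crossV (M ω t) (crossV (M ω t) (W ω t)) = -W ω t
  eqn : ∀ᵐ ω ∂P, ∀ᵐ t ∂volume.restrict (Icc 0 T), ∀ (ψ : L2V D) (R : ℝ),
    (∀ᵐ x ∂volume.restrict D, ‖ψ x‖ ≤ R) → MemH1 D ψ →
    inner ℝ (W ω t + crossV (M ω t) (W ω t) - noiseDrift K (M ω t)) ψ
      + 2 * ∑ k, inner ℝ (crossV (M ω t) (d k ω t)) (weakPartial D k ψ) = 0

/-- The exceptional null set must not depend on `ψ`, so pairs `(ψ, ∇ψ)` are treated as points of a
separable space in which the tested expression is continuous. -/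
lemma ae_inner_eq_zero_of_testedDrift {K : L2V D →L[ℝ] L2V D} {M W : Lp (L2TV T D) 2 P}
    {d : Fin 3 → Lp (L2TV T D) 2 P}
    (h : ∀ (ψ : L2V D) (R : ℝ), (∀ᵐ x ∂volume.restrict D, ‖ψ x‖ ≤ R) → MemH1 D ψ →
      testedDrift K M W d ψ (fun k => weakPartial D k ψ) = 0) :
    ∀ᵐ ω ∂P, ∀ᵐ t ∂volume.restrict (Icc 0 T), ∀ (ψ : L2V D) (R : ℝ),
    (∀ᵐ x ∂volume.restrict D, ‖ψ x‖ ≤ R) → MemH1 D ψ →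
    inner ℝ (W ω t + crossV (M ω t) (W ω t) - noiseDrift K (M ω t)) ψ
      + 2 * ∑ k, inner ℝ (crossV (M ω t) (d k ω t)) (weakPartial D k ψ) = 0 := by
  have h1 := ae_ae_forall_mem (P := P) (μ := volume.restrict (Icc 0 T))
    (A := L2V D × (Fin 3 → L2V D))
    (S := {a | ∃ R, (∀ᵐ x ∂volume.restrict D, ‖a.1 x‖ ≤ R) ∧ MemH1 D a.1 ∧
      a.2 = fun k => weakPartial D k a.1})
    (p := fun ω t a => inner ℝ (W ω t + crossV (M ω t) (W ω t) - noiseDrift K (M ω t)) a.1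
      + 2 * ∑ k, inner ℝ (crossV (M ω t) (d k ω t)) (a.2 k))
    (fun ω t => (continuous_const.inner continuous_fst).add (continuous_const.mul
      (continuous_finsetSum _ fun k _ =>
        continuous_const.inner ((continuous_apply k).comp continuous_snd)))) (by
    rintro ⟨ψ, dψ⟩ ⟨R, hR, hψ1, hdψ⟩
    change dψ = fun k => weakPartial D k ψ at hdψ
    subst hdψ
    have h2 := h ψ R hR hψ1
    rw [eq_zero_iff₂] at h2
    filter_upwards [h2, coeFn_testedDrift K M W d ψ (fun k => weakPartial D k ψ)] with ω h3 h4
    filter_upwards [h3, h4] with t h3 h4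
    rw [← h4, h3])
  refine h1.mono fun ω hω => hω.mono fun t ht ψ R hR hψ1 => ?_
  exact ht (ψ, fun k => weakPartial D k ψ) ⟨R, hR, hψ1, rfl⟩

/-- A common subsequence makes `w` and `∇m` converge weakly, while `m` converges strongly. The
tested expression has a weak limit in `L²` and tends to zero in `L¹`, being of order `√τ`; so the
limit is zero. -/
lemma exists_limitField [IsFiniteMeasure P] {K : L2V D →L[ℝ] L2V D} (hb : Bornology.IsBounded D)
    {θ B : ℝ} (hθ : 0 ≤ θ) (hT : 0 ≤ T)
    {τ : ℕ → ℝ} (hτ0 : ∀ n, 0 ≤ τ n) (hτ : Tendsto τ atTop (𝓝 0)) {M W : ℕ → Lp (L2TV T D) 2 P}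
    {d e : ℕ → Fin 3 → Lp (L2TV T D) 2 P} {M' : Lp (L2TV T D) 2 P}
    (h : ∀ n, DiscreteField P K θ (τ n) B (M n) (W n) (d n) (e n))
    (hM : Tendsto M atTop (𝓝 M')) :
    ∃ (W' : Lp (L2TV T D) 2 P) (d' : Fin 3 → Lp (L2TV T D) 2 P) (φ : ℕ → ℕ), StrictMono φ ∧
      WeakTendsto (fun n => W (φ n)) W' ∧ LimitField P K M' W' d' := by
  have hWb : ∀ n, ‖W n‖ ≤ √B := fun n => norm_le_sqrt_of_enorm_sq (h n).norm_drift
  have hdb : ∀ n k, ‖d n k‖ ≤ √(T * B) := fun n k =>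
    norm_le_sqrt_of_enorm_sq (((h n).norm_grad k).trans_eq (ENNReal.ofReal_mul hT).symm)
  have heb : ∀ n k, ‖e n k‖ ≤ √(τ n * B) := fun n k =>
    norm_le_sqrt_of_enorm_sq (((h n).norm_step k).trans_eq (ENNReal.ofReal_mul (hτ0 n)).symm)
  set C : ℝ := max √B √(T * B) with hC
  have hWC : ∀ n, ‖W n‖ ≤ C := fun n => (hWb n).trans (le_max_left _ _)
  have hdC : ∀ n k, ‖d n k‖ ≤ C := fun n k => (hdb n k).trans (le_max_right _ _)
  obtain ⟨x', φ, hφ, hx⟩ := exists_weakTendsto_subseq_family (ι := Option (Fin 3))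
    (x := fun n i => i.elim (W n) (d n)) (C := C) (fun n i => by
      cases i with
      | none => exact hWC n
      | some k => exact hdC n k)
  have hW' : WeakTendsto (fun n => W (φ n)) (x' none) := hx none
  have hd' : ∀ k, WeakTendsto (fun n => d (φ n) k) (x' (some k)) := fun k => hx (some k)
  have hMφ : Tendsto (fun n => M (φ n)) atTop (𝓝 M') := hM.comp hφ.tendsto_atTop
  refine ⟨x' none, fun k => x' (some k), φ, hφ, hW', ?_, fun k => ?_, ?_, ?_⟩
  · have hcl : IsClosed {f : Lp (L2TV T D) 2 P | ∀ᵐ ω ∂P, f ω ∈ {u : L2TV T D |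
        ∀ᵐ t ∂volume.restrict (Icc 0 T), u t ∈ {v : L2V D | ∀ᵐ x ∂volume.restrict D, ‖v x‖ = 1}}} :=
      isClosed_ae_mem (isClosed_ae_mem (isClosed_norm_eq_one hb))
    exact hcl.mem_of_tendsto hM (Eventually.of_forall fun n => (h n).unit)
  · exact ae_hasWeakPartial_of_weakTendsto (WeakTendsto.of_tendsto hMφ) (hd' k)
      fun n => (h (φ n)).grad k
  · have h1 : ∀ n, crossΩ (M n) (crossΩ (M n) (W n)) = (-1 : ℝ) • W n := fun n => by
      refine Lp.ext ?_
      filter_upwards [(h n).perp, coeFn_crossΩ (M n) (crossΩ (M n) (W n)),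
        coeFn_crossΩ (M n) (W n), coeFn_smul₂ (-1 : ℝ) (W n)] with ω h1 h2 h3 h4
      refine Lp.ext ?_
      filter_upwards [h1, h2, h3, h4] with t h1 h2 h3 h4
      rw [h2, h3, h1, h4, neg_one_smul]
    have h2 := weakTendsto_crossΩ (C := C) (fun n => (crossΩ_isBoundedAction.le _ _).trans
      (hWC (φ n))) hMφ (weakTendsto_crossΩ (fun n => hWC (φ n)) hMφ hW')
    simp only [h1] at h2
    have h3 := h2.unique (hW'.smul (-1))
    filter_upwards [coeFn_crossΩ M' (crossΩ M' (x' none)), coeFn_crossΩ M' (x' none),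
      coeFn_smul₂ (-1 : ℝ) (x' none)] with ω h4 h5 h6
    filter_upwards [h4, h5, h6] with t h4 h5 h6
    rw [← h5, ← h4, h3, h6, neg_one_smul]
  · refine ae_inner_eq_zero_of_testedDrift fun ψ R hψ hψ1 => ?_
    have hlim := weakTendsto_testedDrift K (fun n => hWC (φ n)) (fun n => hdC (φ n)) hMφ hW' hd' ψ
      (fun k => weakPartial D k ψ)
    refine hlim.eq_zero_of_lintegral ?_
    set L : ℝ := ∑ k : Fin 3, (‖mapLp₂ P (volume.restrict (Icc 0 T)) (crossBdd hψ)‖ * C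
      + ‖constΩ P T (weakPartial D k ψ)‖) with hL
    have hF : ∀ n, ∑ k, ‖remainderFactor hψ (M n) (d n) k‖ ≤ L := fun n => by
      refine Finset.sum_le_sum fun k _ => (norm_add_le _ _).trans (add_le_add ?_ ?_)
      · exact (ContinuousLinearMap.le_opNorm _ _).trans
          (mul_le_mul_of_nonneg_left (hdC n k) (norm_nonneg _))
      · exact crossΩ_isBoundedAction.le _ _
    have hE : ∀ n, ∑ k, ‖e n k‖ ≤ 3 * √(τ n * B) := fun n => by
      refine (Finset.sum_le_card_nsmul Finset.univ _ _ fun k _ => heb n k).trans_eq ?_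
      simp
    have hup : ∀ n, ∫⁻ ω, ∫⁻ t, ‖testedDrift K (M (φ n)) (W (φ n)) (d (φ n)) ψ
        (fun k => weakPartial D k ψ) ω t‖ₑ ∂volume.restrict (Icc 0 T) ∂P ≤
        ENNReal.ofReal (2 * θ * ((3 * √(τ (φ n) * B)) * L)) := fun n => by
      refine ((h (φ n)).lintegral_testedDrift_le hθ hψ hψ1).trans (ENNReal.ofReal_le_ofReal ?_)
      refine mul_le_mul_of_nonneg_left ?_ (by positivity)
      exact mul_le_mul (hE _) (hF _) (by positivity) (by positivity)
    have hz : Tendsto (fun n => ENNReal.ofReal (2 * θ * ((3 * √(τ (φ n) * B)) * L))) atTop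
        (𝓝 0) := by
      have h1 : Tendsto (fun n => √(τ (φ n) * B)) atTop (𝓝 0) := by
        have h2 := (Real.continuous_sqrt.tendsto _).comp
          ((hτ.comp hφ.tendsto_atTop).mul_const B)
        rw [zero_mul, Real.sqrt_zero] at h2
        exact h2
      have h3 := (((h1.const_mul 3).mul_const L).const_mul (2 * θ))
      rw [mul_zero, zero_mul, mul_zero] at h3
      have h4 := ENNReal.tendsto_ofReal h3
      rwa [ENNReal.ofReal_zero] at h4
    exact tendsto_of_tendsto_of_tendsto_of_le_of_le tendsto_const_nhds hz
      (fun _ => zero_le) hup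

end LimitEquation

/-! ### Identification of the limit drift -/

section Drift

lemma projPerp_eq {m : E3} (hm : ‖m‖ = 1) (K : E3) : projPerp m K = -cross m (cross m K) := by
  rw [projPerp, Submodule.starProjection_orthogonal, _root_.sub_apply,
    ContinuousLinearMap.id_apply, Submodule.starProjection_singleton, cross_cross_self, hm]
  simp

lemma cross_cross_cross_self {m : E3} (hm : ‖m‖ = 1) (b : E3) :
    cross m (cross m (cross m b)) = -cross m b := by
  rw [cross_cross_self m (cross m b), real_inner_comm, inner_cross_self_left, hm]
  simp

/-- On `mᗮ` the map `m ×` squares to `-1`, so `m × y + m × (m × y)` collapses to `-2w` plus a noise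
part, which is the projection of `K` up to a factor. -/
lemma drift_algebra {m w K L y : E3} (hm : ‖m‖ = 1) (hw : cross m (cross m w) = -w) (a : ℝ)
    (hy : y = w + cross m w - (1 / 2 : ℝ) • (cross m K - cross m (cross m K)))
    (hL : L = -(a • m) - (1 / 2 : ℝ) • cross m y) :
    w = L + a • m + cross m L + (1 / 2 : ℝ) • projPerp m K := by
  have h0 : cross m m = 0 := by
    have h1 := cross_anticomm' m m
    have h2 : (2 : ℝ) • cross m m = 0 := by rw [two_smul]; nth_rewrite 1 [h1]; simp
    exact (smul_eq_zero.1 h2).resolve_left two_ne_zero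
  have hK := cross_cross_cross_self hm K
  rw [projPerp_eq hm, hL, hy]
  simp only [cross_add_right, cross_sub_right, cross_neg_right, cross_smul_right, h0, hw, hK]
  module

/-- With `a = ∂m`, `b = φ`, `c = ∂φ` this is the integrand obtained by testing with `m × φ`: it
separates the Dirichlet form from the term `|∇m|² m`. -/
lemma inner_cross_cross_self {m a b c : E3} (hm : ‖m‖ = 1) (ha : inner ℝ m a = 0) :
    inner ℝ (cross m a) (cross a b + cross m c) = inner ℝ a c - ‖a‖ ^ 2 * inner ℝ m b := by
  have h1 : inner ℝ (cross m a) (cross a b) = -(‖a‖ ^ 2 * inner ℝ m b) := by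
    rw [cross_anticomm' m a, inner_neg_left, inner_cross_swap, cross_cross_self, inner_sub_right,
      real_inner_smul_right, real_inner_smul_right, ha]
    ring
  have h2 : inner ℝ (cross m a) (cross m c) = inner ℝ a c := by
    rw [inner_cross_swap, cross_cross_self, inner_sub_right, real_inner_smul_right,
      real_inner_smul_right, hm, real_inner_comm m a, ha]
    ring
  rw [inner_add_right, h1, h2]
  ring

variable {D : Set E3}

/-- The restriction of a smooth field with compact support to `D`. -/
lemma exists_smooth_field {φ : E3 → E3} (h : IsTestField univ φ) :
    ∃ (Φ : L2V D) (dΦ : Fin 3 → L2V D) (R : ℝ), (Φ =ᵐ[volume.restrict D] φ) ∧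
      (∀ k, dΦ k =ᵐ[volume.restrict D] fun x => fderiv ℝ φ x (stdVec k)) ∧
      (∀ᵐ x ∂volume.restrict D, ‖Φ x‖ ≤ R) ∧ ∀ k, HasWeakPartial D k Φ (dΦ k) := by
  have hmem : ∀ {f : E3 → E3}, IsTestField univ f → MemLp f 2 (volume.restrict D) := fun hf => by
    have h1 := hf.memLp
    rw [Measure.restrict_univ] at h1
    exact h1.restrict D
  obtain ⟨R, hR⟩ := h.bounded
  have hk := fun k => h.lineDeriv (stdVec k)
  refine ⟨(hmem h).toLp, fun k => (hmem (hk k)).toLp, R, (hmem h).coeFn_toLp,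
    fun k => (hmem (hk k)).coeFn_toLp, ?_, fun k => ?_⟩
  · filter_upwards [(hmem h).coeFn_toLp] with x hx
    rw [hx]
    exact hR x
  · rw [hasWeakPartial_def]
    intro η hη
    have hset : ∀ {g : E3 → ℝ} (_ : IsTestField D g) (f : E3 → E3),
        ∫ x in D, g x • f x = ∫ x, g x • f x := fun hg f =>
      setIntegral_eq_integral_of_forall_compl_eq_zero fun x hx => by
        rw [image_eq_zero_of_notMem_tsupport fun h => hx (hg.2.2 h), zero_smul]
    have e1 : ∫ x in D, fderiv ℝ η x (stdVec k) • (hmem h).toLp φ x =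
        ∫ x, fderiv ℝ η x (stdVec k) • φ x := by
      rw [← hset (hη.lineDeriv (stdVec k)) φ]
      refine integral_congr_ae ?_
      filter_upwards [(hmem h).coeFn_toLp] with x hx
      rw [hx]
    have e2 : ∫ x in D, η x • (hmem (hk k)).toLp _ x = ∫ x, η x • fderiv ℝ φ x (stdVec k) := by
      rw [← hset hη]
      refine integral_congr_ae ?_
      filter_upwards [(hmem (hk k)).coeFn_toLp] with x hx
      rw [hx]
    rw [e1, e2]
    have hci : ∀ {f : E3 → E3} {g : E3 → ℝ}, Continuous f → IsTestField D g →
        Integrable (fun x => g x • f x) (volume : Measure E3) := fun hf hg =>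
      (hg.1.continuous.smul hf).integrable_of_hasCompactSupport hg.2.1.smul_right
    rw [integral_smul_fderiv_eq_neg_fderiv_smul_of_integrable
      (hci h.1.continuous (hη.lineDeriv (stdVec k))) (hci (hk k).1.continuous hη)
      (hci h.1.continuous hη) (fun x _ => hη.differentiable x) (fun x _ => h.differentiable x),
      neg_neg]

/-- The identification of the drift from the tested limit equation. -/
lemma isDrift_of_tested (hD : IsOpen D) (hb : Bornology.IsBounded D) {Gf : ℕ → L2V D} {c : ℕ → ℝ}
    (hc : NoiseBound Gf c) {m w : L2V D} {d : Fin 3 → L2V D}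
    (hm : ∀ᵐ x ∂volume.restrict D, ‖m x‖ = 1) (hd : ∀ k, HasWeakPartial D k m (d k))
    (hw : crossV m (crossV m w) = -w)
    (h : ∀ (ψ : L2V D) (R : ℝ), (∀ᵐ x ∂volume.restrict D, ‖ψ x‖ ≤ R) → MemH1 D ψ →
      inner ℝ (w + crossV m w - noiseDrift (noiseOp hc) m) ψ
        + 2 * ∑ k, inner ℝ (crossV m (d k)) (weakPartial D k ψ) = 0) :
    IsDrift D Gf m w := by
  obtain ⟨y, hy⟩ : ∃ y, y = w + crossV m w - noiseDrift (noiseOp hc) m := ⟨_, rfl⟩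
  have hwp : ∀ k, weakPartial D k m = d k := fun k => (hd k).weakPartial_eq hD hb
  have hi1 : ∀ k, Integrable (fun x => ‖d k x‖ ^ 2 • m x) (volume.restrict D) := fun k => by
    have h1 : Integrable (fun x => ‖d k x‖ ^ 2) (volume.restrict D) :=
      (Lp.memLp (d k)).integrable_norm_pow two_ne_zero
    refine h1.mono (h1.aestronglyMeasurable.smul (Lp.aestronglyMeasurable m)) ?_
    filter_upwards [hm] with x hx
    rw [norm_smul, hx, mul_one]
  have hi2 : Integrable (fun x => (∑ k, ‖d k x‖ ^ 2) • m x) (volume.restrict D) := by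
    simp only [Finset.sum_smul]
    exact integrable_finsetSum _ fun k _ => hi1 k
  have hcr := coeFn_crossV hm y
  have hi3 : Integrable (fun x => (1 / 2 : ℝ) • cross (m x) (y x)) (volume.restrict D) := by
    refine Integrable.smul (1 / 2 : ℝ) ?_
    exact (L2V.integrable hb (crossV m y)).congr hcr
  -- The candidate for the Laplacian is dictated by the equation tested with `m × φ`: `2(∇m, ∇φ) =
  -- 2(|∇m|² m, φ) + (m × y, φ)`.
  refine ⟨fun x => -((∑ k, ‖d k x‖ ^ 2) • m x) - (1 / 2 : ℝ) • cross (m x) (y x),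
    ⟨fun k => ⟨_, hd k⟩, hi2.neg.sub hi3, fun φ hφ1 hφ2 => ?_⟩, ?_⟩
  · obtain ⟨Φ, dΦ, R, hΦ, hdΦ, hR, hwΦ⟩ :=
      exists_smooth_field (φ := φ) ⟨hφ1, hφ2, subset_univ _⟩
    have hψw : ∀ k, HasWeakPartial D k (crossV m Φ) (crossBdd hR (d k) + crossV m (dΦ k)) :=
      fun k => HasWeakPartial.crossV_bdd hD hb hm hR (hd k) (hwΦ k)
    have hψR : ∀ᵐ x ∂volume.restrict D, ‖crossV m Φ x‖ ≤ R := by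
      filter_upwards [coeFn_crossV hm Φ, hR, hm] with x h1 h2 h3
      rw [h1]
      refine (norm_cross_le _ _).trans ?_
      rwa [h3, one_mul]
    -- The test fields are not required to vanish on the boundary; this yields the Neumann
    -- condition.
    have heq := h (crossV m Φ) R hψR fun k => ⟨_, hψw k⟩
    simp only [fun k => (hψw k).weakPartial_eq hD hb] at heq
    rw [← hy] at heq
    have e1 : inner ℝ y (crossV m Φ) = -∫ x in D, inner ℝ (cross (m x) (y x)) (φ x) := by
      have h1 : inner ℝ y (crossV m Φ) = -inner ℝ (crossV m y) Φ := by
        rw [crossV_antisymm, neg_neg]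
      rw [h1, L2.inner_def]
      congr 1
      refine integral_congr_ae ?_
      filter_upwards [hcr, hΦ] with x h2 h3
      rw [h2, h3]
    have hib : ∀ k, Integrable (fun x => inner ℝ (d k x) (fderiv ℝ φ x (stdVec k)))
        (volume.restrict D) := fun k => by
      refine (L2.integrable_inner (𝕜 := ℝ) (d k) (dΦ k)).congr ?_
      filter_upwards [hdΦ k] with x h1
      rw [h1]
    obtain ⟨Cφ, hCφ⟩ := (show IsTestField univ φ from ⟨hφ1, hφ2, subset_univ _⟩).bounded
    have hin : ∀ {f : E3 → E3}, Integrable f (volume.restrict D) →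
        Integrable (fun x => inner ℝ (f x) (φ x)) (volume.restrict D) := fun {f} hf => by
      refine (hf.norm.mul_const Cφ).mono' (hf.aestronglyMeasurable.inner
        hφ1.continuous.aestronglyMeasurable) (Eventually.of_forall fun x => ?_)
      exact (norm_inner_le_norm _ _).trans
        (mul_le_mul_of_nonneg_left (hCφ x) (norm_nonneg _))
    have e2 : ∀ k, inner ℝ (crossV m (d k)) (crossBdd hR (d k) + crossV m (dΦ k)) =
        (∫ x in D, inner ℝ (d k x) (fderiv ℝ φ x (stdVec k)))
          - ∫ x in D, inner ℝ (‖d k x‖ ^ 2 • m x) (φ x) := fun k => by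
      rw [← integral_sub (hib k) (hin (hi1 k)), L2.inner_def]
      refine integral_congr_ae ?_
      filter_upwards [coeFn_crossV hm (d k), coeFn_crossV hm (dΦ k), coeFn_crossBdd hR (d k),
        Lp.coeFn_add (crossBdd hR (d k)) (crossV m (dΦ k)), hΦ, hdΦ k, hm,
        (hd k).inner_eq_zero hD hb hm] with x h1 h2 h3 h4 h5 h6 h7 h8
      rw [h1, h4, Pi.add_apply, h2, h3, h5, h6, inner_cross_cross_self h7 h8,
        real_inner_smul_left]
    rw [e1] at heq
    simp only [e2, Finset.sum_sub_distrib] at heq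
    have e3 : ∫ x in D, inner ℝ (-((∑ k, ‖d k x‖ ^ 2) • m x) - (1 / 2 : ℝ) • cross (m x) (y x))
        (φ x) = -(∑ k, ∫ x in D, inner ℝ (‖d k x‖ ^ 2 • m x) (φ x))
          - 1 / 2 * ∫ x in D, inner ℝ (cross (m x) (y x)) (φ x) := by
      simp only [inner_sub_left, inner_neg_left, real_inner_smul_left (cross _ _)]
      have hi4 := hin ((L2V.integrable hb (crossV m y)).congr hcr)
      have hi5 : Integrable (fun x => -inner ℝ ((∑ k, ‖d k x‖ ^ 2) • m x) (φ x))
          (volume.restrict D) := (hin hi2).neg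
      rw [integral_sub hi5 (hi4.const_mul (1 / 2)), integral_neg, integral_const_mul]
      simp only [Finset.sum_smul, sum_inner]
      rw [integral_finsetSum _ fun k _ => hin (hi1 k)]
    rw [e3]
    simp only [hwp]
    change _ = -∑ k, ∫ x in D, inner ℝ (d k x) (fderiv ℝ φ x (stdVec k))
    linarith
  · have hyc : ∀ᵐ x ∂volume.restrict D, y x = w x + cross (m x) (w x) - (1 / 2 : ℝ) •
        (cross (m x) (noiseOp hc m x) - cross (m x) (cross (m x) (noiseOp hc m x))) := by
      have h1 : y = (w + crossV m w) - noiseDrift (noiseOp hc) m := hy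
      filter_upwards [Lp.coeFn_sub (w + crossV m w) (noiseDrift (noiseOp hc) m),
        Lp.coeFn_add w (crossV m w), coeFn_crossV hm w,
        Lp.coeFn_smul (1 / 2 : ℝ)
          (crossV m (noiseOp hc m) - crossV m (crossV m (noiseOp hc m))),
        Lp.coeFn_sub (crossV m (noiseOp hc m)) (crossV m (crossV m (noiseOp hc m))),
        coeFn_crossV hm (noiseOp hc m), coeFn_crossV hm (crossV m (noiseOp hc m))]
        with x h2 h3 h4 h5 h6 h7 h8
      rw [h1, h2, Pi.sub_apply, h3, Pi.add_apply, h4, noiseDrift, h5, Pi.smul_apply, h6,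
        Pi.sub_apply, h8, h7]
    have hwc : ∀ᵐ x ∂volume.restrict D, cross (m x) (cross (m x) (w x)) = -w x := by
      filter_upwards [coeFn_crossV hm w, coeFn_crossV hm (crossV m w), Lp.coeFn_neg w]
        with x h1 h2 h3
      rw [← h1, ← h2, hw, h3, Pi.neg_apply]
    filter_upwards [hyc, hwc, hm, coeFn_noiseOp hc m] with x h1 h2 h3 h4
    simp only [hwp]
    rw [h4.tsum_eq]
    exact drift_algebra h3 h2 _ h1 rfl

end Drift

/-! ### Sums over the time steps -/

section TimeSums

variable {T : ℝ} {D : Set E3} {N : ℕ}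

lemma integrable_L2TV (f : L2TV T D) : Integrable f (volume.restrict (Icc 0 T)) :=
  (Lp.memLp f).integrable one_le_two

/-- The integral over a set of times, as a continuous linear map. -/
def setIntegralCLM (D : Set E3) {I : Set ℝ} (hI : MeasurableSet I) (hIT : I ⊆ Icc 0 T) :
    L2TV T D →L[ℝ] L2V D where
  toFun f := ∫ t in I, f t
  map_add' f g := by
    have hi : ∀ f : L2TV T D, IntegrableOn f I := fun f =>
      IntegrableOn.mono_set (integrable_L2TV f) hIT
    rw [← integral_add (hi f) (hi g)]
    exact integral_congr_ae (ae_restrict_of_ae_restrict_of_subset hIT (Lp.coeFn_add f g))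
  map_smul' r f := by
    rw [RingHom.id_apply, ← integral_smul]
    exact integral_congr_ae (ae_restrict_of_ae_restrict_of_subset hIT (Lp.coeFn_smul r f))
  cont := continuous_setIntegral_L2TV hI hIT

lemma setIntegralCLM_apply {I : Set ℝ} (hI : MeasurableSet I) (hIT : I ⊆ Icc 0 T)
    (f : L2TV T D) : setIntegralCLM D hI hIT f = ∫ t in I, f t := rfl

lemma norm_setIntegral_L2TV_le {I : Set ℝ} (hI : MeasurableSet I) (hIT : I ⊆ Icc 0 T)
    (f : L2TV T D) : ‖∫ t in I, f t‖ ≤ √(volume.real I) * ‖f‖ := by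
  have hfin : volume.restrict (Icc 0 T) I ≠ ∞ := measure_ne_top _ _
  have h1 := lintegral_enorm_mul_le (indicatorConstLp 2 hI hfin (1 : ℝ)) f
  have h2 : ∫⁻ t in Icc 0 T, ‖indicatorConstLp 2 hI hfin (1 : ℝ) t‖ₑ * ‖f t‖ₑ
      = ∫⁻ t in I, ‖f t‖ₑ := by
    have h3 : ∫⁻ t in Icc 0 T, ‖indicatorConstLp 2 hI hfin (1 : ℝ) t‖ₑ * ‖f t‖ₑ =
        ∫⁻ t in Icc 0 T, I.indicator (fun t => ‖f t‖ₑ) t := by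
      refine lintegral_congr_ae ?_
      filter_upwards [indicatorConstLp_coeFn (p := 2) (hs := hI) (hμs := hfin) (c := (1 : ℝ))]
        with t ht
      rw [ht]
      by_cases h : t ∈ I <;> simp [h]
    rw [h3, lintegral_indicator hI, Measure.restrict_restrict hI, inter_eq_left.2 hIT]
  rw [h2] at h1
  have h3 : ‖indicatorConstLp 2 hI hfin (1 : ℝ)‖ = √(volume.real I) := by
    rw [norm_indicatorConstLp two_ne_zero ENNReal.ofNat_ne_top, norm_one, one_mul,
      Real.sqrt_eq_rpow, measureReal_restrict_apply hI, inter_eq_left.2 hIT]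
    norm_num
  have h4 := (enorm_integral_le_lintegral_enorm (μ := volume.restrict I) f).trans h1
  rw [← ofReal_norm, ← ofReal_norm, ← ofReal_norm, ← ENNReal.ofReal_mul (norm_nonneg _),
    ENNReal.ofReal_le_ofReal_iff (by positivity), h3] at h4
  exact h4

/-- The times covered by the steps that are completed up to the time `t`. -/
def completedTimes (T : ℝ) (N : ℕ) (t : ℝ) : Set ℝ :=
  ⋃ n ∈ (Finset.range N).filter (fun n : ℕ => ((n : ℝ) + 1) * (T / N) ≤ t), gridIco T N n

lemma measurableSet_completedTimes (T : ℝ) (N : ℕ) (t : ℝ) :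
    MeasurableSet (completedTimes T N t) :=
  Finset.measurableSet_biUnion _ fun n _ => measurableSet_gridIco T N n

lemma completedTimes_subset (hT : 0 < T) (hN : 1 ≤ N) (t : ℝ) :
    completedTimes T N t ⊆ Icc 0 T ∩ Ico 0 t := by
  intro s hs
  simp only [completedTimes, mem_iUnion, Finset.mem_filter, Finset.mem_range] at hs
  obtain ⟨n, ⟨hn, hnt⟩, hs⟩ := hs
  have h1 := gridIco_subset hT hN hn hs
  exact ⟨h1, h1.1, hs.2.trans_le hnt⟩

lemma sum_eq_setIntegral_completedTimes (hT : 0 < T) (hN : 1 ≤ N) (a : ℕ → L2V D) (t : ℝ) :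
    ∑ n ∈ (Finset.range N).filter (fun n : ℕ => ((n : ℝ) + 1) * (T / N) ≤ t), (T / N) • a n =
      ∫ s in completedTimes T N t, stepFunction T N a s := by
  have hN0 : (0 : ℝ) < N := by exact_mod_cast hN
  have hτ : T / N ≠ 0 := by positivity
  rw [completedTimes, integral_biUnion_finset]
  · refine Finset.sum_congr rfl fun n hn => ?_
    have h1 := stepValue_stepFunction hT hN a (Finset.mem_range.1 (Finset.mem_filter.1 hn).1)
    rw [← h1, stepValue, smul_smul, mul_inv_cancel₀ hτ, one_smul]
    rfl
  · exact fun n _ => measurableSet_gridIco T N n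
  · intro i hi j hj hij
    refine Set.disjoint_left.2 fun s hsi hsj => hij ?_
    have hi' := Finset.mem_range.1 (Finset.mem_filter.1 hi).1
    have h0 := (gridIco_subset hT hN hi' hsi).1
    rw [← (mem_gridIco_iff hT hN h0).1 hsi, ← (mem_gridIco_iff hT hN h0).1 hsj]
  · exact fun n hn => IntegrableOn.mono_set (integrable_L2TV _)
      (gridIco_subset hT hN (Finset.mem_range.1 (Finset.mem_filter.1 hn).1))

/-- Only the step in progress at time `t` is missing. -/
lemma volume_diff_completedTimes_le (hT : 0 < T) (hN : 1 ≤ N) {t : ℝ} (ht : t ≤ T) :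
    volume.real (Ico 0 t \ completedTimes T N t) ≤ T / N := by
  have hN0 : (0 : ℝ) < N := by exact_mod_cast hN
  have hsub : Ico 0 t \ completedTimes T N t ⊆ Icc (t - T / N) t := by
    rintro s ⟨hs, hs'⟩
    refine ⟨?_, hs.2.le⟩
    by_contra hlt
    rw [not_le] at hlt
    have h1 := (mem_gridIco_iff (T := T) (n := ⌊s / (T / N)⌋₊) hT hN hs.1).2 rfl
    refine hs' ?_
    simp only [completedTimes, mem_iUnion, Finset.mem_filter, Finset.mem_range]
    refine ⟨_, ⟨floor_lt hT hN hs.1 (hs.2.trans_le ht), ?_⟩, h1⟩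
    have h2 := h1.1
    linarith
  have h3 := measureReal_mono (μ := volume) hsub measure_Icc_lt_top.ne
  rw [Real.volume_real_Icc] at h3
  refine h3.trans_eq ?_
  rw [sub_sub_cancel, max_eq_left (by positivity)]

lemma norm_completedTimes_sub_le (hT : 0 < T) (hN : 1 ≤ N) {t : ℝ} (ht : t ≤ T)
    (hI : Ico 0 t ⊆ Icc 0 T) (f : L2TV T D) :
    ‖setIntegralCLM D (measurableSet_completedTimes T N t)
        ((completedTimes_subset hT hN t).trans inter_subset_left) f
      - setIntegralCLM D measurableSet_Ico hI f‖ ≤ √(T / N) * ‖f‖ := by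
  have h1 := setIntegral_sdiff (f := f) (measurableSet_completedTimes T N t)
    (IntegrableOn.mono_set (integrable_L2TV f) hI)
    ((completedTimes_subset hT hN t).trans inter_subset_right)
  rw [setIntegralCLM_apply, setIntegralCLM_apply, norm_sub_rev, ← h1]
  refine (norm_setIntegral_L2TV_le (measurableSet_Ico.diff (measurableSet_completedTimes T N t))
    (sdiff_subset.trans hI) f).trans ?_
  exact mul_le_mul_of_nonneg_right (Real.sqrt_le_sqrt (volume_diff_completedTimes_le hT hN ht))
    (norm_nonneg _)

end TimeSums

/-! ### From Hilbert space limits to the stated convergence -/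

section Conclusion

variable {Ω : Type*} {mΩ : MeasurableSpace Ω} {P : Measure Ω} {T : ℝ} {D : Set E3}

lemma weakConvL2_of_weakTendsto {H : Type*} [NormedAddCommGroup H] [InnerProductSpace ℝ H]
    {F : ℕ → Lp H 2 P} {F' : Lp H 2 P} {f : ℕ → Ω → H} {f' : Ω → H} (h : WeakTendsto F F')
    (hf : ∀ j, F j =ᵐ[P] f j) (hf' : F' =ᵐ[P] f') : WeakConvL2 P f f' := by
  refine ⟨fun j => (Lp.memLp (F j)).ae_eq (hf j), (Lp.memLp F').ae_eq hf', fun Φ hΦ => ?_⟩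
  have e : ∀ {U : Lp H 2 P} {u : Ω → H}, U =ᵐ[P] u →
      inner ℝ U hΦ.toLp = ∫ ω, inner ℝ (u ω) (Φ ω) ∂P := fun {U u} hu => by
    rw [L2.inner_def]
    refine integral_congr_ae ?_
    filter_upwards [hu, hΦ.coeFn_toLp] with ω h1 h2
    rw [h1, h2]
  rw [← e hf']
  exact (h hΦ.toLp).congr fun j => e (hf j)

/-- The integration operators over the completed steps differ in norm from integration over `[0,t)`
by at most `√τ`. Since `W j` is bounded, the discrepancy vanishes strongly, and the fixed operator
preserves weak convergence. -/
lemma weakTendsto_sums (hT : 0 < T) {N : ℕ → ℕ} (hN : ∀ j, 1 ≤ N j)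
    (hNlim : Tendsto (fun j => T / N j) atTop (𝓝 0)) {W : ℕ → Lp (L2TV T D) 2 P}
    {W' : Lp (L2TV T D) 2 P} {C : ℝ} (hC : ∀ j, ‖W j‖ ≤ C) (hW : WeakTendsto W W') {t : ℝ}
    (ht : t ≤ T) (hI : Ico 0 t ⊆ Icc 0 T) :
    WeakTendsto (fun j => (setIntegralCLM D (measurableSet_completedTimes T (N j) t)
        ((completedTimes_subset hT (hN j) t).trans inter_subset_left)).compLpL 2 P (W j))
      ((setIntegralCLM D measurableSet_Ico hI).compLpL 2 P W') := by
  have h1 := hW.clm ((setIntegralCLM D measurableSet_Ico hI).compLpL 2 P)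
  have hle : ∀ j, ‖(setIntegralCLM D (measurableSet_completedTimes T (N j) t)
        ((completedTimes_subset hT (hN j) t).trans inter_subset_left)).compLpL 2 P (W j)
      - (setIntegralCLM D measurableSet_Ico hI).compLpL 2 P (W j)‖ ≤ √(T / N j) * C := fun j => by
    have h2 : ‖(setIntegralCLM D (measurableSet_completedTimes T (N j) t)
        ((completedTimes_subset hT (hN j) t).trans inter_subset_left)).compLpL 2 P (W j)
      - (setIntegralCLM D measurableSet_Ico hI).compLpL 2 P (W j)‖ ≤ √(T / N j) * ‖W j‖ := by
      refine Lp.norm_le_mul_norm_of_ae_le_mul ?_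
      filter_upwards [Lp.coeFn_sub ((setIntegralCLM D (measurableSet_completedTimes T (N j) t)
          ((completedTimes_subset hT (hN j) t).trans inter_subset_left)).compLpL 2 P (W j))
          ((setIntegralCLM D measurableSet_Ico hI).compLpL 2 P (W j)),
        (setIntegralCLM D (measurableSet_completedTimes T (N j) t)
          ((completedTimes_subset hT (hN j) t).trans inter_subset_left)).coeFn_compLpL (W j),
        (setIntegralCLM D measurableSet_Ico hI).coeFn_compLpL (W j)] with ω h1 h2 h3
      rw [h1, Pi.sub_apply, h2, h3]
      exact norm_completedTimes_sub_le hT (hN j) ht hI (W j ω)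
    exact h2.trans (mul_le_mul_of_nonneg_left (hC j) (Real.sqrt_nonneg _))
  have hz : Tendsto (fun j => √(T / N j) * C) atTop (𝓝 0) := by
    have h2 := ((Real.continuous_sqrt.tendsto _).comp hNlim).mul_const C
    rw [Real.sqrt_zero, zero_mul] at h2
    exact h2
  have h3 := WeakTendsto.of_tendsto (squeeze_zero_norm hle hz)
  have h4 := h3.add h1
  simpa only [sub_add_cancel, zero_add] using h4

lemma norm_le_of_unit {f : L2TV T D} (h : ∀ᵐ t ∂volume.restrict (Icc 0 T),
    ∀ᵐ x ∂volume.restrict D, ‖f t x‖ = 1) :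
    ‖f‖ ≤ √((volume.restrict D).real univ * T) := by
  refine norm_le_sqrt_of_enorm_sq (le_of_eq ?_)
  have h1 : ‖f‖ₑ ^ 2 = ∫⁻ _ in Icc 0 T, ENNReal.ofReal ((volume.restrict D).real univ) := by
    rw [enorm_sq_eq_lintegral]
    refine lintegral_congr_ae ?_
    filter_upwards [h] with t ht
    rw [← norm_sq_of_unit ht, ENNReal.ofReal_pow (norm_nonneg _), ofReal_norm]
  rw [h1, lintegral_const, Measure.restrict_apply_univ, Real.volume_Icc, sub_zero,
    ← ENNReal.ofReal_mul measureReal_nonneg]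

/-- Almost sure convergence of unit fields implies convergence in `L²`. -/
lemma exists_tendsto_of_unit [IsFiniteMeasure P] {M : ℕ → Lp (L2TV T D) 2 P} {m : Ω → L2TV T D}
    (hu : ∀ j, ∀ᵐ ω ∂P, ∀ᵐ t ∂volume.restrict (Icc 0 T), ∀ᵐ x ∂volume.restrict D, ‖M j ω t x‖ = 1)
    (h : ∀ᵐ ω ∂P, Tendsto (fun j => M j ω) atTop (𝓝 (m ω))) :
    ∃ M' : Lp (L2TV T D) 2 P, M' =ᵐ[P] m ∧ Tendsto M atTop (𝓝 M') := by
  obtain ⟨L, hL⟩ : ∃ L, L = √((volume.restrict D).real univ * T) := ⟨_, rfl⟩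
  have hL0 : 0 ≤ L := by rw [hL]; positivity
  have hb : ∀ j, ∀ᵐ ω ∂P, ‖M j ω‖ ≤ L := fun j => by
    filter_upwards [hu j] with ω hω
    rw [hL]
    exact norm_le_of_unit hω
  have hb' : ∀ᵐ ω ∂P, ‖m ω‖ ≤ L := by
    filter_upwards [ae_all_iff.2 hb, h] with ω h1 h2
    exact le_of_tendsto h2.norm (Eventually.of_forall h1)
  have hmem : MemLp m 2 P := MemLp.of_bound
    (aestronglyMeasurable_of_tendsto_ae atTop (fun j => Lp.aestronglyMeasurable (M j)) h) L hb'
  refine ⟨hmem.toLp, hmem.coeFn_toLp, ?_⟩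
  refine tendsto_Lp_of_dominated (Lp.const 2 P (2 * L)) (fun j => ?_) ?_
  · filter_upwards [hb j, hb', hmem.coeFn_toLp, Lp.coeFn_const 2 P (2 * L)] with ω h1 h2 h3 h4
    rw [h3, h4, Function.const_apply, Real.norm_of_nonneg (by positivity)]
    exact (norm_sub_le _ _).trans (by linarith)
  · filter_upwards [h, hmem.coeFn_toLp] with ω h1 h2
    rwa [h2]

end Conclusion

end

end LLG

/-! ### Assembly of the proof -/

theorem mainTheorem5
    (D : Set E3) (hD_open : IsOpen D) (hD_bdd : Bornology.IsBounded D) (hD_cone : ConeCondition D)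
    (T : ℝ) (hT : 0 < T) (θ : ℝ) (hθ : θ ∈ Ioc (1 / 2 : ℝ) 1)
    (m₀ : L2V D) (hm₀ : MemH1 D m₀) (hm₀_norm : ∀ᵐ x ∂volume.restrict D, ‖m₀ x‖ = 1)
    (e : HilbertBasis ℕ ℝ (L2V D)) (G : L2V D →L[ℝ] L2V D) (hG : IsHilbertSchmidtH2 D e G)
    -- the original probability space and its noise
    {Ω : Type*} [MeasurableSpace Ω] (P : Measure Ω) [IsProbabilityMeasure P]
    (β : ℕ → ℝ≥0 → Ω → ℝ) (GW : Ω → C(Icc (0 : ℝ) T, L2V D))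
    (hGW : IsNoise P (fun i => G (e i)) β GW)
    -- the new probability space, on which copies of `(m_N, GW)` converge along a subsequence
    {Ω' : Type*} [MeasurableSpace Ω'] (P' : Measure Ω') [IsProbabilityMeasure P']
    (mbar : ℕ → Ω' → L2TV T D) (GWbar : ℕ → Ω' → C(Icc (0 : ℝ) T, L2V D))
    (h_law : ∀ N : ℕ, 1 ≤ N →
      EqualLaw (fun ω => (mbar N ω, GWbar N ω)) P'
        (fun ω => (schemeProcess hT.le θ (fun i => G (e i)) m₀ N (GW ω), GW ω)) P)
    (mlim : Ω' → L2TV T D) (σ : ℕ → ℕ) (hσ : StrictMono σ)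
    (h_conv : ∀ᵐ ω ∂P', Tendsto (fun k => mbar (σ k) ω) atTop (𝓝 (mlim ω))) :
    ∃ (ρ : ℕ → ℕ) (wlim : Ω' → L2TV T D), StrictMono ρ ∧
      -- weak convergence of the piecewise constant processes
      WeakConvL2 P'
        (fun j ω => stepFunction T (σ (ρ j))
          (stepW hT.le θ (fun i => G (e i)) (σ (ρ j)) (mbar (σ (ρ j)) ω) (GWbar (σ (ρ j)) ω)))
        wlim ∧
      -- the limit field has a square integrable gradient
      (∀ k : Fin 3, ∃ g : Ω' → L2TV T D, MemLp g 2 P' ∧ ∀ᵐ ω ∂P',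
        ∀ᵐ t ∂volume.restrict (Icc 0 T), HasWeakPartial D k (mlim ω t) (g ω t)) ∧
      -- identification of the weak limit
      (∀ᵐ ω ∂P', ∀ᵐ t ∂volume.restrict (Icc 0 T),
        IsDrift D (fun i => G (e i)) (mlim ω t) (wlim ω t)) ∧
      -- weak convergence of the sums over the time steps up to `t`
      ∀ t ∈ Icc 0 T, WeakConvL2 P'
        (fun j ω => ∑ n ∈ (Finset.range (σ (ρ j))).filter
            (fun n : ℕ => ((n : ℝ) + 1) * (T / (σ (ρ j) : ℕ)) ≤ t),
          (T / (σ (ρ j) : ℕ)) • stepW hT.le θ (fun i => G (e i)) (σ (ρ j))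
            (mbar (σ (ρ j)) ω) (GWbar (σ (ρ j)) ω) n)
        (fun ω => ∫ s in (0 : ℝ)..t, wlim ω s) := by
  have hθ1 : 1 / 2 < θ := hθ.1
  have hθ0 : 0 < θ := one_half_pos.trans hθ1
  obtain ⟨C, -, hCb⟩ := exists_sobolev_const_h2Space hD_open hD_bdd hD_cone
  have hc := noiseBound_of_normSqH2 hG.1 hG.2 hCb
  obtain ⟨B, hB⟩ := exists_schemeBounds hD_open hD_bdd hc hCb hG.1 hG.2 hθ1 hT
    (m₀ := m₀) ⟨hm₀, hm₀_norm⟩ hGW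
  -- `σ 0` may be zero, where no scheme is defined; the sequence is shifted by one so that all time
  -- steps are genuine.
  have hσ1 : ∀ j, 1 ≤ σ (j + 1) := fun j => (Nat.le_add_left 1 j).trans hσ.le_apply
  choose M W d d' hfield hM hW using fun j =>
    exists_discreteField hD_open hD_bdd hc hθ0 hT (hσ1 j) (hB _ (hσ1 j)) (h_law _ (hσ1 j))
  have hconv : ∀ᵐ ω ∂P', Tendsto (fun j => M j ω) atTop (𝓝 (mlim ω)) := by
    filter_upwards [h_conv, ae_all_iff.2 hM] with ω h1 h2
    simp only [h2]
    exact h1.comp (tendsto_add_atTop_nat 1)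
  -- Unit fields have a common `L²` bound, which dominates the almost surely convergent sequence.
  obtain ⟨M', hM', hMlim⟩ := exists_tendsto_of_unit (fun j => (hfield j).unit) hconv
  have hτ : Tendsto (fun j => T / (σ (j + 1) : ℕ)) atTop (𝓝 0) :=
    tendsto_const_nhds.div_atTop (tendsto_natCast_atTop_atTop.comp
      (hσ.tendsto_atTop.comp (tendsto_add_atTop_nat 1)))
  obtain ⟨W', D', φ, hφ, hWlim, hlim⟩ := exists_limitField hD_bdd hθ0.le hT.le
    (fun j => by positivity) hτ hfield hMlim
  have hWC : ∀ j, ‖W j‖ ≤ √B := fun j => norm_le_sqrt_of_enorm_sq (hfield j).norm_drift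
  -- The `+ 1` restores the shift of the index.
  refine ⟨fun j => φ j + 1, W', fun i j hij => Nat.add_lt_add_right (hφ hij) 1,
    weakConvL2_of_weakTendsto hWlim (fun j => hW (φ j)) EventuallyEq.rfl, fun k => ?_, ?_,
    fun t ht => ?_⟩
  · refine ⟨D' k, Lp.memLp _, ?_⟩
    filter_upwards [hlim.grad k, hM'] with ω h1 h2
    rwa [← h2]
  · filter_upwards [hlim.unit, ae_all_iff.2 hlim.grad, hlim.perp, hlim.eqn, hM'] with
      ω h1 h2 h3 h4 h5
    rw [← h5]
    filter_upwards [h1, ae_all_iff.2 h2, h3, h4] with t h1 h2 h3 h4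
    exact isDrift_of_tested hD_open hD_bdd hc h1 h2 h3 h4
  · have hI : Ico 0 t ⊆ Icc 0 T := fun s hs => ⟨hs.1, hs.2.le.trans ht.2⟩
    refine weakConvL2_of_weakTendsto (weakTendsto_sums hT (fun j => hσ1 (φ j))
      (hτ.comp hφ.tendsto_atTop) (fun j => hWC (φ j)) hWlim ht.2 hI) (fun j => ?_) ?_
    · filter_upwards [hW (φ j), (setIntegralCLM D (measurableSet_completedTimes T (σ (φ j + 1)) t)
        ((completedTimes_subset hT (hσ1 (φ j)) t).trans inter_subset_left)).coeFn_compLpL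
          (W (φ j))] with ω h1 h2
      rw [h2, setIntegralCLM_apply, h1, ← sum_eq_setIntegral_completedTimes hT (hσ1 (φ j))]
    · filter_upwards [(setIntegralCLM D measurableSet_Ico hI).coeFn_compLpL W'] with ω h1
      rw [h1, setIntegralCLM_apply, intervalIntegral.integral_of_le ht.1,
        integral_Ico_eq_integral_Ioc]
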